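/- Let $\Bbbk$ be a field and $n\ge 0$ an integer. Let $I=\{1,\dots,n-1\}$ (empty if $n\le 1$), let $\alpha_i=(0,\dots,0,-1,1,0,\dots,0)\in\mathbb Z^n$ with $-1$ in position $i$, and let $\langle\cdot,\cdot\rangle$ be the standard bilinear form on $\mathbb Z^n$. Below, $\operatorname{span}\{\alpha_i\}$ is the $\Bbbk$-vector space with basis $(\alpha_i)_{i\in I}$, and $\langle\theta,\alpha_i\rangle\in\Bbbk$ for $\theta$ in it is defined by linear extension. **The 2-category $\mathcal K_n$.** For $k\in\mathbb N$ let $\mathbb A_k=\mathbb A^k/S_k=\operatorname{Spec}\Bbbk[x_1,\dots,x_k]^{S_k}$, graded by $\deg x_\ell=2$. For $\underline k\in\mathbb Z^n$ let $\mathbb A_{\underline k}=\mathbb A_{k_1}\times\dots\times\mathbb A_{k_n}$ if all $k_i\ge 0$, and $\mathbb A_{\underline k}=\emptyset$ otherwise; use the same notation for sequences of other lengths. Let $D(X)$ be the (unbounded) derived category of $\Bbbk^\times$-equivariant quasi-coherent sheaves on $X$; on affine $X$ these sheaves are the graded modules. Let $\{s\}$ be the grading shift with $M\{s\}_q=M_{q+s}$.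 The objects of $\mathcal K_n$ are the categories $D(\mathbb A_{\underline k})$, $\underline k\in\mathbb Z^n$; the 1-morphisms $\underline k\to\underline k'$ are all objects (kernels) of $D(\mathbb A_{\underline k}\times\mathbb A_{\underline k'})$, composed by convolution; the 2-morphisms are the morphisms between kernels; and $\langle 1\rangle=\{1\}$. Write $\mathbf 1_{\underline k}=\mathcal O_\Delta$ for the identity 1-morphism of $D(\mathbb A_{\underline k})$, and $\operatorname{End}^l(\mathsf A)=\operatorname{Hom}(\mathsf A,\mathsf A\langle l\rangle)$. Call a kernel coherent if its total cohomology is a finitely generated module on the product. **The data.** For $i\in I$ let $Z=\mathbb A_{(\dots,k_i-1,1,k_{i+1},\dots)}$ with its natural projections to $\mathbb A_{\underline k}$ and to $\mathbb A_{\underline k+\alpha_i}$, and put $$\mathsf E_i\mathbf 1_{\underline k}=\mathcal O_Z\{k_i-1\}\in D(\mathbb A_{\underline k}\times\mathbb A_{\underline k+\alpha_i}),\qquad \mathbf 1_{\underline k}\mathsf F_i=\mathcal O_Z\{k_{i+1}\}\in D(\mathbb A_{\underline k+\alpha_i}\times\mathbb A_{\underline k}).$$ Let $\operatorname{span}\{\alpha_i\}\to\operatorname{End}^2(\mathbf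 1_{\underline k})$ be the linear map that sends $\alpha_i$ to the multiplication by $e_1^{(i)}-e_1^{(i+1)}$, where $e_1^{(i)}$ is the first elementary symmetric function of the factor $\mathbb A_{k_i}$. The image of $\theta$ is again denoted by $\theta$. **Theorem.** The sheaves $\mathcal O_Z$ are flat over both factors, and these data define an $(\mathfrak{sl}_n,\theta)$ action on $\mathcal K_n$. That is, $\mathcal K_n$ is a graded, additive, $\Bbbk$-linear, idempotent complete 2-category, and the following hold for all $\underline k$ and all $i,j\in I$, where $\bigoplus_{[m]}\mathsf A=\mathsf A\langle m-1\rangle\oplus\mathsf A\langle m-3\rangle\oplus\dots\oplus\mathsf A\langle 1-m\rangle$. 1. $\operatorname{End}^l(\mathbf 1_{\underline k})$ is zero if $l<0$, and one-dimensional if $l=0$ and $\mathbf 1_{\underline k}\ne0$. The space of 2-morphisms between any two coherent 1-morphisms is finite-dimensional. The coherent 1-morphisms include all $\mathbf 1_{\underline k}$ and are closed under isomorphism, under shifts $\langle s\rangle$, and under composition on either side with the $\mathsf E_i$ and $\mathsf F_i$; so they include all compositions of $\mathsf E$'s and $\mathsf F$'s. 2. $\mathsf E_i\mathbf 1_{\underline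 k}$ has the right adjoint $\mathbf 1_{\underline k}\mathsf F_i\langle\langle\underline k,\alpha_i\rangle+1\rangle$ and the left adjoint $\mathbf 1_{\underline k}\mathsf F_i\langle-\langle\underline k,\alpha_i\rangle-1\rangle$. 3. $\mathsf E_i\mathsf F_i\mathbf 1_{\underline k}\cong\mathsf F_i\mathsf E_i\mathbf 1_{\underline k}\oplus\bigoplus_{[\langle\underline k,\alpha_i\rangle]}\mathbf 1_{\underline k}$ if $\langle\underline k,\alpha_i\rangle\ge0$, and $\mathsf F_i\mathsf E_i\mathbf 1_{\underline k}\cong\mathsf E_i\mathsf F_i\mathbf 1_{\underline k}\oplus\bigoplus_{[-\langle\underline k,\alpha_i\rangle]}\mathbf 1_{\underline k}$ if $\langle\underline k,\alpha_i\rangle\le0$. 4. If $i\ne j$, then $\mathsf F_j\mathsf E_i\mathbf 1_{\underline k}\cong\mathsf E_i\mathsf F_j\mathbf 1_{\underline k}$. 5. There are a 1-morphism $\mathsf E_i^{(2)}:\underline k-\alpha_i\to\underline k+\alpha_i$ and an isomorphism $\mathsf E_i\mathbf 1_{\underline k}\mathsf E_i\cong\mathsf E_i^{(2)}\langle-1\rangle\oplus\mathsf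 E_i^{(2)}\langle1\rangle$ such that for every $\theta\in\operatorname{span}\{\alpha_i\}$ the map $I\theta I\in\operatorname{End}^2(\mathsf E_i\mathbf 1_{\underline k}\mathsf E_i)$ induces a map between the summands $\mathsf E_i^{(2)}\langle1\rangle$ on either side which is nonzero if $\langle\theta,\alpha_i\rangle\ne0$ and $\mathsf E_i^{(2)}\ne0$, and zero if $\langle\theta,\alpha_i\rangle=0$. 6. If $\alpha=\alpha_i$, or $\alpha=\alpha_i+\alpha_j$ with $|i-j|=1$, then $\mathbf 1_{\underline k+r\alpha}=0$ for $r\gg0$ and for $r\ll0$. 7. If $i\ne j$ and $\mathbf 1_{\underline k+\alpha_i}$, $\mathbf 1_{\underline k+\alpha_j}$ are nonzero, then $\mathbf 1_{\underline k}$ and $\mathbf 1_{\underline k+\alpha_i+\alpha_j}$ are nonzero. -/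

import Mathlib

open CategoryTheory TensorProduct

universe u

set_option linter.unusedVariables false
set_option linter.deprecated false

noncomputable section

/-! ### Homogeneous elements -/

section Homogeneous

variable {𝕜 : Type u} [Field 𝕜] {ι : Type} [DecidableEq ι]
  {M X : Type u} [AddCommGroup M] [Module 𝕜 M] [AddCommGroup X] [Module 𝕜 X]

theorem homogeneous_induction [Nonempty ι] {gr : ι → Submodule 𝕜 M}
    (h : DirectSum.IsInternal gr) {p : M → Prop} (hp : ∀ s, ∀ m ∈ gr s, p m)
    (hadd : ∀ m m', p m → p m' → p (m + m')) (m : M) : p m := by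
  have hm : m ∈ iSup gr := by rw [h.submodule_iSup_eq_top]; trivial
  obtain ⟨i₀⟩ := ‹Nonempty ι›
  exact Submodule.iSup_induction gr (motive := p) hm hp (hp i₀ 0 (gr i₀).zero_mem) hadd

/-- The linear map that is given by `f s` on the elements of degree `s`. -/
def homogeneousLift {gr : ι → Submodule 𝕜 M} (h : DirectSum.IsInternal gr)
    (f : ∀ s, gr s →ₗ[𝕜] X) : M →ₗ[𝕜] X :=
  DirectSum.toModule 𝕜 ι X f ∘ₗ
    (LinearEquiv.ofBijective (DirectSum.coeLinearMap gr) h).symm.toLinearMap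

theorem homogeneousLift_apply {gr : ι → Submodule 𝕜 M} (h : DirectSum.IsInternal gr)
    (f : ∀ s, gr s →ₗ[𝕜] X) {s : ι} {m : M} (hm : m ∈ gr s) :
    homogeneousLift h f m = f s ⟨m, hm⟩ := by
  have : (LinearEquiv.ofBijective (DirectSum.coeLinearMap gr) h).symm m =
      DirectSum.lof 𝕜 ι (fun s => gr s) s ⟨m, hm⟩ := by
    rw [LinearEquiv.symm_apply_eq]
    exact (DirectSum.coeLinearMap_lof gr s ⟨m, hm⟩).symm
  rw [homogeneousLift, LinearMap.comp_apply, LinearEquiv.coe_coe, this, DirectSum.toModule_lof]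

theorem isInternal_of_projections {gr : ι → Submodule 𝕜 M} (π : ι → M →ₗ[𝕜] M)
    (h₁ : ∀ s, ∀ m ∈ gr s, π s m = m) (h₂ : ∀ s t, t ≠ s → ∀ m ∈ gr t, π s m = 0)
    (h₃ : ∀ m, m ∈ iSup gr) : DirectSum.IsInternal gr := by
  refine DirectSum.isInternal_submodule_of_iSupIndep_of_iSup_eq_top ?_ (eq_top_iff.2 fun m _ => h₃ m)
  intro s
  rw [Submodule.disjoint_def]
  intro m hm hm'
  rw [← h₁ s m hm]
  have : ⨆ t, ⨆ (_ : t ≠ s), gr t ≤ LinearMap.ker (π s) :=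
    iSup₂_le fun t ht x hx => h₂ s t ht x hx
  exact this hm'

end Homogeneous

/-! ### Graded algebras and complexes of graded bimodules -/

/-- A commutative `ℤ`-graded `𝕜`-algebra. -/
structure GrAlg (𝕜 : Type u) [Field 𝕜] where
  carrier : Type u
  [ring : CommRing carrier]
  [alg : Algebra 𝕜 carrier]
  gr : ℤ → Submodule 𝕜 carrier
  [graded : GradedAlgebra gr]

attribute [instance] GrAlg.ring GrAlg.alg GrAlg.graded

variable {𝕜 : Type u} [Field 𝕜]

theorem GrAlg.internal (A : GrAlg 𝕜) : DirectSum.IsInternal A.gr :=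
  DirectSum.Decomposition.isInternal A.gr

/-- A cochain complex of graded `A`-`C`-bimodules (that is, of graded `A ⊗ C`-modules, equivalently
of `𝔾ₘ`-equivariant quasi-coherent sheaves on `Spec A × Spec C`), as one bigraded `𝕜`-module. The
piece `gr (p, q)` is the part of cohomological degree `p` and internal degree `q`. The algebras `A`
and `C` act through `l` and `r`, and `d` is the differential. -/
structure Cplx (A C : GrAlg 𝕜) where
  carrier : Type u
  [grp : AddCommGroup carrier]
  [mod : Module 𝕜 carrier]
  gr : ℤ × ℤ → Submodule 𝕜 carrier
  internal : DirectSum.IsInternal gr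
  l : A.carrier →ₐ[𝕜] Module.End 𝕜 carrier
  r : C.carrier →ₐ[𝕜] Module.End 𝕜 carrier
  l_r : ∀ a c m, l a (r c m) = r c (l a m)
  l_mem : ∀ {q a p q' m}, a ∈ A.gr q → m ∈ gr (p, q') → l a m ∈ gr (p, q + q')
  r_mem : ∀ {q c p q' m}, c ∈ C.gr q → m ∈ gr (p, q') → r c m ∈ gr (p, q + q')
  d : carrier →ₗ[𝕜] carrier
  d_mem : ∀ {p q m}, m ∈ gr (p, q) → d m ∈ gr (p + 1, q)
  d_d : ∀ m, d (d m) = 0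
  d_l : ∀ a m, d (l a m) = l a (d m)
  d_r : ∀ c m, d (r c m) = r c (d m)

attribute [instance] Cplx.grp Cplx.mod

variable {A B C D : GrAlg 𝕜}

/-- The morphisms of complexes of graded bimodules. -/
def Cplx.homs (M N : Cplx A C) : Submodule 𝕜 (M.carrier →ₗ[𝕜] N.carrier) where
  carrier := {f | (∀ s, ∀ m ∈ M.gr s, f m ∈ N.gr s) ∧ (∀ a m, f (M.l a m) = N.l a (f m)) ∧
    (∀ c m, f (M.r c m) = N.r c (f m)) ∧ ∀ m, f (M.d m) = N.d (f m)}
  zero_mem' := by simp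
  add_mem' := by
    rintro f g ⟨h₁, h₂, h₃, h₄⟩ ⟨k₁, k₂, k₃, k₄⟩
    exact ⟨fun s m hm => add_mem (h₁ s m hm) (k₁ s m hm), by simp [h₂, k₂], by simp [h₃, k₃],
      by simp [h₄, k₄]⟩
  smul_mem' := by
    rintro x f ⟨h₁, h₂, h₃, h₄⟩
    exact ⟨fun s m hm => Submodule.smul_mem _ x (h₁ s m hm), by simp [h₂], by simp [h₃],
      by simp [h₄]⟩

/-- A morphism of complexes is a quasi-isomorphism if it is injective and surjective on
cohomology. -/
def Cplx.IsQis {M N : Cplx A C} (f : M.homs N) : Prop :=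
  (∀ m, M.d m = 0 → (∃ y, f.1 m = N.d y) → ∃ x, m = M.d x) ∧
    ∀ y, N.d y = 0 → ∃ m x, M.d m = 0 ∧ y = f.1 m + N.d x

/-- The grading shift `{s}`, with `M{s}_q = M_{q+s}`; so multiplication by an element of degree `s`
is a map `M → M{s}`. -/
abbrev Cplx.shift (s : ℤ) (M : Cplx A C) : Cplx A C where
  carrier := M.carrier
  gr t := M.gr (t.1, t.2 + s)
  internal := by
    have e : (ℤ × ℤ) ≃ (ℤ × ℤ) := (Equiv.refl ℤ).prodCongr (Equiv.addRight s)
    refine DirectSum.isInternal_submodule_of_iSupIndep_of_iSup_eq_top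
      (M.internal.submodule_iSupIndep.comp (f := fun t : ℤ × ℤ => (t.1, t.2 + s)) ?_)
      (eq_top_iff.2 fun m _ => ?_)
    · rintro ⟨a, b⟩ ⟨a', b'⟩ h
      simpa using h
    · have hm : m ∈ iSup M.gr := by rw [M.internal.submodule_iSup_eq_top]; trivial
      refine (iSup_le fun t => ?_ : iSup M.gr ≤ _) hm
      refine le_trans (le_of_eq ?_) (le_iSup _ (t.1, t.2 - s))
      simp
  l := M.l
  r := M.r
  l_r := M.l_r
  l_mem ha hm := by simpa [add_assoc] using M.l_mem ha hm
  r_mem ha hm := by simpa [add_assoc] using M.r_mem ha hm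
  d := M.d
  d_mem hm := M.d_mem hm
  d_d := M.d_d
  d_l := M.d_l
  d_r := M.d_r

/-! ### The tensor product of complexes of bimodules -/

namespace Cplx

/-- The operator that multiplies an element of degree `t` by `φ t`. -/
def scale (M : Cplx A C) (φ : ℤ × ℤ → 𝕜) : M.carrier →ₗ[𝕜] M.carrier :=
  homogeneousLift M.internal fun t => φ t • (M.gr t).subtype

theorem scale_apply (M : Cplx A C) (φ : ℤ × ℤ → 𝕜) {t : ℤ × ℤ} {m : M.carrier} (hm : m ∈ M.gr t) :
    M.scale φ m = φ t • m := by
  rw [scale, homogeneousLift_apply _ _ hm]; rfl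

/-- The operator `m ↦ (-1)^p m` on elements of cohomological degree `p`. -/
def sgn (M : Cplx A C) : M.carrier →ₗ[𝕜] M.carrier := M.scale fun t => ((t.1.negOnePow : ℤ) : 𝕜)

theorem induction (M : Cplx A C) {p : M.carrier → Prop} (hp : ∀ s, ∀ m ∈ M.gr s, p m)
    (hadd : ∀ m m', p m → p m' → p (m + m')) (m : M.carrier) : p m :=
  homogeneous_induction M.internal hp hadd m

theorem sgn_apply (M : Cplx A C) {t : ℤ × ℤ} {m : M.carrier} (hm : m ∈ M.gr t) :
    M.sgn m = ((t.1.negOnePow : ℤ) : 𝕜) • m :=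
  M.scale_apply _ hm

theorem sgn_mem (M : Cplx A C) {t : ℤ × ℤ} {m : M.carrier} (hm : m ∈ M.gr t) :
    M.sgn m ∈ M.gr t := by
  rw [M.sgn_apply hm]; exact Submodule.smul_mem _ _ hm

theorem sgn_sgn (M : Cplx A C) (m : M.carrier) : M.sgn (M.sgn m) = m := by
  induction m using M.induction with
  | hp s m hm =>
    rw [M.sgn_apply hm, map_smul, M.sgn_apply hm, smul_smul, ← Int.cast_mul, ← Units.val_mul,
      Int.units_mul_self]
    simp
  | hadd m m' h h' => rw [map_add, map_add, h, h']

theorem sgn_d (M : Cplx A C) (m : M.carrier) : M.sgn (M.d m) = - M.d (M.sgn m) := by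
  induction m using M.induction with
  | hp s m hm =>
    rw [M.sgn_apply hm, M.sgn_apply (M.d_mem hm), map_smul]
    simp [Int.negOnePow_succ]
  | hadd m m' h h' => simp only [map_add, h, h']; abel

theorem sgn_l (M : Cplx A C) (a : A.carrier) (m : M.carrier) :
    M.sgn (M.l a m) = M.l a (M.sgn m) := by
  induction m using M.induction with
  | hp s m hm =>
    induction a using homogeneous_induction A.internal with
    | hp q a ha => rw [M.sgn_apply hm, M.sgn_apply (M.l_mem ha hm), map_smul]
    | hadd a a' h h' => simp only [map_add, LinearMap.add_apply, h, h']
  | hadd m m' h h' => simp only [map_add, h, h']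

theorem sgn_r (M : Cplx A C) (a : C.carrier) (m : M.carrier) :
    M.sgn (M.r a m) = M.r a (M.sgn m) := by
  induction m using M.induction with
  | hp s m hm =>
    induction a using homogeneous_induction C.internal with
    | hp q a ha => rw [M.sgn_apply hm, M.sgn_apply (M.r_mem ha hm), map_smul]
    | hadd a a' h h' => simp only [map_add, LinearMap.add_apply, h, h']
  | hadd m m' h h' => simp only [map_add, h, h']

theorem hom_sgn {M N : Cplx A C} (f : M.homs N) (m : M.carrier) :
    f.1 (M.sgn m) = N.sgn (f.1 m) := by
  induction m using M.induction with
  | hp s m hm => rw [M.sgn_apply hm, N.sgn_apply (f.2.1 s m hm), map_smul]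
  | hadd m m' h h' => simp only [map_add, h, h']

section Tensor

variable (M : Cplx A B) (N : Cplx B C)

/-- The relations `m b ⊗ n = m ⊗ b n`. -/
def balance : Submodule 𝕜 (M.carrier ⊗[𝕜] N.carrier) :=
  Submodule.span 𝕜 {x | ∃ m b n, x = M.r b m ⊗ₜ[𝕜] n - m ⊗ₜ[𝕜] N.l b n}

/-- The tensor product `M ⊗_B N` as a vector space. -/
def TC : Type u := (M.carrier ⊗[𝕜] N.carrier) ⧸ balance M N

instance : AddCommGroup (TC M N) := inferInstanceAs (AddCommGroup (_ ⧸ balance M N))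
instance : Module 𝕜 (TC M N) := inferInstanceAs (Module 𝕜 (_ ⧸ balance M N))

/-- The map `(m, n) ↦ m ⊗ n`. -/
def tmk : M.carrier →ₗ[𝕜] N.carrier →ₗ[𝕜] TC M N :=
  (TensorProduct.mk 𝕜 M.carrier N.carrier).compr₂ (balance M N).mkQ

variable {M N}

theorem tmk_balance (m : M.carrier) (b : B.carrier) (n : N.carrier) :
    tmk M N (M.r b m) n = tmk M N m (N.l b n) :=
  (Submodule.Quotient.eq _).2 (Submodule.subset_span ⟨m, b, n, rfl⟩)

/-- The universal property of `M ⊗_B N`. -/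
def tlift {X : Type u} [AddCommGroup X] [Module 𝕜 X] (f : M.carrier →ₗ[𝕜] N.carrier →ₗ[𝕜] X)
    (hf : ∀ m b n, f (M.r b m) n = f m (N.l b n)) : TC M N →ₗ[𝕜] X :=
  (balance M N).liftQ (TensorProduct.lift f) (by
    refine Submodule.span_le.2 ?_
    rintro _ ⟨m, b, n, rfl⟩
    simp [hf])

@[simp]
theorem tlift_tmk {X : Type u} [AddCommGroup X] [Module 𝕜 X]
    (f : M.carrier →ₗ[𝕜] N.carrier →ₗ[𝕜] X) (hf : ∀ m b n, f (M.r b m) n = f m (N.l b n))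
    (m : M.carrier) (n : N.carrier) : tlift f hf (tmk M N m n) = f m n := by
  erw [tlift, Submodule.liftQ_apply]

theorem tinduction {p : TC M N → Prop} (h : ∀ m n, p (tmk M N m n))
    (hadd : ∀ x y, p x → p y → p (x + y)) (x : TC M N) : p x := by
  obtain ⟨x, rfl⟩ := (balance M N).mkQ_surjective x
  induction x using TensorProduct.induction_on with
  | zero =>
    have h₀ := h 0 0
    rw [map_zero] at h₀
    rwa [map_zero]
  | tmul m n => exact h m n
  | add x y hx hy => rw [map_add]; exact hadd _ _ hx hy

theorem thom_ext {X : Type u} [AddCommGroup X] [Module 𝕜 X] {f g : TC M N →ₗ[𝕜] X}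
    (h : ∀ m n, f (tmk M N m n) = g (tmk M N m n)) : f = g :=
  LinearMap.ext fun x => tinduction (p := fun x => f x = g x) h
    (fun x y hx hy => by rw [map_add, map_add, hx, hy]) x

variable (M N)

/-- The part of degree `s` of `M ⊗_B N`. -/
def tgr (s : ℤ × ℤ) : Submodule 𝕜 (TC M N) :=
  Submodule.span 𝕜 {x | ∃ i j m n, i + j = s ∧ m ∈ M.gr i ∧ n ∈ N.gr j ∧ x = tmk M N m n}

variable {M N}

theorem tmk_mem {i j s : ℤ × ℤ} {m : M.carrier} {n : N.carrier} (hm : m ∈ M.gr i)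
    (hn : n ∈ N.gr j) (h : i + j = s) : tmk M N m n ∈ tgr M N s :=
  Submodule.subset_span ⟨i, j, m, n, h, hm, hn, rfl⟩

theorem map_mem_of_tgr {X : Type u} [AddCommGroup X] [Module 𝕜 X] {f : TC M N →ₗ[𝕜] X}
    {U : Submodule 𝕜 X} {s : ℤ × ℤ}
    (h : ∀ i j m n, i + j = s → m ∈ M.gr i → n ∈ N.gr j → f (tmk M N m n) ∈ U)
    {x : TC M N} (hx : x ∈ tgr M N s) : f x ∈ U := by
  have : tgr M N s ≤ U.comap f := Submodule.span_le.2 (by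
    rintro _ ⟨i, j, m, n, hs, hm, hn, rfl⟩
    exact h i j m n hs hm hn)
  exact this hx

variable (M N)

/-- The projection of `M ⊗_B N` to its part of degree `s`. -/
def tproj (s : ℤ × ℤ) : TC M N →ₗ[𝕜] TC M N :=
  tlift (homogeneousLift M.internal fun i => ((tmk M N) ∘ₗ (M.gr i).subtype).compl₂
      (N.scale fun j => if i + j = s then 1 else 0)) (by
    intro m b n
    induction m using M.induction with
    | hp i m hm =>
      induction n using N.induction with
      | hp j n hn =>
        induction b using homogeneous_induction B.internal with
        | hp q b hb =>
          rw [homogeneousLift_apply _ _ (M.r_mem hb hm), homogeneousLift_apply _ _ hm]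
          simp only [LinearMap.compl₂_apply, LinearMap.comp_apply, Submodule.subtype_apply]
          rw [scale_apply _ _ hn, scale_apply _ _ (N.l_mem hb hn), map_smul, map_smul, tmk_balance]
          congr 1
          simp only [Prod.ext_iff, Prod.fst_add, Prod.snd_add]
          congr 2
          simp only [eq_iff_iff]
          constructor <;> intro h <;> omega
        | hadd b b' h h' => simp only [map_add, LinearMap.add_apply, h, h']
      | hadd n n' h h' => simp only [map_add, h, h']
    | hadd m m' h h' => simp only [map_add, LinearMap.add_apply, h, h'])

theorem tproj_apply (s : ℤ × ℤ) {i j : ℤ × ℤ} {m : M.carrier} {n : N.carrier} (hm : m ∈ M.gr i)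
    (hn : n ∈ N.gr j) : tproj M N s (tmk M N m n) = if i + j = s then tmk M N m n else 0 := by
  rw [tproj, tlift_tmk, homogeneousLift_apply _ _ hm]
  simp only [LinearMap.compl₂_apply, LinearMap.comp_apply, Submodule.subtype_apply]
  rw [scale_apply _ _ hn]
  split_ifs <;> simp

theorem tgr_internal : DirectSum.IsInternal (tgr M N) := by
  refine isInternal_of_projections (tproj M N) (fun s x hx => ?_) (fun s t hst x hx => ?_) ?_
  · rw [← sub_eq_zero]
    have : ∀ y ∈ tgr M N s, (tproj M N s - (LinearMap.id : TC M N →ₗ[𝕜] TC M N)) y ∈ (⊥ : Submodule 𝕜 (TC M N)) :=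
      fun y hy => map_mem_of_tgr (fun i j m n h hm hn => by
        simp [tproj_apply M N s hm hn, h]) hy
    simpa using this x hx
  · have : ∀ y ∈ tgr M N t, tproj M N s y ∈ (⊥ : Submodule 𝕜 (TC M N)) :=
      fun y hy => map_mem_of_tgr (fun i j m n h hm hn => by
        simp [tproj_apply M N s hm hn, h, hst]) hy
    simpa using this x hx
  · refine tinduction (fun m n => ?_) fun x y hx hy => add_mem hx hy
    induction m using M.induction with
    | hp i m hm =>
      induction n using N.induction with
      | hp j n hn => exact Submodule.mem_iSup_of_mem (i + j) (tmk_mem hm hn rfl)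
      | hadd n n' h h' => rw [map_add]; exact add_mem h h'
    | hadd m m' h h' => rw [map_add, LinearMap.add_apply]; exact add_mem h h'

variable {M N} in
/-- The tensor product `f ⊗ g` of two linear maps. -/
def tmapLin {M' : Cplx A B} {N' : Cplx B C} (f : M.carrier →ₗ[𝕜] M'.carrier)
    (g : N.carrier →ₗ[𝕜] N'.carrier) (hf : ∀ b m, f (M.r b m) = M'.r b (f m))
    (hg : ∀ b n, g (N.l b n) = N'.l b (g n)) : TC M N →ₗ[𝕜] TC M' N' :=
  tlift ((tmk M' N' ∘ₗ f).compl₂ g) (by simp [hf, hg, tmk_balance])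

variable {M N} in
@[simp]
theorem tmapLin_tmk {M' : Cplx A B} {N' : Cplx B C} (f : M.carrier →ₗ[𝕜] M'.carrier)
    (g : N.carrier →ₗ[𝕜] N'.carrier) (hf : ∀ b m, f (M.r b m) = M'.r b (f m))
    (hg : ∀ b n, g (N.l b n) = N'.l b (g n)) (m : M.carrier) (n : N.carrier) :
    tmapLin f g hf hg (tmk M N m n) = tmk M' N' (f m) (g n) := by
  simp [tmapLin]

/-- The left action on `M ⊗_B N`. -/
def tl : A.carrier →ₐ[𝕜] Module.End 𝕜 (TC M N) :=
  AlgHom.ofLinearMap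
    ({ toFun := fun a => tmapLin (M.l a) LinearMap.id (fun b m => M.l_r a b m) (fun _ _ => rfl)
       map_add' := fun a a' => thom_ext fun m n => by simp
       map_smul' := fun x a => thom_ext fun m n => by simp } :
      A.carrier →ₗ[𝕜] Module.End 𝕜 (TC M N))
    (thom_ext fun m n => by simp) fun a a' => thom_ext fun m n => by simp

/-- The right action on `M ⊗_B N`. -/
def tr : C.carrier →ₐ[𝕜] Module.End 𝕜 (TC M N) :=
  AlgHom.ofLinearMap
    ({ toFun := fun c => tmapLin LinearMap.id (N.r c) (fun _ _ => rfl) fun b n => (N.l_r b c n).symm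
       map_add' := fun a a' => thom_ext fun m n => by simp
       map_smul' := fun x a => thom_ext fun m n => by simp } :
      C.carrier →ₗ[𝕜] Module.End 𝕜 (TC M N))
    (thom_ext fun m n => by simp) fun a a' => thom_ext fun m n => by simp

/-- The differential `d (m ⊗ n) = dm ⊗ n + (-1)^|m| m ⊗ dn`. -/
def td : TC M N →ₗ[𝕜] TC M N :=
  tmapLin M.d LinearMap.id (fun b m => M.d_r b m) (fun _ _ => rfl) +
    tmapLin M.sgn N.d (fun b m => M.sgn_r b m) fun b n => N.d_l b n

variable {M N}

@[simp]
theorem tl_tmk (a : A.carrier) (m : M.carrier) (n : N.carrier) :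
    tl M N a (tmk M N m n) = tmk M N (M.l a m) n :=
  tmapLin_tmk _ _ (fun b m => M.l_r a b m) (fun _ _ => rfl) m n

@[simp]
theorem tr_tmk (c : C.carrier) (m : M.carrier) (n : N.carrier) :
    tr M N c (tmk M N m n) = tmk M N m (N.r c n) :=
  tmapLin_tmk _ _ (fun _ _ => rfl) (fun b n => (N.l_r b c n).symm) m n

@[simp]
theorem td_tmk (m : M.carrier) (n : N.carrier) :
    td M N (tmk M N m n) = tmk M N (M.d m) n + tmk M N (M.sgn m) (N.d n) := by
  rw [td, LinearMap.add_apply, tmapLin_tmk, tmapLin_tmk]; rfl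

variable (M N)

/-- The tensor product `M ⊗_B N` of complexes of graded bimodules. -/
def tensor : Cplx A C where
  carrier := TC M N
  gr := tgr M N
  internal := tgr_internal M N
  l := tl M N
  r := tr M N
  l_r a c x := tinduction (p := fun x => tl M N a (tr M N c x) = tr M N c (tl M N a x))
    (fun m n => by simp) (fun x y hx hy => by simp only [map_add, hx, hy]) x
  l_mem ha hx := map_mem_of_tgr (fun i j m n hs hm hn => by
    rw [tl_tmk]
    exact tmk_mem (M.l_mem ha hm) hn (by simp [Prod.ext_iff] at hs ⊢; omega)) hx
  r_mem ha hx := map_mem_of_tgr (fun i j m n hs hm hn => by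
    rw [tr_tmk]
    exact tmk_mem hm (N.r_mem ha hn) (by simp [Prod.ext_iff] at hs ⊢; omega)) hx
  d := td M N
  d_mem hx := map_mem_of_tgr (fun i j m n hs hm hn => by
    rw [td_tmk]
    exact add_mem (tmk_mem (M.d_mem hm) hn (by simp [Prod.ext_iff] at hs ⊢; omega))
      (tmk_mem (M.sgn_mem hm) (N.d_mem hn) (by simp [Prod.ext_iff] at hs ⊢; omega))) hx
  d_d x := tinduction (p := fun x => td M N (td M N x) = 0)
    (fun m n => by simp [M.d_d, N.d_d, M.sgn_d])
    (fun x y hx hy => by rw [map_add, map_add, hx, hy, add_zero]) x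
  d_l a x := tinduction (p := fun x => td M N (tl M N a x) = tl M N a (td M N x))
    (fun m n => by simp [M.d_l, M.sgn_l]) (fun x y hx hy => by simp only [map_add, hx, hy]) x
  d_r a x := tinduction (p := fun x => td M N (tr M N a x) = tr M N a (td M N x))
    (fun m n => by simp [N.d_r]) (fun x y hx hy => by simp only [map_add, hx, hy]) x

end Tensor

/-! ### The interface of the tensor product -/

section Interface

variable {M : Cplx A B} {N : Cplx B C}

theorem hom_gr {M N : Cplx A C} (f : M.homs N) {s : ℤ × ℤ} {m : M.carrier} (hm : m ∈ M.gr s) :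
    f.1 m ∈ N.gr s := f.2.1 s m hm

theorem hom_l {M N : Cplx A C} (f : M.homs N) (a : A.carrier) (m : M.carrier) :
    f.1 (M.l a m) = N.l a (f.1 m) := f.2.2.1 a m

theorem hom_r {M N : Cplx A C} (f : M.homs N) (c : C.carrier) (m : M.carrier) :
    f.1 (M.r c m) = N.r c (f.1 m) := f.2.2.2.1 c m

theorem hom_d {M N : Cplx A C} (f : M.homs N) (m : M.carrier) :
    f.1 (M.d m) = N.d (f.1 m) := f.2.2.2.2 m

/-- The element `m ⊗ n` of the tensor product. -/
def tm : M.carrier →ₗ[𝕜] N.carrier →ₗ[𝕜] (tensor M N).carrier := tmk M N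

theorem tm_balance (m : M.carrier) (b : B.carrier) (n : N.carrier) :
    (tm (M.r b m) n : (tensor M N).carrier) = tm m (N.l b n) := tmk_balance m b n

theorem tensor_l (a : A.carrier) (m : M.carrier) (n : N.carrier) :
    (tensor M N).l a (tm m n) = tm (M.l a m) n := tl_tmk a m n

theorem tensor_r (c : C.carrier) (m : M.carrier) (n : N.carrier) :
    (tensor M N).r c (tm m n) = tm m (N.r c n) := tr_tmk c m n

theorem tensor_d (m : M.carrier) (n : N.carrier) :
    (tensor M N).d (tm m n) = tm (M.d m) n + tm (M.sgn m) (N.d n) := td_tmk m n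

theorem tm_mem {i j s : ℤ × ℤ} {m : M.carrier} {n : N.carrier} (hm : m ∈ M.gr i)
    (hn : n ∈ N.gr j) (h : i + j = s) : tm m n ∈ (tensor M N).gr s := tmk_mem hm hn h

theorem tensor_induction {p : (tensor M N).carrier → Prop} (h : ∀ m n, p (tm m n))
    (hadd : ∀ x y, p x → p y → p (x + y)) (x : (tensor M N).carrier) : p x :=
  tinduction h hadd x

section

variable {X : Type u} [AddCommGroup X] [Module 𝕜 X]

theorem tensor_ext {f g : (tensor M N).carrier →ₗ[𝕜] X} (h : ∀ m n, f (tm m n) = g (tm m n)) :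
    f = g := thom_ext h

theorem map_mem_of_tensor_gr {f : (tensor M N).carrier →ₗ[𝕜] X} {U : Submodule 𝕜 X} {s : ℤ × ℤ}
    (h : ∀ i j m n, i + j = s → m ∈ M.gr i → n ∈ N.gr j → f (tm m n) ∈ U)
    {x : (tensor M N).carrier} (hx : x ∈ (tensor M N).gr s) : f x ∈ U := map_mem_of_tgr h hx

/-- The universal property of `M ⊗_B N`. -/
def tensorLift (f : M.carrier →ₗ[𝕜] N.carrier →ₗ[𝕜] X)
    (hf : ∀ m b n, f (M.r b m) n = f m (N.l b n)) : (tensor M N).carrier →ₗ[𝕜] X := tlift f hf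

theorem tensorLift_tm (f : M.carrier →ₗ[𝕜] N.carrier →ₗ[𝕜] X)
    (hf : ∀ m b n, f (M.r b m) n = f m (N.l b n)) (m : M.carrier) (n : N.carrier) :
    tensorLift f hf (tm m n) = f m n := tlift_tmk f hf m n

end

/-- A linear map on the tensor product that is compatible with all structures on elements `m ⊗ n`
is a map of complexes. -/
def tensorHom {X : Cplx A C} (f : (tensor M N).carrier →ₗ[𝕜] X.carrier)
    (h₁ : ∀ i j m n, m ∈ M.gr i → n ∈ N.gr j → f (tm m n) ∈ X.gr (i + j))
    (h₂ : ∀ a m n, f (tm (M.l a m) n) = X.l a (f (tm m n)))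
    (h₃ : ∀ c m n, f (tm m (N.r c n)) = X.r c (f (tm m n)))
    (h₄ : ∀ m n, f (tm (M.d m) n) + f (tm (M.sgn m) (N.d n)) = X.d (f (tm m n))) :
    (tensor M N).homs X :=
  ⟨f, fun s x hx => map_mem_of_tensor_gr (fun i j m n hs hm hn => hs ▸ h₁ i j m n hm hn) hx,
    fun a x => tensor_induction (p := fun x => f ((tensor M N).l a x) = X.l a (f x))
      (fun m n => by rw [tensor_l, h₂]) (fun x y hx hy => by simp only [map_add, hx, hy]) x,
    fun a x => tensor_induction (p := fun x => f ((tensor M N).r a x) = X.r a (f x))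
      (fun m n => by rw [tensor_r, h₃]) (fun x y hx hy => by simp only [map_add, hx, hy]) x,
    fun x => tensor_induction (p := fun x => f ((tensor M N).d x) = X.d (f x))
      (fun m n => by rw [tensor_d, map_add, h₄]) (fun x y hx hy => by simp only [map_add, hx, hy]) x⟩

theorem tensor_sgn (m : M.carrier) (n : N.carrier) :
    (tensor M N).sgn (tm m n) = tm (M.sgn m) (N.sgn n) := by
  induction m using M.induction with
  | hp i m hm =>
    induction n using N.induction with
    | hp j n hn =>
      rw [sgn_apply _ hm, sgn_apply _ hn, sgn_apply _ (tm_mem hm hn rfl)]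
      simp [Int.negOnePow_add, smul_smul, mul_comm]
    | hadd n n' h h' => simp only [map_add, h, h']
  | hadd m m' h h' => simp only [map_add, LinearMap.add_apply, h, h']

theorem tmap_balance {M' : Cplx A B} {N' : Cplx B C} (f : M.homs M') (g : N.homs N')
    (m : M.carrier) (b : B.carrier) (n : N.carrier) :
    ((tm ∘ₗ f.1).compl₂ g.1 (M.r b m) n : (tensor M' N').carrier) =
      (tm ∘ₗ f.1).compl₂ g.1 m (N.l b n) := by
  simp only [LinearMap.compl₂_apply, LinearMap.comp_apply, hom_r, hom_l, tm_balance]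

/-- The map `f ⊗ g` of complexes. -/
def tmap {M' : Cplx A B} {N' : Cplx B C} (f : M.homs M') (g : N.homs N') :
    (tensor M N).homs (tensor M' N') :=
  tensorHom (tensorLift ((tm ∘ₗ f.1).compl₂ g.1) (tmap_balance f g))
    (fun i j m n hm hn => by
      rw [tensorLift_tm]; exact tm_mem (hom_gr f hm) (hom_gr g hn) rfl)
    (fun a m n => by simp [tensorLift_tm, hom_l, tensor_l])
    (fun a m n => by simp [tensorLift_tm, hom_r, tensor_r])
    (fun m n => by simp [tensorLift_tm, hom_d, tensor_d, hom_sgn])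

@[simp]
theorem tmap_tm {M' : Cplx A B} {N' : Cplx B C} (f : M.homs M') (g : N.homs N')
    (m : M.carrier) (n : N.carrier) : (tmap f g).1 (tm m n) = tm (f.1 m) (g.1 n) :=
  tensorLift_tm _ (tmap_balance f g) m n

/-- The identity of a complex. -/
def idHom (M : Cplx A C) : M.homs M :=
  ⟨LinearMap.id, fun _ _ h => h, fun _ _ => rfl, fun _ _ => rfl, fun _ => rfl⟩

/-- The composition of maps of complexes. -/
def compHom {M N P : Cplx A C} (f : M.homs N) (g : N.homs P) : M.homs P :=
  ⟨g.1 ∘ₗ f.1, fun _ _ h => hom_gr g (hom_gr f h), fun a m => by simp [hom_l],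
    fun c m => by simp [hom_r], fun m => by simp [hom_d]⟩

@[simp]
theorem idHom_apply (M : Cplx A C) (m : M.carrier) : (idHom M).1 m = m := rfl

@[simp]
theorem compHom_apply {M N P : Cplx A C} (f : M.homs N) (g : N.homs P) (m : M.carrier) :
    (compHom f g).1 m = g.1 (f.1 m) := rfl

theorem homs_ext {M N : Cplx A C} {f g : M.homs N} (h : ∀ m, f.1 m = g.1 m) : f = g :=
  Subtype.ext (LinearMap.ext h)

end Interface

/-! ### Associativity and unit -/

section Assoc

variable (M : Cplx A B) (N : Cplx B C) (P : Cplx C D)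

/-- The linear map `(m ⊗ n) ⊗ p ↦ m ⊗ (n ⊗ p)`. -/
def assocLin : (tensor (tensor M N) P).carrier →ₗ[𝕜] (tensor M (tensor N P)).carrier :=
  tensorLift (tensorLift (LinearMap.mk₂ 𝕜 (fun m n => tm m ∘ₗ tm n)
      (fun m m' n => by rw [map_add, LinearMap.add_comp])
      (fun x m n => by rw [map_smul, LinearMap.smul_comp])
      (fun m n n' => by rw [map_add, LinearMap.comp_add])
      (fun x m n => by rw [map_smul, LinearMap.comp_smul]))
      (fun m b n => LinearMap.ext fun p => by
        simp only [LinearMap.mk₂_apply, LinearMap.comp_apply, tm_balance, tensor_l]))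
    (fun x c p => by
      induction x using tensor_induction with
      | h m n =>
        simp only [tensor_r, tensorLift_tm, LinearMap.mk₂_apply, LinearMap.comp_apply, tm_balance]
      | hadd x y hx hy => simp only [map_add, LinearMap.add_apply, hx, hy])

@[simp]
theorem assocLin_tm (m : M.carrier) (n : N.carrier) (p : P.carrier) :
    assocLin M N P (tm (tm m n) p) = tm m (tm n p) := by
  simp only [assocLin, tensorLift_tm, LinearMap.mk₂_apply, LinearMap.comp_apply]

/-- The linear map `m ⊗ (n ⊗ p) ↦ (m ⊗ n) ⊗ p`. -/
def assocInvLin : (tensor M (tensor N P)).carrier →ₗ[𝕜] (tensor (tensor M N) P).carrier :=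
  tensorLift (LinearMap.flip (tensorLift (LinearMap.mk₂ 𝕜
      (fun n p => tm.flip p ∘ₗ tm.flip n)
      (fun m m' n => by rw [map_add, LinearMap.comp_add])
      (fun x m n => by rw [map_smul, LinearMap.comp_smul])
      (fun m n n' => by rw [map_add, LinearMap.add_comp])
      (fun x m n => by rw [map_smul, LinearMap.smul_comp]))
      (fun n c p => LinearMap.ext fun m => by
        simp only [LinearMap.mk₂_apply, LinearMap.comp_apply, LinearMap.flip_apply, ← tm_balance,
          tensor_r])))
    (fun m b x => by
      induction x using tensor_induction with
      | h n p =>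
        simp only [tensor_l, tensorLift_tm, LinearMap.mk₂_apply, LinearMap.comp_apply, tm_balance,
          LinearMap.flip_apply]
      | hadd x y hx hy => simp only [map_add, hx, hy])

@[simp]
theorem assocInvLin_tm (m : M.carrier) (n : N.carrier) (p : P.carrier) :
    assocInvLin M N P (tm m (tm n p)) = tm (tm m n) p := by
  simp only [assocInvLin, tensorLift_tm, LinearMap.mk₂_apply, LinearMap.comp_apply,
    LinearMap.flip_apply]

/-- The associativity isomorphism `(M ⊗ N) ⊗ P → M ⊗ (N ⊗ P)`. -/
def assocHom : (tensor (tensor M N) P).homs (tensor M (tensor N P)) :=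
  tensorHom (assocLin M N P)
    (fun s k x p hx hp => map_mem_of_tensor_gr (f := assocLin M N P ∘ₗ tm.flip p)
      (fun i j m n hs hm hn => by
        simp only [LinearMap.comp_apply, LinearMap.flip_apply, assocLin_tm]
        exact tm_mem hm (tm_mem hn hp rfl) (by rw [← hs, add_assoc])) hx)
    (fun a x p => by
      induction x using tensor_induction with
      | h m n => simp only [tensor_l, assocLin_tm]
      | hadd x y hx hy => simp only [map_add, LinearMap.add_apply, hx, hy])
    (fun c x p => by
      induction x using tensor_induction with
      | h m n => simp only [tensor_r, assocLin_tm]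
      | hadd x y hx hy => simp only [map_add, LinearMap.add_apply, hx, hy])
    (fun x p => by
      induction x using tensor_induction with
      | h m n =>
        simp only [tensor_d, tensor_sgn, assocLin_tm, map_add, LinearMap.add_apply, add_assoc]
      | hadd x y hx hy =>
        simp only [map_add, LinearMap.add_apply] at hx hy ⊢
        rw [← hx, ← hy]; abel)

/-- The inverse of `assocHom`. -/
def assocInvHom : (tensor M (tensor N P)).homs (tensor (tensor M N) P) :=
  tensorHom (assocInvLin M N P)
    (fun i s m x hm hx => map_mem_of_tensor_gr (f := assocInvLin M N P ∘ₗ tm m)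
      (fun j k n p hs hn hp => by
        simp only [LinearMap.comp_apply, assocInvLin_tm]
        exact tm_mem (tm_mem hm hn rfl) hp (by rw [← hs, add_assoc])) hx)
    (fun a m x => by
      induction x using tensor_induction with
      | h n p => simp only [tensor_l, assocInvLin_tm]
      | hadd x y hx hy => simp only [map_add, hx, hy])
    (fun c m x => by
      induction x using tensor_induction with
      | h n p => simp only [tensor_r, assocInvLin_tm]
      | hadd x y hx hy => simp only [map_add, hx, hy])
    (fun m x => by
      induction x using tensor_induction with
      | h n p =>
        simp only [tensor_d, tensor_sgn, assocInvLin_tm, map_add, LinearMap.add_apply, add_assoc]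
      | hadd x y hx hy =>
        simp only [map_add] at hx hy ⊢
        rw [← hx, ← hy]; abel)

@[simp]
theorem assocHom_tm (m : M.carrier) (n : N.carrier) (p : P.carrier) :
    (assocHom M N P).1 (tm (tm m n) p) = tm m (tm n p) := assocLin_tm M N P m n p

@[simp]
theorem assocInvHom_tm (m : M.carrier) (n : N.carrier) (p : P.carrier) :
    (assocInvHom M N P).1 (tm m (tm n p)) = tm (tm m n) p := assocInvLin_tm M N P m n p

theorem assocHom_assocInvHom (x : (tensor M (tensor N P)).carrier) :
    (assocHom M N P).1 ((assocInvHom M N P).1 x) = x := by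
  induction x using tensor_induction with
  | h m x =>
    induction x using tensor_induction with
    | h n p => simp
    | hadd x y hx hy => simp only [map_add, hx, hy]
  | hadd x y hx hy => simp only [map_add, hx, hy]

theorem assocInvHom_assocHom (x : (tensor (tensor M N) P).carrier) :
    (assocInvHom M N P).1 ((assocHom M N P).1 x) = x := by
  induction x using tensor_induction with
  | h x p =>
    induction x using tensor_induction with
    | h m n => simp
    | hadd x y hx hy => simp only [map_add, LinearMap.add_apply, hx, hy]
  | hadd x y hx hy => simp only [map_add, hx, hy]

end Assoc

/-! ### Structure sheaves of correspondences -/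

/-- A homomorphism of graded algebras `A → Z`. -/
structure _root_.GrAlg.GrHom (A Z : GrAlg 𝕜) where
  hom : A.carrier →ₐ[𝕜] Z.carrier
  hom_mem : ∀ {q a}, a ∈ A.gr q → hom a ∈ Z.gr q

/-- The identity homomorphism. -/
def _root_.GrAlg.GrHom.id (A : GrAlg 𝕜) : A.GrHom A := ⟨AlgHom.id 𝕜 A.carrier, fun h => h⟩

/-- The structure sheaf of a correspondence `Spec A ← Spec Z → Spec C`, that is, its direct image
on `Spec A × Spec C`: the bimodule `Z` in cohomological degree `0`. -/
def corr {A C Z : GrAlg 𝕜} (f : A.GrHom Z) (g : C.GrHom Z) : Cplx A C where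
  carrier := Z.carrier
  gr t := if t.1 = 0 then Z.gr t.2 else ⊥
  internal := by
    refine isInternal_of_projections
      (fun t => if t.1 = 0 then GradedAlgebra.proj Z.gr t.2 else 0) ?_ ?_ ?_
    · rintro ⟨p, q⟩ m hm
      dsimp only at hm ⊢
      split_ifs at hm ⊢
      · exact DirectSum.decompose_of_mem_same Z.gr hm
      · simp_all
    · rintro ⟨p, q⟩ ⟨p', q'⟩ h m hm
      dsimp only at hm ⊢
      split_ifs at hm ⊢ with h₁ h₂
      · refine DirectSum.decompose_of_mem_ne Z.gr hm ?_
        rintro rfl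
        exact h (by rw [h₁, h₂])
      all_goals simp_all
    · refine homogeneous_induction Z.internal (fun q m hm => ?_) fun x y hx hy => add_mem hx hy
      exact Submodule.mem_iSup_of_mem (0, q) (by simpa using hm)
  l := (Algebra.lmul 𝕜 Z.carrier).comp f.hom
  r := (Algebra.lmul 𝕜 Z.carrier).comp g.hom
  l_r a c m := by simp [mul_left_comm]
  l_mem {q a p q' m} ha hm := by
    dsimp only at hm ⊢
    split_ifs at hm ⊢ with h
    · exact SetLike.mul_mem_graded (f.hom_mem ha) hm
    · simp_all
  r_mem {q a p q' m} ha hm := by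
    dsimp only at hm ⊢
    split_ifs at hm ⊢ with h
    · exact SetLike.mul_mem_graded (g.hom_mem ha) hm
    · simp_all
  d := 0
  d_mem _ := Submodule.zero_mem _
  d_d _ := rfl
  d_l _ _ := by simp
  d_r _ _ := by simp

/-- The structure sheaf of the diagonal. -/
def unit (A : GrAlg 𝕜) : Cplx A A := corr (GrAlg.GrHom.id A) (GrAlg.GrHom.id A)

/-- The element `1` of the structure sheaf of the diagonal. -/
def unitOne (A : GrAlg 𝕜) : (unit A).carrier := (1 : A.carrier)

theorem unitOne_mem (A : GrAlg 𝕜) : unitOne A ∈ (unit A).gr (0, 0) :=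
  (SetLike.one_mem_graded A.gr : (1 : A.carrier) ∈ A.gr 0)

theorem mem_unit_gr {A : GrAlg 𝕜} {t : ℤ × ℤ} {a : A.carrier}
    (ha : (show (unit A).carrier from a) ∈ (unit A).gr t) : a = 0 ∨ t.1 = 0 ∧ a ∈ A.gr t.2 := by
  dsimp only [unit, corr] at ha
  split_ifs at ha with h
  · exact Or.inr ⟨h, ha⟩
  · exact Or.inl ha

theorem sgn_unit (A : GrAlg 𝕜) (x : (unit A).carrier) : (unit A).sgn x = x := by
  induction x using (unit A).induction with
  | hp t x hx =>
    rw [sgn_apply _ hx]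
    rcases mem_unit_gr hx with rfl | ⟨h, -⟩
    · exact smul_zero (A := (unit A).carrier) _
    · rw [h]; simp
  | hadd x y hx hy => rw [map_add, hx, hy]

section Unitors

variable (M : Cplx A C)

/-- The linear map `a ⊗ m ↦ a m`. -/
def leftUnitLin : (tensor (unit A) M).carrier →ₗ[𝕜] M.carrier :=
  tensorLift (N := M) (M := unit A) M.l.toLinearMap fun (a b : A.carrier) m => by
    change M.l (b * a) m = M.l a (M.l b m)
    rw [mul_comm, map_mul]; rfl

theorem leftUnitLin_tm (a : A.carrier) (m : M.carrier) :
    leftUnitLin M (tm (M := unit A) a m) = M.l a m := tensorLift_tm (M := unit A) _ _ _ _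

/-- The linear map `m ⊗ c ↦ m c`. -/
def rightUnitLin : (tensor M (unit C)).carrier →ₗ[𝕜] M.carrier :=
  tensorLift (M := M) (N := unit C) (LinearMap.flip M.r.toLinearMap) fun m b (c : C.carrier) => by
    change M.r c (M.r b m) = M.r (b * c) m
    rw [mul_comm, map_mul]; rfl

theorem rightUnitLin_tm (m : M.carrier) (c : C.carrier) :
    rightUnitLin M (tm (N := unit C) m c) = M.r c m := tensorLift_tm (N := unit C) _ _ _ _

/-- The isomorphism `A ⊗_A M → M`. -/
def leftUnitHom : (tensor (unit A) M).homs M :=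
  tensorHom (leftUnitLin M)
    (fun (i j : ℤ × ℤ) (a : A.carrier) m ha hm => by
      rw [leftUnitLin_tm]
      rcases mem_unit_gr ha with rfl | ⟨h, ha⟩
      · simp
      · convert M.l_mem ha hm using 2
        simp [Prod.ext_iff, h])
    (fun a (b : A.carrier) m => by
      change leftUnitLin M (tm (M := unit A) (a * b : A.carrier) m) = _
      rw [leftUnitLin_tm, leftUnitLin_tm, map_mul]; rfl)
    (fun c (b : A.carrier) m => by
      rw [leftUnitLin_tm, leftUnitLin_tm, l_r])
    (fun (a : A.carrier) m => by
      have h := sgn_unit A a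
      change leftUnitLin M (tm (M := unit A) (0 : (unit A).carrier) m) + _ = _
      rw [h, leftUnitLin_tm, leftUnitLin_tm, d_l, map_zero, LinearMap.zero_apply, map_zero,
        zero_add])

/-- The isomorphism `M ⊗_C C → M`. -/
def rightUnitHom : (tensor M (unit C)).homs M :=
  tensorHom (rightUnitLin M)
    (fun (i j : ℤ × ℤ) m (c : C.carrier) hm hc => by
      rw [rightUnitLin_tm]
      rcases mem_unit_gr hc with rfl | ⟨h, hc⟩
      · simp
      · convert M.r_mem hc hm using 2
        simp [Prod.ext_iff, h, add_comm])
    (fun a m (c : C.carrier) => by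
      rw [rightUnitLin_tm, rightUnitLin_tm, l_r])
    (fun c m (b : C.carrier) => by
      change rightUnitLin M (tm (N := unit C) m (c * b : C.carrier)) = _
      rw [rightUnitLin_tm, rightUnitLin_tm, map_mul]; rfl)
    (fun m (c : C.carrier) => by
      change _ + rightUnitLin M (tm (N := unit C) (M.sgn m) (0 : (unit C).carrier)) = _
      rw [rightUnitLin_tm, rightUnitLin_tm, d_r, map_zero, map_zero, add_zero])

/-- The inverse of `leftUnitHom`. -/
def leftUnitInv : M.homs (tensor (unit A) M) :=
  ⟨tm (unitOne A), fun s m hm => tm_mem (unitOne_mem A) hm (by simp [Prod.ext_iff]), fun a m => by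
      rw [tensor_l, ← tm_balance]; rfl,
    fun c m => by rw [tensor_r], fun m => by
      rw [tensor_d, sgn_unit]
      change _ = tm (0 : (unit A).carrier) m + _
      rw [map_zero, LinearMap.zero_apply, zero_add]⟩

/-- The inverse of `rightUnitHom`. -/
def rightUnitInv : M.homs (tensor M (unit C)) :=
  ⟨tm.flip (unitOne C), fun s m hm => tm_mem hm (unitOne_mem C) (by simp [Prod.ext_iff]),
    fun a m => by rw [LinearMap.flip_apply, LinearMap.flip_apply, tensor_l],
    fun c m => by
      rw [LinearMap.flip_apply, LinearMap.flip_apply, tensor_r, tm_balance]; rfl,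
    fun m => by
      rw [LinearMap.flip_apply, LinearMap.flip_apply, tensor_d]
      change _ = _ + tm _ (0 : (unit C).carrier)
      rw [map_zero, add_zero]⟩

theorem leftUnitHom_tm (a : A.carrier) (m : M.carrier) :
    (leftUnitHom M).1 (tm (M := unit A) a m) = M.l a m := leftUnitLin_tm M a m

theorem rightUnitHom_tm (m : M.carrier) (c : C.carrier) :
    (rightUnitHom M).1 (tm (N := unit C) m c) = M.r c m := rightUnitLin_tm M m c

theorem leftUnitHom_inv (m : M.carrier) : (leftUnitHom M).1 ((leftUnitInv M).1 m) = m := by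
  have : (leftUnitHom M).1 ((leftUnitInv M).1 m) = M.l 1 m := leftUnitLin_tm M 1 m
  rw [this, map_one]; rfl

theorem rightUnitHom_inv (m : M.carrier) : (rightUnitHom M).1 ((rightUnitInv M).1 m) = m := by
  have : (rightUnitHom M).1 ((rightUnitInv M).1 m) = M.r 1 m := rightUnitLin_tm M m 1
  rw [this, map_one]; rfl

theorem leftUnitInv_hom (x : (tensor (unit A) M).carrier) :
    (leftUnitInv M).1 ((leftUnitHom M).1 x) = x := by
  induction x using tensor_induction with
  | h a m =>
    have : (leftUnitHom M).1 (tm a m) = M.l (show A.carrier from a) m := leftUnitHom_tm M a m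
    rw [this, hom_l]
    change (tensor (unit A) M).l _ (tm (unitOne A) m) = _
    rw [tensor_l]
    congr 2
    exact mul_one (show A.carrier from a)
  | hadd x y hx hy => simp only [map_add, hx, hy]

theorem rightUnitInv_hom (x : (tensor M (unit C)).carrier) :
    (rightUnitInv M).1 ((rightUnitHom M).1 x) = x := by
  induction x using tensor_induction with
  | h m c =>
    have : (rightUnitHom M).1 (tm m c) = M.r (show C.carrier from c) m := rightUnitHom_tm M m c
    rw [this, hom_r]
    change (tensor M (unit C)).r _ (tm m (unitOne C)) = _
    rw [tensor_r]
    congr 1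
    exact mul_one (show C.carrier from c)
  | hadd x y hx hy => simp only [map_add, hx, hy]

end Unitors

/-! ### K-flat complexes -/

/-- `M` is K-flat over `B`: the functor `M ⊗_B -` preserves quasi-isomorphisms. -/
def IsKFlatRight (M : Cplx A B) : Prop :=
  ∀ (C : GrAlg 𝕜) (N N' : Cplx B C) (f : N.homs N'), IsQis f → IsQis (tmap (idHom M) f)

/-- `M` is K-flat over `A`: the functor `- ⊗_A M` preserves quasi-isomorphisms. -/
def IsKFlatLeft (M : Cplx A B) : Prop :=
  ∀ (C : GrAlg 𝕜) (N N' : Cplx C A) (f : N.homs N'), IsQis f → IsQis (tmap f (idHom M))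

/-- A map that is isomorphic to a quasi-isomorphism (as a map of complexes of vector spaces) is a
quasi-isomorphism. -/
theorem IsQis.of_square {A' C' : GrAlg 𝕜} {M N : Cplx A C} {M' N' : Cplx A' C'} {f : M.homs N}
    (hf : IsQis f) (g : M'.homs N') (α : M'.carrier →ₗ[𝕜] M.carrier)
    (β : N'.carrier →ₗ[𝕜] N.carrier) (hα : Function.Bijective α) (hβ : Function.Bijective β)
    (dα : ∀ x, α (M'.d x) = M.d (α x)) (dβ : ∀ x, β (N'.d x) = N.d (β x))
    (h : ∀ x, β (g.1 x) = f.1 (α x)) : IsQis g := by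
  constructor
  · rintro m hm ⟨y, hy⟩
    obtain ⟨x, hx⟩ := hf.1 (α m) (by rw [← dα, hm, map_zero]) ⟨β y, by rw [← h, hy, dβ]⟩
    obtain ⟨x, rfl⟩ := hα.2 x
    exact ⟨x, hα.1 (by rw [hx, dα])⟩
  · intro y hy
    obtain ⟨m, x, hm, hx⟩ := hf.2 (β y) (by rw [← dβ, hy, map_zero])
    obtain ⟨m, rfl⟩ := hα.2 m
    obtain ⟨x, rfl⟩ := hβ.2 x
    refine ⟨m, x, hα.1 (by rw [dα, hm, map_zero]), hβ.1 ?_⟩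
    rw [hx, map_add, h, dβ]

theorem leftUnitHom_bijective (M : Cplx A C) : Function.Bijective (leftUnitHom M).1 :=
  ⟨Function.LeftInverse.injective (leftUnitInv_hom M),
    Function.RightInverse.surjective (leftUnitHom_inv M)⟩

theorem rightUnitHom_bijective (M : Cplx A C) : Function.Bijective (rightUnitHom M).1 :=
  ⟨Function.LeftInverse.injective (rightUnitInv_hom M),
    Function.RightInverse.surjective (rightUnitHom_inv M)⟩

theorem assocHom_bijective (M : Cplx A B) (N : Cplx B C) (P : Cplx C D) :
    Function.Bijective (assocHom M N P).1 :=
  ⟨Function.LeftInverse.injective (assocInvHom_assocHom M N P),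
    Function.RightInverse.surjective (assocHom_assocInvHom M N P)⟩

theorem assocInvHom_bijective (M : Cplx A B) (N : Cplx B C) (P : Cplx C D) :
    Function.Bijective (assocInvHom M N P).1 :=
  ⟨Function.LeftInverse.injective (assocHom_assocInvHom M N P),
    Function.RightInverse.surjective (assocInvHom_assocHom M N P)⟩

/-! The associativity and unit isomorphisms are natural. -/

theorem leftUnit_natural {M N : Cplx A C} (f : M.homs N) :
    compHom (tmap (idHom (unit A)) f) (leftUnitHom N) = compHom (leftUnitHom M) f := by
  refine Subtype.ext (tensor_ext fun a m => ?_)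
  change (leftUnitHom N).1 ((tmap (idHom (unit A)) f).1 (tm a m)) = f.1 ((leftUnitHom M).1 (tm a m))
  rw [tmap_tm]
  exact (leftUnitHom_tm N a _).trans ((hom_l f _ _).symm.trans
    (congrArg f.1 (leftUnitHom_tm M a m).symm))

theorem rightUnit_natural {M N : Cplx A C} (f : M.homs N) :
    compHom (tmap f (idHom (unit C))) (rightUnitHom N) = compHom (rightUnitHom M) f := by
  refine Subtype.ext (tensor_ext fun m c => ?_)
  change (rightUnitHom N).1 ((tmap f (idHom (unit C))).1 (tm m c)) =
    f.1 ((rightUnitHom M).1 (tm m c))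
  rw [tmap_tm]
  exact (rightUnitHom_tm N _ c).trans ((hom_r f _ _).symm.trans
    (congrArg f.1 (rightUnitHom_tm M m c).symm))

theorem tensor_ext₃ {M : Cplx A B} {N : Cplx B C} {P : Cplx C D} {X : Cplx A D}
    {f g : (tensor (tensor M N) P).homs X}
    (h : ∀ m n p, f.1 (tm (tm m n) p) = g.1 (tm (tm m n) p)) : f = g := by
  refine Subtype.ext (tensor_ext fun x p => ?_)
  induction x using tensor_induction with
  | h m n => exact h m n p
  | hadd x y hx hy => simp only [map_add, LinearMap.add_apply, hx, hy]

theorem assoc_natural {M M' : Cplx A B} {N N' : Cplx B C} {P P' : Cplx C D} (f : M.homs M')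
    (g : N.homs N') (h : P.homs P') :
    compHom (tmap (tmap f g) h) (assocHom M' N' P') =
      compHom (assocHom M N P) (tmap f (tmap g h)) :=
  tensor_ext₃ fun m n p => by simp

theorem homs_congr {M N : Cplx A C} {f g : M.homs N} (h : f = g) (x : M.carrier) :
    f.1 x = g.1 x := by rw [h]

theorem unit_isKFlatRight (A : GrAlg 𝕜) : IsKFlatRight (unit A) := fun _ N N' f hf =>
  hf.of_square _ (leftUnitHom N).1 (leftUnitHom N').1 (leftUnitHom_bijective N)
    (leftUnitHom_bijective N') (hom_d _) (hom_d _) (homs_congr (leftUnit_natural f))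

theorem unit_isKFlatLeft (A : GrAlg 𝕜) : IsKFlatLeft (unit A) := fun _ N N' f hf =>
  hf.of_square _ (rightUnitHom N).1 (rightUnitHom N').1 (rightUnitHom_bijective N)
    (rightUnitHom_bijective N') (hom_d _) (hom_d _) (homs_congr (rightUnit_natural f))

@[simp]
theorem tmap_idHom (M : Cplx A B) (N : Cplx B C) :
    tmap (idHom M) (idHom N) = idHom (tensor M N) :=
  Subtype.ext (tensor_ext fun m n => by simp)

theorem IsKFlatRight.tensor {M : Cplx A B} {N : Cplx B C} (hM : IsKFlatRight M)
    (hN : IsKFlatRight N) : IsKFlatRight (tensor M N) := fun D P P' f hf => by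
  refine (hM _ _ _ _ (hN D P P' f hf)).of_square _ (assocHom M N P).1 (assocHom M N P').1
    (assocHom_bijective M N P) (assocHom_bijective M N P') (hom_d _) (hom_d _) ?_
  rw [← tmap_idHom]
  exact homs_congr (assoc_natural (idHom M) (idHom N) f)

theorem IsKFlatLeft.tensor {M : Cplx A B} {N : Cplx B C} (hM : IsKFlatLeft M)
    (hN : IsKFlatLeft N) : IsKFlatLeft (tensor M N) := fun D P P' f hf => by
  refine (hN _ _ _ _ (hM D P P' f hf)).of_square _ (assocInvHom P M N).1 (assocInvHom P' M N).1
    (assocInvHom_bijective P M N) (assocInvHom_bijective P' M N) (hom_d _) (hom_d _) fun x => ?_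
  refine (assocHom_bijective P' M N).1 ?_
  rw [assocHom_assocInvHom]
  refine Eq.trans ?_ (homs_congr (assoc_natural f (idHom M) (idHom N)) _).symm
  rw [tmap_idHom, compHom_apply, assocHom_assocInvHom]

end Cplx
/-! ### The 2-category of K-flat complexes of graded bimodules -/

/-- A complex of graded `A`-`C`-bimodules that is K-flat over `A` and over `C`. -/
structure Ker (A C : GrAlg 𝕜) where
  cplx : Cplx A C
  flatLeft : cplx.IsKFlatLeft
  flatRight : cplx.IsKFlatRight

namespace Cplx

theorem tmap_compHom {M M' M'' : Cplx A B} {N N' N'' : Cplx B C} (f : M.homs M') (f' : M'.homs M'')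
    (g : N.homs N') (g' : N'.homs N'') :
    tmap (compHom f f') (compHom g g') = compHom (tmap f g) (tmap f' g') :=
  Subtype.ext (tensor_ext fun m n => by simp)

theorem triangle_hom (M : Cplx A B) (N : Cplx B C) :
    compHom (assocHom M (unit B) N) (tmap (idHom M) (leftUnitHom N)) =
      tmap (rightUnitHom M) (idHom N) :=
  tensor_ext₃ fun m b n => by
    rw [compHom_apply, assocHom_tm, tmap_tm, tmap_tm]
    have h₁ : (leftUnitHom N).1 (tm b n) = N.l (show B.carrier from b) n := leftUnitHom_tm N b n
    have h₂ : (rightUnitHom M).1 (tm m b) = M.r (show B.carrier from b) m := rightUnitHom_tm M m b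
    rw [h₁, h₂]
    exact (tm_balance _ _ _).symm

theorem pentagon_hom {E : GrAlg 𝕜} (M : Cplx A B) (N : Cplx B C) (P : Cplx C D) (Q : Cplx D E) :
    compHom (tmap (assocHom M N P) (idHom Q))
      (compHom (assocHom M (tensor N P) Q) (tmap (idHom M) (assocHom N P Q))) =
    compHom (assocHom (tensor M N) P Q) (assocHom M N (tensor P Q)) :=
  tensor_ext₃ fun x p q => by
    induction x using tensor_induction with
    | h m n => simp
    | hadd x y hx hy => simp only [map_add, LinearMap.add_apply, hx, hy]

end Cplx

namespace Ker

open Cplx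

instance : Category (Ker A C) where
  Hom M N := M.cplx.homs N.cplx
  id M := idHom M.cplx
  comp f g := compHom f g

@[simp]
theorem id_apply (M : Ker A C) (m : M.cplx.carrier) : (𝟙 M : M.cplx.homs M.cplx).1 m = m := rfl

@[simp]
theorem comp_apply {M N P : Ker A C} (f : M ⟶ N) (g : N ⟶ P) (m : M.cplx.carrier) :
    (f ≫ g : M.cplx.homs P.cplx).1 m = (g : N.cplx.homs P.cplx).1 ((f : M.cplx.homs N.cplx).1 m) :=
  rfl

instance : Preadditive (Ker A C) where
  homGroup M N := inferInstanceAs (AddCommGroup (M.cplx.homs N.cplx))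
  add_comp M N P f f' g := Subtype.ext (LinearMap.comp_add _ _ _)
  comp_add M N P f g g' := Subtype.ext (LinearMap.add_comp _ _ _)

instance : Linear 𝕜 (Ker A C) where
  homModule M N := inferInstanceAs (Module 𝕜 (M.cplx.homs N.cplx))
  smul_comp M N P x f g := Subtype.ext (LinearMap.comp_smul _ _ _)
  comp_smul M N P f x g := Subtype.ext (LinearMap.smul_comp _ _ _)

/-- The class of quasi-isomorphisms. -/
def qis (A C : GrAlg 𝕜) : MorphismProperty (Ker A C) := fun _ _ f => IsQis f

/-- The tensor product over `B`. -/
def tensor (M : Ker A B) (N : Ker B C) : Ker A C :=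
  ⟨Cplx.tensor M.cplx N.cplx, M.flatLeft.tensor N.flatLeft, M.flatRight.tensor N.flatRight⟩

/-- The structure sheaf of the diagonal. -/
def unit (A : GrAlg 𝕜) : Ker A A := ⟨Cplx.unit A, unit_isKFlatLeft A, unit_isKFlatRight A⟩

/-- An isomorphism, from two maps of complexes that are inverse to each other. -/
def isoMk {M N : Ker A C} (f : M.cplx.homs N.cplx) (g : N.cplx.homs M.cplx)
    (h : ∀ x, g.1 (f.1 x) = x) (h' : ∀ x, f.1 (g.1 x) = x) : M ≅ N where
  hom := f
  inv := g
  hom_inv_id := homs_ext h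
  inv_hom_id := homs_ext h'

/-- The associativity isomorphism. -/
def assocIso (M : Ker A B) (N : Ker B C) (P : Ker C D) :
    (M.tensor N).tensor P ≅ M.tensor (N.tensor P) :=
  isoMk (assocHom M.cplx N.cplx P.cplx) (assocInvHom M.cplx N.cplx P.cplx)
    (assocInvHom_assocHom _ _ _) (assocHom_assocInvHom _ _ _)

/-- The left unit isomorphism. -/
def leftUnitIso (M : Ker A C) : (unit A).tensor M ≅ M :=
  isoMk (leftUnitHom M.cplx) (leftUnitInv M.cplx) (leftUnitInv_hom _) (leftUnitHom_inv _)

/-- The right unit isomorphism. -/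
def rightUnitIso (M : Ker A C) : M.tensor (unit C) ≅ M :=
  isoMk (rightUnitHom M.cplx) (rightUnitInv M.cplx) (rightUnitInv_hom _) (rightUnitHom_inv _)

theorem conj₁ {X X' Y Y' : Ker A C} (a : X ≅ Y) (b : X' ≅ Y') {f : X ⟶ X'} {g : Y ⟶ Y'}
    (h : f ≫ b.hom = a.hom ≫ g) : f = a.hom ≫ g ≫ b.inv := by
  rw [← Category.assoc, ← h, Category.assoc, b.hom_inv_id, Category.comp_id]

theorem conj₂ {X X' Y Y' : Ker A C} (a : X ≅ Y) (b : X' ≅ Y') {f : X ⟶ X'} {g : Y ⟶ Y'}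
    (h : f ≫ b.hom = a.hom ≫ g) : g = a.inv ≫ f ≫ b.hom := by
  rw [h, a.inv_hom_id_assoc]

end Ker

open Cplx in
instance : Bicategory (GrAlg 𝕜) where
  Hom A C := Ker A C
  id A := Ker.unit A
  comp M N := Ker.tensor M N
  homCategory A C := inferInstanceAs (Category (Ker A C))
  whiskerLeft M _ _ f := tmap (idHom M.cplx) f
  whiskerRight f N := tmap f (idHom N.cplx)
  associator M N P := Ker.assocIso M N P
  leftUnitor M := Ker.leftUnitIso M
  rightUnitor M := Ker.rightUnitIso M
  whiskerLeft_id M N := tmap_idHom _ _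
  whiskerLeft_comp M _ _ _ f g := tmap_compHom (idHom _) (idHom _) f g
  id_whiskerLeft {_ _ M N} f := Ker.conj₁ (Ker.leftUnitIso M) (Ker.leftUnitIso N) (leftUnit_natural f)
  comp_whiskerLeft M N P P' f := Ker.conj₁ (Ker.assocIso M N P) (Ker.assocIso M N P') (
    (congrArg (fun i => compHom (tmap i f) (assocHom _ _ _))
    (tmap_idHom M.cplx N.cplx).symm).trans (assoc_natural (idHom M.cplx) (idHom N.cplx) f))
  id_whiskerRight M N := tmap_idHom _ _
  comp_whiskerRight f g N := tmap_compHom f g (idHom _) (idHom _)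
  whiskerRight_id {_ _ M N} f := Ker.conj₁ (Ker.rightUnitIso M) (Ker.rightUnitIso N) (rightUnit_natural f)
  whiskerRight_comp {_ _ _ _ M M'} f N P := Ker.conj₂ (Ker.assocIso M N P) (Ker.assocIso M' N P)
    ((assoc_natural f (idHom N.cplx) (idHom P.cplx)).trans
    (congrArg (fun i => compHom (assocHom _ _ _) (tmap f i)) (tmap_idHom N.cplx P.cplx)))
  whisker_assoc M N N' f P := Ker.conj₁ (Ker.assocIso M N P) (Ker.assocIso M N' P)
    (assoc_natural (idHom M.cplx) f (idHom P.cplx))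
  whisker_exchange f g :=
    (tmap_compHom (idHom _) f g (idHom _)).symm.trans (tmap_compHom f (idHom _) (idHom _) g)
  pentagon M N P Q := pentagon_hom M.cplx N.cplx P.cplx Q.cplx
  triangle M N := triangle_hom M.cplx N.cplx
/-! ### Shifts and direct sums of kernels -/

namespace Cplx

/-- A quasi-isomorphism on each of two summands is a quasi-isomorphism on the sum. -/
theorem IsQis.of_sum {X X₁ X₂ Y Y₁ Y₂ : Cplx A C} (g : X.homs Y) {g₁ : X₁.homs Y₁}
    {g₂ : X₂.homs Y₂} (h₁ : IsQis g₁) (h₂ : IsQis g₂) (i₁ : X₁.homs X) (i₂ : X₂.homs X)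
    (p₁ : X.homs X₁) (p₂ : X.homs X₂) (j₁ : Y₁.homs Y) (j₂ : Y₂.homs Y) (q₁ : Y.homs Y₁)
    (q₂ : Y.homs Y₂) (hX : ∀ x, i₁.1 (p₁.1 x) + i₂.1 (p₂.1 x) = x)
    (hY : ∀ y, j₁.1 (q₁.1 y) + j₂.1 (q₂.1 y) = y) (hq₁ : ∀ x, q₁.1 (g.1 x) = g₁.1 (p₁.1 x))
    (hq₂ : ∀ x, q₂.1 (g.1 x) = g₂.1 (p₂.1 x)) (hi₁ : ∀ x, g.1 (i₁.1 x) = j₁.1 (g₁.1 x))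
    (hi₂ : ∀ x, g.1 (i₂.1 x) = j₂.1 (g₂.1 x)) : IsQis g := by
  constructor
  · rintro m hm ⟨y, hy⟩
    obtain ⟨x₁, hx₁⟩ := h₁.1 (p₁.1 m) (by rw [← hom_d, hm, map_zero])
      ⟨q₁.1 y, by rw [← hq₁, hy, hom_d]⟩
    obtain ⟨x₂, hx₂⟩ := h₂.1 (p₂.1 m) (by rw [← hom_d, hm, map_zero])
      ⟨q₂.1 y, by rw [← hq₂, hy, hom_d]⟩
    exact ⟨i₁.1 x₁ + i₂.1 x₂, by rw [map_add, ← hom_d, ← hom_d, ← hx₁, ← hx₂, hX]⟩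
  · intro y hy
    obtain ⟨m₁, x₁, hm₁, hx₁⟩ := h₁.2 (q₁.1 y) (by rw [← hom_d, hy, map_zero])
    obtain ⟨m₂, x₂, hm₂, hx₂⟩ := h₂.2 (q₂.1 y) (by rw [← hom_d, hy, map_zero])
    refine ⟨i₁.1 m₁ + i₂.1 m₂, j₁.1 x₁ + j₂.1 x₂, ?_, ?_⟩
    · rw [map_add, ← hom_d, ← hom_d, hm₁, hm₂, map_zero, map_zero, add_zero]
    · rw [← hY y, hx₁, hx₂]
      simp only [map_add, hi₁, hi₂, hom_d]
      abel

/-- The direct sum of two complexes. -/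
def prod (M N : Cplx A C) : Cplx A C where
  carrier := M.carrier × N.carrier
  gr s := (M.gr s).prod (N.gr s)
  internal := by
    refine isInternal_of_projections (fun s => (M.scale fun t => if t = s then 1 else 0).prodMap
      (N.scale fun t => if t = s then 1 else 0)) ?_ ?_ ?_
    · rintro s ⟨m, n⟩ ⟨hm, hn⟩
      simp [M.scale_apply _ hm, N.scale_apply _ hn]
    · rintro s t h ⟨m, n⟩ ⟨hm, hn⟩
      simp [M.scale_apply _ hm, N.scale_apply _ hn, h]
    · rintro ⟨m, n⟩
      have : ((m, n) : M.carrier × N.carrier) = (m, 0) + (0, n) := by simp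
      rw [this]
      refine add_mem ?_ ?_
      · induction m using M.induction with
        | hp s m hm => exact Submodule.mem_iSup_of_mem s ⟨hm, Submodule.zero_mem _⟩
        | hadd m m' h h' => simpa using add_mem (h (by simp)) (h' (by simp))
      · induction n using N.induction with
        | hp s n hn => exact Submodule.mem_iSup_of_mem s ⟨Submodule.zero_mem _, hn⟩
        | hadd m m' h h' => simpa using add_mem (h (by simp)) (h' (by simp))
  l := AlgHom.ofLinearMap
    { toFun := fun a => (M.l a).prodMap (N.l a)
      map_add' := fun a a' => by ext <;> simp
      map_smul' := fun x a => by ext <;> simp }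
    (by ext <;> simp) (fun a a' => by ext <;> simp)
  r := AlgHom.ofLinearMap
    { toFun := fun a => (M.r a).prodMap (N.r a)
      map_add' := fun a a' => by ext <;> simp
      map_smul' := fun x a => by ext <;> simp }
    (by ext <;> simp) (fun a a' => by ext <;> simp)
  l_r a c m := Prod.ext (M.l_r a c m.1) (N.l_r a c m.2)
  l_mem ha hm := ⟨M.l_mem ha hm.1, N.l_mem ha hm.2⟩
  r_mem ha hm := ⟨M.r_mem ha hm.1, N.r_mem ha hm.2⟩
  d := M.d.prodMap N.d
  d_mem hm := ⟨M.d_mem hm.1, N.d_mem hm.2⟩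
  d_d m := Prod.ext (M.d_d m.1) (N.d_d m.2)
  d_l a m := Prod.ext (M.d_l a m.1) (N.d_l a m.2)
  d_r a m := Prod.ext (M.d_r a m.1) (N.d_r a m.2)

section Prod

variable (M N : Cplx A C)

/-- The first projection. -/
def fst : (prod M N).homs M :=
  ⟨LinearMap.fst 𝕜 _ _, fun _ _ h => h.1, fun _ _ => rfl, fun _ _ => rfl, fun _ => rfl⟩

/-- The second projection. -/
def snd : (prod M N).homs N :=
  ⟨LinearMap.snd 𝕜 _ _, fun _ _ h => h.2, fun _ _ => rfl, fun _ _ => rfl, fun _ => rfl⟩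

/-- The first inclusion. -/
def inl : M.homs (prod M N) :=
  ⟨LinearMap.inl 𝕜 _ _, fun _ _ h => ⟨h, Submodule.zero_mem _⟩,
    fun a _ => Prod.ext rfl (map_zero (N.l a)).symm,
    fun a _ => Prod.ext rfl (map_zero (N.r a)).symm, fun _ => Prod.ext rfl (map_zero N.d).symm⟩

/-- The second inclusion. -/
def inr : N.homs (prod M N) :=
  ⟨LinearMap.inr 𝕜 _ _, fun _ _ h => ⟨Submodule.zero_mem _, h⟩,
    fun a _ => Prod.ext (map_zero (M.l a)).symm rfl,
    fun a _ => Prod.ext (map_zero (M.r a)).symm rfl, fun _ => Prod.ext (map_zero M.d).symm rfl⟩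

theorem inl_fst_add (x : (prod M N).carrier) :
    (inl M N).1 ((fst M N).1 x) + (inr M N).1 ((snd M N).1 x) = x :=
  Prod.ext (add_zero _) (zero_add _)

end Prod

theorem IsKFlatRight.prod {M N : Cplx A B} (hM : IsKFlatRight M) (hN : IsKFlatRight N) :
    IsKFlatRight (prod M N) := fun C P P' f hf => by
  refine IsQis.of_sum _ (hM C P P' f hf) (hN C P P' f hf)
    (tmap (inl M N) (idHom P)) (tmap (inr M N) (idHom P))
    (tmap (fst M N) (idHom P)) (tmap (snd M N) (idHom P))
    (tmap (inl M N) (idHom P')) (tmap (inr M N) (idHom P'))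
    (tmap (fst M N) (idHom P')) (tmap (snd M N) (idHom P')) ?_ ?_ ?_ ?_ ?_ ?_
  all_goals
    intro x
    induction x using tensor_induction with
    | h m n =>
      simp only [tmap_tm, idHom_apply, ← LinearMap.add_apply, ← map_add, inl_fst_add]
    | hadd x y hx hy => first
      | rw [map_add, map_add, map_add, map_add, add_add_add_comm, hx, hy]
      | simp only [map_add, hx, hy]

theorem IsKFlatLeft.prod {M N : Cplx A B} (hM : IsKFlatLeft M) (hN : IsKFlatLeft N) :
    IsKFlatLeft (prod M N) := fun C P P' f hf => by
  refine IsQis.of_sum _ (hM C P P' f hf) (hN C P P' f hf)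
    (tmap (idHom P) (inl M N)) (tmap (idHom P) (inr M N))
    (tmap (idHom P) (fst M N)) (tmap (idHom P) (snd M N))
    (tmap (idHom P') (inl M N)) (tmap (idHom P') (inr M N))
    (tmap (idHom P') (fst M N)) (tmap (idHom P') (snd M N)) ?_ ?_ ?_ ?_ ?_ ?_
  all_goals
    intro x
    induction x using tensor_induction with
    | h m n =>
      simp only [tmap_tm, idHom_apply, ← LinearMap.add_apply, ← map_add, inl_fst_add]
    | hadd x y hx hy => first
      | rw [map_add, map_add, map_add, map_add, add_add_add_comm, hx, hy]
      | simp only [map_add, hx, hy]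

/-- The shift of a map. -/
def shiftMap (s : ℤ) {M N : Cplx A C} (f : M.homs N) : (M.shift s).homs (N.shift s) :=
  ⟨f.1, fun t _ h => f.2.1 (t.1, t.2 + s) _ h, f.2.2⟩

/-- A map `M → N{-s}`, as a map `M{s} → N`. -/
def unshift (s : ℤ) {M N : Cplx A C} (f : M.homs (N.shift (-s))) : (M.shift s).homs N :=
  ⟨f.1, fun t m h => by
    have h' : f.1 m ∈ N.gr (t.1, t.2 + s + -s) := f.2.1 (t.1, t.2 + s) m h
    rwa [add_neg_cancel_right] at h', f.2.2⟩

theorem shift_sgn (s : ℤ) (M : Cplx A C) (m : M.carrier) : (M.shift s).sgn m = M.sgn m := by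
  refine (M.shift s).induction (p := fun m => (M.shift s).sgn m = M.sgn m) (fun t m hm => ?_)
    (fun x y hx hy => ?_) m
  · exact ((M.shift s).sgn_apply hm).trans (M.sgn_apply (t := (t.1, t.2 + s)) hm).symm
  · exact ((M.shift s).sgn.map_add x y).trans ((congrArg₂ _ hx hy).trans (M.sgn.map_add x y).symm)


section Exchange

variable (s : ℤ) (M : Cplx A B) (N : Cplx B C)

/-- The linear map `m ⊗ n ↦ m ⊗ n` from `M{s} ⊗ N` to `M ⊗ N`. -/
def exLLin : (tensor (M.shift s) N).carrier →ₗ[𝕜] (tensor M N).carrier :=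
  tensorLift (M := M.shift s) (tm (M := M)) (tm_balance (M := M))

theorem exLLin_tm (m : M.carrier) (n : N.carrier) :
    exLLin s M N (tm (M := M.shift s) m n) = tm m n := tensorLift_tm (M := M.shift s) _ _ _ _

/-- The linear map `m ⊗ n ↦ m ⊗ n` from `M ⊗ N` to `M{s} ⊗ N`. -/
def exLInvLin : (tensor M N).carrier →ₗ[𝕜] (tensor (M.shift s) N).carrier :=
  tensorLift (M := M) (tm (M := M.shift s)) (tm_balance (M := M.shift s))

theorem exLInvLin_tm (m : M.carrier) (n : N.carrier) :
    exLInvLin s M N (tm m n) = tm (M := M.shift s) m n := tensorLift_tm _ _ _ _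

/-- The isomorphism `M{s} ⊗ N → (M ⊗ N){s}`. -/
def exL : (tensor (M.shift s) N).homs ((tensor M N).shift s) :=
  tensorHom (M := M.shift s) (X := (tensor M N).shift s) (exLLin s M N)
    (fun i j m n hm hn => by
      rw [exLLin_tm]
      exact tm_mem (M := M) (i := (i.1, i.2 + s)) hm hn (Prod.ext rfl (by simp; ring)))
    (fun a m n => (exLLin_tm s M N _ n).trans
      ((tensor_l a (M := M) m n).symm.trans (congrArg _ (exLLin_tm s M N m n).symm)))
    (fun a m n => (exLLin_tm s M N _ _).trans
      ((tensor_r a (M := M) m n).symm.trans (congrArg _ (exLLin_tm s M N m n).symm)))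
    (fun m n => by
      rw [shift_sgn]
      exact (congrArg₂ (· + ·) (exLLin_tm s M N _ _) (exLLin_tm s M N _ _)).trans
        ((tensor_d (M := M) m n).symm.trans (congrArg _ (exLLin_tm s M N m n).symm)))

/-- The inverse of `exL`. -/
def exLInv : ((tensor M N).shift s).homs (tensor (M.shift s) N) :=
  unshift s (tensorHom (X := (tensor (M.shift s) N).shift (-s)) (exLInvLin s M N)
    (fun i j m n hm hn => by
      rw [exLInvLin_tm]
      refine tm_mem (M := M.shift s) (i := (i.1, i.2 - s)) (j := j) ?_ hn
        (Prod.ext rfl (by simp; ring))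
      change m ∈ M.gr (i.1, i.2 - s + s)
      rwa [sub_add_cancel])
    (fun a m n => (exLInvLin_tm s M N _ n).trans
      ((tensor_l a (M := M.shift s) m n).symm.trans (congrArg _ (exLInvLin_tm s M N m n).symm)))
    (fun a m n => (exLInvLin_tm s M N _ _).trans
      ((tensor_r a (M := M.shift s) m n).symm.trans (congrArg _ (exLInvLin_tm s M N m n).symm)))
    (fun m n => by
      rw [← shift_sgn s]
      exact (congrArg₂ (· + ·) (exLInvLin_tm s M N _ _) (exLInvLin_tm s M N _ _)).trans
        ((tensor_d (M := M.shift s) m n).symm.trans (congrArg _ (exLInvLin_tm s M N m n).symm))))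

theorem exLInv_exL (x : (tensor (M.shift s) N).carrier) :
    (exLInv s M N).1 ((exL s M N).1 x) = x := by
  induction x using tensor_induction with
  | h m n => exact (congrArg _ (exLLin_tm s M N m n)).trans (exLInvLin_tm s M N m n)
  | hadd x y hx hy => simp only [map_add, hx, hy]

theorem exL_exLInv (x : (tensor M N).carrier) : (exL s M N).1 ((exLInv s M N).1 x) = x := by
  induction x using tensor_induction with
  | h m n => exact (congrArg _ (exLInvLin_tm s M N m n)).trans (exLLin_tm s M N m n)
  | hadd x y hx hy =>
    refine (congrArg _ ((exLInv s M N).1.map_add x y)).trans (((exL s M N).1.map_add _ _).trans ?_)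
    exact congrArg₂ (· + ·) hx hy

/-- The linear map `m ⊗ n ↦ m ⊗ n` from `M ⊗ N{s}` to `M ⊗ N`. -/
def exRLin : (tensor M (N.shift s)).carrier →ₗ[𝕜] (tensor M N).carrier :=
  tensorLift (N := N.shift s) (tm (N := N)) (tm_balance (N := N))

theorem exRLin_tm (m : M.carrier) (n : N.carrier) :
    exRLin s M N (tm (N := N.shift s) m n) = tm m n := tensorLift_tm (N := N.shift s) _ _ _ _

/-- The linear map `m ⊗ n ↦ m ⊗ n` from `M ⊗ N` to `M ⊗ N{s}`. -/
def exRInvLin : (tensor M N).carrier →ₗ[𝕜] (tensor M (N.shift s)).carrier :=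
  tensorLift (N := N) (tm (N := N.shift s)) (tm_balance (N := N.shift s))

theorem exRInvLin_tm (m : M.carrier) (n : N.carrier) :
    exRInvLin s M N (tm m n) = tm (N := N.shift s) m n := tensorLift_tm _ _ _ _

/-- The isomorphism `M ⊗ N{s} → (M ⊗ N){s}`. -/
def exR : (tensor M (N.shift s)).homs ((tensor M N).shift s) :=
  tensorHom (N := N.shift s) (X := (tensor M N).shift s) (exRLin s M N)
    (fun i j m n hm hn => by
      rw [exRLin_tm]
      exact tm_mem (N := N) (j := (j.1, j.2 + s)) hm hn (Prod.ext rfl (by simp; ring)))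
    (fun a m n => (exRLin_tm s M N _ n).trans
      ((tensor_l a (N := N) m n).symm.trans (congrArg _ (exRLin_tm s M N m n).symm)))
    (fun a m n => (exRLin_tm s M N _ _).trans
      ((tensor_r a (N := N) m n).symm.trans (congrArg _ (exRLin_tm s M N m n).symm)))
    (fun m n => (congrArg₂ (· + ·) (exRLin_tm s M N _ _) (exRLin_tm s M N _ _)).trans
        ((tensor_d (N := N) m n).symm.trans (congrArg _ (exRLin_tm s M N m n).symm)))

/-- The inverse of `exR`. -/
def exRInv : ((tensor M N).shift s).homs (tensor M (N.shift s)) :=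
  unshift s (tensorHom (X := (tensor M (N.shift s)).shift (-s)) (exRInvLin s M N)
    (fun i j m n hm hn => by
      rw [exRInvLin_tm]
      refine tm_mem (N := N.shift s) (i := i) (j := (j.1, j.2 - s)) hm ?_
        (Prod.ext rfl (by simp; ring))
      change n ∈ N.gr (j.1, j.2 - s + s)
      rwa [sub_add_cancel])
    (fun a m n => (exRInvLin_tm s M N _ n).trans
      ((tensor_l a (N := N.shift s) m n).symm.trans (congrArg _ (exRInvLin_tm s M N m n).symm)))
    (fun a m n => (exRInvLin_tm s M N _ _).trans
      ((tensor_r a (N := N.shift s) m n).symm.trans (congrArg _ (exRInvLin_tm s M N m n).symm)))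
    (fun m n => (congrArg₂ (· + ·) (exRInvLin_tm s M N _ _) (exRInvLin_tm s M N _ _)).trans
        ((tensor_d (N := N.shift s) m n).symm.trans (congrArg _ (exRInvLin_tm s M N m n).symm))))

theorem exRInv_exR (x : (tensor M (N.shift s)).carrier) :
    (exRInv s M N).1 ((exR s M N).1 x) = x := by
  induction x using tensor_induction with
  | h m n => exact (congrArg _ (exRLin_tm s M N m n)).trans (exRInvLin_tm s M N m n)
  | hadd x y hx hy => simp only [map_add, hx, hy]

theorem exR_exRInv (x : (tensor M N).carrier) : (exR s M N).1 ((exRInv s M N).1 x) = x := by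
  induction x using tensor_induction with
  | h m n => exact (congrArg _ (exRInvLin_tm s M N m n)).trans (exRLin_tm s M N m n)
  | hadd x y hx hy =>
    refine (congrArg _ ((exRInv s M N).1.map_add x y)).trans (((exR s M N).1.map_add _ _).trans ?_)
    exact congrArg₂ (· + ·) hx hy

end Exchange

theorem exL_bijective (s : ℤ) (M : Cplx A B) (N : Cplx B C) : Function.Bijective (exL s M N).1 :=
  ⟨Function.LeftInverse.injective (exLInv_exL s M N),
    Function.RightInverse.surjective (exL_exLInv s M N)⟩

theorem exR_bijective (s : ℤ) (M : Cplx A B) (N : Cplx B C) : Function.Bijective (exR s M N).1 :=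
  ⟨Function.LeftInverse.injective (exRInv_exR s M N),
    Function.RightInverse.surjective (exR_exRInv s M N)⟩

theorem exL_natural (s : ℤ) {M M' : Cplx A B} {N N' : Cplx B C} (f : M.homs M') (g : N.homs N') :
    compHom (tmap (shiftMap s f) g) (exL s M' N') =
      compHom (exL s M N) (shiftMap s (tmap f g)) := by
  refine Subtype.ext (tensor_ext fun m n => ?_)
  have h := congrArg (exL s M' N').1 (tmap_tm (shiftMap s f) g m n)
  refine h.trans ((exLLin_tm s M' N' _ _).trans ((tmap_tm f g m n).symm.trans ?_))
  exact congrArg (tmap f g).1 (exLLin_tm s M N m n).symm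

theorem exR_natural (s : ℤ) {M M' : Cplx A B} {N N' : Cplx B C} (f : M.homs M') (g : N.homs N') :
    compHom (tmap f (shiftMap s g)) (exR s M' N') =
      compHom (exR s M N) (shiftMap s (tmap f g)) := by
  refine Subtype.ext (tensor_ext fun m n => ?_)
  have h := congrArg (exR s M' N').1 (tmap_tm f (shiftMap s g) m n)
  refine h.trans ((exRLin_tm s M' N' _ _).trans ((tmap_tm f g m n).symm.trans ?_))
  exact congrArg (tmap f g).1 (exRLin_tm s M N m n).symm

theorem IsQis.shift (s : ℤ) {M N : Cplx A C} {f : M.homs N} (hf : IsQis f) :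
    IsQis (shiftMap s f) := hf

theorem IsKFlatRight.shift (s : ℤ) {M : Cplx A B} (hM : IsKFlatRight M) :
    IsKFlatRight (M.shift s) := fun C P P' f hf =>
  (IsQis.shift s (hM C P P' f hf)).of_square _ (exL s M P).1 (exL s M P').1 (exL_bijective s M P)
    (exL_bijective s M P') (hom_d (exL s M P)) (hom_d (exL s M P'))
    (homs_congr (exL_natural s (idHom M) f))

theorem IsKFlatLeft.shift (s : ℤ) {M : Cplx A B} (hM : IsKFlatLeft M) :
    IsKFlatLeft (M.shift s) := fun C P P' f hf =>
  (IsQis.shift s (hM C P P' f hf)).of_square _ (exR s P M).1 (exR s P' M).1 (exR_bijective s P M)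
    (exR_bijective s P' M) (hom_d (exR s P M)) (hom_d (exR s P' M))
    (homs_congr (exR_natural s f (idHom M)))

end Cplx

namespace Ker

open Cplx

/-- The shift functor `{s}`. -/
def shift (s : ℤ) : Ker A C ⥤ Ker A C where
  obj M := ⟨M.cplx.shift s, M.flatLeft.shift s, M.flatRight.shift s⟩
  map f := shiftMap s f

/-- The natural isomorphism `M{0} ≅ M`. -/
def shiftZero : shift 0 ≅ 𝟭 (Ker A C) :=
  NatIso.ofComponents (fun M => isoMk
    ⟨LinearMap.id, fun t m h => by
      have h' : m ∈ M.cplx.gr (t.1, t.2 + 0) := h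
      rwa [add_zero] at h', fun _ _ => rfl, fun _ _ => rfl, fun _ => rfl⟩
    ⟨LinearMap.id, fun t m h => by
      change m ∈ M.cplx.gr (t.1, t.2 + 0)
      rwa [add_zero], fun _ _ => rfl, fun _ _ => rfl, fun _ => rfl⟩
    (fun _ => rfl) (fun _ => rfl)) fun _ => rfl

/-- The natural isomorphism `M{s + t} ≅ M{s}{t}`. -/
def shiftAdd (s t : ℤ) : shift (s + t) ≅ shift s ⋙ (shift t : Ker A C ⥤ Ker A C) :=
  NatIso.ofComponents (fun M => isoMk
    ⟨LinearMap.id, fun q m h => by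
      have h' : m ∈ M.cplx.gr (q.1, q.2 + (s + t)) := h
      rwa [add_comm s t, ← add_assoc] at h', fun _ _ => rfl, fun _ _ => rfl, fun _ => rfl⟩
    ⟨LinearMap.id, fun q m h => by
      change m ∈ M.cplx.gr (q.1, q.2 + (s + t))
      rwa [add_comm s t, ← add_assoc], fun _ _ => rfl, fun _ _ => rfl, fun _ => rfl⟩
    (fun _ => rfl) (fun _ => rfl)) fun _ => rfl

/-- The isomorphism `M{s} ⊗ N ≅ (M ⊗ N){s}`. -/
def shiftTensor (s : ℤ) (M : Ker A B) (N : Ker B C) :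
    ((shift s).obj M).tensor N ≅ (shift s).obj (M.tensor N) :=
  isoMk (exL s M.cplx N.cplx) (exLInv s M.cplx N.cplx) (exLInv_exL _ _ _) (exL_exLInv _ _ _)

/-- The isomorphism `M ⊗ N{s} ≅ (M ⊗ N){s}`. -/
def tensorShift (s : ℤ) (M : Ker A B) (N : Ker B C) :
    M.tensor ((shift s).obj N) ≅ (shift s).obj (M.tensor N) :=
  isoMk (exR s M.cplx N.cplx) (exRInv s M.cplx N.cplx) (exRInv_exR _ _ _) (exR_exRInv _ _ _)

/-- The direct sum. -/
def prod (M N : Ker A C) : Ker A C :=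
  ⟨Cplx.prod M.cplx N.cplx, M.flatLeft.prod N.flatLeft, M.flatRight.prod N.flatRight⟩

end Ker
namespace Ker

open Cplx

instance : Limits.HasBinaryBiproducts (Ker A C) where
  has_binary_biproduct M N := Limits.HasBinaryBiproduct.mk
    { bicone :=
        { pt := M.prod N
          fst := fst M.cplx N.cplx
          snd := snd M.cplx N.cplx
          inl := inl M.cplx N.cplx
          inr := inr M.cplx N.cplx
          inl_fst := homs_ext fun _ => rfl
          inl_snd := homs_ext fun _ => rfl
          inr_fst := homs_ext fun _ => rfl
          inr_snd := homs_ext fun _ => rfl }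
      isBilimit := Limits.isBinaryBilimitOfTotal _ (homs_ext (inl_fst_add M.cplx N.cplx)) }

theorem qis_of_isIso {M N : Ker A C} (f : M ⟶ N) [IsIso f] : qis A C f := by
  have h : ∀ x, (inv f : N.cplx.homs M.cplx).1 ((f : M.cplx.homs N.cplx).1 x) = x :=
    homs_congr (IsIso.hom_inv_id f)
  have h' : ∀ x, (f : M.cplx.homs N.cplx).1 ((inv f : N.cplx.homs M.cplx).1 x) = x :=
    homs_congr (IsIso.inv_hom_id f)
  constructor
  · rintro m - ⟨y, hy⟩
    exact ⟨(inv f : N.cplx.homs M.cplx).1 y, by rw [← hom_d, ← hy, h]⟩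
  · intro y hy
    refine ⟨(inv f : N.cplx.homs M.cplx).1 y, 0, by rw [← hom_d, hy, map_zero], ?_⟩
    rw [h', map_zero, add_zero]

theorem qis_comp {M N P : Ker A C} (f : M ⟶ N) (g : N ⟶ P) (hf : qis A C f) (hg : qis A C g) :
    qis A C (f ≫ g) := by
  constructor
  · rintro m hm ⟨y, hy⟩
    exact hf.1 m hm (hg.1 _ (by rw [← hom_d, hm, map_zero]) ⟨y, hy⟩)
  · intro y hy
    obtain ⟨n, x, hn, rfl⟩ := hg.2 y hy
    obtain ⟨m, z, hm, rfl⟩ := hf.2 n hn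
    refine ⟨m, (g : N.cplx.homs P.cplx).1 z + x, hm, ?_⟩
    rw [comp_apply, map_add, map_add, hom_d, add_assoc]

instance : (qis A C).IsMultiplicative where
  id_mem _ := qis_of_isIso _
  comp_mem := qis_comp

instance : (qis A C).RespectsIso where
  precomp e he f hf := qis_comp _ _ (have : IsIso e := he; qis_of_isIso e) hf
  postcomp e he f hf := qis_comp _ _ hf (have : IsIso e := he; qis_of_isIso e)

open Limits in
instance : (qis A C).IsStableUnderProductsOfShape WalkingPair := by
  refine MorphismProperty.IsStableUnderProductsOfShape.mk _ _ fun X₁ X₂ _ _ f hf => ?_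
  let i (X : WalkingPair → Ker A C) : X .left ⟶ ∏ᶜ X :=
    Pi.lift fun b => match b with
      | .left => 𝟙 _
      | .right => 0
  let j (X : WalkingPair → Ker A C) : X .right ⟶ ∏ᶜ X :=
    Pi.lift fun b => match b with
      | .left => 0
      | .right => 𝟙 _
  have tot (X : WalkingPair → Ker A C) :
      Pi.π X .left ≫ i X + Pi.π X .right ≫ j X = 𝟙 _ := by
    refine Pi.hom_ext _ _ fun b => ?_
    cases b <;> simp [i, j]
  have hi : i X₁ ≫ Limits.Pi.map f = f .left ≫ i X₂ := by
    refine Pi.hom_ext _ _ fun b => ?_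
    cases b <;> simp [i]
  have hj : j X₁ ≫ Limits.Pi.map f = f .right ≫ j X₂ := by
    refine Pi.hom_ext _ _ fun b => ?_
    cases b <;> simp [j]
  exact IsQis.of_sum (Limits.Pi.map f) (hf .left) (hf .right) (i X₁) (j X₁) (Pi.π X₁ .left)
    (Pi.π X₁ .right) (i X₂) (j X₂) (Pi.π X₂ .left) (Pi.π X₂ .right) (homs_congr (tot X₁))
    (homs_congr (tot X₂)) (homs_congr (Limits.Pi.map_π f _)) (homs_congr (Limits.Pi.map_π f _))
    (homs_congr hi) (homs_congr hj)

end Ker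

/-! ### The additive structure of a localization -/

section Localization

open Limits Localization.Construction

variable {K : Type (u + 1)} [Category.{u} K] {W : MorphismProperty K}

/-- The object of the original category that an object of the localization comes from. -/
abbrev locObj (X : W.Localization) : K := (objEquiv W).symm X

theorem loc_induction {p : ∀ {X Y : K}, (W.Q.obj X ⟶ W.Q.obj Y) → Prop}
    (h : ∀ {X Y : K} (f : X ⟶ Y), p (W.Q.map f))
    (hinv : ∀ {X Y : K} (w : X ⟶ Y) (hw : W w), p (wIso w hw).inv)
    (hcomp : ∀ {X Y Z : K} (f : W.Q.obj X ⟶ W.Q.obj Y) (g : W.Q.obj Y ⟶ W.Q.obj Z),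
      p f → p g → p (f ≫ g))
    {X Y : K} (f : W.Q.obj X ⟶ W.Q.obj Y) : p f := by
  let P : MorphismProperty W.Localization := fun X Y f => p (X := locObj X) (Y := locObj Y) f
  have : P.IsStableUnderComposition :=
    ⟨fun {X Y Z} f g => hcomp (X := locObj X) (Y := locObj Y) (Z := locObj Z) f g⟩
  have hP := morphismProperty_eq_top P (fun _ _ f => h f) (fun _ _ w hw => hinv w hw)
  change P f
  rw [hP]
  trivial

/-- A family of morphisms that is natural with respect to the morphisms of the original category is
natural with respect to the morphisms of the localization. -/
theorem loc_natural {E : Type*} [Category E] {F G : W.Localization ⥤ E}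
    (τ : ∀ X : K, F.obj (W.Q.obj X) ⟶ G.obj (W.Q.obj X))
    (h : ∀ {X Y : K} (f : X ⟶ Y),
      F.map (W.Q.map f) ≫ τ Y = τ X ≫ G.map (W.Q.map f))
    {X Y : K} (f : W.Q.obj X ⟶ W.Q.obj Y) : F.map f ≫ τ Y = τ X ≫ G.map f := by
  induction f using loc_induction with
  | h f => exact h f
  | hinv w hw =>
    have h₁ : F.map (wIso w hw).hom ≫ τ _ = τ _ ≫ G.map (wIso w hw).hom := h w
    rw [← cancel_epi (F.map (wIso w hw).hom), ← Category.assoc, ← F.map_comp, Iso.hom_inv_id,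
      F.map_id, Category.id_comp, ← Category.assoc, h₁, Category.assoc, ← G.map_comp,
      Iso.hom_inv_id, G.map_id, Category.comp_id]
  | hcomp f g hf hg => rw [F.map_comp, Category.assoc, hg, ← Category.assoc, hf, Category.assoc,
      G.map_comp]

variable [Preadditive K] [HasBinaryBiproducts K] [W.ContainsIdentities]
  [W.IsStableUnderProductsOfShape WalkingPair]

/-- The image of `Y ⊞ Y` in the localization is the product of `Y` with itself. -/
def locIsLimit (Y : K) : IsLimit (BinaryFan.mk (W.Q.map (biprod.fst : Y ⊞ Y ⟶ Y))
    (W.Q.map (biprod.snd : Y ⊞ Y ⟶ Y))) :=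
  have : PreservesLimitsOfShape (Discrete WalkingPair) W.Q :=
    Localization.preservesProductsOfShape W.Q W WalkingPair
  mapIsLimitOfPreservesOfIsLimit W.Q _ _ (BinaryBiproduct.isLimit Y Y)

/-- The morphism to `Y ⊞ Y` with components `f` and `g`. -/
def locPair {X : W.Localization} {Y : K} (f g : X ⟶ W.Q.obj Y) : X ⟶ W.Q.obj (Y ⊞ Y) :=
  BinaryFan.IsLimit.lift (locIsLimit (W := W) Y) f g

theorem locPair_fst {X : W.Localization} {Y : K} (f g : X ⟶ W.Q.obj Y) :
    locPair f g ≫ W.Q.map biprod.fst = f :=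
  BinaryFan.IsLimit.lift_fst (locIsLimit (W := W) Y) _ _

theorem locPair_snd {X : W.Localization} {Y : K} (f g : X ⟶ W.Q.obj Y) :
    locPair f g ≫ W.Q.map biprod.snd = g :=
  BinaryFan.IsLimit.lift_snd (locIsLimit (W := W) Y) _ _

theorem locPair_ext {X : W.Localization} {Y : K} {u v : X ⟶ W.Q.obj (Y ⊞ Y)}
    (h : u ≫ W.Q.map biprod.fst = v ≫ W.Q.map biprod.fst)
    (h' : u ≫ W.Q.map biprod.snd = v ≫ W.Q.map biprod.snd) : u = v :=
  BinaryFan.IsLimit.hom_ext (locIsLimit (W := W) Y) h h'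

/-- The sum of two morphisms of the localization: their pairing, followed by the sum of the two
projections. -/
def locAdd {X : W.Localization} {Y : K} (f g : X ⟶ W.Q.obj Y) : X ⟶ W.Q.obj Y :=
  locPair f g ≫ W.Q.map (biprod.fst + biprod.snd)

theorem locAdd_eq {X : W.Localization} {Y : K} (u : X ⟶ W.Q.obj (Y ⊞ Y)) :
    locAdd (u ≫ W.Q.map biprod.fst) (u ≫ W.Q.map biprod.snd) =
      u ≫ W.Q.map (biprod.fst + biprod.snd) := by
  rw [locAdd]
  congr 1
  exact locPair_ext (locPair_fst _ _) (locPair_snd _ _)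

theorem comp_locAdd {X Y : W.Localization} {Z : K} (h : X ⟶ Y) (f g : Y ⟶ W.Q.obj Z) :
    h ≫ locAdd f g = locAdd (h ≫ f) (h ≫ g) := by
  have := locAdd_eq (h ≫ locPair f g)
  rw [Category.assoc, Category.assoc, locPair_fst, locPair_snd] at this
  rw [this, locAdd, Category.assoc]

theorem locAdd_map {X Y : K} (f g : X ⟶ Y) :
    locAdd (W.Q.map f) (W.Q.map g) = W.Q.map (f + g) := by
  have := locAdd_eq (W := W) (W.Q.map (biprod.lift f g))
  rwa [← W.Q.map_comp, ← W.Q.map_comp, ← W.Q.map_comp, biprod.lift_fst, biprod.lift_snd,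
    Preadditive.comp_add, biprod.lift_fst, biprod.lift_snd] at this

theorem locAdd_comp_map {X : W.Localization} {Y Z : K} (h : X ⟶ W.Q.obj Y) (f g : Y ⟶ Z) :
    locAdd (h ≫ W.Q.map f) (h ≫ W.Q.map g) = h ≫ W.Q.map (f + g) := by
  rw [← locAdd_map, comp_locAdd]

theorem locAdd_comp {X : W.Localization} {Y Z : K} (f g : X ⟶ W.Q.obj Y)
    (h : W.Q.obj Y ⟶ W.Q.obj Z) : locAdd f g ≫ h = locAdd (f ≫ h) (g ≫ h) := by
  revert f g
  induction h using loc_induction with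
  | h h =>
    intro f g
    rw [locAdd, Category.assoc, ← W.Q.map_comp, Preadditive.add_comp, ← locAdd_comp_map,
      W.Q.map_comp, W.Q.map_comp, ← Category.assoc, ← Category.assoc, locPair_fst, locPair_snd]
  | hinv w hw =>
    intro f g
    have key (f g : X ⟶ _) : locAdd f g ≫ (wIso w hw).hom =
        locAdd (f ≫ (wIso w hw).hom) (g ≫ (wIso w hw).hom) := by
      change _ ≫ W.Q.map w = locAdd (_ ≫ W.Q.map w) (_ ≫ W.Q.map w)
      rw [locAdd, Category.assoc, ← W.Q.map_comp, Preadditive.add_comp, ← locAdd_comp_map,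
        W.Q.map_comp, W.Q.map_comp, ← Category.assoc, ← Category.assoc, locPair_fst, locPair_snd]
    rw [Iso.comp_inv_eq, key, Category.assoc, Category.assoc, Iso.inv_hom_id, Category.comp_id,
      Category.comp_id]
  | hcomp h k hh hk => intro f g; rw [← Category.assoc, hh, hk, Category.assoc, Category.assoc]

theorem locAdd_comm {X : W.Localization} {Y : K} (f g : X ⟶ W.Q.obj Y) :
    locAdd f g = locAdd g f := by
  obtain ⟨u, rfl, rfl⟩ : ∃ u : X ⟶ W.Q.obj (Y ⊞ Y), f = u ≫ W.Q.map biprod.fst ∧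
      g = u ≫ W.Q.map biprod.snd := ⟨locPair f g, (locPair_fst f g).symm, (locPair_snd f g).symm⟩
  rw [locAdd_comp_map, locAdd_comp_map, add_comm]

theorem locAdd_assoc {X : W.Localization} {Y : K} (f g h : X ⟶ W.Q.obj Y) :
    locAdd (locAdd f g) h = locAdd f (locAdd g h) := by
  obtain ⟨u, a, b, c, rfl, rfl, rfl⟩ : ∃ (u : X ⟶ W.Q.obj ((Y ⊞ Y) ⊞ (Y ⊞ Y)))
      (a b c : (Y ⊞ Y) ⊞ (Y ⊞ Y) ⟶ Y), f = u ≫ W.Q.map a ∧ g = u ≫ W.Q.map b ∧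
        h = u ≫ W.Q.map c :=
    ⟨locPair (locPair f g) (locPair h h), biprod.fst ≫ biprod.fst, biprod.fst ≫ biprod.snd,
      biprod.snd ≫ biprod.fst,
      by rw [W.Q.map_comp, ← Category.assoc, locPair_fst, locPair_fst],
      by rw [W.Q.map_comp, ← Category.assoc, locPair_fst, locPair_snd],
      by rw [W.Q.map_comp, ← Category.assoc, locPair_snd, locPair_fst]⟩
  simp only [locAdd_comp_map, add_assoc]

theorem comp_map_zero {X Y : K} (f : W.Q.obj X ⟶ W.Q.obj Y) (Z : K) :
    f ≫ W.Q.map (0 : Y ⟶ Z) = W.Q.map 0 := by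
  induction f using loc_induction with
  | h f => rw [← W.Q.map_comp, Limits.comp_zero]
  | hinv w hw =>
    rw [Iso.inv_comp_eq]
    change _ = W.Q.map w ≫ _
    rw [← W.Q.map_comp, Limits.comp_zero]
  | hcomp f g hf hg => rw [Category.assoc, hg, hf]

/-- The additive group of morphisms of the localization. -/
abbrev locGroup (X Y : K) : AddCommGroup (W.Q.obj X ⟶ W.Q.obj Y) where
  add := locAdd
  zero := W.Q.map 0
  neg f := f ≫ W.Q.map (-𝟙 Y)
  nsmul := @nsmulRec _ ⟨W.Q.map 0⟩ ⟨locAdd⟩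
  zsmul := @zsmulRec _ ⟨W.Q.map 0⟩ ⟨locAdd⟩ ⟨fun f => f ≫ W.Q.map (-𝟙 Y)⟩
    (@nsmulRec _ ⟨W.Q.map 0⟩ ⟨locAdd⟩)
  add_assoc := locAdd_assoc
  add_comm := locAdd_comm
  zero_add f := by
    change locAdd (W.Q.map 0) f = f
    have h := locAdd_comp_map f 0 (𝟙 Y)
    rwa [comp_map_zero, zero_add, W.Q.map_id, Category.comp_id] at h
  add_zero f := by
    change locAdd f (W.Q.map 0) = f
    have h := locAdd_comp_map f (𝟙 Y) 0
    rwa [comp_map_zero, add_zero, W.Q.map_id, Category.comp_id] at h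
  neg_add_cancel f := by
    change locAdd (f ≫ W.Q.map (-𝟙 Y)) f = W.Q.map 0
    have h := locAdd_comp_map f (-𝟙 Y) (𝟙 Y)
    rwa [neg_add_cancel, W.Q.map_id, Category.comp_id, comp_map_zero] at h

instance : Preadditive W.Localization where
  homGroup X Y := locGroup (locObj X) (locObj Y)
  add_comp X Y Z f g h := locAdd_comp (Y := locObj Y) (Z := locObj Z) f g h
  comp_add X Y Z f g h := comp_locAdd (Z := locObj Z) f g h

instance : W.Q.Additive where
  map_add {_ _ f g} := (locAdd_map f g).symm

theorem loc_map_locAdd {E : Type*} [Category E] [Preadditive E] (F : W.Localization ⥤ E)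
    (h : ∀ {X Y : K} (f g : X ⟶ Y),
      F.map (W.Q.map (f + g)) = F.map (W.Q.map f) + F.map (W.Q.map g))
    {X : W.Localization} {Y : K} (f g : X ⟶ W.Q.obj Y) :
    F.map (locAdd f g) = F.map f + F.map g := by
  obtain ⟨u, rfl, rfl⟩ : ∃ u : X ⟶ W.Q.obj (Y ⊞ Y), f = u ≫ W.Q.map biprod.fst ∧
      g = u ≫ W.Q.map biprod.snd := ⟨locPair f g, (locPair_fst f g).symm, (locPair_snd f g).symm⟩
  rw [locAdd_comp_map, F.map_comp, F.map_comp, F.map_comp, h, Preadditive.comp_add]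

/-- A functor on the localization is additive if it is additive on the original category. -/
theorem loc_additive {E : Type*} [Category E] [Preadditive E] (F : W.Localization ⥤ E)
    (h : ∀ {X Y : K} (f g : X ⟶ Y),
      F.map (W.Q.map (f + g)) = F.map (W.Q.map f) + F.map (W.Q.map g)) : F.Additive where
  map_add {_ Y f g} := loc_map_locAdd F h (Y := locObj Y) f g

variable [Linear 𝕜 K]

theorem loc_smul_map {X Y : K} (x : 𝕜) (f : X ⟶ Y) : W.Q.map (x • f) = x • W.Q.map f :=
  W.Q.map_smul x f

theorem loc_linear_aux {E : Type*} [Category E] [Preadditive E] [Linear 𝕜 E]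
    (F : W.Localization ⥤ E)
    (h : ∀ {X Y : K} (f : X ⟶ Y) (x : 𝕜), F.map (W.Q.map (x • f)) = x • F.map (W.Q.map f))
    {X : W.Localization} {Y : K} (f : X ⟶ W.Q.obj Y) (x : 𝕜) : F.map (x • f) = x • F.map f := by
  have h₁ : x • f = f ≫ W.Q.map (x • 𝟙 Y) := by
    rw [loc_smul_map, W.Q.map_id, Linear.comp_smul, Category.comp_id]
  rw [h₁, F.map_comp, h, Linear.comp_smul, W.Q.map_id, F.map_id, Category.comp_id]

/-- A functor on the localization is linear if it is linear on the original category. -/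
theorem loc_linear {E : Type*} [Category E] [Preadditive E] [Linear 𝕜 E] (F : W.Localization ⥤ E)
    (h : ∀ {X Y : K} (f : X ⟶ Y) (x : 𝕜), F.map (W.Q.map (x • f)) = x • F.map (W.Q.map f)) :
    F.Linear 𝕜 where
  map_smul {_ Y} f x := loc_linear_aux F h (Y := locObj Y) f x

end Localization
/-! ### The derived 2-category -/

section Derived

open Localization.Construction Cplx

/-- The derived category of graded `A`-`C`-bimodules, that is, of `𝔾ₘ`-equivariant quasi-coherent
sheaves on `Spec A × Spec C`: the complexes that are K-flat over `A` and over `C`, with the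
quasi-isomorphisms inverted. (Every complex is quasi-isomorphic to a semi-free one, which is K-flat
over `A` and over `C`, so that all objects of the derived category are obtained.) -/
abbrev DKer (A C : GrAlg 𝕜) := (Ker.qis A C).Localization

/-- A kernel as an object of the derived category. -/
abbrev DKer.of (M : Ker A C) : DKer A C := (Ker.qis A C).Q.obj M

/-- A map of complexes as a morphism of the derived category. -/
abbrev DKer.ofHom {M N : Ker A C} (f : M ⟶ N) : DKer.of M ⟶ DKer.of N := (Ker.qis A C).Q.map f

/-- An isomorphism of complexes as an isomorphism of the derived category. -/
abbrev DKer.ofIso {M N : Ker A C} (f : M ≅ N) : DKer.of M ≅ DKer.of N := (Ker.qis A C).Q.mapIso f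

/-- The functor `M ⊗ -` on complexes. -/
def Ker.tensorLeft (M : Ker A B) : Ker B C ⥤ Ker A C where
  obj N := M.tensor N
  map f := tmap (idHom M.cplx) f
  map_id N := tmap_idHom _ _
  map_comp f g := tmap_compHom (idHom _) (idHom _) f g

/-- The functor `- ⊗ N` on complexes. -/
def Ker.tensorRight (N : Ker B C) : Ker A B ⥤ Ker A C where
  obj M := M.tensor N
  map f := tmap f (idHom N.cplx)
  map_id M := tmap_idHom _ _
  map_comp f g := tmap_compHom f g (idHom _) (idHom _)

theorem Ker.tensorLeft_inverts (M : Ker A B) :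
    (qis B C).IsInvertedBy (M.tensorLeft ⋙ (qis A C).Q) := fun _ _ f hf =>
  (qis A C).Q_inverts (M.tensorLeft.map f) (M.flatRight _ _ _ f hf)

theorem Ker.tensorRight_inverts (N : Ker B C) :
    (qis A B).IsInvertedBy (N.tensorRight ⋙ (qis A C).Q) := fun _ _ f hf =>
  (qis A C).Q_inverts (N.tensorRight.map f) (N.flatLeft _ _ _ f hf)

theorem Ker.shift_inverts (s : ℤ) :
    (qis A C).IsInvertedBy (shift s ⋙ (qis A C).Q) := fun _ _ f hf =>
  (qis A C).Q_inverts ((shift s).map f) (IsQis.shift s hf)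

/-- The functor `M ⊗ -` on derived categories. -/
def DKer.tensorLeft (M : Ker A B) : DKer B C ⥤ DKer A C := lift _ M.tensorLeft_inverts

/-- The functor `- ⊗ N` on derived categories. -/
def DKer.tensorRight (N : Ker B C) : DKer A B ⥤ DKer A C := lift _ N.tensorRight_inverts

/-- The shift functor `{s}` on derived categories. -/
def DKer.shift (s : ℤ) : DKer A C ⥤ DKer A C := lift _ (Ker.shift_inverts s)

namespace DKer

/-- The map `M ⊗ f`. -/
abbrev lmap (M : Ker A B) {N N' : Ker B C} (f : of N ⟶ of N') :
    of (M.tensor N) ⟶ of (M.tensor N') := (tensorLeft M).map f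

/-- The map `f ⊗ N`. -/
abbrev rmap {M M' : Ker A B} (f : of M ⟶ of M') (N : Ker B C) :
    of (M.tensor N) ⟶ of (M'.tensor N) := (tensorRight N).map f

/-- The map `f{s}`. -/
abbrev smap (s : ℤ) {M M' : Ker A B} (f : of M ⟶ of M') :
    of ((Ker.shift s).obj M) ⟶ of ((Ker.shift s).obj M') := (shift s).map f

theorem tensorLeft_map (M : Ker A B) {N N' : Ker B C} (f : N ⟶ N') :
    (tensorLeft M).map (ofHom f) = ofHom (M.tensorLeft.map f) := by
  have h := Functor.congr_hom (fac _ (M.tensorLeft_inverts (C := C))) f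
  simpa using! h

theorem tensorRight_map (N : Ker B C) {M M' : Ker A B} (f : M ⟶ M') :
    (tensorRight N).map (ofHom f) = ofHom (N.tensorRight.map f) := by
  have h := Functor.congr_hom (fac _ (N.tensorRight_inverts (A := A))) f
  simpa using! h

theorem shift_map (s : ℤ) {M M' : Ker A B} (f : M ⟶ M') :
    (shift s).map (ofHom f) = ofHom ((Ker.shift s).map f) := by
  have h := Functor.congr_hom (fac _ (Ker.shift_inverts (A := A) (C := B) s)) f
  simpa using! h

theorem ofHom_square {X X' Y Y' : Ker A C} {f : X ⟶ X'} {b : X' ⟶ Y'} {a : X ⟶ Y} {g : Y ⟶ Y'}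
    (h : f ≫ b = a ≫ g) {f' : of X ⟶ of X'} {g' : of Y ⟶ of Y'} (hf : f' = ofHom f)
    (hg : g' = ofHom g) : f' ≫ ofHom b = ofHom a ≫ g' := by
  rw [hf, hg]
  exact ((Ker.qis A C).Q.map_comp _ _).symm.trans ((congrArg (Ker.qis A C).Q.map h).trans
    ((Ker.qis A C).Q.map_comp _ _))

theorem leftUnit_natural {M N : Ker A C} (f : of M ⟶ of N) :
    lmap (Ker.unit A) f ≫ ofHom N.leftUnitIso.hom = ofHom M.leftUnitIso.hom ≫ f :=
  loc_natural (F := tensorLeft (Ker.unit A)) (G := 𝟭 _) (fun N => ofHom (Ker.leftUnitIso N).hom)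
    (fun f => ofHom_square (Cplx.leftUnit_natural f) (tensorLeft_map _ f) rfl) f

theorem rightUnit_natural {M N : Ker A C} (f : of M ⟶ of N) :
    rmap f (Ker.unit C) ≫ ofHom N.rightUnitIso.hom = ofHom M.rightUnitIso.hom ≫ f :=
  loc_natural (F := tensorRight (Ker.unit C)) (G := 𝟭 _) (fun N => ofHom (Ker.rightUnitIso N).hom)
    (fun f => ofHom_square (Cplx.rightUnit_natural f) (tensorRight_map _ f) rfl) f

theorem assoc₁ {M M' : Ker A B} (f : M ⟶ M') (N : Ker B C) (P : Ker C D) :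
    P.tensorRight.map (N.tensorRight.map f) ≫ (M'.assocIso N P).hom =
      (M.assocIso N P).hom ≫ (N.tensor P).tensorRight.map f :=
  (Cplx.assoc_natural f (idHom N.cplx) (idHom P.cplx)).trans
    (congrArg (fun i => compHom (assocHom _ _ _) (tmap f i)) (tmap_idHom N.cplx P.cplx))

theorem assoc₂ (M : Ker A B) {N N' : Ker B C} (f : N ⟶ N') (P : Ker C D) :
    P.tensorRight.map (M.tensorLeft.map f) ≫ (M.assocIso N' P).hom =
      (M.assocIso N P).hom ≫ M.tensorLeft.map (P.tensorRight.map f) :=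
  Cplx.assoc_natural (idHom M.cplx) f (idHom P.cplx)

theorem assoc₃ (M : Ker A B) (N : Ker B C) {P P' : Ker C D} (f : P ⟶ P') :
    (M.tensor N).tensorLeft.map f ≫ (M.assocIso N P').hom =
      (M.assocIso N P).hom ≫ M.tensorLeft.map (N.tensorLeft.map f) :=
  (congrArg (fun i => compHom (tmap i f) (assocHom _ _ _)) (tmap_idHom M.cplx N.cplx).symm).trans
    (Cplx.assoc_natural (idHom M.cplx) (idHom N.cplx) f)

theorem exchange₀ {M M' : Ker A B} {N N' : Ker B C} (f : M ⟶ M') (g : N ⟶ N') :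
    N.tensorRight.map f ≫ M'.tensorLeft.map g = M.tensorLeft.map g ≫ N'.tensorRight.map f :=
  (tmap_compHom f (idHom M'.cplx) (idHom N.cplx) g).symm.trans
    (tmap_compHom (idHom M.cplx) f g (idHom N'.cplx))

theorem assoc_natural₁ {M M' : Ker A B} (f : of M ⟶ of M') (N : Ker B C) (P : Ker C D) :
    rmap (rmap f N) P ≫ ofHom (M'.assocIso N P).hom =
      ofHom (M.assocIso N P).hom ≫ rmap f (N.tensor P) := by
  refine loc_natural (F := tensorRight N ⋙ tensorRight P) (G := tensorRight (N.tensor P))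
    (fun M => ofHom (M.assocIso N P).hom) (fun f => ?_) f
  refine ofHom_square (assoc₁ f N P) ?_ ?_
  · exact (congrArg (tensorRight P).map (tensorRight_map N f)).trans (tensorRight_map P _)
  · exact tensorRight_map _ f

theorem assoc_natural₂ (M : Ker A B) {N N' : Ker B C} (f : of N ⟶ of N') (P : Ker C D) :
    rmap (lmap M f) P ≫ ofHom (M.assocIso N' P).hom =
      ofHom (M.assocIso N P).hom ≫ lmap M (rmap f P) := by
  refine loc_natural (F := tensorLeft M ⋙ tensorRight P) (G := tensorRight P ⋙ tensorLeft M)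
    (fun N => ofHom (M.assocIso N P).hom) (fun f => ?_) f
  refine ofHom_square (assoc₂ M f P) ?_ ?_
  · exact (congrArg (tensorRight P).map (tensorLeft_map M f)).trans (tensorRight_map P _)
  · exact (congrArg (tensorLeft M).map (tensorRight_map P f)).trans (tensorLeft_map M _)

theorem assoc_natural₃ (M : Ker A B) (N : Ker B C) {P P' : Ker C D} (f : of P ⟶ of P') :
    lmap (M.tensor N) f ≫ ofHom (M.assocIso N P').hom =
      ofHom (M.assocIso N P).hom ≫ lmap M (lmap N f) := by
  refine loc_natural (F := tensorLeft (M.tensor N)) (G := tensorLeft N ⋙ tensorLeft M)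
    (fun P => ofHom (M.assocIso N P).hom) (fun f => ?_) f
  refine ofHom_square (assoc₃ M N f) ?_ ?_
  · exact tensorLeft_map _ f
  · exact (congrArg (tensorLeft M).map (tensorLeft_map N f)).trans (tensorLeft_map M _)

theorem exchange₁ {M M' : Ker A B} {N N' : Ker B C} (f : of M ⟶ of M') (g : N ⟶ N') :
    rmap f N ≫ ofHom (M'.tensorLeft.map g) =
      ofHom (M.tensorLeft.map g) ≫ rmap f N' := by
  refine loc_natural (F := tensorRight N) (G := tensorRight N')
    (fun M => ofHom (M.tensorLeft.map g)) (fun f => ?_) f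
  refine ofHom_square (exchange₀ f g) ?_ ?_
  · exact tensorRight_map N f
  · exact tensorRight_map N' f

theorem exchange {M M' : Ker A B} {N N' : Ker B C} (f : of M ⟶ of M') (g : of N ⟶ of N') :
    lmap M g ≫ rmap f N' = rmap f N ≫ lmap M' g := by
  refine loc_natural (F := tensorLeft M) (G := tensorLeft M')
    (fun N => (tensorRight N).map f) (fun {N N'} g => ?_) g
  have h (M : Ker A B) := tensorLeft_map M g
  refine Eq.trans (congrArg (fun e => e ≫ (tensorRight N').map f) (h M)) (Eq.trans ?_
    (congrArg (fun e => (tensorRight N).map f ≫ e) (h M')).symm)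
  exact (exchange₁ f g).symm

theorem conj₁ {X X' Y Y' : Ker A C} (a : X ≅ Y) (b : X' ≅ Y') {f : of X ⟶ of X'}
    {g : of Y ⟶ of Y'} (h : f ≫ ofHom b.hom = ofHom a.hom ≫ g) :
    f = (ofIso a).hom ≫ g ≫ (ofIso b).inv := by
  rw [← Category.assoc, Iso.eq_comp_inv]
  exact h

theorem conj₂ {X X' Y Y' : Ker A C} (a : X ≅ Y) (b : X' ≅ Y') {f : of X ⟶ of X'}
    {g : of Y ⟶ of Y'} (h : f ≫ ofHom b.hom = ofHom a.hom ≫ g) :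
    g = (ofIso a).inv ≫ f ≫ (ofIso b).hom := by
  rw [Iso.eq_inv_comp]
  exact h.symm

theorem shiftTensor_natural₀ (s : ℤ) {M M' : Ker A B} (f : M ⟶ M') (N : Ker B C) :
    N.tensorRight.map ((Ker.shift s).map f) ≫ (Ker.shiftTensor s M' N).hom =
      (Ker.shiftTensor s M N).hom ≫ (Ker.shift s).map (N.tensorRight.map f) :=
  exL_natural s f (idHom N.cplx)

theorem tensorShift_natural₀ (s : ℤ) (M : Ker A B) {N N' : Ker B C} (f : N ⟶ N') :
    M.tensorLeft.map ((Ker.shift s).map f) ≫ (Ker.tensorShift s M N').hom =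
      (Ker.tensorShift s M N).hom ≫ (Ker.shift s).map (M.tensorLeft.map f) :=
  exR_natural s (idHom M.cplx) f

theorem shiftTensor_natural (s : ℤ) {M M' : Ker A B} (f : of M ⟶ of M') (N : Ker B C) :
    rmap (smap s f) N ≫ ofHom (Ker.shiftTensor s M' N).hom =
      ofHom (Ker.shiftTensor s M N).hom ≫ smap s (rmap f N) := by
  refine loc_natural (F := shift s ⋙ tensorRight N) (G := tensorRight N ⋙ shift s)
    (fun M => ofHom (Ker.shiftTensor s M N).hom) (fun f => ?_) f
  refine ofHom_square (shiftTensor_natural₀ s f N) ?_ ?_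
  · exact (congrArg (tensorRight N).map (shift_map s f)).trans (tensorRight_map N _)
  · exact (congrArg (shift s).map (tensorRight_map N f)).trans (shift_map s _)

theorem tensorShift_natural (s : ℤ) (M : Ker A B) {N N' : Ker B C} (f : of N ⟶ of N') :
    lmap M (smap s f) ≫ ofHom (Ker.tensorShift s M N').hom =
      ofHom (Ker.tensorShift s M N).hom ≫ smap s (lmap M f) := by
  refine loc_natural (F := shift s ⋙ tensorLeft M) (G := tensorLeft M ⋙ shift s)
    (fun N => ofHom (Ker.tensorShift s M N).hom) (fun f => ?_) f
  refine ofHom_square (tensorShift_natural₀ s M f) ?_ ?_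
  · exact (congrArg (tensorLeft M).map (shift_map s f)).trans (tensorLeft_map M _)
  · exact (congrArg (shift s).map (tensorLeft_map M f)).trans (shift_map s _)

theorem triangle_eq (M : Ker A B) (N : Ker B C) :
    ofHom (M.assocIso (Ker.unit B) N).hom ≫ lmap M (ofHom N.leftUnitIso.hom) =
      rmap (ofHom M.rightUnitIso.hom) N :=
  (congrArg (fun e => ofHom (M.assocIso (Ker.unit B) N).hom ≫ e) (tensorLeft_map M _)).trans
    (((Ker.qis A C).Q.map_comp _ _).symm.trans ((congrArg (Ker.qis A C).Q.map
      (triangle_hom M.cplx N.cplx)).trans (tensorRight_map N _).symm))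

theorem pentagon₀ {E : GrAlg 𝕜} (M : Ker A B) (N : Ker B C) (P : Ker C D) (Q : Ker D E) :
    Q.tensorRight.map (M.assocIso N P).hom ≫ (M.assocIso (N.tensor P) Q).hom ≫
        M.tensorLeft.map (N.assocIso P Q).hom =
      ((M.tensor N).assocIso P Q).hom ≫ (M.assocIso N (P.tensor Q)).hom :=
  pentagon_hom M.cplx N.cplx P.cplx Q.cplx

theorem ofHom_pentagon {X Y Z T Y' : Ker A C} {a : X ⟶ Y} {b : Y ⟶ Z} {c : Z ⟶ T} {a' : X ⟶ Y'}
    {b' : Y' ⟶ T} (h : a ≫ b ≫ c = a' ≫ b') {f : of X ⟶ of Y} {g : of Z ⟶ of T}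
    (hf : f = ofHom a) (hg : g = ofHom c) : f ≫ ofHom b ≫ g = ofHom a' ≫ ofHom b' := by
  rw [hf, hg, ← (Ker.qis A C).Q.map_comp, ← (Ker.qis A C).Q.map_comp, h,
    (Ker.qis A C).Q.map_comp]

theorem pentagon_eq {E : GrAlg 𝕜} (M : Ker A B) (N : Ker B C) (P : Ker C D) (Q : Ker D E) :
    rmap (ofHom (M.assocIso N P).hom) Q ≫ ofHom (M.assocIso (N.tensor P) Q).hom ≫
        lmap M (ofHom (N.assocIso P Q).hom) =
      ofHom ((M.tensor N).assocIso P Q).hom ≫ ofHom (M.assocIso N (P.tensor Q)).hom := by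
  refine ofHom_pentagon (pentagon₀ M N P Q) ?_ ?_
  · exact tensorRight_map Q _
  · exact tensorLeft_map M _

end DKer

/-- The 2-category whose objects are the derived categories of graded `F i`-modules (represented by
the index `i`), whose 1-morphisms are kernels, with convolution (the derived tensor product) as
composition, and whose 2-morphisms are morphisms between kernels. -/
structure DerBicat {ι : Type} (F : ι → GrAlg 𝕜) where
  idx : ι

open DKer in
instance {ι : Type} (F : ι → GrAlg 𝕜) : Bicategory (DerBicat F) where
  Hom a b := DKer (F a.idx) (F b.idx)
  id a := of (Ker.unit (F a.idx))
  comp M N := of ((locObj M).tensor (locObj N))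
  homCategory a b := inferInstanceAs (Category (DKer (F a.idx) (F b.idx)))
  whiskerLeft M _ _ f := (tensorLeft (locObj M)).map f
  whiskerRight f N := (tensorRight (locObj N)).map f
  associator M N P := ofIso ((locObj M).assocIso (locObj N) (locObj P))
  leftUnitor M := ofIso (locObj M).leftUnitIso
  rightUnitor M := ofIso (locObj M).rightUnitIso
  whiskerLeft_id M _ := (tensorLeft (locObj M)).map_id _
  whiskerLeft_comp M _ _ _ f g := (tensorLeft (locObj M)).map_comp f g
  id_whiskerLeft {_ _ M N} f := conj₁ (locObj M).leftUnitIso (locObj N).leftUnitIso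
    (DKer.leftUnit_natural (M := locObj M) (N := locObj N) f)
  comp_whiskerLeft M N P P' f := conj₁ ((locObj M).assocIso (locObj N) (locObj P))
    ((locObj M).assocIso (locObj N) (locObj P'))
    (assoc_natural₃ (locObj M) (locObj N) (P := locObj P) (P' := locObj P') f)
  id_whiskerRight _ N := (tensorRight (locObj N)).map_id _
  comp_whiskerRight f g N := (tensorRight (locObj N)).map_comp f g
  whiskerRight_id {_ _ M N} f := conj₁ (locObj M).rightUnitIso (locObj N).rightUnitIso
    (DKer.rightUnit_natural (M := locObj M) (N := locObj N) f)
  whiskerRight_comp {_ _ _ _ M M'} f N P := conj₂ ((locObj M).assocIso (locObj N) (locObj P))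
    ((locObj M').assocIso (locObj N) (locObj P))
    (assoc_natural₁ (M := locObj M) (M' := locObj M') f (locObj N) (locObj P))
  whisker_assoc M N N' f P := conj₁ ((locObj M).assocIso (locObj N) (locObj P))
    ((locObj M).assocIso (locObj N') (locObj P))
    (assoc_natural₂ (locObj M) (N := locObj N) (N' := locObj N') f (locObj P))
  whisker_exchange {_ _ _ M M' N N'} f g := exchange (M := locObj M) (M' := locObj M')
    (N := locObj N) (N' := locObj N') f g
  pentagon M N P Q := pentagon_eq (locObj M) (locObj N) (locObj P) (locObj Q)
  triangle M N := triangle_eq (locObj M) (locObj N)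

end Derived
/-! ### Graded linear 2-categories -/

/-- A graded `𝕜`-linear 2-category: the categories of 1-morphisms are `𝕜`-linear, horizontal
composition is bilinear on 2-morphisms, and the 1-morphisms carry auto-equivalences `⟨s⟩` that are
compatible with the composition of 1-morphisms. -/
class GradedLinearBicategory (𝕜 : Type*) [Field 𝕜] (B : Type*) [Bicategory B] where
  preadditive (a b : B) : Preadditive (a ⟶ b)
  linear (a b : B) : Linear 𝕜 (a ⟶ b)
  whiskerLeft_add {a b c : B} (f : a ⟶ b) {g h : b ⟶ c} (η θ : g ⟶ h) :
    Bicategory.whiskerLeft f (η + θ) = Bicategory.whiskerLeft f η + Bicategory.whiskerLeft f θ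
  whiskerLeft_smul {a b c : B} (f : a ⟶ b) {g h : b ⟶ c} (x : 𝕜) (η : g ⟶ h) :
    Bicategory.whiskerLeft f (x • η) = x • Bicategory.whiskerLeft f η
  add_whiskerRight {a b c : B} {f g : a ⟶ b} (η θ : f ⟶ g) (h : b ⟶ c) :
    Bicategory.whiskerRight (η + θ) h = Bicategory.whiskerRight η h + Bicategory.whiskerRight θ h
  smul_whiskerRight {a b c : B} {f g : a ⟶ b} (x : 𝕜) (η : f ⟶ g) (h : b ⟶ c) :
    Bicategory.whiskerRight (x • η) h = x • Bicategory.whiskerRight η h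
  /-- The shift `⟨s⟩`. -/
  shift (s : ℤ) (a b : B) : (a ⟶ b) ⥤ (a ⟶ b)
  shift_additive (s : ℤ) (a b : B) : (shift s a b).Additive
  shift_linear (s : ℤ) (a b : B) : (shift s a b).Linear 𝕜
  shiftZero (a b : B) : shift 0 a b ≅ 𝟭 (a ⟶ b)
  shiftAdd (s t : ℤ) (a b : B) : shift (s + t) a b ≅ shift s a b ⋙ shift t a b
  /-- The isomorphism `f⟨s⟩ g ≅ (f g)⟨s⟩`. -/
  shiftComp (s : ℤ) {a b c : B} (f : a ⟶ b) (g : b ⟶ c) :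
    (shift s a b).obj f ≫ g ≅ (shift s a c).obj (f ≫ g)
  /-- The isomorphism `f g⟨s⟩ ≅ (f g)⟨s⟩`. -/
  compShift (s : ℤ) {a b c : B} (f : a ⟶ b) (g : b ⟶ c) :
    f ≫ (shift s b c).obj g ≅ (shift s a c).obj (f ≫ g)
  shiftComp_natural (s : ℤ) {a b c : B} {f f' : a ⟶ b} (η : f ⟶ f') (g : b ⟶ c) :
    Bicategory.whiskerRight ((shift s a b).map η) g ≫ (shiftComp s f' g).hom =
      (shiftComp s f g).hom ≫ (shift s a c).map (Bicategory.whiskerRight η g)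
  compShift_natural (s : ℤ) {a b c : B} (f : a ⟶ b) {g g' : b ⟶ c} (η : g ⟶ g') :
    Bicategory.whiskerLeft f ((shift s b c).map η) ≫ (compShift s f g').hom =
      (compShift s f g).hom ≫ (shift s a c).map (Bicategory.whiskerLeft f η)

attribute [instance] GradedLinearBicategory.preadditive GradedLinearBicategory.linear

section Derived

open Localization.Construction Cplx

namespace Ker

instance (M : Ker A B) : (M.tensorLeft (C := C)).Additive where
  map_add {N N' f g} := Subtype.ext (tensor_ext fun m n => by
    change (tmap (idHom M.cplx) (f + g : N.cplx.homs N'.cplx)).1 (tm m n) =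
      (tmap (idHom M.cplx) f).1 (tm m n) + (tmap (idHom M.cplx) g).1 (tm m n)
    rw [tmap_tm, tmap_tm, tmap_tm]
    exact (tm m).map_add _ _)

instance (M : Ker A B) : (M.tensorLeft (C := C)).Linear 𝕜 where
  map_smul {N N'} f x := Subtype.ext (tensor_ext fun m n => by
    change (tmap (idHom M.cplx) (x • f : N.cplx.homs N'.cplx)).1 (tm m n) =
      x • (tmap (idHom M.cplx) f).1 (tm m n)
    rw [tmap_tm, tmap_tm]
    exact (tm m).map_smul _ _)

instance (N : Ker B C) : (N.tensorRight (A := A)).Additive where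
  map_add {M M' f g} := Subtype.ext (tensor_ext fun m n => by
    change (tmap (f + g : M.cplx.homs M'.cplx) (idHom N.cplx)).1 (tm m n) =
      (tmap f (idHom N.cplx)).1 (tm m n) + (tmap g (idHom N.cplx)).1 (tm m n)
    rw [tmap_tm, tmap_tm, tmap_tm]
    exact (tm.flip n).map_add _ _)

instance (N : Ker B C) : (N.tensorRight (A := A)).Linear 𝕜 where
  map_smul {M M'} f x := Subtype.ext (tensor_ext fun m n => by
    change (tmap (x • f : M.cplx.homs M'.cplx) (idHom N.cplx)).1 (tm m n) =
      x • (tmap f (idHom N.cplx)).1 (tm m n)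
    rw [tmap_tm, tmap_tm]
    exact (tm.flip n).map_smul _ _)

instance (s : ℤ) : (shift s : Ker A C ⥤ Ker A C).Additive where
  map_add := rfl

instance (s : ℤ) : (shift s : Ker A C ⥤ Ker A C).Linear 𝕜 where
  map_smul _ _ := rfl

end Ker

namespace DKer

theorem additive_lift {A' C' : GrAlg 𝕜} (F : Ker A C ⥤ Ker A' C') [F.Additive]
    (hF : (Ker.qis A C).IsInvertedBy (F ⋙ (Ker.qis A' C').Q)) : (lift _ hF).Additive := by
  have h {M N : Ker A C} (f : M ⟶ N) : (lift _ hF).map (ofHom f) = ofHom (F.map f) := by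
    have h := Functor.congr_hom (fac _ hF) f
    simpa using! h
  refine loc_additive _ fun f g => ?_
  rw [h, h, h, F.map_add]
  exact (Ker.qis A' C').Q.map_add

theorem linear_lift {A' C' : GrAlg 𝕜} (F : Ker A C ⥤ Ker A' C') [F.Additive] [F.Linear 𝕜]
    (hF : (Ker.qis A C).IsInvertedBy (F ⋙ (Ker.qis A' C').Q)) : (lift _ hF).Linear 𝕜 := by
  have h {M N : Ker A C} (f : M ⟶ N) : (lift _ hF).map (ofHom f) = ofHom (F.map f) := by
    have h := Functor.congr_hom (fac _ hF) f
    simpa using! h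
  refine loc_linear _ fun f x => ?_
  rw [h, h, F.map_smul]
  exact (Ker.qis A' C').Q.map_smul _ _

instance (M : Ker A B) : (tensorLeft M (C := C)).Additive := additive_lift _ _
instance (M : Ker A B) : (tensorLeft M (C := C)).Linear 𝕜 := linear_lift _ _
instance (N : Ker B C) : (tensorRight N (A := A)).Additive := additive_lift _ _
instance (N : Ker B C) : (tensorRight N (A := A)).Linear 𝕜 := linear_lift _ _
instance (s : ℤ) : (shift s : DKer A C ⥤ DKer A C).Additive := additive_lift _ _
instance (s : ℤ) : (shift s : DKer A C ⥤ DKer A C).Linear 𝕜 := linear_lift _ _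

theorem shiftZero_natural {M N : Ker A C} (f : of M ⟶ of N) :
    smap 0 f ≫ ofHom (Ker.shiftZero.hom.app N) = ofHom (Ker.shiftZero.hom.app M) ≫ f := by
  refine loc_natural (F := shift 0) (G := 𝟭 _) (fun N => ofHom (Ker.shiftZero.hom.app N))
    (fun f => ?_) f
  refine ofHom_square (Ker.shiftZero.hom.naturality f) ?_ rfl
  exact shift_map 0 f

theorem shiftAdd_natural (s t : ℤ) {M N : Ker A C} (f : of M ⟶ of N) :
    smap (s + t) f ≫ ofHom ((Ker.shiftAdd s t).hom.app N) =
      ofHom ((Ker.shiftAdd s t).hom.app M) ≫ smap t (smap s f) := by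
  refine loc_natural (F := shift (s + t)) (G := shift s ⋙ shift t)
    (fun N => ofHom ((Ker.shiftAdd s t).hom.app N)) (fun f => ?_) f
  refine ofHom_square ((Ker.shiftAdd s t).hom.naturality f) ?_ ?_
  · exact shift_map (s + t) f
  · exact (congrArg (shift t).map (shift_map s f)).trans (shift_map t _)

end DKer

open DKer in
instance {ι : Type} (F : ι → GrAlg 𝕜) : GradedLinearBicategory 𝕜 (DerBicat F) where
  preadditive a b := inferInstanceAs (Preadditive (DKer (F a.idx) (F b.idx)))
  linear a b := inferInstanceAs (Linear 𝕜 (DKer (F a.idx) (F b.idx)))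
  whiskerLeft_add M _ _ _ _ := (tensorLeft (locObj M)).map_add
  whiskerLeft_smul M _ _ x f := (tensorLeft (locObj M)).map_smul x f
  add_whiskerRight _ _ N := (tensorRight (locObj N)).map_add
  smul_whiskerRight x f N := (tensorRight (locObj N)).map_smul x f
  shift s a b := DKer.shift s
  shift_additive _ _ _ := inferInstanceAs (DKer.shift _).Additive
  shift_linear _ _ _ := inferInstanceAs ((DKer.shift _).Linear 𝕜)
  shiftZero a b := NatIso.ofComponents (fun M => ofIso (Ker.shiftZero.app (locObj M)))
    fun {M N} f => shiftZero_natural (M := locObj M) (N := locObj N) f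
  shiftAdd s t a b := NatIso.ofComponents (fun M => ofIso ((Ker.shiftAdd s t).app (locObj M)))
    fun {M N} f => shiftAdd_natural s t (M := locObj M) (N := locObj N) f
  shiftComp s _ _ _ M N := ofIso (Ker.shiftTensor s (locObj M) (locObj N))
  compShift s _ _ _ M N := ofIso (Ker.tensorShift s (locObj M) (locObj N))
  shiftComp_natural s _ _ _ M M' f N :=
    shiftTensor_natural s (M := locObj M) (M' := locObj M') f (locObj N)
  compShift_natural s _ _ _ M N N' f :=
    tensorShift_natural s (locObj M) (N := locObj N) (N' := locObj N') f

end Derived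
/-! ### Symmetric quotients of affine space -/

section Sym

variable (𝕜) {m : ℕ}

/-- The partial sum of the first `j` entries of a sequence. The variables `x₀, x₁, …` are divided
into blocks by these numbers: the block of `c i` consists of the `x` with
`cut c i ≤ x < cut c (i + 1)`. -/
def cut (c : Fin m → ℤ) (j : ℕ) : ℤ := ∑ l, if l.val < j then c l else 0

/-- A permutation of the variables that preserves the blocks. -/
def PreservesBlocks (c : Fin m → ℤ) (σ : Equiv.Perm ℕ) : Prop :=
  ∀ j ≤ m, ∀ x : ℕ, cut c j ≤ (σ x : ℤ) ↔ cut c j ≤ (x : ℤ)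

/-- The polynomials in the variables `x₀, …, x_{N-1}`, where `N` is the sum of the `c i`, that are
invariant under the product of the symmetric groups of the blocks. -/
def symPoly (c : Fin m → ℤ) : Subalgebra 𝕜 (MvPolynomial ℕ 𝕜) where
  carrier := {p | p ∈ MvPolynomial.supported 𝕜 {x : ℕ | (x : ℤ) < cut c m} ∧
    ∀ σ, PreservesBlocks c σ → MvPolynomial.rename σ p = p}
  mul_mem' := fun hp hq => ⟨mul_mem hp.1 hq.1, fun σ hσ => by rw [map_mul, hp.2 σ hσ, hq.2 σ hσ]⟩
  add_mem' := fun hp hq => ⟨add_mem hp.1 hq.1, fun σ hσ => by rw [map_add, hp.2 σ hσ, hq.2 σ hσ]⟩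
  algebraMap_mem' x := ⟨Subalgebra.algebraMap_mem _ x, fun σ _ => AlgHom.commutes _ x⟩

/-- The degree in which every variable has degree `2`. -/
abbrev varDeg (_ : ℕ) : ℤ := 2

variable {𝕜}

theorem coeff_perm {p : MvPolynomial ℕ 𝕜} {σ : Equiv.Perm ℕ} (h : MvPolynomial.rename σ p = p)
    (d : ℕ →₀ ℕ) : p.coeff (d.mapDomain σ) = p.coeff d := by
  conv_lhs => rw [← h]
  exact MvPolynomial.coeff_rename_mapDomain σ σ.injective p d

theorem component_mem {c : Fin m → ℤ} {p : MvPolynomial ℕ 𝕜} (hp : p ∈ symPoly 𝕜 c) (q : ℤ) :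
    MvPolynomial.weightedHomogeneousComponent varDeg q p ∈ symPoly 𝕜 c := by
  classical
  refine ⟨?_, fun σ hσ => ?_⟩
  · rw [MvPolynomial.mem_supported]
    refine Set.Subset.trans ?_ (MvPolynomial.mem_supported.1 hp.1)
    intro x hx
    simp only [Finset.mem_coe, MvPolynomial.mem_vars, MvPolynomial.mem_support_iff,
      MvPolynomial.coeff_weightedHomogeneousComponent] at hx ⊢
    obtain ⟨d, hd, hx⟩ := hx
    exact ⟨d, fun h => hd (by simp [h]), hx⟩
  · ext d
    obtain ⟨d, rfl⟩ : ∃ d', d = Finsupp.mapDomain σ d' :=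
      ⟨d.mapDomain σ.symm, by rw [← Finsupp.mapDomain_comp]; simp⟩
    rw [MvPolynomial.coeff_rename_mapDomain σ σ.injective,
      MvPolynomial.coeff_weightedHomogeneousComponent,
      MvPolynomial.coeff_weightedHomogeneousComponent, coeff_perm (hp.2 σ hσ)]
    congr 2
    rw [Finsupp.weight_apply, Finsupp.weight_apply, Finsupp.sum_mapDomain_index] <;> simp [add_mul]

variable (𝕜) in
/-- The coordinate ring of the product of the symmetric quotients `𝔸^{c i} / S_{c i}`. If some `c i`
is negative, then the product is empty and the ring is zero. -/
abbrev symRing (c : Fin m → ℤ) : Type u := PLift (∀ i, 0 ≤ c i) → symPoly 𝕜 c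

variable (𝕜) in
/-- The part of degree `q` of the coordinate ring. -/
def symGr (c : Fin m → ℤ) (q : ℤ) : Submodule 𝕜 (symRing 𝕜 c) where
  carrier := {f | ∀ h, ((f h : symPoly 𝕜 c) : MvPolynomial ℕ 𝕜) ∈
    MvPolynomial.weightedHomogeneousSubmodule 𝕜 varDeg q}
  add_mem' hf hg h := add_mem (hf h) (hg h)
  zero_mem' _ := Submodule.zero_mem _
  smul_mem' x _ hf h := Submodule.smul_mem _ x (hf h)

/-- The projection to the part of degree `q`. -/
def symProj (c : Fin m → ℤ) (q : ℤ) : symRing 𝕜 c →ₗ[𝕜] symRing 𝕜 c where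
  toFun f h := ⟨MvPolynomial.weightedHomogeneousComponent varDeg q (f h).1,
    component_mem (f h).2 q⟩
  map_add' f g := by ext1 h; exact Subtype.ext (map_add _ (f h).1 (g h).1)
  map_smul' x f := by ext1 h; exact Subtype.ext (map_smul _ x (f h).1)

theorem symGr_internal (c : Fin m → ℤ) : DirectSum.IsInternal (symGr 𝕜 c) := by
  classical
  refine isInternal_of_projections (symProj c) (fun q f hf => ?_) (fun q t h f hf => ?_) fun f => ?_
  · ext1 h
    refine Subtype.ext ((MvPolynomial.weightedHomogeneousComponent_of_mem (hf h)).trans ?_)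
    rw [if_pos rfl]
  · ext1 h'
    refine Subtype.ext ((MvPolynomial.weightedHomogeneousComponent_of_mem (hf h')).trans ?_)
    rw [if_neg h.symm]; rfl
  · by_cases h : ∀ i, 0 ≤ c i
    · have hf : f = ∑ q ∈ (f ⟨h⟩).1.support.image (Finsupp.weight varDeg), symProj c q f := by
        ext1 h'
        refine Subtype.ext (MvPolynomial.ext _ _ fun d => ?_)
        rw [Finset.sum_apply, AddSubmonoidClass.coe_finset_sum, MvPolynomial.coeff_sum]
        simp only [symProj, LinearMap.coe_mk, AddHom.coe_mk,
          MvPolynomial.coeff_weightedHomogeneousComponent]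
        rw [Finset.sum_ite_eq]
        split_ifs with hd
        · rfl
        · by_contra hne
          exact hd (Finset.mem_image_of_mem _ (MvPolynomial.mem_support_iff.2 hne))
      rw [hf]
      refine sum_mem fun q _ => Submodule.mem_iSup_of_mem q fun h' => ?_
      exact MvPolynomial.weightedHomogeneousComponent_isWeightedHomogeneous _ _
    · have hf : f = 0 := funext fun h' => (h h'.down).elim
      rw [hf]; exact Submodule.zero_mem _

instance (c : Fin m → ℤ) : GradedAlgebra (symGr 𝕜 c) where
  one_mem _ := MvPolynomial.isWeightedHomogeneous_one 𝕜 _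
  mul_mem _ _ _ _ hf hg h := (hf h).mul (hg h)
  toDecomposition := (symGr_internal c).chooseDecomposition

variable (𝕜) in
/-- The graded coordinate ring of the product of the symmetric quotients `𝔸^{c i} / S_{c i}`. -/
def symAlg (c : Fin m → ℤ) : GrAlg 𝕜 where
  carrier := symRing 𝕜 c
  gr := symGr 𝕜 c

theorem symPoly_le {m' : ℕ} {c : Fin m → ℤ} {c' : Fin m' → ℤ} (h₂ : cut c m = cut c' m')
    (h₃ : ∀ j ≤ m, ∃ j' ≤ m', cut c j = cut c' j') : symPoly 𝕜 c ≤ symPoly 𝕜 c' := by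
  rintro p ⟨hp, hp'⟩
  refine ⟨h₂ ▸ hp, fun σ hσ => hp' σ fun j hj x => ?_⟩
  obtain ⟨j', hj', e⟩ := h₃ j hj
  rw [e]
  exact hσ j' hj' x

/-- If the blocks of `c'` refine those of `c`, then the coordinate ring of `c` is contained in that
of `c'`. -/
def symInclHom {m' : ℕ} {c : Fin m → ℤ} {c' : Fin m' → ℤ} (h₁ : (∀ i, 0 ≤ c' i) → ∀ i, 0 ≤ c i)
    (h₂ : cut c m = cut c' m') (h₃ : ∀ j ≤ m, ∃ j' ≤ m', cut c j = cut c' j') :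
    symRing 𝕜 c →ₐ[𝕜] symRing 𝕜 c' :=
  Pi.algHom 𝕜 (fun _ : PLift (∀ i, 0 ≤ c' i) => symPoly 𝕜 c') fun h =>
    (Subalgebra.inclusion (symPoly_le h₂ h₃)).comp
      (Pi.evalAlgHom 𝕜 (fun _ : PLift (∀ i, 0 ≤ c i) => symPoly 𝕜 c) ⟨h₁ h.down⟩)

theorem symInclHom_apply {m' : ℕ} {c : Fin m → ℤ} {c' : Fin m' → ℤ}
    (h₁ : (∀ i, 0 ≤ c' i) → ∀ i, 0 ≤ c i) (h₂ : cut c m = cut c' m')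
    (h₃ : ∀ j ≤ m, ∃ j' ≤ m', cut c j = cut c' j') (f : symRing 𝕜 c)
    (h : PLift (∀ i, 0 ≤ c' i)) : (symInclHom h₁ h₂ h₃ f h).1 = (f ⟨h₁ h.down⟩).1 := by
  simp only [symInclHom, Pi.algHom_apply, AlgHom.comp_apply, Pi.evalAlgHom_apply]
  exact Subalgebra.coe_inclusion (h := symPoly_le h₂ h₃) (f ⟨h₁ h.down⟩)

theorem mem_symGr {c : Fin m → ℤ} {q : ℤ} {f : symRing 𝕜 c} : f ∈ symGr 𝕜 c q ↔
    ∀ h, (f h).1 ∈ MvPolynomial.weightedHomogeneousSubmodule 𝕜 varDeg q := Iff.rfl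

theorem symInclHom_mem {m' : ℕ} {c : Fin m → ℤ} {c' : Fin m' → ℤ}
    (h₁ : (∀ i, 0 ≤ c' i) → ∀ i, 0 ≤ c i) (h₂ : cut c m = cut c' m')
    (h₃ : ∀ j ≤ m, ∃ j' ≤ m', cut c j = cut c' j') {q : ℤ} {f : symRing 𝕜 c}
    (hf : f ∈ symGr 𝕜 c q) : symInclHom h₁ h₂ h₃ f ∈ symGr 𝕜 c' q := by
  rw [mem_symGr] at hf ⊢
  intro h
  rw [symInclHom_apply]
  exact hf _

/-- The inclusion of coordinate rings, as a homomorphism of graded algebras. -/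
def symIncl {m' : ℕ} {c : Fin m → ℤ} {c' : Fin m' → ℤ} (h₁ : (∀ i, 0 ≤ c' i) → ∀ i, 0 ≤ c i)
    (h₂ : cut c m = cut c' m') (h₃ : ∀ j ≤ m, ∃ j' ≤ m', cut c j = cut c' j') :
    (symAlg 𝕜 c).GrHom (symAlg 𝕜 c') where
  hom := symInclHom h₁ h₂ h₃
  hom_mem hf := symInclHom_mem h₁ h₂ h₃ hf

theorem cut_mono {c : Fin m → ℤ} (h : ∀ i, 0 ≤ c i) {j j' : ℕ} (hj : j ≤ j') :
    cut c j ≤ cut c j' :=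
  Finset.sum_le_sum fun l _ => by split_ifs <;> first | omega | exact h l

/-- The first elementary symmetric function in the variables of the block of `c i`. -/
def e₁ (c : Fin m → ℤ) (i : Fin m) : symRing 𝕜 c := fun h =>
  ⟨∑ x ∈ Finset.Ico (cut c i.val).toNat (cut c (i.val + 1)).toNat, MvPolynomial.X x, by
    constructor
    · refine sum_mem fun x hx => Algebra.subset_adjoin (Set.mem_image_of_mem _ ?_)
      have h₁ := cut_mono h.down (show i.val + 1 ≤ m from i.isLt)
      have h₂ := Int.lt_toNat.1 (Finset.mem_Ico.1 hx).2
      exact lt_of_lt_of_le h₂ h₁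
    · intro σ hσ
      rw [map_sum]
      simp only [MvPolynomial.rename_X]
      refine Finset.sum_equiv σ (fun x => ?_) fun _ _ => rfl
      rw [Finset.mem_Ico, Finset.mem_Ico, Int.toNat_le, Int.toNat_le, Int.lt_toNat, Int.lt_toNat,
        ← not_le, ← not_le, hσ _ i.isLt.le, hσ _ i.isLt]⟩

theorem e₁_mem (c : Fin m → ℤ) (i : Fin m) : e₁ c i ∈ symGr 𝕜 c 2 := fun _ =>
  Submodule.sum_mem (MvPolynomial.weightedHomogeneousSubmodule 𝕜 varDeg 2) fun x _ =>
    MvPolynomial.isWeightedHomogeneous_X 𝕜 varDeg x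

end Sym
/-! ### The 2-category and the correspondences -/

section Corr

variable {n : ℕ}

/-- The position of the entry `-1` of the simple root `α_i`. -/
def lo (i : Fin (n - 1)) : Fin n := ⟨i.val, by omega⟩

/-- The position of the entry `1` of the simple root `α_i`. -/
def hi (i : Fin (n - 1)) : Fin n := ⟨i.val + 1, by omega⟩

/-- The simple root `α_i = (0, …, 0, -1, 1, 0, …, 0)`. -/
def root (i : Fin (n - 1)) : Fin n → ℤ := Pi.single (hi i) 1 - Pi.single (lo i) 1

/-- The sequence `(k₁, …, k_i - 1, 1, k_{i+1}, …, k_n)`. -/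
def splitSeq (i : Fin (n - 1)) (k : Fin n → ℤ) : Fin (n + 1) → ℤ :=
  Fin.insertNth (hi i).castSucc 1 (k - Pi.single (lo i) 1)

theorem cut_sub_single (k : Fin n → ℤ) (i : Fin n) (j : ℕ) :
    cut (k - Pi.single i 1) j = cut k j - if i.val < j then 1 else 0 := by
  have h : ∑ l : Fin n, (if l.val < j then (Pi.single i 1 : Fin n → ℤ) l else 0) =
      if i.val < j then 1 else 0 := by
    rw [Finset.sum_eq_single i]
    · simp
    · intro l _ hl; simp [hl]
    · simp
  rw [cut, cut, ← h, ← Finset.sum_sub_distrib]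
  refine Finset.sum_congr rfl fun l _ => ?_
  split_ifs <;> simp

theorem cut_add_root (k : Fin n → ℤ) (i : Fin (n - 1)) (j : ℕ) :
    cut (k + root i) j = cut k j - if j = i.val + 1 then 1 else 0 := by
  have h₁ := cut_sub_single (k + root i) (hi i) j
  have h₂ := cut_sub_single k (lo i) j
  have e : k + root i - Pi.single (hi i) 1 = k - Pi.single (lo i) 1 := by
    rw [root]; abel
  rw [e] at h₁
  simp only [lo, hi] at h₁ h₂
  split_ifs at * <;> omega

theorem cut_splitSeq (k : Fin n → ℤ) (i : Fin (n - 1)) (j : ℕ) :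
    cut (splitSeq i k) j = cut k (if j ≤ i.val + 1 then j else j - 1) -
      if j = i.val + 1 then 1 else 0 := by
  have h := cut_sub_single k (lo i) (if j ≤ i.val + 1 then j else j - 1)
  have e : cut (splitSeq i k) j = (if i.val + 1 < j then 1 else 0) +
      cut (k - Pi.single (lo i) 1) (if j ≤ i.val + 1 then j else j - 1) := by
    rw [cut, Fin.sum_univ_succAbove _ (hi i).castSucc, cut]
    simp only [splitSeq, Fin.insertNth_apply_same, Fin.insertNth_apply_succAbove]
    refine congrArg₂ (· + ·) rfl (Finset.sum_congr rfl fun l _ => ?_)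
    have hl : (Fin.succAbove (hi i).castSucc l).val < j ↔
        l.val < if j ≤ i.val + 1 then j else j - 1 := by
      have : (Fin.succAbove (hi i).castSucc l).val =
          if l.val < i.val + 1 then l.val else l.val + 1 := by
        rw [Fin.succAbove]
        simp only [Fin.lt_def, hi, Fin.val_castSucc]
        split_ifs <;> simp
      rw [this]
      split_ifs <;> omega
    simp only [hl]
  rw [e, h]
  simp only [lo]
  split_ifs <;> omega

theorem splitSeq_nonneg {k : Fin n → ℤ} {i : Fin (n - 1)} (h : ∀ j, 0 ≤ splitSeq i k j) :
    (∀ j, 0 ≤ k j) ∧ ∀ j, 0 ≤ (k + root i) j := by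
  have h' (j : Fin n) : 0 ≤ (k - Pi.single (lo i) 1 : Fin n → ℤ) j := by
    have := h ((hi i).castSucc.succAbove j)
    rwa [splitSeq, Fin.insertNth_apply_succAbove] at this
  have hs (l j : Fin n) : 0 ≤ (Pi.single l 1 : Fin n → ℤ) j := by
    rw [Pi.single_apply]; split_ifs <;> simp
  refine ⟨fun j => ?_, fun j => ?_⟩
  · have := h' j; have := hs (lo i) j
    simp only [Pi.sub_apply] at *; omega
  · have := h' j; have := hs (hi i) j
    simp only [root, Pi.sub_apply, Pi.add_apply] at *; omega

theorem exists_cut_left (k : Fin n → ℤ) (i : Fin (n - 1)) (j : ℕ) (hj : j ≤ n) :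
    ∃ j' ≤ n + 1, cut k j = cut (splitSeq i k) j' := by
  have hi := i.isLt
  by_cases h : j ≤ i.val
  · refine ⟨j, by omega, ?_⟩
    rw [cut_splitSeq, if_pos (by omega), if_neg (by omega), sub_zero]
  · refine ⟨j + 1, by omega, ?_⟩
    rw [cut_splitSeq, if_neg (by omega), if_neg (by omega), sub_zero, Nat.add_sub_cancel]

theorem exists_cut_right (k : Fin n → ℤ) (i : Fin (n - 1)) (j : ℕ) (hj : j ≤ n) :
    ∃ j' ≤ n + 1, cut (k + root i) j = cut (splitSeq i k) j' := by
  have hi := i.isLt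
  by_cases h : j = i.val + 1
  · refine ⟨j, by omega, ?_⟩
    rw [cut_splitSeq, cut_add_root, if_pos (show j ≤ i.val + 1 by omega)]
  · rw [cut_add_root, if_neg h, sub_zero]
    exact exists_cut_left k i j hj

theorem cut_splitSeq_last (k : Fin n → ℤ) (i : Fin (n - 1)) :
    cut (splitSeq i k) (n + 1) = cut k n := by
  have hi := i.isLt
  rw [cut_splitSeq, if_neg (by omega), if_neg (by omega), sub_zero, Nat.add_sub_cancel]

/-- The projection `𝔸_{(…, k_i - 1, 1, k_{i+1}, …)} → 𝔸_k`. -/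
def projLeft (i : Fin (n - 1)) (k : Fin n → ℤ) :
    (symAlg 𝕜 k).GrHom (symAlg 𝕜 (splitSeq i k)) :=
  symIncl (fun h => (splitSeq_nonneg h).1) (cut_splitSeq_last k i).symm (exists_cut_left k i)

/-- The projection `𝔸_{(…, k_i - 1, 1, k_{i+1}, …)} → 𝔸_{k + α_i}`. -/
def projRight (i : Fin (n - 1)) {k k' : Fin n → ℤ} (h : k' = k + root i) :
    (symAlg 𝕜 k').GrHom (symAlg 𝕜 (splitSeq i k)) :=
  symIncl (fun h' => h ▸ (splitSeq_nonneg h').2) (by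
    have hi := i.isLt
    rw [h, cut_splitSeq_last, cut_add_root, if_neg (by omega), sub_zero])
    (h ▸ exists_cut_right k i)

variable (𝕜 n) in
/-- The 2-category `𝒦_n`. -/
abbrev Kn := DerBicat (symAlg 𝕜 : (Fin n → ℤ) → GrAlg 𝕜)

open Cplx

/-- The kernel `𝒪_Z{k_i - 1}` on `𝔸_k × 𝔸_{k + α_i}`, where `Z = 𝔸_{(…, k_i - 1, 1, k_{i+1}, …)}`. -/
def kerE (i : Fin (n - 1)) {k k' : Fin n → ℤ} (h : k' = k + root i) :
    Cplx (symAlg 𝕜 k) (symAlg 𝕜 k') :=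
  (corr (projLeft i k) (projRight i h)).shift (k (lo i) - 1)

/-- The kernel `𝒪_Z{k_{i+1}}` on `𝔸_{k + α_i} × 𝔸_k`, where `Z = 𝔸_{(…, k_i - 1, 1, k_{i+1}, …)}`. -/
def kerF (i : Fin (n - 1)) {k k' : Fin n → ℤ} (h : k' = k + root i) :
    Cplx (symAlg 𝕜 k') (symAlg 𝕜 k) :=
  (corr (projRight i h) (projLeft i k)).shift (k (hi i))

/-- Multiplication by an element of degree `s`, as a map `A → A{s}`. -/
def unitMul (A : GrAlg 𝕜) (s : ℤ) : A.gr s →ₗ[𝕜] (unit A).homs ((unit A).shift s) where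
  toFun a := ⟨(LinearMap.mulLeft 𝕜 (a : A.carrier) : A.carrier →ₗ[𝕜] A.carrier),
    fun t (m : A.carrier) hm => by
      rcases mem_unit_gr hm with rfl | ⟨h, hm⟩
      · change (a : A.carrier) * 0 ∈ (unit A).gr (t.1, t.2 + s)
        rw [mul_zero]; exact Submodule.zero_mem _
      · change (a : A.carrier) * m ∈ if t.1 = 0 then A.gr (t.2 + s) else ⊥
        rw [if_pos h, add_comm]; exact SetLike.mul_mem_graded a.2 hm,
    fun (x m : A.carrier) => mul_left_comm _ x m,
    fun (x m : A.carrier) => mul_left_comm _ x m, fun _ => mul_zero (a : A.carrier)⟩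
  map_add' a b := Subtype.ext (LinearMap.ext fun (x : A.carrier) => add_mul (a : A.carrier) b x)
  map_smul' x b := Subtype.ext (LinearMap.ext fun (y : A.carrier) =>
    smul_mul_assoc x (b : A.carrier) y)

/-- The element `∑ c_i (e₁^{(i)} - e₁^{(i+1)})` of degree `2`. -/
def thetaElt (k : Fin n → ℤ) : (Fin (n - 1) → 𝕜) →ₗ[𝕜] (symAlg 𝕜 k).gr 2 :=
  Fintype.linearCombination 𝕜 fun i => (⟨e₁ k (lo i), e₁_mem k _⟩ - ⟨e₁ k (hi i), e₁_mem k _⟩ :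
    symGr 𝕜 k 2)

end Corr

/-! ### Categorical actions of `sl_n` -/

section Action

open Limits Bicategory

/-- The 1-morphism `f⟨s⟩`. -/
abbrev sh (𝕜 : Type*) [Field 𝕜] {B : Type*} [Bicategory B] [GradedLinearBicategory 𝕜 B] (s : ℤ)
    {a b : B} (f : a ⟶ b) : a ⟶ b := (GradedLinearBicategory.shift 𝕜 s a b).obj f

/-- The data of an `(sl_n, θ)` action on a graded `𝕜`-linear 2-category: objects indexed by the
weights `k`, 1-morphisms `E_i 1_k : k → k + α_i` and `1_k F_i : k + α_i → k`, and for every `k` a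
linear map `θ` from the span of the `α_i` to `End²(1_k)`. A vector `c` stands for `∑ c_i α_i`. -/
structure SlThetaData (𝕜 : Type*) [Field 𝕜] (B : Type*) [Bicategory B] [GradedLinearBicategory 𝕜 B]
    (n : ℕ) where
  obj : (Fin n → ℤ) → B
  E (i : Fin (n - 1)) {k k' : Fin n → ℤ} (h : k' = k + root i) : obj k ⟶ obj k'
  F (i : Fin (n - 1)) {k k' : Fin n → ℤ} (h : k' = k + root i) : obj k' ⟶ obj k
  θ (k : Fin n → ℤ) : (Fin (n - 1) → 𝕜) →ₗ[𝕜] (𝟙 (obj k) ⟶ sh 𝕜 2 (𝟙 (obj k)))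

variable {𝕜 : Type*} [Field 𝕜] {B : Type*} [Bicategory B] [GradedLinearBicategory 𝕜 B] {n : ℕ}

/-- `X` is a direct sum of the finite family `f`. -/
def IsDirectSum {C : Type*} [Category C] [HasZeroMorphisms C] {J : Type} (f : J → C) (X : C) :
    Prop := ∃ b : Bicone f, Nonempty b.IsBilimit ∧ Nonempty (X ≅ b.pt)

/-- The summands of `f ⊕ ⨁_{[m]} g`, where `⨁_{[m]} g = g⟨m-1⟩ ⊕ g⟨m-3⟩ ⊕ ⋯ ⊕ g⟨1-m⟩`. -/
def addQuantum (𝕜 : Type*) [Field 𝕜] {B : Type*} [Bicategory B] [GradedLinearBicategory 𝕜 B]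
    {a b : B} (f g : a ⟶ b) (m : ℤ) : Option (Fin m.toNat) → (a ⟶ b)
  | none => f
  | some j => sh 𝕜 (m - 1 - 2 * j.val) g

/-- The pairing `⟨∑ c_j α_j, α_i⟩`, an element of `𝕜`. -/
def thetaPairing (c : Fin (n - 1) → 𝕜) (i : Fin (n - 1)) : 𝕜 :=
  ∑ j, c j * ((root j ⬝ᵥ root i : ℤ) : 𝕜)

/-- The 2-morphism `I t I : f g → (f g)⟨2⟩` for `t : 1 → 1⟨2⟩`. -/
def insertTheta {a b c : B} (f : a ⟶ b) (t : 𝟙 b ⟶ sh 𝕜 2 (𝟙 b)) (g : b ⟶ c) :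
    f ≫ g ⟶ sh 𝕜 2 (f ≫ g) :=
  f ◁ ((λ_ g).inv ≫ t ▷ g ≫ (GradedLinearBicategory.shiftComp 2 (𝟙 b) g).hom ≫
    (GradedLinearBicategory.shift 𝕜 2 b c).map (λ_ g).hom) ≫
    (GradedLinearBicategory.compShift 2 f g).hom

/-- The conditions on an `(sl_n, θ)` action. The spaces of 2-morphisms are required to be
finite-dimensional for the 1-morphisms that satisfy `P`. -/
structure IsSlThetaAction (D : SlThetaData 𝕜 B n)
    (P : ∀ {k k' : Fin n → ℤ}, (D.obj k ⟶ D.obj k') → Prop) : Prop where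
  /-- The target 2-category is additive. -/
  additive (k k' : Fin n → ℤ) : HasFiniteBiproducts (D.obj k ⟶ D.obj k')
  /-- The target 2-category is idempotent complete. -/
  idempotentComplete (k k' : Fin n → ℤ) : IsIdempotentComplete (D.obj k ⟶ D.obj k')
  end_neg (k : Fin n → ℤ) (l : ℤ) (hl : l < 0) (f : 𝟙 (D.obj k) ⟶ sh 𝕜 l (𝟙 (D.obj k))) : f = 0
  end_zero (k : Fin n → ℤ) (hk : ¬ IsZero (𝟙 (D.obj k))) :
    Module.finrank 𝕜 (𝟙 (D.obj k) ⟶ 𝟙 (D.obj k)) = 1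
  hom_finite {k k' : Fin n → ℤ} (f g : D.obj k ⟶ D.obj k') (hf : P f) (hg : P g) :
    Module.Finite 𝕜 (f ⟶ g)
  /-- The right adjoint of `E_i 1_k` is `1_k F_i⟨⟨k, α_i⟩ + 1⟩`. -/
  right_adjoint (i : Fin (n - 1)) {k k' : Fin n → ℤ} (h : k' = k + root i) :
    Nonempty (Bicategory.Adjunction (D.E i h) (sh 𝕜 (k ⬝ᵥ root i + 1) (D.F i h)))
  /-- The left adjoint of `E_i 1_k` is `1_k F_i⟨-⟨k, α_i⟩ - 1⟩`. -/
  left_adjoint (i : Fin (n - 1)) {k k' : Fin n → ℤ} (h : k' = k + root i) :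
    Nonempty (Bicategory.Adjunction (sh 𝕜 (-(k ⬝ᵥ root i) - 1) (D.F i h)) (D.E i h))
  /-- `E_i F_i 1_k ≅ F_i E_i 1_k ⊕ ⨁_{[⟨k, α_i⟩]} 1_k`. -/
  EF_of_nonneg (i : Fin (n - 1)) {k₁ k k₂ : Fin n → ℤ} (h₁ : k = k₁ + root i)
    (h₂ : k₂ = k + root i) (hk : 0 ≤ k ⬝ᵥ root i) :
    IsDirectSum (addQuantum 𝕜 (D.E i h₂ ≫ D.F i h₂) (𝟙 (D.obj k)) (k ⬝ᵥ root i))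
      (D.F i h₁ ≫ D.E i h₁)
  /-- `F_i E_i 1_k ≅ E_i F_i 1_k ⊕ ⨁_{[-⟨k, α_i⟩]} 1_k`. -/
  FE_of_nonpos (i : Fin (n - 1)) {k₁ k k₂ : Fin n → ℤ} (h₁ : k = k₁ + root i)
    (h₂ : k₂ = k + root i) (hk : k ⬝ᵥ root i ≤ 0) :
    IsDirectSum (addQuantum 𝕜 (D.F i h₁ ≫ D.E i h₁) (𝟙 (D.obj k)) (-(k ⬝ᵥ root i)))
      (D.E i h₂ ≫ D.F i h₂)
  /-- `F_j E_i 1_k ≅ E_i F_j 1_k`. -/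
  EF_comm {i j : Fin (n - 1)} (hij : i ≠ j) {k k₁ k₂ k₃ : Fin n → ℤ} (h₁ : k₁ = k + root i)
    (h₂ : k₁ = k₃ + root j) (h₃ : k = k₂ + root j) (h₄ : k₃ = k₂ + root i) :
    Nonempty (D.E i h₁ ≫ D.F j h₂ ≅ D.F j h₃ ≫ D.E i h₄)
  /-- `E_i E_i ≅ E_i^{(2)}⟨-1⟩ ⊕ E_i^{(2)}⟨1⟩`, and `I θ I : E_i E_i → E_i E_i⟨2⟩` induces a map
  between the summands `E_i^{(2)}⟨1⟩` of both sides which is nonzero if `⟨θ, α_i⟩ ≠ 0` and zero if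
  `⟨θ, α_i⟩ = 0`. -/
  EE (i : Fin (n - 1)) {k₁ k k₂ : Fin n → ℤ} (h₁ : k = k₁ + root i) (h₂ : k₂ = k + root i) :
    ∃ (E₂ : D.obj k₁ ⟶ D.obj k₂) (b : BinaryBicone (sh 𝕜 (-1) E₂) (sh 𝕜 1 E₂))
      (e : D.E i h₁ ≫ D.E i h₂ ≅ b.pt), Nonempty b.IsBilimit ∧
      ∀ c : Fin (n - 1) → 𝕜,
        let φ : sh 𝕜 1 E₂ ⟶ sh 𝕜 2 (sh 𝕜 (-1) E₂) :=
          b.inr ≫ e.inv ≫ insertTheta (D.E i h₁) (D.θ k c) (D.E i h₂) ≫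
            (GradedLinearBicategory.shift 𝕜 2 _ _).map (e.hom ≫ b.fst)
        (thetaPairing c i ≠ 0 → ¬ IsZero E₂ → φ ≠ 0) ∧ (thetaPairing c i = 0 → φ = 0)
  /-- `1_{k + rα} = 0` for `r ≫ 0` and for `r ≪ 0`. -/
  vanish (k α : Fin n → ℤ) (hα : (∃ i, α = root i) ∨
    ∃ i j : Fin (n - 1), |(i.val : ℤ) - j.val| = 1 ∧ α = root i + root j) :
    ∃ r₀ : ℤ, ∀ r : ℤ, r₀ ≤ |r| → IsZero (𝟙 (D.obj (k + r • α)))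
  nonzero {i j : Fin (n - 1)} (hij : i ≠ j) (k : Fin n → ℤ)
    (h₁ : ¬ IsZero (𝟙 (D.obj (k + root i)))) (h₂ : ¬ IsZero (𝟙 (D.obj (k + root j)))) :
    ¬ IsZero (𝟙 (D.obj k)) ∧ ¬ IsZero (𝟙 (D.obj (k + root i + root j)))

/-- The class `P` of 1-morphisms contains the identities and is closed under isomorphisms, shifts,
and composition on either side with the 1-morphisms `E_i` and `F_i`. In particular, it contains all
compositions of the `E_i` and `F_i`. -/
structure IsActionStable (D : SlThetaData 𝕜 B n)
    (P : ∀ {k k' : Fin n → ℤ}, (D.obj k ⟶ D.obj k') → Prop) : Prop where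
  id (k : Fin n → ℤ) : P (𝟙 (D.obj k))
  iso {k k' : Fin n → ℤ} {f g : D.obj k ⟶ D.obj k'} (e : f ≅ g) (hf : P f) : P g
  shift (s : ℤ) {k k' : Fin n → ℤ} {f : D.obj k ⟶ D.obj k'} (hf : P f) : P (sh 𝕜 s f)
  comp_E (i : Fin (n - 1)) {l k k' : Fin n → ℤ} (h : k' = k + root i) {f : D.obj l ⟶ D.obj k}
    (hf : P f) : P (f ≫ D.E i h)
  comp_F (i : Fin (n - 1)) {l k k' : Fin n → ℤ} (h : k' = k + root i) {f : D.obj l ⟶ D.obj k'}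
    (hf : P f) : P (f ≫ D.F i h)
  E_comp (i : Fin (n - 1)) {l k k' : Fin n → ℤ} (h : k' = k + root i) {f : D.obj k' ⟶ D.obj l}
    (hf : P f) : P (D.E i h ≫ f)
  F_comp (i : Fin (n - 1)) {l k k' : Fin n → ℤ} (h : k' = k + root i) {f : D.obj k ⟶ D.obj l}
    (hf : P f) : P (D.F i h ≫ f)

end Action

/-! ### The action on `𝒦_n` -/

section Main

variable {n : ℕ}

/-- A complex of graded bimodules is coherent if its total cohomology is a finitely generated
bimodule. -/
def Cplx.IsCoherent {A C : GrAlg 𝕜} (M : Cplx A C) : Prop :=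
  ∃ s : Finset M.carrier, (∀ z ∈ s, M.d z = 0) ∧ ∀ z, M.d z = 0 →
    z ∈ Submodule.span 𝕜 {x | ∃ a c, ∃ y ∈ s, x = M.l a (M.r c y)} ⊔ LinearMap.range M.d

variable (𝕜 n) in
/-- The kernels that define `E_i` and `F_i` are K-flat over both factors. -/
structure KernelsFlat : Prop where
  E_left (i : Fin (n - 1)) {k k' : Fin n → ℤ} (h : k' = k + root i) :
    (kerE (𝕜 := 𝕜) i h).IsKFlatLeft
  E_right (i : Fin (n - 1)) {k k' : Fin n → ℤ} (h : k' = k + root i) :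
    (kerE (𝕜 := 𝕜) i h).IsKFlatRight
  F_left (i : Fin (n - 1)) {k k' : Fin n → ℤ} (h : k' = k + root i) :
    (kerF (𝕜 := 𝕜) i h).IsKFlatLeft
  F_right (i : Fin (n - 1)) {k k' : Fin n → ℤ} (h : k' = k + root i) :
    (kerF (𝕜 := 𝕜) i h).IsKFlatRight

/-- The data of the `(sl_n, θ)` action on `𝒦_n`: the 1-morphisms `E_i` and `F_i` are the shifted
structure sheaves of the correspondences, and `θ` is the multiplication by
`∑ c_i (e₁^{(i)} - e₁^{(i+1)})`. -/
def knData (hf : KernelsFlat 𝕜 n) : SlThetaData 𝕜 (Kn 𝕜 n) n where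
  obj k := ⟨k⟩
  E i _ _ h := DKer.of ⟨kerE i h, hf.E_left i h, hf.E_right i h⟩
  F i _ _ h := DKer.of ⟨kerF i h, hf.F_left i h, hf.F_right i h⟩
  θ k := (Ker.qis (symAlg 𝕜 k) (symAlg 𝕜 k)).Q.mapLinearMap 𝕜
      (X := Ker.unit (symAlg 𝕜 k)) (Y := (Ker.shift 2).obj (Ker.unit (symAlg 𝕜 k))) ∘ₗ
    unitMul (symAlg 𝕜 k) 2 ∘ₗ thetaElt k

/-- The coherent kernels. -/
def knCoherent (hf : KernelsFlat 𝕜 n) {k k' : Fin n → ℤ}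
    (M : (knData hf).obj k ⟶ (knData hf).obj k') : Prop :=
  (locObj M : Ker (symAlg 𝕜 k) (symAlg 𝕜 k')).cplx.IsCoherent

end Main

end

/-!
Objects of the derived category `D(X × Y)` are differential graded bimodules that are K-flat over
both rings, localized at quasi-isomorphisms. The proof needs three things about it.

*Resolutions.* The bar resolution of a bimodule over the base field (`bar`) is K-flat, and maps out
of it lift along surjective quasi-isomorphisms (`exists_bar_lift`). So morphisms in the localization
are represented by maps of complexes out of bar resolutions. With truncations this gives
`End^l(𝟙) = 0` for `l < 0` and `End^0(𝟙) = A_0`. The space of morphisms between coherent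
kernels is finite-dimensional (`hom_finite`), since generators of the top cohomology can be killed by
a free bimodule of finite rank, until no morphisms to the target are left. Idempotents split by
mapping telescopes (`exists_split`).

*Correspondences.* Let `Z` be the correspondence that moves a point `x` from the factor `i` to
`i + 1`. By the theory of symmetric polynomials (`IsIncl.isPow`), its ring is free over either side,
with a basis `1, x, …, x^(r-1)` (`IsPow`). Hence `𝒪_Z` is flat over both factors, and composites of
such kernels are underived tensor products. The coefficient of `x^(r-1)` is a nondegenerate trace
form (`IsPow.exists_dual`), and the dual bases give the unit and the counit of the adjunctions
(`IsPow.nonempty_adjunction`).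

*Composites.* Where the fibre product is irreducible, the composite is its structure sheaf
(`mulHom_bijective`). This yields `F_j E_i ≅ E_i F_j`. It also shows that `E_i E_i` is the structure
sheaf of the space of two ordered moving points. That is free with basis `1, x` over the space of
unordered pairs, which is the divided power. There, `θ` acts as an element of the smaller ring plus
`⟨θ, α_i⟩ x` (`exists_thetaElt_eq`), so its component between the two summands is `⟨θ, α_i⟩`.
For `E_i F_i` and `F_i E_i`, the fibre product has two components. One is the diagonal with a marked
point; the other is `W`, where one point leaves a factor and another enters it, and it is the same on
both sides (`exists_square`). A function on the fibre product is a pair of functions on the two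
components that agree on their intersection (`mem_range_pairMul`). So the difference between
`E_i F_i` and `F_i E_i` lies in the diagonal components, with bases of powers of `x` of lengths
`k_i` and `k_{i+1}`, and division with remainder by the minimal polynomial of `x` identifies it with
`|k_i - k_{i+1}|` shifted copies of `𝟙` (`isDirectSum_of_square`).
-/

noncomputable section

open LinearMap (range ker mem_ker)
open Submodule (mem_sup mem_sup_left mem_sup_right span span_le subset_span mem_iSup_of_mem)
open Finset (mem_image mem_image_of_mem mem_range mem_Ico mem_erase mem_filter sum_congr sum_eq_zero sum_eq_single sum_add_distrib smul_sum mul_sum)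
open Function (Bijective Surjective Injective)
open Module.End (mul_apply)

/-! ### Modules with a differential -/

section Plain

variable {R : Type u} [CommRing R]

/-- A linear map between modules with differentials is a quasi-isomorphism if every relative
cocycle `(u, v)` is a relative boundary, that is, if its mapping cone is acyclic. -/
def RelAcyclic {U V : Type u} [AddCommGroup U] [Module R U] [AddCommGroup V] [Module R V]
    (dU : U →ₗ[R] U) (dV : V →ₗ[R] V) (G : U →ₗ[R] V) : Prop :=
  ∀ u v, dU u = 0 → G u = dV v → ∃ x y, u = dU x ∧ v = G x + dV y

/-- Let `G : U → V` be a map between modules with differentials that are direct sums of pieces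
`U i`, `V i`, such that the differential is triangular with respect to a rank function on the
pieces, and equal to `± d` on each piece. If `G` is a quasi-isomorphism on each piece, then it is
one on the sum. -/
lemma RelAcyclic.of_pieces {U V : Type u} [AddCommGroup U] [Module R U] [AddCommGroup V]
    [Module R V] {dU : U →ₗ[R] U} {dV : V →ₗ[R] V} {G : U →ₗ[R] V}
    (hdU : ∀ u, dU (dU u) = 0) (hdV : ∀ v, dV (dV v) = 0) (hG : ∀ u, G (dU u) = dV (G u))
    {ι : Type*} [DecidableEq ι] (ρ : ι → ℕ) (ε : ι → ℤˣ)
    {P Q : ι → Type u} [∀ i, AddCommGroup (P i)] [∀ i, Module R (P i)]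
    [∀ i, AddCommGroup (Q i)] [∀ i, Module R (Q i)]
    {dP : ∀ i, P i →ₗ[R] P i} {dQ : ∀ i, Q i →ₗ[R] Q i} {g : ∀ i, P i →ₗ[R] Q i}
    (hg : ∀ i, RelAcyclic (dP i) (dQ i) (g i))
    (a : ∀ i, P i →ₗ[R] U) (p : ∀ i, U →ₗ[R] P i) (b : ∀ i, Q i →ₗ[R] V) (q : ∀ i, V →ₗ[R] Q i)
    (hp : ∀ i x, p i (a i x) = x) (hp' : ∀ i j x, j ≠ i → p j (a i x) = 0)
    (hq : ∀ i x, q i (b i x) = x) (hq' : ∀ i j x, j ≠ i → q j (b i x) = 0)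
    (hU : ∀ u, ∃ S : Finset ι, u = ∑ i ∈ S, a i (p i u))
    (hV : ∀ v, ∃ S : Finset ι, v = ∑ i ∈ S, b i (q i v))
    (hGa : ∀ i x, G (a i x) = b i (g i x)) (hGp : ∀ i u, q i (G u) = g i (p i u))
    (hd : ∀ i x, p i (dU (a i x)) = (ε i : ℤ) • dP i x)
    (hd' : ∀ i j x, j ≠ i → ρ i ≤ ρ j → p j (dU (a i x)) = 0)
    (he : ∀ i x, q i (dV (b i x)) = (ε i : ℤ) • dQ i x)
    (he' : ∀ i j x, j ≠ i → ρ i ≤ ρ j → q j (dV (b i x)) = 0) : RelAcyclic dU dV G := by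
  have εε (i : ι) {X : Type u} [AddCommGroup X] (x : X) : (ε i : ℤ) • (ε i : ℤ) • x = x := by
    rw [smul_smul, ← Units.val_mul, Int.units_mul_self, Units.val_one, one_smul]
  -- induction on a bound `r` for the ranks of the pieces in which `(u, v)` is nonzero
  have key : ∀ r : ℕ, ∀ u v, (∀ i, r ≤ ρ i → p i u = 0) → (∀ i, r ≤ ρ i → q i v = 0) →
      dU u = 0 → G u = dV v → ∃ x y, u = dU x ∧ v = G x + dV y := by
    intro r
    induction r with
    | zero =>
      intro u v hu hv _ _
      refine ⟨0, 0, ?_, ?_⟩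
      · obtain ⟨S, hS⟩ := hU u
        rw [hS, map_zero]
        exact sum_eq_zero fun i _ => by rw [hu i (Nat.zero_le _), map_zero]
      · obtain ⟨S, hS⟩ := hV v
        rw [hS, map_zero, map_zero, add_zero]
        exact sum_eq_zero fun i _ => by rw [hv i (Nat.zero_le _), map_zero]
    | succ r ih =>
      intro u v hu hv hdu huv
      obtain ⟨S₁, hS₁⟩ := hU u
      obtain ⟨S₂, hS₂⟩ := hV v
      have hpd (i : ι) (hi : ρ i = r) : p i (dU u) = (ε i : ℤ) • dP i (p i u) := by
        have h : p i u = ∑ j ∈ S₁, p i (a j (p j u)) := by conv_lhs => rw [hS₁, map_sum]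
        conv_lhs => rw [hS₁, map_sum, map_sum]
        rw [h, map_sum, smul_sum]
        refine sum_congr rfl fun j _ => ?_
        by_cases hij : j = i
        · subst hij; rw [hp, hd]
        · rw [hp' j i _ (Ne.symm hij), map_zero, smul_zero]
          by_cases hj : ρ j ≤ ρ i
          · exact hd' j i _ (Ne.symm hij) hj
          · rw [hu j (by omega), map_zero, map_zero, map_zero]
      have hqd (i : ι) (hi : ρ i = r) : q i (dV v) = (ε i : ℤ) • dQ i (q i v) := by
        have h : q i v = ∑ j ∈ S₂, q i (b j (q j v)) := by conv_lhs => rw [hS₂, map_sum]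
        conv_lhs => rw [hS₂, map_sum, map_sum]
        rw [h, map_sum, smul_sum]
        refine sum_congr rfl fun j _ => ?_
        by_cases hij : j = i
        · subst hij; rw [hq, he]
        · rw [hq' j i _ (Ne.symm hij), map_zero, smul_zero]
          by_cases hj : ρ j ≤ ρ i
          · exact he' j i _ (Ne.symm hij) hj
          · rw [hv j (by omega), map_zero, map_zero, map_zero]
      have hpiece (i : ι) : ∃ x y, ρ i = r → p i u = dP i x ∧ (ε i : ℤ) • q i v = g i x + dQ i y := by
        by_cases hi : ρ i = r
        · obtain ⟨x, y, h, h'⟩ := hg i (p i u) ((ε i : ℤ) • q i v) (by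
            have := hpd i hi
            rw [hdu, map_zero] at this
            rw [← εε i (dP i (p i u)), ← this, smul_zero]) (by
            rw [map_zsmul, ← hqd i hi, ← huv, hGp])
          exact ⟨x, y, fun _ => ⟨h, h'⟩⟩
        · exact ⟨0, 0, fun h => (hi h).elim⟩
      choose x y hxy using hpiece
      let T : Finset ι := (S₁ ∪ S₂).filter fun i => ρ i = r
      have hTu (i : ι) (hi : ρ i = r) (hT : i ∉ T) : p i u = 0 := by
        rw [hS₁, map_sum]
        refine sum_eq_zero fun j hj => hp' j i _ ?_
        rintro rfl
        exact hT (mem_filter.2 ⟨Finset.mem_union_left _ hj, hi⟩)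
      have hTv (i : ι) (hi : ρ i = r) (hT : i ∉ T) : q i v = 0 := by
        rw [hS₂, map_sum]
        refine sum_eq_zero fun j hj => hq' j i _ ?_
        rintro rfl
        exact hT (mem_filter.2 ⟨Finset.mem_union_right _ hj, hi⟩)
      have hTr (i : ι) (hi : i ∈ T) : ρ i = r := (mem_filter.1 hi).2
      let X : U := ∑ i ∈ T, a i ((ε i : ℤ) • x i)
      let Y : V := ∑ i ∈ T, b i (y i)
      have hX (j : ι) (hj : r ≤ ρ j) : p j (dU X) = if j ∈ T then dP j (x j) else 0 := by
        simp only [X, map_sum]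
        split_ifs with h
        · rw [Finset.sum_eq_single_of_mem j h fun i hi hij =>
            hd' i j _ (Ne.symm hij) (by rw [hTr i hi]; exact hj)]
          rw [hd, map_zsmul, εε]
        · refine sum_eq_zero fun i hi => ?_
          refine hd' i j _ ?_ (by rw [hTr i hi]; exact hj)
          rintro rfl; exact h hi
      have hY (j : ι) (hj : r ≤ ρ j) :
          q j (dV Y) = if j ∈ T then (ε j : ℤ) • dQ j (y j) else 0 := by
        simp only [Y, map_sum]
        split_ifs with h
        · rw [Finset.sum_eq_single_of_mem j h fun i hi hij =>
            he' i j _ (Ne.symm hij) (by rw [hTr i hi]; exact hj)]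
          rw [he]
        · refine sum_eq_zero fun i hi => ?_
          refine he' i j _ ?_ (by rw [hTr i hi]; exact hj)
          rintro rfl; exact h hi
      have hGX (j : ι) : q j (G X) = if j ∈ T then (ε j : ℤ) • g j (x j) else 0 := by
        simp only [X, map_sum, hGa]
        split_ifs with h
        · rw [Finset.sum_eq_single_of_mem j h fun i hi hij => hq' i j _ (Ne.symm hij)]
          rw [hq, map_zsmul]
        · refine sum_eq_zero fun i hi => hq' i j _ ?_
          rintro rfl; exact h hi
      obtain ⟨x', y', hx', hy'⟩ := ih (u - dU X) (v - G X - dV Y) (fun j hj => by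
          rw [map_sub, hX j hj]
          by_cases hr : ρ j = r
          · split_ifs with h
            · rw [(hxy j hr).1, sub_self]
            · rw [hTu j hr h, sub_self]
          · rw [hu j (by omega), if_neg (fun h => hr (hTr j h)), sub_self])
        (fun j hj => by
          rw [map_sub, map_sub, hGX, hY j hj]
          by_cases hr : ρ j = r
          · split_ifs with h
            · have := (hxy j hr).2
              rw [← εε j (q j v), this, smul_add]
              abel
            · rw [hTv j hr h, sub_self, sub_self]
          · rw [hv j (by omega), if_neg (fun h => hr (hTr j h)),
              if_neg (fun h => hr (hTr j h)), sub_self, sub_self])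
        (by rw [map_sub, hdu, hdU, sub_self])
        (by
          rw [map_sub, map_sub, map_sub, huv, hG, hdV, sub_zero])
      refine ⟨x' + X, y' + Y, ?_, ?_⟩
      · rw [map_add, ← hx', sub_add_cancel]
      · rw [map_add, map_add, add_right_comm, ← add_assoc, ← hy']
        abel
  intro u v hu huv
  obtain ⟨S₁, hS₁⟩ := hU u
  obtain ⟨S₂, hS₂⟩ := hV v
  refine key ((S₁ ∪ S₂).sup ρ + 1) u v (fun i hi => ?_) (fun i hi => ?_) hu huv
  · rw [hS₁, map_sum]
    refine sum_eq_zero fun j hj => hp' j i _ ?_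
    rintro rfl
    have := Finset.le_sup (f := ρ) (Finset.mem_union_left S₂ hj)
    omega
  · rw [hS₂, map_sum]
    refine sum_eq_zero fun j hj => hq' j i _ ?_
    rintro rfl
    have := Finset.le_sup (f := ρ) (Finset.mem_union_right S₁ hj)
    omega

end Plain

section Plain

/-- A chain homotopy equivalence is a quasi-isomorphism. -/
lemma RelAcyclic.of_homotopy {R : Type u} [CommRing R] {U V : Type u} [AddCommGroup U]
    [Module R U] [AddCommGroup V] [Module R V] {dU : U →ₗ[R] U} {dV : V →ₗ[R] V} {G : U →ₗ[R] V}
    (hdU : ∀ u, dU (dU u) = 0) (hG : ∀ u, G (dU u) = dV (G u)) (F : V →ₗ[R] U) (K : U →ₗ[R] U)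
    (L : V →ₗ[R] V) (hF : ∀ v, F (dV v) = dU (F v)) (hK : ∀ u, u = F (G u) + dU (K u) + K (dU u))
    (hL : ∀ v, v = G (F v) + dV (L v) + L (dV v)) : RelAcyclic dU dV G := by
  intro u v hu huv
  have h₁ : u = dU (F v + K u) := by
    rw [map_add, ← hF, ← huv]
    conv_lhs => rw [hK u, hu, map_zero, add_zero]
  obtain ⟨c, hc⟩ : ∃ c, c = v - G (F v + K u) := ⟨_, rfl⟩
  have hdc : dV c = 0 := by rw [hc, map_sub, ← hG, ← h₁, huv, sub_self]
  refine ⟨F v + K u + F c, L c, ?_, ?_⟩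
  · rw [map_add dU _ (F c), ← h₁, ← hF, hdc, map_zero, add_zero]
  · have := hL c
    rw [hdc, map_zero, add_zero] at this
    rw [map_add, add_assoc, ← this, hc, add_sub_cancel]

variable {k : Type u} [Field k]

/-- An acyclic complex over a field is contractible. -/
lemma exists_contraction {K : Type u} [AddCommGroup K] [Module k K] (d : K →ₗ[k] K)
    (hd : ∀ x, d (d x) = 0) (hK : ∀ x, d x = 0 → ∃ y, x = d y) :
    ∃ h : K →ₗ[k] K, ∀ x, d (h x) + h (d x) = x := by
  let d' : K →ₗ[k] ker d := d.codRestrict _ fun x => hd x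
  have hs : Surjective d' := fun x => by
    obtain ⟨y, hy⟩ := hK x.1 x.2
    exact ⟨y, Subtype.ext hy.symm⟩
  obtain ⟨σ, hσ⟩ := d'.exists_rightInverse_of_surjective (LinearMap.range_eq_top.2 hs)
  have hσ' (z : ker d) : d (σ z) = z.1 := congrArg Subtype.val (LinearMap.congr_fun hσ z)
  have hP (x : K) : (LinearMap.id - σ ∘ₗ d' : K →ₗ[k] K) x ∈ ker d := by
    rw [mem_ker, LinearMap.sub_apply, map_sub, LinearMap.comp_apply, hσ']
    exact sub_self _
  let P : K →ₗ[k] ker d := (LinearMap.id - σ ∘ₗ d' : K →ₗ[k] K).codRestrict _ hP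
  have e (x : K) : P (d x) = d' x := by
    have h : d' (d x) = 0 := Subtype.ext (hd x)
    refine Subtype.ext ?_
    change d x - σ (d' (d x)) = d x
    rw [h, map_zero, sub_zero]
  refine ⟨σ ∘ₗ P, fun x => ?_⟩
  rw [LinearMap.comp_apply, LinearMap.comp_apply, hσ', e]
  exact sub_add_cancel x _

/-- A quasi-isomorphism over a field is a homotopy equivalence. -/
lemma RelAcyclic.exists_homotopy {U V : Type u} [AddCommGroup U]
    [Module k U] [AddCommGroup V] [Module k V] {dU : U →ₗ[k] U} {dV : V →ₗ[k] V} {G : U →ₗ[k] V}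
    (hdU : ∀ u, dU (dU u) = 0) (hdV : ∀ v, dV (dV v) = 0) (hG : ∀ u, G (dU u) = dV (G u))
    (h : RelAcyclic dU dV G) : ∃ (F : V →ₗ[k] U) (K : U →ₗ[k] U) (L : V →ₗ[k] V),
      (∀ v, F (dV v) = dU (F v)) ∧ (∀ u, u = F (G u) + dU (K u) + K (dU u)) ∧
      ∀ v, v = G (F v) + dV (L v) + L (dV v) := by
  -- the mapping cone of `G`
  let D : U × V →ₗ[k] U × V :=
    LinearMap.prod (-(dU ∘ₗ LinearMap.fst k U V)) (G ∘ₗ LinearMap.fst k U V + dV ∘ₗ LinearMap.snd k U V)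
  have hD (u : U) (v : V) : D (u, v) = (-dU u, G u + dV v) := rfl
  obtain ⟨H, hH⟩ := exists_contraction D (fun ⟨u, v⟩ => by simp [hD, hdU, hdV, hG])
    (fun ⟨u, v⟩ huv => by
      rw [hD, Prod.mk_eq_zero, neg_eq_zero] at huv
      obtain ⟨x, y, hx, hy⟩ := h u (-v) huv.1 (by
        rw [map_neg]; exact eq_neg_of_add_eq_zero_left huv.2)
      refine ⟨(-x, -y), ?_⟩
      rw [hD, map_neg, neg_neg, ← hx, map_neg, map_neg, ← neg_add, ← hy, neg_neg])
  refine ⟨LinearMap.fst k U V ∘ₗ H ∘ₗ LinearMap.inr k U V,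
    -(LinearMap.fst k U V ∘ₗ H ∘ₗ LinearMap.inl k U V),
    LinearMap.snd k U V ∘ₗ H ∘ₗ LinearMap.inr k U V, fun v => ?_, fun u => ?_, fun v => ?_⟩
  · have := congrArg Prod.fst (hH (0, v))
    rcases e : H (0, v) with ⟨a, b⟩
    rw [e, hD, hD] at this
    simp only [map_zero, neg_zero, zero_add, Prod.fst_add] at this
    simp only [LinearMap.comp_apply, LinearMap.inr_apply, LinearMap.fst_apply, e]
    exact (neg_add_eq_zero.1 this).symm
  · have := congrArg Prod.fst (hH (u, 0))
    rcases e : H (u, 0) with ⟨a, b⟩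
    rw [e, hD, hD] at this
    simp only [map_zero, add_zero, Prod.fst_add] at this
    have e' : H (-dU u, G u) = - H (dU u, 0) + H (0, G u) := by
      rw [← H.map_neg, ← H.map_add]; simp
    rw [e'] at this
    simp only [LinearMap.comp_apply, LinearMap.inr_apply, LinearMap.inl_apply, LinearMap.fst_apply,
      LinearMap.neg_apply, e, map_neg]
    simp only [Prod.fst_add, Prod.fst_neg] at this
    refine this.symm.trans ?_
    abel
  · have := congrArg Prod.snd (hH (0, v))
    rcases e : H (0, v) with ⟨a, b⟩
    rw [e, hD, hD] at this
    simp only [map_zero, neg_zero, zero_add, Prod.snd_add] at this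
    simp only [LinearMap.comp_apply, LinearMap.inr_apply, LinearMap.fst_apply, LinearMap.snd_apply,
      e]
    exact this.symm

end Plain

variable {K : Type u} [Field K] {A B C D : GrAlg K}

instance : CoeSort (GrAlg.{u} K) (Type u) := ⟨GrAlg.carrier⟩

instance : CoeSort (Cplx.{u} A C) (Type u) := ⟨Cplx.carrier⟩

namespace Cplx

/-! ### Homogeneous components -/

lemma isQis_iff {M N : Cplx A C} (f : M.homs N) : IsQis f ↔ RelAcyclic M.d N.d f.1 := by
  constructor
  · rintro ⟨h₁, h₂⟩ u v hu huv
    obtain ⟨x, rfl⟩ := h₁ u hu ⟨v, huv⟩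
    obtain ⟨m, y, hm, h⟩ := h₂ (v - f.1 x) (by rw [map_sub, ← hom_d, huv, sub_self])
    exact ⟨x + m, y, by rw [map_add, hm, add_zero], by rw [map_add, add_assoc, ← h]; abel⟩
  · intro h
    refine ⟨fun m hm ⟨y, hy⟩ => ?_, fun y hy => ?_⟩
    · obtain ⟨x, -, hx, -⟩ := h m y hm hy
      exact ⟨x, hx⟩
    · obtain ⟨x, z, hx, hz⟩ := h 0 y (map_zero _) (by rw [map_zero, hy])
      exact ⟨x, z, hx.symm, hz⟩

/-- The homogeneous component of degree `t`. -/
def proj (M : Cplx A C) (t : ℤ × ℤ) : M →ₗ[K] M := M.scale fun t' => if t' = t then 1 else 0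

lemma proj_of_mem (M : Cplx A C) {t : ℤ × ℤ} {m : M} (hm : m ∈ M.gr t) : M.proj t m = m := by
  rw [proj, scale_apply _ _ hm, if_pos rfl, one_smul]

lemma proj_of_ne (M : Cplx A C) {t t' : ℤ × ℤ} {m : M} (hm : m ∈ M.gr t') (h : t' ≠ t) :
    M.proj t m = 0 := by
  rw [proj, scale_apply _ _ hm, if_neg h, zero_smul]

lemma proj_mem (M : Cplx A C) (t : ℤ × ℤ) (m : M) : M.proj t m ∈ M.gr t := by
  induction m using M.induction with
  | hp s m hm =>
    by_cases h : s = t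
    · subst h; rwa [M.proj_of_mem hm]
    · rw [M.proj_of_ne hm h]; exact zero_mem _
  | hadd m m' h h' => rw [map_add]; exact add_mem h h'

lemma exists_sum_proj (M : Cplx A C) (m : M) :
    ∃ S : Finset (ℤ × ℤ), ∀ T, S ⊆ T → m = ∑ t ∈ T, M.proj t m := by
  induction m using M.induction with
  | hp s m hm =>
    refine ⟨{s}, fun T hT => ?_⟩
    rw [Finset.sum_eq_single_of_mem s (hT (Finset.mem_singleton_self s)) fun t _ ht =>
      M.proj_of_ne hm (Ne.symm ht), M.proj_of_mem hm]
  | hadd m m' h h' =>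
    obtain ⟨S, hS⟩ := h
    obtain ⟨S', hS'⟩ := h'
    refine ⟨S ∪ S', fun T hT => ?_⟩
    simp only [map_add, sum_add_distrib]
    rw [← hS T (Finset.union_subset_left hT), ← hS' T (Finset.union_subset_right hT)]

lemma map_proj {A' C' : GrAlg K} {M : Cplx A C} {N : Cplx A' C'} (f : M →ₗ[K] N)
    (e : ℤ × ℤ) (hf : ∀ t, ∀ m ∈ M.gr t, f m ∈ N.gr (t + e)) (t : ℤ × ℤ) (m : M) :
    f (M.proj t m) = N.proj (t + e) (f m) := by
  induction m using M.induction with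
  | hp s m hm =>
    by_cases h : s = t
    · subst h; rw [M.proj_of_mem hm, N.proj_of_mem (hf _ _ hm)]
    · rw [M.proj_of_ne hm h, N.proj_of_ne (hf _ _ hm) (fun h' => h (add_right_cancel h')), map_zero]
  | hadd m m' h h' => simp only [map_add, h, h']

lemma d_mem' (M : Cplx A C) {t : ℤ × ℤ} {m : M} (hm : m ∈ M.gr t) :
    M.d m ∈ M.gr (t + (1, 0)) := by
  have := M.d_mem (p := t.1) (q := t.2) hm
  convert this using 2
  simp [Prod.ext_iff]

lemma d_proj (M : Cplx A C) (t : ℤ × ℤ) (m : M) :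
    M.d (M.proj t m) = M.proj (t + (1, 0)) (M.d m) :=
  map_proj M.d (1, 0) (fun _ _ h => M.d_mem' h) t m

lemma hom_proj {M N : Cplx A C} (f : M.homs N) (t : ℤ × ℤ) (m : M) :
    f.1 (M.proj t m) = N.proj t (f.1 m) := by
  have := map_proj f.1 0 (fun t m h => by rw [add_zero]; exact hom_gr f h) t m
  rwa [add_zero] at this

/-- The part of degree `e` of a linear map. -/
def degPart {A' C' : GrAlg K} (M : Cplx A C) (N : Cplx A' C') (e : ℤ × ℤ)
    (H : M →ₗ[K] N) : M →ₗ[K] N :=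
  homogeneousLift M.internal fun t => N.proj (t + e) ∘ₗ H ∘ₗ (M.gr t).subtype

lemma degPart_apply {A' C' : GrAlg K} {M : Cplx A C} {N : Cplx A' C'} (e : ℤ × ℤ)
    (H : M →ₗ[K] N) {t : ℤ × ℤ} {m : M} (hm : m ∈ M.gr t) :
    degPart M N e H m = N.proj (t + e) (H m) := by
  rw [degPart, homogeneousLift_apply _ _ hm]; rfl

lemma degPart_mem {A' C' : GrAlg K} {M : Cplx A C} {N : Cplx A' C'} (e : ℤ × ℤ)
    (H : M →ₗ[K] N) {t : ℤ × ℤ} {m : M} (hm : m ∈ M.gr t) :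
    degPart M N e H m ∈ N.gr (t + e) := by
  rw [degPart_apply e H hm]; exact N.proj_mem _ _

/-- For a surjective quasi-isomorphism `f : M → N` of complexes there are a graded section of `f`
and a graded contraction of its kernel. -/
lemma exists_section_contraction {M N : Cplx A C} (f : M.homs N) (hf : IsQis f)
    (hs : Surjective f.1) :
    ∃ (σ : N →ₗ[K] M) (h : M →ₗ[K] M), (∀ t, ∀ n ∈ N.gr t, σ n ∈ M.gr t) ∧ (∀ n, f.1 (σ n) = n) ∧
      (∀ t, ∀ m ∈ M.gr t, h m ∈ M.gr (t + (-1, 0))) ∧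
      ∀ m, f.1 m = 0 → f.1 (h m) = 0 ∧ M.d (h m) + h (M.d m) = m := by
  obtain ⟨σ₀, hσ₀⟩ := f.1.exists_rightInverse_of_surjective (LinearMap.range_eq_top.2 hs)
  have hσ₀' (n) : f.1 (σ₀ n) = n := LinearMap.congr_fun hσ₀ n
  let L := ker f.1
  have hdK (x : L) : M.d x.1 ∈ L := by
    rw [mem_ker, hom_d, mem_ker.1 x.2, map_zero]
  let dK : L →ₗ[K] L := (M.d ∘ₗ L.subtype).codRestrict L hdK
  obtain ⟨h₁, hh₁⟩ := exists_contraction dK (fun x => Subtype.ext (M.d_d x.1)) (fun x hx => by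
    obtain ⟨y, z, hy, hz⟩ := (isQis_iff f).1 hf x.1 0 (congrArg Subtype.val hx) (by
      rw [map_zero]; exact x.2)
    obtain ⟨z, rfl⟩ := hs z
    refine ⟨⟨y + M.d z, ?_⟩, Subtype.ext ?_⟩
    · rw [mem_ker, map_add, hom_d, ← hz]
    · change x.1 = M.d (y + M.d z)
      rw [map_add, M.d_d, add_zero, hy])
  -- extend the contraction by zero along the section
  let h₀ : M →ₗ[K] M := L.subtype ∘ₗ h₁ ∘ₗ (LinearMap.id - σ₀ ∘ₗ f.1).codRestrict L fun x => by
      simp [L, mem_ker, hσ₀']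
  have hh₀ (x : L) : h₀ x.1 = (h₁ x).1 := by
    have : (LinearMap.id - σ₀ ∘ₗ f.1).codRestrict L (fun x => by
        simp [L, mem_ker, hσ₀']) x.1 = x := by
      refine Subtype.ext ?_
      simp [mem_ker.1 x.2]
    simp only [h₀, LinearMap.comp_apply, this, Submodule.subtype_apply]
  have key (m) (hm : f.1 m = 0) : f.1 (h₀ m) = 0 ∧ M.d (h₀ m) + h₀ (M.d m) = m := by
    have e₁ := hh₀ ⟨m, hm⟩
    have e₂ := hh₀ (dK ⟨m, hm⟩)
    refine ⟨?_, ?_⟩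
    · rw [e₁]; exact (h₁ ⟨m, hm⟩).2
    · have := congrArg Subtype.val (hh₁ ⟨m, hm⟩)
      change _ + h₀ (dK ⟨m, hm⟩).1 = m
      rw [e₁, e₂]
      exact this
  refine ⟨degPart N M 0 σ₀, degPart M M (-1, 0) h₀, fun t n hn => ?_, fun n => ?_,
    fun t m hm => degPart_mem _ _ hm, fun m hm => ?_⟩
  · simpa using degPart_mem (M := N) (N := M) 0 σ₀ hn
  · induction n using N.induction with
    | hp t n hn =>
      rw [degPart_apply 0 σ₀ hn, hom_proj, hσ₀', add_zero, N.proj_of_mem hn]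
    | hadd n n' h h' => rw [map_add, map_add, h, h']
  · have hom (t : ℤ × ℤ) (m) (hm : m ∈ M.gr t) (hfm : f.1 m = 0) :
        f.1 (degPart M M (-1, 0) h₀ m) = 0 ∧
          M.d (degPart M M (-1, 0) h₀ m) + degPart M M (-1, 0) h₀ (M.d m) = m := by
      obtain ⟨k₁, k₂⟩ := key m hfm
      rw [degPart_apply _ _ hm, degPart_apply _ _ (M.d_mem' hm), hom_proj, k₁, map_zero, d_proj]
      refine ⟨rfl, ?_⟩
      have : t + (-1, 0) + (1, 0) = t := by simp [Prod.ext_iff]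
      have h' : t + (1, 0) + (-1, 0) = t := by simp [Prod.ext_iff]
      rw [this, h', ← map_add, k₂, M.proj_of_mem hm]
    obtain ⟨S, hS⟩ := M.exists_sum_proj m
    have hm' := hS S subset_rfl
    have hmt (t) := hom t (M.proj t m) (M.proj_mem t m) (by rw [hom_proj, hm, map_zero])
    constructor
    · rw [hm', map_sum, map_sum]
      exact sum_eq_zero fun t _ => (hmt t).1
    · conv_lhs => rw [hm']
      simp only [map_sum]
      rw [← sum_add_distrib, sum_congr rfl fun t _ => (hmt t).2, ← hm']

end Cplx

namespace Cplx

/-! ### Exchanging the two sides of a bimodule -/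

/-- The operator that multiplies an element of cohomological degree `p` by `φ p`. -/
def par (M : Cplx A C) (φ : ℤ → K) : M →ₗ[K] M := M.scale fun t => φ t.1

lemma par_apply (M : Cplx A C) (φ : ℤ → K) {t : ℤ × ℤ} {m : M} (hm : m ∈ M.gr t) :
    M.par φ m = φ t.1 • m := M.scale_apply _ hm

lemma par_l (M : Cplx A C) (φ : ℤ → K) (a : A) (m : M) :
    M.par φ (M.l a m) = M.l a (M.par φ m) := by
  induction m using M.induction with
  | hp s m hm =>
    induction a using homogeneous_induction A.internal with
    | hp q a ha => rw [M.par_apply φ hm, M.par_apply φ (M.l_mem ha hm), map_smul]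
    | hadd a a' h h' => simp only [map_add, LinearMap.add_apply, h, h']
  | hadd m m' h h' => simp only [map_add, h, h']

lemma par_r (M : Cplx A C) (φ : ℤ → K) (a : C) (m : M) :
    M.par φ (M.r a m) = M.r a (M.par φ m) := by
  induction m using M.induction with
  | hp s m hm =>
    induction a using homogeneous_induction C.internal with
    | hp q a ha => rw [M.par_apply φ hm, M.par_apply φ (M.r_mem ha hm), map_smul]
    | hadd a a' h h' => simp only [map_add, LinearMap.add_apply, h, h']
  | hadd m m' h h' => simp only [map_add, h, h']

lemma hom_par {M N : Cplx A C} (f : M.homs N) (φ : ℤ → K) (m : M) :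
    f.1 (M.par φ m) = N.par φ (f.1 m) := by
  induction m using M.induction with
  | hp s m hm => rw [M.par_apply φ hm, N.par_apply φ (f.2.1 s m hm), map_smul]
  | hadd m m' h h' => simp only [map_add, h, h']

/-- The part of even cohomological degree. -/
def ev (M : Cplx A C) : M →ₗ[K] M := M.par fun p => if Even p then 1 else 0

/-- The part of odd cohomological degree. -/
def od (M : Cplx A C) : M →ₗ[K] M := M.par fun p => if Even p then 0 else 1

lemma ev_add_od (M : Cplx A C) (m : M) : M.ev m + M.od m = m := by
  induction m using M.induction with
  | hp s m hm =>
    rw [ev, od, M.par_apply _ hm, M.par_apply _ hm]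
    split_ifs <;> simp
  | hadd m m' h h' => rw [map_add, map_add, add_add_add_comm, h, h']

lemma ev_d (M : Cplx A C) (m : M) : M.ev (M.d m) = M.d (M.od m) := by
  induction m using M.induction with
  | hp s m hm =>
    rw [ev, od, M.par_apply _ hm, M.par_apply _ (M.d_mem hm), map_smul]
    simp only [Int.even_add_one]
    split_ifs <;> simp_all
  | hadd m m' h h' => simp only [map_add, h, h']

lemma od_d (M : Cplx A C) (m : M) : M.od (M.d m) = M.d (M.ev m) := by
  induction m using M.induction with
  | hp s m hm =>
    rw [ev, od, M.par_apply _ hm, M.par_apply _ (M.d_mem hm), map_smul]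
    simp only [Int.even_add_one]
    split_ifs <;> simp_all
  | hadd m m' h h' => simp only [map_add, h, h']

lemma ev_sgn (M : Cplx A C) (m : M) : M.ev (M.sgn m) = M.ev m := by
  induction m using M.induction with
  | hp s m hm =>
    rw [M.sgn_apply hm, map_smul, ev, M.par_apply _ hm]
    split_ifs with h
    · simp [Int.negOnePow_even _ h]
    · simp
  | hadd m m' h h' => simp only [map_add, h, h']

lemma od_sgn (M : Cplx A C) (m : M) : M.od (M.sgn m) = -M.od m := by
  induction m using M.induction with
  | hp s m hm =>
    rw [M.sgn_apply hm, map_smul, od, M.par_apply _ hm]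
    split_ifs with h
    · simp
    · simp [Int.negOnePow_odd _ (Int.not_even_iff_odd.1 h)]
  | hadd m m' h h' => simp only [map_add, h, h']; abel

lemma ev_ev (M : Cplx A C) (m : M) : M.ev (M.ev m) = M.ev m := by
  induction m using M.induction with
  | hp s m hm => rw [ev, M.par_apply _ hm, map_smul, M.par_apply _ hm]; split_ifs <;> simp
  | hadd m m' h h' => simp only [map_add, h, h']

lemma od_od (M : Cplx A C) (m : M) : M.od (M.od m) = M.od m := by
  induction m using M.induction with
  | hp s m hm => rw [od, M.par_apply _ hm, map_smul, M.par_apply _ hm]; split_ifs <;> simp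
  | hadd m m' h h' => simp only [map_add, h, h']

lemma ev_od (M : Cplx A C) (m : M) : M.ev (M.od m) = 0 := by
  have := M.ev_add_od (M.od m)
  rwa [od_od, add_eq_right] at this

lemma od_ev (M : Cplx A C) (m : M) : M.od (M.ev m) = 0 := by
  have := M.ev_add_od (M.ev m)
  rwa [ev_ev, add_eq_left] at this

/-- An `A`-`C`-bimodule as a `C`-`A`-bimodule. -/
abbrev flip (M : Cplx A C) : Cplx C A where
  carrier := M
  gr := M.gr
  internal := M.internal
  l := M.r
  r := M.l
  l_r a c m := (M.l_r c a m).symm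
  l_mem ha hm := M.r_mem ha hm
  r_mem ha hm := M.l_mem ha hm
  d := M.d
  d_mem hm := M.d_mem hm
  d_d := M.d_d
  d_l := M.d_r
  d_r := M.d_l

/-- A map of complexes of `A`-`C`-bimodules as a map of complexes of `C`-`A`-bimodules. -/
def flipHom {M N : Cplx A C} (f : M.homs N) : M.flip.homs N.flip :=
  ⟨f.1, f.2.1, f.2.2.2.1, f.2.2.1, f.2.2.2.2⟩

section Swap

variable (N : Cplx A B) (M : Cplx B C)

/-- The map `n ⊗ m ↦ (-1)^(|n||m|) m ⊗ n`. -/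
def swapLin : tensor N M →ₗ[K] tensor M.flip N.flip :=
  tensorLift (LinearMap.compl₂ (tm (M := M.flip) (N := N.flip)) N.ev +
      LinearMap.compl₂ (tm (M := M.flip) (N := N.flip) ∘ₗ M.sgn) N.od).flip (fun n b m => by
    simp only [LinearMap.flip_apply, LinearMap.add_apply, LinearMap.compl₂_apply,
      LinearMap.comp_apply]
    rw [ev, od, par_r, par_r, sgn_l]
    exact congrArg₂ (· + ·) (tm_balance (M := M.flip) (N := N.flip) _ _ _).symm
      (tm_balance (M := M.flip) (N := N.flip) _ _ _).symm)

lemma swapLin_tm (n : N) (m : M) : swapLin N M (tm n m) =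
    tm (M := M.flip) (N := N.flip) m (N.ev n) + tm (M := M.flip) (N := N.flip) (M.sgn m) (N.od n) :=
  tensorLift_tm _ _ _ _

/-- The inverse of `swapLin`. -/
def swapInvLin : tensor M.flip N.flip →ₗ[K] tensor N M :=
  tensorLift (M := M.flip) (N := N.flip) (LinearMap.flip (tm ∘ₗ N.ev) +
      LinearMap.compl₂ tm.flip N.od ∘ₗ M.sgn) (fun m b n => by
    have h₁ : N.ev (N.r b n) = N.r b (N.ev n) := N.par_r _ b n
    have h₂ : N.od (N.r b n) = N.r b (N.od n) := N.par_r _ b n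
    change tm (N.ev n) (M.l b m) + tm (N.od n) (M.sgn (M.l b m)) =
      tm (N.ev (N.r b n)) m + tm (N.od (N.r b n)) (M.sgn m)
    rw [h₁, h₂, sgn_l, tm_balance, tm_balance])

lemma swapInvLin_tm (m : M) (n : N) : swapInvLin N M (tm (M := M.flip) (N := N.flip) m n) =
      tm (N.ev n) m + tm (N.od n) (M.sgn m) :=
  tensorLift_tm (M := M.flip) (N := N.flip) _ _ _ _

lemma swapLin_bijective : Bijective (swapLin N M) := by
  refine Function.bijective_iff_has_inverse.2 ⟨swapInvLin N M, fun x => ?_, fun x => ?_⟩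
  · induction x using tensor_induction with
    | h n m =>
      rw [swapLin_tm, map_add, swapInvLin_tm, swapInvLin_tm, ev_ev, od_ev, ev_od, od_od, sgn_sgn]
      simp only [map_zero, LinearMap.zero_apply, add_zero, zero_add]
      rw [← LinearMap.add_apply, ← map_add, ev_add_od]
    | hadd x y hx hy => simp only [map_add, hx, hy]
  · induction x using tensor_induction with
    | h m n =>
      have e : swapInvLin N M (tm (M := M.flip) (N := N.flip) m n) = _ := swapInvLin_tm N M m n
      rw [e, map_add, swapLin_tm, swapLin_tm, ev_ev, od_ev, ev_od, od_od, sgn_sgn]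
      simp only [map_zero, add_zero, zero_add]
      have := N.ev_add_od n
      exact ((tm (M := M.flip) (N := N.flip) m).map_add _ _).symm.trans (congrArg _ this)
    | hadd x y hx hy => simp only [map_add, hx, hy]

lemma swapLin_d (x : tensor N M) :
    swapLin N M ((tensor N M).d x) = (tensor M.flip N.flip).d (swapLin N M x) := by
  induction x using tensor_induction with
  | h n m =>
    have e (m : M) (n : N) : (tensor M.flip N.flip).d (tm (M := M.flip) (N := N.flip) m n) =
          tm (M := M.flip) (N := N.flip) (M.d m) n +
            tm (M := M.flip) (N := N.flip) (M.sgn m) (N.d n) :=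
      tensor_d (M := M.flip) (N := N.flip) m n
    rw [tensor_d, map_add, swapLin_tm, swapLin_tm, swapLin_tm, map_add, e, e, ev_d, od_d, ev_sgn,
      od_sgn, sgn_sgn, sgn_d]
    simp only [map_neg, LinearMap.neg_apply, neg_neg]
    abel
  | hadd x y hx hy => simp only [map_add, hx, hy]

end Swap

lemma IsKFlatLeft.of_flip {M : Cplx B C} (h : IsKFlatRight M.flip) : IsKFlatLeft M :=
  fun A N N' f hf => by
  have hf' : IsQis (flipHom f) := hf
  refine (h A N.flip N'.flip (flipHom f) hf').of_square _ (swapLin N M) (swapLin N' M)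
    (swapLin_bijective N M) (swapLin_bijective N' M) (swapLin_d N M) (swapLin_d N' M) fun x => ?_
  induction x using tensor_induction with
  | h n m =>
    have e (m : M) (n : N) :
        (tmap (idHom M.flip) (flipHom f)).1 (tm (M := M.flip) (N := N.flip) m n) =
          tm (M := M.flip) (N := N'.flip) m (f.1 n) := tmap_tm (idHom M.flip) (flipHom f) m n
    rw [tmap_tm, swapLin_tm, swapLin_tm, map_add, e, e]
    have h₁ : f.1 (N.ev n) = N'.ev (f.1 n) := hom_par f _ n
    have h₂ : f.1 (N.od n) = N'.od (f.1 n) := hom_par f _ n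
    rw [h₁, h₂]
    rfl
  | hadd x y hx hy => simp only [map_add, hx, hy]

/-! ### Bimodules over the base field -/

end Cplx

lemma GrAlg.base_internal : DirectSum.IsInternal
    fun q : ℤ => if q = 0 then (⊤ : Submodule K K) else ⊥ := by
  refine isInternal_of_projections (fun q => if q = 0 then LinearMap.id else 0) ?_ ?_ ?_
  · intro s m hm
    by_cases h : s = 0 <;> simp_all
  · intro s t hst m hm
    by_cases h : s = 0 <;> by_cases h' : t = 0 <;> simp_all
  · exact fun m => mem_iSup_of_mem 0 (by simp)

/-- The base field as a graded algebra. -/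
abbrev GrAlg.base (K : Type u) [Field K] : GrAlg K where
  carrier := K
  gr := fun q => if q = 0 then ⊤ else ⊥
  graded := {
      one_mem := by simp
      mul_mem := fun i j a b ha hb => by
        by_cases h : i = 0 <;> by_cases h' : j = 0 <;> simp_all
      toDecomposition := GrAlg.base_internal.chooseDecomposition }

lemma GrAlg.base_gr (q : ℤ) : (GrAlg.base K).gr q =
    (if q = 0 then (⊤ : Submodule K K) else ⊥) := rfl

/-- The structure homomorphism of a graded algebra. -/
def GrAlg.ofBase (A : GrAlg K) : (GrAlg.base K).GrHom A where
  hom := Algebra.ofId K A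
  hom_mem {q a} ha := by
    rw [GrAlg.base_gr] at ha
    split_ifs at ha with h
    · subst h
      have : Algebra.ofId K A a = a • (1 : A) := Algebra.algebraMap_eq_smul_one a
      rw [this]
      exact Submodule.smul_mem _ _ (SetLike.one_mem_graded A.gr)
    · have ha' : a = (0 : K) := ha
      have : Algebra.ofId K A a = 0 := by rw [ha']; exact map_zero _
      rw [this]
      exact zero_mem _

namespace Cplx

lemma l_base (M : Cplx (GrAlg.base K) C) (x : GrAlg.base K) (m : M) :
    M.l x m = (show K from x) • m := by
  have h := M.l.commutes (show K from x)
  have : algebraMap K (GrAlg.base K) (show K from x) = x := rfl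
  rw [this] at h
  rw [h]; rfl

lemma r_base (M : Cplx A (GrAlg.base K)) (x : GrAlg.base K) (m : M) :
    M.r x m = (show K from x) • m := by
  have h := M.r.commutes (show K from x)
  have : algebraMap K (GrAlg.base K) (show K from x) = x := rfl
  rw [this] at h
  rw [h]; rfl

/-- Over the base field, all complexes are K-flat, since quasi-isomorphisms of complexes of vector
spaces are homotopy equivalences. -/
lemma isKFlatRight_base (M : Cplx A (GrAlg.base K)) : IsKFlatRight M := fun C N N' f hf => by
  obtain ⟨F, H, L, hF, hK, hL⟩ := ((isQis_iff f).1 hf).exists_homotopy N.d_d N'.d_d (hom_d f)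
  let T {X Y : Cplx (GrAlg.base K) C} (a : M →ₗ[K] M)
      (b : X →ₗ[K] Y) : tensor M X →ₗ[K] tensor M Y :=
    tensorLift ((tm ∘ₗ a).compl₂ b) fun m x n => by
      have h₁ : M.r x m = (show K from x) • m := M.r_base x m
      have h₂ : X.l x n = (show K from x) • n := X.l_base x n
      change tm (a (M.r x m)) (b n) = tm (a m) (b (X.l x n))
      rw [h₁, h₂, map_smul, map_smul, map_smul, map_smul, LinearMap.smul_apply]
  have hT {X Y : Cplx (GrAlg.base K) C} (a : M →ₗ[K] M)
      (b : X →ₗ[K] Y) (m n) : T a b (tm m n) = tm (a m) (b n) := tensorLift_tm _ _ _ _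
  rw [isQis_iff]
  refine RelAcyclic.of_homotopy (tensor M N).d_d (hom_d _) (T LinearMap.id F) (T M.sgn H)
    (T M.sgn L) (fun x => ?_) (fun x => ?_) fun x => ?_
  · induction x using tensor_induction with
    | h m n => simp only [tensor_d, map_add, hT, LinearMap.id_apply, hF]
    | hadd x y hx hy => simp only [map_add, hx, hy]
  · induction x using tensor_induction with
    | h m n =>
      simp only [tensor_d, map_add, hT, LinearMap.id_apply, tmap_tm, idHom_apply, sgn_sgn, sgn_d,
        map_neg, LinearMap.neg_apply]
      have := hK n
      conv_lhs => rw [this]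
      simp only [map_add]
      abel
    | hadd x y hx hy => simp only [map_add]; conv_lhs => rw [hx, hy]
                        abel
  · induction x using tensor_induction with
    | h m n =>
      simp only [tensor_d, map_add, hT, LinearMap.id_apply, tmap_tm, idHom_apply, sgn_sgn, sgn_d,
        map_neg, LinearMap.neg_apply]
      have := hL n
      conv_lhs => rw [this]
      simp only [map_add]
      abel
    | hadd x y hx hy => simp only [map_add]; conv_lhs => rw [hx, hy]
                        abel

lemma isKFlatLeft_base (M : Cplx (GrAlg.base K) C) : IsKFlatLeft M :=
  .of_flip (isKFlatRight_base M.flip)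

/-! ### Restriction of scalars and subcomplexes -/

/-- Restriction of scalars. -/
def res {A' C' : GrAlg K} (M : Cplx A C) (f : A'.GrHom A) (g : C'.GrHom C) : Cplx A' C' where
  carrier := M
  gr := M.gr
  internal := M.internal
  l := M.l.comp f.hom
  r := M.r.comp g.hom
  l_r a c m := M.l_r _ _ m
  l_mem ha hm := M.l_mem (f.hom_mem ha) hm
  r_mem ha hm := M.r_mem (g.hom_mem ha) hm
  d := M.d
  d_mem hm := M.d_mem hm
  d_d := M.d_d
  d_l a m := M.d_l _ m
  d_r a m := M.d_r _ m

/-- A homogeneous subspace that is stable under the actions and the differential, as a complex. -/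
def sub (M : Cplx A C) (S : Submodule K M) (hS : ∀ t, ∀ m ∈ S, M.proj t m ∈ S)
    (hl : ∀ a, ∀ m ∈ S, M.l a m ∈ S) (hr : ∀ a, ∀ m ∈ S, M.r a m ∈ S) (hd : ∀ m ∈ S, M.d m ∈ S) :
    Cplx A C where
  carrier := S
  gr t := (M.gr t).comap S.subtype
  internal := by
    refine isInternal_of_projections (fun t => (M.proj t).restrict (hS t)) ?_ ?_ ?_
    · exact fun t m hm => Subtype.ext (M.proj_of_mem hm)
    · exact fun s t h m hm => Subtype.ext (M.proj_of_ne hm h)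
    · intro m
      obtain ⟨T, hT⟩ := M.exists_sum_proj m.1
      have : m = ∑ t ∈ T, (M.proj t).restrict (hS t) m := Subtype.ext (by
        rw [AddSubmonoidClass.coe_finset_sum]; exact hT T subset_rfl)
      rw [this]
      exact sum_mem fun t _ => mem_iSup_of_mem t (M.proj_mem t m.1)
  l := AlgHom.ofLinearMap
    { toFun := fun a => (M.l a).restrict (hl a)
      map_add' := fun a a' => by ext m; simp [LinearMap.restrict_apply]
      map_smul' := fun x a => by ext m; simp [LinearMap.restrict_apply] }
    (by ext m; simp [LinearMap.restrict_apply]) (fun a a' => by ext m; simp [LinearMap.restrict_apply])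
  r := AlgHom.ofLinearMap
    { toFun := fun a => (M.r a).restrict (hr a)
      map_add' := fun a a' => by ext m; simp [LinearMap.restrict_apply]
      map_smul' := fun x a => by ext m; simp [LinearMap.restrict_apply] }
    (by ext m; simp [LinearMap.restrict_apply]) (fun a a' => by ext m; simp [LinearMap.restrict_apply])
  l_r a c m := Subtype.ext (M.l_r a c m.1)
  l_mem ha hm := M.l_mem ha hm
  r_mem ha hm := M.r_mem ha hm
  d := M.d.restrict hd
  d_mem hm := M.d_mem hm
  d_d m := Subtype.ext (M.d_d m.1)
  d_l a m := Subtype.ext (M.d_l a m.1)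
  d_r a m := Subtype.ext (M.d_r a m.1)

/-- The inclusion of a subcomplex. -/
def subIncl (M : Cplx A C) (S : Submodule K M) (hS : ∀ t, ∀ m ∈ S, M.proj t m ∈ S)
    (hl : ∀ a, ∀ m ∈ S, M.l a m ∈ S) (hr : ∀ a, ∀ m ∈ S, M.r a m ∈ S) (hd : ∀ m ∈ S, M.d m ∈ S) :
    (M.sub S hS hl hr hd).homs M :=
  ⟨S.subtype, fun _ _ h => h, fun _ _ => rfl, fun _ _ => rfl, fun _ => rfl⟩

/-- The kernel of a map of complexes. -/
def kernel {M N : Cplx A C} (f : M.homs N) : Cplx A C := M.sub (ker f.1)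
    (fun t m hm => by rw [mem_ker] at hm ⊢; rw [hom_proj, hm, map_zero])
    (fun a m hm => by rw [mem_ker] at hm ⊢; rw [hom_l, hm, map_zero])
    (fun a m hm => by rw [mem_ker] at hm ⊢; rw [hom_r, hm, map_zero])
    (fun m hm => by rw [mem_ker] at hm ⊢; rw [hom_d, hm, map_zero])

/-- The inclusion of the kernel. -/
def kernelIncl {M N : Cplx A C} (f : M.homs N) : (kernel f).homs M := subIncl _ _ _ _ _ _

end Cplx

namespace Cplx

/-! ### Twisted direct sums -/

lemma tmapLin_tm {M M' : Cplx A B} {N N' : Cplx B C} (f : M →ₗ[K] M')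
    (g : N →ₗ[K] N') (hf : ∀ b m, f (M.r b m) = M'.r b (f m))
    (hg : ∀ b n, g (N.l b n) = N'.l b (g n)) (m : M) (n : N) :
    (tmapLin f g hf hg : tensor M N →ₗ[K] tensor M' N') (tm m n) =
      tm (f m) (g n) := tmapLin_tmk f g hf hg m n

variable {ι : Type} [DecidableEq ι]

/-- A differential on the direct sum of a family of complexes `M i`, each placed with its
cohomological degree lowered by `n i`. -/
structure Twist (M : ι → Cplx A C) (n : ι → ℤ) where
  D : (Π₀ i, M i) →ₗ[K] Π₀ i, M i
  mem : ∀ i t m, m ∈ (M i).gr t → ∀ j,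
    D (DFinsupp.single i m) j ∈ (M j).gr (t.1 - n i + 1 + n j, t.2)
  sq : ∀ i m, D (D (DFinsupp.single i m)) = 0
  l : ∀ a i m j, D (DFinsupp.single i ((M i).l a m)) j = (M j).l a (D (DFinsupp.single i m) j)
  r : ∀ c i m j, D (DFinsupp.single i ((M i).r c m)) j = (M j).r c (D (DFinsupp.single i m) j)

variable {M : ι → Cplx A C} {n : ι → ℤ}

lemma dfinsupp_induction {p : (Π₀ i, M i) → Prop}
    (h : ∀ i, ∀ t, ∀ m ∈ (M i).gr t, p (DFinsupp.single i m)) (h₀ : p 0)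
    (hadd : ∀ x y, p x → p y → p (x + y)) (x : Π₀ i, M i) : p x := by
  refine DFinsupp.induction x h₀ fun i m x _ h0 hx => hadd _ _ ?_ hx
  clear h0
  induction m using (M i).induction with
  | hp t m hm => exact h i t m hm
  | hadd m m' h h' => rw [DFinsupp.single_add]; exact hadd _ _ h h'

/-- The direct sum of a family of complexes with a given differential. -/
def twsum (T : Twist M n) : Cplx A C where
  carrier := Π₀ i, M i
  gr t :=
    { carrier := {x | ∀ i, x i ∈ (M i).gr (t.1 + n i, t.2)}
      zero_mem' := fun i => zero_mem _
      add_mem' := fun hx hy i => add_mem (hx i) (hy i)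
      smul_mem' := fun c x hx i => Submodule.smul_mem _ c (hx i) }
  internal := by
    refine isInternal_of_projections
      (fun t => DFinsupp.mapRange.linearMap fun i => (M i).proj (t.1 + n i, t.2)) ?_ ?_ ?_
    · intro t x hx
      ext i
      simpa using (M i).proj_of_mem (hx i)
    · intro s t h x hx
      ext i
      simpa using (M i).proj_of_ne (hx i) (by
        intro e; apply h; simp only [Prod.mk.injEq, add_left_inj] at e; exact Prod.ext e.1 e.2)
    · refine dfinsupp_induction (fun i t m hm => ?_) (zero_mem _) fun x y => add_mem
      refine mem_iSup_of_mem (t.1 - n i, t.2) fun j => ?_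
      by_cases h : i = j
      · subst h; simpa using hm
      · rw [DFinsupp.single_eq_of_ne (Ne.symm h)]; exact zero_mem _
  l := AlgHom.ofLinearMap
    { toFun := fun a => DFinsupp.mapRange.linearMap fun i => (M i).l a
      map_add' := fun a a' => by ext; simp
      map_smul' := fun x a => by ext; simp }
    (by ext; simp) (fun a a' => by ext; simp)
  r := AlgHom.ofLinearMap
    { toFun := fun a => DFinsupp.mapRange.linearMap fun i => (M i).r a
      map_add' := fun a a' => by ext; simp
      map_smul' := fun x a => by ext; simp }
    (by ext; simp) (fun a a' => by ext; simp)
  l_r a c m := by ext i; exact (M i).l_r a c (m i)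
  l_mem {q a p q' m} ha hm := fun i => (M i).l_mem ha (hm i)
  r_mem {q a p q' m} ha hm := fun i => (M i).r_mem ha (hm i)
  d := T.D
  d_mem {p q m} hm := fun j => by
    classical
    have : m = ∑ i ∈ m.support, DFinsupp.single i (m i) := (DFinsupp.sum_single (f := m)).symm
    rw [this, map_sum, DFinsupp.finset_sum_apply]
    refine sum_mem fun i _ => ?_
    have := T.mem i _ _ (hm i) j
    simpa using this
  d_d m := by
    have : T.D ∘ₗ T.D = 0 := DFinsupp.lhom_ext fun i m => T.sq i m
    exact LinearMap.congr_fun this m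
  d_l a m := by
    have : T.D ∘ₗ (DFinsupp.mapRange.linearMap fun i => (M i).l a) =
        (DFinsupp.mapRange.linearMap fun i => (M i).l a) ∘ₗ T.D :=
      DFinsupp.lhom_ext fun i m => by ext j; simpa using T.l a i m j
    exact LinearMap.congr_fun this m
  d_r a m := by
    have : T.D ∘ₗ (DFinsupp.mapRange.linearMap fun i => (M i).r a) =
        (DFinsupp.mapRange.linearMap fun i => (M i).r a) ∘ₗ T.D :=
      DFinsupp.lhom_ext fun i m => by ext j; simpa using T.r a i m j
    exact LinearMap.congr_fun this m

variable (T : Twist M n)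

/-- The inclusion of a summand. -/
def twIn (i : ι) : M i →ₗ[K] twsum T := DFinsupp.lsingle (M := fun i => (M i)) i

/-- The projection to a summand. -/
def twPr (i : ι) : twsum T →ₗ[K] M i := DFinsupp.lapply (M := fun i => (M i)) i

lemma twPr_twIn (i : ι) (m : M i) : twPr T i (twIn T i m) = m :=
  DFinsupp.single_eq_same (β := fun i => (M i))

lemma twPr_twIn_of_ne {i j : ι} (h : j ≠ i) (m : M i) : twPr T j (twIn T i m) = 0 :=
  DFinsupp.single_eq_of_ne (β := fun i => (M i)) h

lemma tw_ext {x y : twsum T} (h : ∀ i, twPr T i x = twPr T i y) : x = y := DFinsupp.ext h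

lemma tw_hom_ext {X : Type*} [AddCommGroup X] [Module K X] {f g : twsum T →ₗ[K] X}
    (h : ∀ i m, f (twIn T i m) = g (twIn T i m)) : f = g :=
  DFinsupp.lhom_ext (M := fun i => (M i)) h

lemma tw_sum (x : twsum T) : ∃ S : Finset ι, x = ∑ i ∈ S, twIn T i (twPr T i x) := by
  classical
  exact ⟨_, (DFinsupp.sum_single (f := (x : Π₀ i, M i))).symm⟩

lemma mem_twsum_gr {t : ℤ × ℤ} {x : twsum T} :
    x ∈ (twsum T).gr t ↔ ∀ i, twPr T i x ∈ (M i).gr (t.1 + n i, t.2) := Iff.rfl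

lemma twIn_mem {i : ι} {t : ℤ × ℤ} {m : M i} (hm : m ∈ (M i).gr t) :
    twIn T i m ∈ (twsum T).gr (t.1 - n i, t.2) := by
  rw [mem_twsum_gr]
  intro j
  by_cases h : j = i
  · subst h; rw [twPr_twIn]; simpa using hm
  · rw [twPr_twIn_of_ne T h]; exact zero_mem _

lemma twPr_l (i : ι) (a : A) (x : twsum T) :
    twPr T i ((twsum T).l a x) = (M i).l a (twPr T i x) := rfl

lemma twPr_r (i : ι) (a : C) (x : twsum T) :
    twPr T i ((twsum T).r a x) = (M i).r a (twPr T i x) := rfl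

lemma twIn_l (i : ι) (a : A) (m : M i) : (twsum T).l a (twIn T i m) = twIn T i ((M i).l a m) := by
  refine tw_ext T fun j => ?_
  rw [twPr_l]
  by_cases h : j = i
  · subst h; rw [twPr_twIn, twPr_twIn]
  · rw [twPr_twIn_of_ne T h, twPr_twIn_of_ne T h, map_zero]

lemma twIn_r (i : ι) (a : C) (m : M i) : (twsum T).r a (twIn T i m) = twIn T i ((M i).r a m) := by
  refine tw_ext T fun j => ?_
  rw [twPr_r]
  by_cases h : j = i
  · subst h; rw [twPr_twIn, twPr_twIn]
  · rw [twPr_twIn_of_ne T h, twPr_twIn_of_ne T h, map_zero]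

lemma twsum_sgn_twIn (i : ι) (m : M i) :
    (twsum T).sgn (twIn T i m) = ((n i).negOnePow : ℤ) • twIn T i ((M i).sgn m) := by
  induction m using (M i).induction with
  | hp t m hm =>
    rw [sgn_apply _ (twIn_mem T hm), sgn_apply _ hm, map_smul, ← Int.cast_smul_eq_zsmul K,
      smul_smul, ← Int.cast_mul, ← Units.val_mul, Int.negOnePow_sub, mul_comm]
  | hadd m m' h h' => simp only [map_add, h, h', smul_add]

/-- A twisted direct sum of K-flat complexes is K-flat if its differential is triangular. -/
lemma twsum_isKFlatRight {M : ι → Cplx A B} (T : Twist M n) (ρ : ι → ℕ)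
    (hM : ∀ i, IsKFlatRight (M i))
    (h : ∀ i m, twPr T i ((twsum T).d (twIn T i m)) = ((n i).negOnePow : ℤ) • (M i).d m)
    (h' : ∀ i j m, j ≠ i → ρ i ≤ ρ j → twPr T j ((twsum T).d (twIn T i m)) = 0) :
    IsKFlatRight (twsum T) := fun C N N' f hf => by
  rw [isQis_iff]
  let a (X : Cplx B C) (i : ι) : tensor (M i) X →ₗ[K] tensor (twsum T) X :=
    tmapLin (twIn T i) LinearMap.id (fun b m => (twIn_r T i b m).symm) fun _ _ => rfl
  let p (X : Cplx B C) (i : ι) : tensor (twsum T) X →ₗ[K] tensor (M i) X :=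
    tmapLin (twPr T i) LinearMap.id (fun b m => twPr_r T i b m) fun _ _ => rfl
  have ha (X : Cplx B C) (i m x) : a X i (tm m x) = tm (twIn T i m) x := tmapLin_tm _ _ _ _ _ _
  have hp (X : Cplx B C) (i m x) : p X i (tm m x) = tm (twPr T i m) x := tmapLin_tm _ _ _ _ _ _
  have hpa (X : Cplx B C) (i x) : p X i (a X i x) = x := by
    induction x using tensor_induction with
    | h m x => rw [ha, hp, twPr_twIn]
    | hadd x y hx hy => rw [map_add, map_add, hx, hy]
  have hpa' (X : Cplx B C) (i j x) (hj : j ≠ i) : p X j (a X i x) = 0 := by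
    induction x using tensor_induction with
    | h m x => rw [ha, hp, twPr_twIn_of_ne T hj, map_zero, LinearMap.zero_apply]
    | hadd x y hx hy => rw [map_add, map_add, hx, hy, add_zero]
  have hsum (X : Cplx B C) (u) : ∃ S : Finset ι, ∀ S', S ⊆ S' → u = ∑ i ∈ S', a X i (p X i u) := by
    induction u using tensor_induction with
    | h m x =>
      obtain ⟨S, hS⟩ := tw_sum T m
      refine ⟨S, fun S' h => ?_⟩
      have : m = ∑ i ∈ S', twIn T i (twPr T i m) := by
        rw [← Finset.sum_subset h fun i _ hi => ?_, ← hS]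
        rw [hS, map_sum, sum_eq_zero fun j hj => twPr_twIn_of_ne T (by
          rintro rfl; exact hi hj) _, map_zero]
      simp only [hp, ha]
      conv_lhs => rw [this, map_sum, LinearMap.sum_apply]
    | hadd x y hx hy =>
      obtain ⟨S, hS⟩ := hx
      obtain ⟨S', hS'⟩ := hy
      refine ⟨S ∪ S', fun S'' h => ?_⟩
      simp only [map_add]
      rw [sum_add_distrib, ← hS _ (Finset.union_subset_left h),
        ← hS' _ (Finset.union_subset_right h)]
  have hd (X : Cplx B C) (i x) :
      p X i ((tensor (twsum T) X).d (a X i x)) = ((n i).negOnePow : ℤ) • (tensor (M i) X).d x := by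
    induction x using tensor_induction with
    | h m x =>
      rw [ha, tensor_d, map_add, hp, hp, h, twsum_sgn_twIn, map_zsmul (twPr T i), twPr_twIn, tensor_d,
        smul_add, map_zsmul, map_zsmul, LinearMap.smul_apply, LinearMap.smul_apply]
    | hadd x y hx hy => simp only [map_add, hx, hy, smul_add]
  have hd' (X : Cplx B C) (i j x) (hj : j ≠ i) (hr : ρ i ≤ ρ j) :
      p X j ((tensor (twsum T) X).d (a X i x)) = 0 := by
    induction x using tensor_induction with
    | h m x =>
      rw [ha, tensor_d, map_add, hp, hp, h' i j m hj hr, twsum_sgn_twIn,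
        map_zsmul (twPr T j), twPr_twIn_of_ne T hj]
      simp
    | hadd x y hx hy => simp only [map_add, hx, hy, add_zero]
  refine RelAcyclic.of_pieces (tensor (twsum T) N).d_d (tensor (twsum T) N').d_d (hom_d _) ρ
    (fun i => (n i).negOnePow) (fun i => (isQis_iff _).1 (hM i C N N' f hf)) (a N) (p N) (a N')
    (p N') (hpa N) (hpa' N) (hpa N') (hpa' N') (fun u => (hsum N u).imp fun S h => h S subset_rfl)
    (fun u => (hsum N' u).imp fun S h => h S subset_rfl) (fun i x => ?_) (fun i x => ?_) (hd N)
    (hd' N) (hd N') (hd' N')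
  · induction x using tensor_induction with
    | h m x => simp only [ha, tmap_tm, idHom_apply]
    | hadd x y hx hy => simp only [map_add, hx, hy]
  · induction x using tensor_induction with
    | h m x => simp only [hp, tmap_tm, idHom_apply]
    | hadd x y hx hy => simp only [map_add, hx, hy]

lemma twsum_isKFlatLeft {M : ι → Cplx A B} (T : Twist M n) (ρ : ι → ℕ)
    (hM : ∀ i, IsKFlatRight (M i).flip)
    (h : ∀ i m, twPr T i ((twsum T).d (twIn T i m)) = ((n i).negOnePow : ℤ) • (M i).d m)
    (h' : ∀ i j m, j ≠ i → ρ i ≤ ρ j → twPr T j ((twsum T).d (twIn T i m)) = 0) :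
    IsKFlatLeft (twsum T) :=
  .of_flip (twsum_isKFlatRight (M := fun i => (M i).flip)
    ({ D := T.D, mem := T.mem, sq := T.sq, l := T.r, r := T.l } : Twist (fun i => (M i).flip) n)
    ρ hM h h')

/-! ### Flat correspondences -/

lemma sgn_corr {Z : GrAlg K} (f : A.GrHom Z) (g : C.GrHom Z) (z : corr f g) :
    (corr f g).sgn z = z := by
  induction z using (corr f g).induction with
  | hp t x hx =>
    rw [sgn_apply _ hx]
    dsimp only [corr] at hx
    split_ifs at hx with h
    · rw [h]; simp
    · have : x = 0 := hx
      rw [this, smul_zero]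
  | hadd x y hx hy => rw [map_add, hx, hy]

/-- If `b` is a basis of `M` as a right module, then every element of `M ⊗ X` is uniquely of the form
`∑ b_j ⊗ x_j`. -/
lemma tensor_basis_bijective (M : Cplx A B) {r : ℕ} (b : Fin r → M)
    (hb : Bijective fun c : Fin r → B => ∑ j, M.r (c j) (b j)) (X : Cplx B C) :
    Bijective fun x : Fin r → X => ∑ j, tm (b j) (x j) := by
  let e : (Fin r → B) →ₗ[K] M :=
    { toFun := fun c => ∑ j, M.r (c j) (b j)
      map_add' := fun c c' => by simp [sum_add_distrib]
      map_smul' := fun x c => by simp [smul_sum] }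
  let E : (Fin r → B) ≃ₗ[K] M := LinearEquiv.ofBijective e hb
  have hE (c) : E c = ∑ j, M.r (c j) (b j) := rfl
  have hEs (x : B) (z : M) (j) : E.symm (M.r x z) j = x * E.symm z j := by
    have : E (fun j => x * E.symm z j) = M.r x z := by
      conv_rhs => rw [← E.apply_symm_apply z]
      simp only [hE, map_mul, map_sum, mul_apply]
    rw [← this, E.symm_apply_apply]
  have hbE (j) : b j = E (Pi.single j 1) := by
    rw [hE, sum_eq_single j]
    · simp
    · intro i _ h; simp [Pi.single_eq_of_ne h]
    · simp
  let Ψ : tensor M X →ₗ[K] (Fin r → X) :=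
    tensorLift (LinearMap.mk₂ K (fun z x j => X.l (E.symm z j) x)
      (fun z z' x => by ext j; simp) (fun c z x => by ext j; simp) (fun z x x' => by ext j; simp)
      (fun c z x => by ext j; simp)) fun z c x => by
        ext j
        change X.l (E.symm (M.r c z) j) x = X.l (E.symm z j) (X.l c x)
        rw [hEs, mul_comm, map_mul]; rfl
  have hΨ (z : M) (x j) : Ψ (tm z x) j = X.l (E.symm z j) x := congrFun (tensorLift_tm _ _ _ _) j
  refine Function.bijective_iff_has_inverse.2 ⟨Ψ, fun x => ?_, fun x => ?_⟩
  · ext j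
    dsimp only
    rw [map_sum, Finset.sum_apply, sum_eq_single j]
    · rw [hΨ, hbE, E.symm_apply_apply]; simp
    · intro i _ h; rw [hΨ, hbE, E.symm_apply_apply]; simp [Pi.single_eq_of_ne (Ne.symm h)]
    · simp
  · induction x using tensor_induction with
    | h z x =>
      have hj (j) : tm (b j) (Ψ (tm z x) j) = tm (M.r (E.symm z j) (b j)) x := by
        rw [hΨ]; exact (tm_balance _ _ _).symm
      dsimp only
      rw [sum_congr rfl fun j _ => hj j, ← LinearMap.sum_apply, ← map_sum]
      congr 2
      exact E.apply_symm_apply z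
    | hadd x y hx hy =>
      simp only [map_add, Pi.add_apply, sum_add_distrib] at hx hy ⊢
      rw [hx, hy]

lemma tensor_basis_d (M : Cplx A B) (hs : ∀ m, M.sgn m = m) (hd₀ : ∀ m, M.d m = 0) {r : ℕ}
    (b : Fin r → M) (X : Cplx B C) (x : Fin r → X) :
    (tensor M X).d (∑ j, tm (b j) (x j)) = ∑ j, tm (b j) (X.d (x j)) := by
  rw [map_sum]
  refine sum_congr rfl fun j _ => ?_
  rw [tensor_d, hs, hd₀, map_zero, LinearMap.zero_apply, zero_add]

/-- A bimodule with zero differential, concentrated in even cohomological degrees, is K-flat over a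
factor over which it has a finite basis. -/
lemma isKFlatRight_of_basis (M : Cplx A B) (hs : ∀ m, M.sgn m = m) (hd₀ : ∀ m, M.d m = 0) {r : ℕ}
    (b : Fin r → M)
    (hb : Bijective fun c : Fin r → B => ∑ j, M.r (c j) (b j)) :
    IsKFlatRight M := fun C N N' F hF => by
  have hbij (X : Cplx B C) := tensor_basis_bijective M b hb X
  have hd (X : Cplx B C) (x : Fin r → X) := tensor_basis_d M hs hd₀ b X x
  have hG (x : Fin r → N) :
      (tmap (idHom M) F).1 (∑ j, tm (b j) (x j)) = ∑ j, tm (b j) (F.1 (x j)) := by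
    rw [map_sum]
    refine sum_congr rfl fun j _ => ?_
    rw [tmap_tm, idHom_apply]
  rw [isQis_iff] at hF ⊢
  intro U V hU hUV
  obtain ⟨U, rfl⟩ := (hbij N).2 U
  obtain ⟨V, rfl⟩ := (hbij N').2 V
  dsimp only at hU hUV
  rw [hd] at hU
  rw [hd, hG] at hUV
  have h₁ (j) := congrFun ((hbij N).1 (a₂ := 0) (hU.trans (by simp))) j
  have h₂ (j) := congrFun ((hbij N').1 hUV) j
  choose x y hx hy using fun j => hF (U j) (V j) (h₁ j) (h₂ j)
  refine ⟨∑ j, tm (b j) (x j), ∑ j, tm (b j) (y j), ?_, ?_⟩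
  · rw [hd]
    exact sum_congr rfl fun j _ => congrArg _ (hx j)
  · rw [hd, hG, ← sum_add_distrib]
    exact sum_congr rfl fun j _ => (congrArg _ (hy j)).trans (map_add _ _ _)

lemma corr_isKFlatRight {Z : GrAlg K} (f : A.GrHom Z) (g : B.GrHom Z) {r : ℕ} (b : Fin r → Z)
    (hb : Bijective fun c : Fin r → B => ∑ j, g.hom (c j) * b j) :
    IsKFlatRight (corr f g) :=
  isKFlatRight_of_basis (corr f g) (sgn_corr f g) (fun _ => rfl) b hb

lemma corr_isKFlatLeft {Z : GrAlg K} (f : A.GrHom Z) (g : C.GrHom Z) {r : ℕ} (b : Fin r → Z)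
    (hb : Bijective fun c : Fin r → A => ∑ j, f.hom (c j) * b j) :
    IsKFlatLeft (corr f g) :=
  .of_flip (corr_isKFlatRight g f b hb)

end Cplx

namespace Cplx

lemma IsKFlatRight.of_flip {M : Cplx A B} (h : IsKFlatLeft M.flip) : IsKFlatRight M :=
  fun C N N' f hf => by
  have hf' : IsQis (flipHom f) := hf
  refine (h C N.flip N'.flip (flipHom f) hf').of_square _ (swapLin M N) (swapLin M N')
    (swapLin_bijective M N) (swapLin_bijective M N') (swapLin_d M N) (swapLin_d M N') fun x => ?_
  induction x using tensor_induction with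
  | h m n =>
    have e (n : N) (m : M) :
        (tmap (flipHom f) (idHom M.flip)).1 (tm (M := N.flip) (N := M.flip) n m) =
          tm (M := N'.flip) (N := M.flip) (f.1 n) m := tmap_tm (flipHom f) (idHom M.flip) n m
    rw [tmap_tm, swapLin_tm, swapLin_tm, map_add, e, e, hom_sgn, idHom_apply]
  | hadd x y hx hy => simp only [map_add, hx, hy]

/-! ### Elements of structure sheaves of correspondences -/

section Corr

variable {Z : GrAlg K} (f : A.GrHom Z) (g : C.GrHom Z)

/-- The identification of `Z` with the vector space that underlies the bimodule `corr f g`. -/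
def toCorr : Z ≃ₗ[K] (corr f g) := LinearEquiv.refl K Z

lemma corr_l (a : A) (z : Z) : (corr f g).l a (toCorr f g z) = toCorr f g (f.hom a * z) := rfl

lemma corr_r (c : C) (z : Z) : (corr f g).r c (toCorr f g z) = toCorr f g (g.hom c * z) := rfl

lemma corr_d (x : corr f g) : (corr f g).d x = 0 := rfl

lemma toCorr_mem {q : ℤ} {z : Z} (hz : z ∈ Z.gr q) : toCorr f g z ∈ (corr f g).gr (0, q) := by
  change z ∈ (if (0 : ℤ) = 0 then Z.gr q else ⊥)
  rwa [if_pos rfl]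

lemma exists_of_mem_corr {t : ℤ × ℤ} {x : corr f g} (hx : x ∈ (corr f g).gr t) :
    x = 0 ∨ t.1 = 0 ∧ ∃ z ∈ Z.gr t.2, x = toCorr f g z := by
  dsimp only [corr] at hx
  split_ifs at hx with h
  · exact Or.inr ⟨h, x, hx, rfl⟩
  · exact Or.inl hx

end Corr

/-! ### Free bimodules -/

/-- The algebra `A` as a complex of left modules. -/
def freeL (A : GrAlg K) : Cplx A (GrAlg.base K) := corr (GrAlg.GrHom.id A) (GrAlg.ofBase A)

/-- The algebra `C` as a complex of right modules. -/
def freeR (C : GrAlg K) : Cplx (GrAlg.base K) C := (freeL C).flip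

/-- An element of `A` as an element of the left module `A`. -/
def toL (A : GrAlg K) : A ≃ₗ[K] (freeL A) := toCorr _ _

/-- An element of `C` as an element of the right module `C`. -/
def toR (C : GrAlg K) : C ≃ₗ[K] (freeR C) := toL C

lemma freeL_l (a b : A) : (freeL A).l a (toL A b) = toL A (a * b) := rfl

lemma freeR_r (a b : C) : (freeR C).r a (toR C b) = toR C (a * b) := rfl

lemma freeL_d (x : freeL A) : (freeL A).d x = 0 := rfl

lemma freeR_d (x : freeR C) : (freeR C).d x = 0 := rfl

lemma freeL_sgn (x : freeL A) : (freeL A).sgn x = x := sgn_corr _ _ x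

lemma toL_mem {q : ℤ} {a : A} (ha : a ∈ A.gr q) : toL A a ∈ (freeL A).gr (0, q) :=
  toCorr_mem _ _ ha

lemma toR_mem {q : ℤ} {a : C} (ha : a ∈ C.gr q) : toR C a ∈ (freeR C).gr (0, q) := toL_mem ha

lemma exists_of_mem_freeL {t : ℤ × ℤ} {x : freeL A} (hx : x ∈ (freeL A).gr t) :
    x = 0 ∨ t.1 = 0 ∧ ∃ a ∈ A.gr t.2, x = toL A a := exists_of_mem_corr _ _ hx

lemma exists_of_mem_freeR {t : ℤ × ℤ} {x : freeR C} (hx : x ∈ (freeR C).gr t) :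
    x = 0 ∨ t.1 = 0 ∧ ∃ a ∈ C.gr t.2, x = toR C a := exists_of_mem_freeL hx

lemma freeL_isKFlatLeft (A : GrAlg K) : IsKFlatLeft (freeL A) :=
  corr_isKFlatLeft _ _ (r := 1) (fun _ => 1) (by
    have : (fun c : Fin 1 → A => ∑ j, (GrAlg.GrHom.id A).hom (c j) * 1) =
        Equiv.funUnique (Fin 1) A := by
      ext c; simp [GrAlg.GrHom.id]
    rw [this]; exact Equiv.bijective _)

lemma freeR_isKFlatRight (C : GrAlg K) : IsKFlatRight (freeR C) := .of_flip (freeL_isKFlatLeft C)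

/-- The free bimodule `A ⊗ V ⊗ C` on a complex of graded vector spaces. -/
def Fr (A C : GrAlg K) (V : Cplx (GrAlg.base K) (GrAlg.base K)) : Cplx A C :=
  tensor (tensor (freeL A) V) (freeR C)

variable (V : Cplx (GrAlg.base K) (GrAlg.base K))

lemma Fr_isKFlatRight : IsKFlatRight (Fr A C V) :=
  ((isKFlatRight_base _).tensor (isKFlatRight_base V)).tensor (freeR_isKFlatRight C)

lemma Fr_isKFlatLeft : IsKFlatLeft (Fr A C V) :=
  ((freeL_isKFlatLeft A).tensor (isKFlatLeft_base V)).tensor (isKFlatLeft_base _)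

/-- The element `a ⊗ v ⊗ c` of a free bimodule. -/
def frMk (a : A) (v : V) (c : C) : Fr A C V := tm (tm (toL A a) v) (toR C c)

/-- The inclusion of the generators. -/
def frGen : V →ₗ[K] Fr A C V :=
  (tm (M := tensor (freeL A) V) (N := freeR C)).flip (toR C 1) ∘ₗ tm (toL A 1)

lemma frGen_l_r (a : A) (v : V) (c : C) :
    (Fr A C V).l a ((Fr A C V).r c (frGen V v)) = frMk V a v c := by
  change (Fr A C V).l a ((Fr A C V).r c (tm (tm (toL A 1) v) (toR C 1))) = _
  have h₁ := tensor_r (M := tensor (freeL A) V) (N := freeR C) c (tm (toL A 1) v) (toR C 1)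
  have h₂ := tensor_l (M := tensor (freeL A) V) (N := freeR C) a (tm (toL A 1) v) (toR C c)
  rw [freeR_r, mul_one] at h₁
  have h₃ := tensor_l a (toL A 1) v
  rw [freeL_l, mul_one] at h₃
  rw [h₃] at h₂
  exact (congrArg ((Fr A C V).l a) h₁).trans h₂

lemma fr_induction {p : Fr A C V → Prop}
    (h : ∀ a v c, p ((Fr A C V).l a ((Fr A C V).r c (frGen V v))))
    (hadd : ∀ x y, p x → p y → p (x + y)) (x : Fr A C V) : p x := by
  refine tensor_induction (fun x c => ?_) hadd x
  obtain ⟨c, rfl⟩ := (toR C).surjective c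
  induction x using tensor_induction with
  | h a v =>
    obtain ⟨a, rfl⟩ := (toL A).surjective a
    have := h a v c
    rwa [frGen_l_r] at this
  | hadd x y hx hy => rw [map_add, LinearMap.add_apply]; exact hadd _ _ hx hy

lemma fr_map_mem {X : Type u} [AddCommGroup X] [Module K X] {f : Fr A C V →ₗ[K] X}
    {U : Submodule K X} {t : ℤ × ℤ}
    (h : ∀ a q v s c q', a ∈ A.gr q → v ∈ V.gr s → c ∈ C.gr q' → s + (0, q + q') = t →
      f ((Fr A C V).l a ((Fr A C V).r c (frGen V v))) ∈ U)
    {x : Fr A C V} (hx : x ∈ (Fr A C V).gr t) : f x ∈ U := by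
  let f' : tensor (tensor (freeL A) V) (freeR C) →ₗ[K] X := f
  change f' x ∈ U
  refine map_mem_of_tensor_gr (fun i j x c hij hx hc => ?_) hx
  rcases exists_of_mem_freeR hc with rfl | ⟨hj, c, hc, rfl⟩
  · rw [map_zero, map_zero]; exact U.zero_mem
  · change (f' ∘ₗ tm.flip (toR C c)) x ∈ U
    refine map_mem_of_tensor_gr (fun k s a v hks ha hv => ?_) hx
    rcases exists_of_mem_freeL ha with rfl | ⟨hk, a, ha, rfl⟩
    · rw [map_zero, LinearMap.zero_apply, map_zero]; exact U.zero_mem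
    · have := h a k.2 v s c j.2 ha hv hc (by
        rw [← hij, ← hks]; ext <;> simp [hk, hj]; ring)
      exact (congrArg (fun y => f y ∈ U) (frGen_l_r V a v c)).mp this

lemma frGen_mem {t : ℤ × ℤ} {v : V} (hv : v ∈ V.gr t) :
    (frGen V v : Fr A C V) ∈ (Fr A C V).gr t := by
  refine tm_mem (tm_mem (toL_mem (SetLike.one_mem_graded A.gr)) hv rfl)
    (toR_mem (SetLike.one_mem_graded C.gr)) ?_
  ext <;> simp

lemma frGen_d (v : V) : (Fr A C V).d (frGen V v) = frGen V (V.d v) := by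
  change (tensor (tensor (freeL A) V) (freeR C)).d (tm (tm (toL A 1) v) (toR C 1)) =
    tm (tm (toL A 1) (V.d v)) (toR C 1)
  rw [tensor_d, tensor_d, freeL_d, freeR_d, freeL_sgn, map_zero, map_zero, LinearMap.zero_apply,
    zero_add, add_zero]

section Lift

variable {V} {X : Cplx A C}

/-- The map of bimodules that is given by `t` on the generators, on `A ⊗ V`. -/
def frLinAux (t : V →ₗ[K] X) : tensor (freeL A) V →ₗ[K] X :=
  tensorLift (LinearMap.mk₂ K (fun a v => X.l ((toL A).symm a) (t v)) (fun a a' v => by simp)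
    (fun x a v => by simp) (fun a v v' => by simp) (fun x a v => by simp)) fun a x v => by
    have h₁ : V.l x v = (show K from x) • v := V.l_base x v
    have h₂ : (freeL A).r x a = (show K from x) • a := (freeL A).r_base x a
    rw [h₁, h₂, map_smul, map_smul, LinearMap.smul_apply]

lemma frLinAux_tm (t : V →ₗ[K] X) (a : A) (v : V) :
    frLinAux t (tm (toL A a) v) = X.l a (t v) := by
  rw [frLinAux, tensorLift_tm, LinearMap.mk₂_apply, LinearEquiv.symm_apply_apply]

/-- The map of bimodules that is given by `t` on the generators. -/
def frLin (t : V →ₗ[K] X) : Fr A C V →ₗ[K] X := tensorLift (M := tensor (freeL A) V) (N := freeR C)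
    (LinearMap.mk₂ K (fun x c => X.r ((toR C).symm c) (frLinAux t x)) (fun a a' v => by simp)
    (fun x a v => by simp) (fun a v v' => by simp) (fun x a v => by simp)) fun y x c => by
    have h₁ : (tensor (freeL A) V).r x y = (show K from x) • y := r_base _ x y
    have h₂ : (freeR C).l x c = (show K from x) • c := l_base _ x c
    rw [h₁, h₂, map_smul, map_smul, LinearMap.smul_apply]

lemma frLin_apply (t : V →ₗ[K] X) (a : A) (v : V) (c : C) :
    frLin t ((Fr A C V).l a ((Fr A C V).r c (frGen V v))) = X.l a (X.r c (t v)) := by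
  rw [frGen_l_r, X.l_r, ← frLinAux_tm]
  refine (tensorLift_tm (M := tensor (freeL A) V) (N := freeR C) _ _ _ _).trans ?_
  rw [LinearMap.mk₂_apply, LinearEquiv.symm_apply_apply]

lemma frLin_gen (t : V →ₗ[K] X) (v : V) : frLin t (frGen V v : Fr A C V) = t v := by
  have := frLin_apply t (1 : A) v (1 : C)
  simpa using this

lemma frLin_l (t : V →ₗ[K] X) (a : A) (x : Fr A C V) :
    frLin t ((Fr A C V).l a x) = X.l a (frLin t x) := by
  induction x using fr_induction with
  | h a' v c =>
    have := frLin_apply t (a * a') v c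
    rw [map_mul, map_mul] at this
    rw [frLin_apply]; exact this
  | hadd x y hx hy => rw [map_add, map_add, map_add, map_add, hx, hy]

lemma frLin_r (t : V →ₗ[K] X) (c : C) (x : Fr A C V) :
    frLin t ((Fr A C V).r c x) = X.r c (frLin t x) := by
  induction x using fr_induction with
  | h a v c' =>
    have := frLin_apply t a v (c * c')
    rw [map_mul, map_mul] at this
    rw [frLin_apply, ← l_r, ← X.l_r]; exact this
  | hadd x y hx hy => rw [map_add, map_add, map_add, map_add, hx, hy]

lemma frLin_mem {t : V →ₗ[K] X} {e : ℤ × ℤ}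
    (ht : ∀ s, ∀ v ∈ V.gr s, t v ∈ X.gr (s + e)) {s : ℤ × ℤ} {x : Fr A C V}
    (hx : x ∈ (Fr A C V).gr s) : frLin t x ∈ X.gr (s + e) := by
  refine fr_map_mem V (fun a q v s' c q' ha hv hc h => ?_) hx
  rw [frLin_apply]
  have := X.l_mem ha (X.r_mem hc (ht s' v hv))
  convert this using 2
  rw [← h]; ext <;> simp; ring

lemma frLin_d (t : V →ₗ[K] X) (x : Fr A C V) : frLin t ((Fr A C V).d x) = frLin (t ∘ₗ V.d) x := by
  induction x using fr_induction with
  | h a v c => rw [d_l, d_r, frGen_d, frLin_apply, frLin_apply, LinearMap.comp_apply]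
  | hadd x y hx hy => rw [map_add, map_add, map_add, hx, hy]

lemma map_frLin {Y : Cplx A C} (t : V →ₗ[K] X)
    (f : X →ₗ[K] Y) (hl : ∀ a x, f (X.l a x) = Y.l a (f x))
    (hr : ∀ c x, f (X.r c x) = Y.r c (f x)) (x : Fr A C V) :
    f (frLin t x) = frLin (f ∘ₗ t) x := by
  induction x using fr_induction with
  | h a v c => rw [frLin_apply, frLin_apply, hl, hr, LinearMap.comp_apply]
  | hadd x y hx hy => rw [map_add, map_add, map_add, hx, hy]

lemma frLin_gen_comp {f : Fr A C V →ₗ[K] X} (hl : ∀ a x, f ((Fr A C V).l a x) = X.l a (f x))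
    (hr : ∀ c x, f ((Fr A C V).r c x) = X.r c (f x)) (x : Fr A C V) :
    frLin (f ∘ₗ frGen V) x = f x := by
  induction x using fr_induction with
  | h a v c => rw [frLin_apply, hl, hr, LinearMap.comp_apply]
  | hadd x y hx hy => rw [map_add, map_add, hx, hy]

/-- The map of complexes of bimodules that is given by `t` on the generators. -/
def frHom (t : V →ₗ[K] X) (ht : ∀ s, ∀ v ∈ V.gr s, t v ∈ X.gr s)
    (hd : ∀ v, t (V.d v) = X.d (t v)) : (Fr A C V).homs X :=
  ⟨frLin t, fun s x hx => by
    have := frLin_mem (e := 0) (fun s v hv => by rw [add_zero]; exact ht s v hv) hx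
    rwa [add_zero] at this, frLin_l t, frLin_r t, fun x => by
    rw [frLin_d, map_frLin t X.d (fun a x => X.d_l a x) (fun c x => X.d_r c x)]
    congr 2
    exact LinearMap.ext hd⟩

end Lift

/-! ### The bar resolution -/

/-- The complex of graded vector spaces underlying a complex of graded bimodules. -/
def under (M : Cplx A C) : Cplx (GrAlg.base K) (GrAlg.base K) :=
  M.res (GrAlg.ofBase A) (GrAlg.ofBase C)

/-- The identification of the underlying vector spaces. -/
def toUnder (M : Cplx A C) : M ≃ₗ[K] M.under := LinearEquiv.refl K M

lemma toUnder_symm_mem (M : Cplx A C) {t : ℤ × ℤ} {m : M.under} :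
    M.toUnder.symm m ∈ M.gr t ↔ m ∈ M.under.gr t := Iff.rfl

lemma toUnder_symm_d (M : Cplx A C) (m : M.under) :
    M.toUnder.symm (M.under.d m) = M.d (M.toUnder.symm m) := rfl

/-- The free bimodule on a bimodule. -/
def frU (M : Cplx A C) : Cplx A C := Fr A C M.under

/-- The augmentation of the free bimodule on a bimodule. -/
def aug (M : Cplx A C) : (frU M).homs M :=
  frHom M.toUnder.symm.toLinearMap (fun _ _ hv => M.toUnder_symm_mem.2 hv) M.toUnder_symm_d

/-- A bimodule as generators of its free bimodule. -/
def gen (M : Cplx A C) : M →ₗ[K] frU M := frGen M.under ∘ₗ M.toUnder.toLinearMap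

lemma aug_gen (M : Cplx A C) (m : M) : (aug M).1 (gen M m) = m :=
  frLin_gen (V := M.under) (X := M) _ _

lemma gen_mem (M : Cplx A C) {t : ℤ × ℤ} {m : M} (hm : m ∈ M.gr t) :
    gen M m ∈ (frU M).gr t := frGen_mem M.under hm

lemma gen_d (M : Cplx A C) (m : M) : (frU M).d (gen M m) = gen M (M.d m) := frGen_d M.under _

/-- The map of bimodules out of the free bimodule on `M` that extends a linear map. -/
def ext {M X : Cplx A C} (t : M →ₗ[K] X) : frU M →ₗ[K] X :=
  frLin (V := M.under) (t ∘ₗ M.toUnder.symm.toLinearMap)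

section Ext

variable {M X : Cplx A C} (t : M →ₗ[K] X)

lemma ext_gen (m : M) : ext t (gen M m) = t m := frLin_gen (V := M.under) _ _

lemma ext_l (a : A) (x : frU M) : ext t ((frU M).l a x) = X.l a (ext t x) := frLin_l _ _ _

lemma ext_r (a : C) (x : frU M) : ext t ((frU M).r a x) = X.r a (ext t x) := frLin_r _ _ _

lemma ext_d (x : frU M) : ext t ((frU M).d x) = ext (t ∘ₗ M.d) x := frLin_d _ _

lemma ext_mem {e : ℤ × ℤ} (ht : ∀ s, ∀ v ∈ M.gr s, t v ∈ X.gr (s + e)) {s : ℤ × ℤ}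
    {x : frU M} (hx : x ∈ (frU M).gr s) : ext t x ∈ X.gr (s + e) :=
  frLin_mem (V := M.under) ht hx

lemma map_ext {Y : Cplx A C} (f : X →ₗ[K] Y)
    (hl : ∀ a x, f (X.l a x) = Y.l a (f x)) (hr : ∀ c x, f (X.r c x) = Y.r c (f x))
    (x : frU M) : f (ext t x) = ext (f ∘ₗ t) x := map_frLin _ f hl hr x

lemma ext_comp_gen {f : frU M →ₗ[K] X} (hl : ∀ a x, f ((frU M).l a x) = X.l a (f x))
    (hr : ∀ c x, f ((frU M).r c x) = X.r c (f x)) (x : frU M) :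
    ext (f ∘ₗ gen M) x = f x := frLin_gen_comp (V := M.under) hl hr x

end Ext

/-- `M` vanishes in cohomological degrees at least `a`. -/
def Below (M : Cplx A C) (a : ℤ) : Prop := ∀ t, a ≤ t.1 → ∀ m ∈ M.gr t, m = 0

lemma Below.frU {M : Cplx A C} {a : ℤ} (h : Below M a) : Below (frU M) a := fun t ht x hx => by
  have : (LinearMap.id : Fr A C M.under →ₗ[K] _) x ∈ (⊥ : Submodule K (Fr A C M.under)) :=
    fr_map_mem M.under (fun a q v s c q' ha hv hc hs => by
      have : v = 0 := h s (by rw [← hs] at ht; simpa using ht) v hv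
      rw [this, map_zero, map_zero, map_zero, map_zero]; exact zero_mem _) hx
  exact this

/-- The iterated syzygies of a bimodule. -/
def syz (M : Cplx A C) : ℕ → Cplx A C
  | 0 => M
  | i + 1 => kernel (aug (syz M i))

lemma Below.syz {M : Cplx A C} {a : ℤ} (h : Below M a) : ∀ i, Below (syz M i) a
  | 0 => h
  | i + 1 => fun t ht x hx => Subtype.ext ((h.syz i).frU t ht x.1 hx)

end Cplx

namespace Cplx

section Seq

lemma single_mem {ι : Type} [DecidableEq ι] {M : ι → Cplx A C} (n : ι → ℤ) {i : ι} {p q : ℤ}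
    {m : M i} (hm : m ∈ (M i).gr (p + n i, q)) (j : ι) :
    (DFinsupp.single i m : Π₀ i, M i) j ∈ (M j).gr (p + n j, q) := by
  by_cases h : j = i
  · subst h; rwa [DFinsupp.single_eq_same]
  · rw [DFinsupp.single_eq_of_ne h]; exact zero_mem _

lemma single_map {ι : Type} [DecidableEq ι] {M : ι → Cplx A C}
    (f : ∀ i, Module.End K (M i)) (i : ι) (m : M i) (j : ι) :
    (DFinsupp.single i (f i m) : Π₀ i, M i) j = f j ((DFinsupp.single i m : Π₀ i, M i) j) := by
  by_cases h : j = i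
  · subst h; rw [DFinsupp.single_eq_same, DFinsupp.single_eq_same]
  · rw [DFinsupp.single_eq_of_ne h, DFinsupp.single_eq_of_ne h, map_zero]

variable (G : ℕ → Cplx A C) (δ : ∀ i, (G (i + 1)).homs (G i))

/-- The differential of the total complex of a sequence of complexes, on a summand. -/
def seqD : ∀ i, (G i) →ₗ[K] Π₀ i, G i
  | 0 => DFinsupp.lsingle (M := fun i => (G i)) 0 ∘ₗ (G 0).d
  | i + 1 => DFinsupp.lsingle (M := fun i => (G i)) (i + 1) ∘ₗ
        ((((i + 1 : ℕ) : ℤ).negOnePow : ℤ) • (G (i + 1)).d) +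
      DFinsupp.lsingle (M := fun i => (G i)) i ∘ₗ (δ i).1

lemma seqD_zero (m : G 0) : seqD G δ 0 m = DFinsupp.single 0 ((G 0).d m) := rfl

lemma seqD_succ (i : ℕ) (m : (G (i + 1))) : seqD G δ (i + 1) m =
    DFinsupp.single (i + 1) ((((i + 1 : ℕ) : ℤ).negOnePow : ℤ) • (G (i + 1)).d m) +
      DFinsupp.single i ((δ i).1 m) := rfl

lemma lsum_seqD (i : ℕ) (m : G i) :
    DFinsupp.lsum ℕ (seqD G δ) (DFinsupp.single i m) = seqD G δ i m :=
  DFinsupp.lsum_single _ _ _ _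

/-- The total complex of `⋯ → G 2 → G 1 → G 0`, as a twisted direct sum. -/
def seqTwist (hδ : ∀ i x, (δ i).1 ((δ (i + 1)).1 x) = 0) : Twist G (fun i => (i : ℤ)) where
  D := DFinsupp.lsum ℕ (seqD G δ)
  mem i t m hm j := by
    rw [lsum_seqD]
    cases i with
    | zero =>
      rw [seqD_zero]
      refine single_mem (fun i : ℕ => (i : ℤ)) ?_ j
      simpa using (G 0).d_mem hm
    | succ i =>
      rw [seqD_succ]
      refine add_mem (single_mem (fun i : ℕ => (i : ℤ)) ?_ j)
        (single_mem (fun i : ℕ => (i : ℤ)) ?_ j)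
      · rw [show t.1 - ((i + 1 : ℕ) : ℤ) + 1 + ((i + 1 : ℕ) : ℤ) = t.1 + 1 by ring]
        exact zsmul_mem ((G (i + 1)).d_mem hm) _
      · rw [show t.1 - ((i + 1 : ℕ) : ℤ) + 1 + (i : ℤ) = t.1 by push_cast; ring]
        exact hom_gr (δ i) hm
  sq i m := by
    rw [lsum_seqD]
    match i, m with
    | 0, m => rw [seqD_zero, lsum_seqD, seqD_zero, d_d, DFinsupp.single_zero]
    | 1, m =>
      rw [seqD_succ, map_add, lsum_seqD, lsum_seqD, seqD_succ, seqD_zero, map_zsmul (G 1).d, d_d,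
        map_zsmul (δ 0).1, hom_d]
      simp
    | i + 2, m =>
      rw [seqD_succ, map_add, lsum_seqD, lsum_seqD, seqD_succ, seqD_succ, map_zsmul (G (i + 2)).d,
        d_d, map_zsmul (δ (i + 1)).1, hom_d, hδ]
      simp only [smul_zero, DFinsupp.single_zero, zero_add, add_zero]
      rw [← DFinsupp.single_add, ← add_smul]
      have : (((i + 1 + 1 : ℕ) : ℤ).negOnePow : ℤ) + (((i + 1 : ℕ) : ℤ).negOnePow : ℤ) = 0 := by
        rw [show ((i + 1 + 1 : ℕ) : ℤ) = ((i + 1 : ℕ) : ℤ) + 1 by push_cast; ring,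
          Int.negOnePow_succ]
        simp
      rw [this, zero_smul, DFinsupp.single_zero]
  l a i m j := by
    rw [lsum_seqD, lsum_seqD]
    cases i with
    | zero => rw [seqD_zero, seqD_zero, d_l]; exact single_map (fun i => (G i).l a) _ _ _
    | succ i =>
      rw [seqD_succ, seqD_succ, d_l, hom_l, DFinsupp.add_apply, DFinsupp.add_apply, map_add,
        ← map_zsmul]
      exact congrArg₂ _ (single_map (fun i => (G i).l a) _ _ _)
        (single_map (fun i => (G i).l a) _ _ _)
  r a i m j := by
    rw [lsum_seqD, lsum_seqD]
    cases i with
    | zero => rw [seqD_zero, seqD_zero, d_r]; exact single_map (fun i => (G i).r a) _ _ _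
    | succ i =>
      rw [seqD_succ, seqD_succ, d_r, hom_r, DFinsupp.add_apply, DFinsupp.add_apply, map_add,
        ← map_zsmul]
      exact congrArg₂ _ (single_map (fun i => (G i).r a) _ _ _)
        (single_map (fun i => (G i).r a) _ _ _)

variable (hδ : ∀ i x, (δ i).1 ((δ (i + 1)).1 x) = 0)

/-- The total complex of a sequence of complexes. -/
def seqTot : Cplx A C := twsum (seqTwist G δ hδ)

/-- The inclusion of a summand of the total complex. -/
def seqIn (i : ℕ) : G i →ₗ[K] seqTot G δ hδ := twIn (seqTwist G δ hδ) i

lemma seqTot_d_zero (m : G 0) :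
    (seqTot G δ hδ).d (seqIn G δ hδ 0 m) = seqIn G δ hδ 0 ((G 0).d m) :=
  (lsum_seqD G δ 0 m).trans (seqD_zero G δ m)

lemma seqTot_d_succ (i : ℕ) (m : (G (i + 1))) : (seqTot G δ hδ).d (seqIn G δ hδ (i + 1) m) =
      (((i + 1 : ℕ) : ℤ).negOnePow : ℤ) • seqIn G δ hδ (i + 1) ((G (i + 1)).d m) +
        seqIn G δ hδ i ((δ i).1 m) := by
  rw [← map_zsmul]
  exact (lsum_seqD G δ (i + 1) m).trans (seqD_succ G δ i m)

lemma seqTot_l (i : ℕ) (a : A) (m : G i) :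
    (seqTot G δ hδ).l a (seqIn G δ hδ i m) = seqIn G δ hδ i ((G i).l a m) :=
  twIn_l _ i a m

lemma seqTot_r (i : ℕ) (a : C) (m : G i) :
    (seqTot G δ hδ).r a (seqIn G δ hδ i m) = seqIn G δ hδ i ((G i).r a m) :=
  twIn_r _ i a m

lemma seqIn_mem {i : ℕ} {t : ℤ × ℤ} {m : G i} (hm : m ∈ (G i).gr t) :
    seqIn G δ hδ i m ∈ (seqTot G δ hδ).gr (t.1 - i, t.2) := twIn_mem _ hm

lemma seqTot_hom_ext {X : Type*} [AddCommGroup X] [Module K X] {f g : seqTot G δ hδ →ₗ[K] X}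
    (h : ∀ i m, f (seqIn G δ hδ i m) = g (seqIn G δ hδ i m)) : f = g := tw_hom_ext _ h

lemma seqTot_isKFlat (hl : ∀ i, IsKFlatLeft (G i)) (hr : ∀ i, IsKFlatRight (G i)) :
    IsKFlatLeft (seqTot G δ hδ) ∧ IsKFlatRight (seqTot G δ hδ) := by
  have h (i : ℕ) (m : G i) : twPr (seqTwist G δ hδ) i
      ((twsum (seqTwist G δ hδ)).d (twIn (seqTwist G δ hδ) i m)) =
      ((i : ℤ).negOnePow : ℤ) • (G i).d m := by
    cases i with
    | zero =>
      refine (congrArg _ (seqTot_d_zero G δ hδ m)).trans ?_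
      refine (twPr_twIn _ 0 _).trans (by simp)
    | succ i =>
      refine (congrArg _ (seqTot_d_succ G δ hδ i m)).trans ?_
      refine (map_add (twPr (seqTwist G δ hδ) (i + 1)) _ _).trans ?_
      refine (congrArg₂ (· + ·) ((map_zsmul (twPr (seqTwist G δ hδ) (i + 1)) _ _).trans
        (congrArg _ (twPr_twIn _ _ _))) (twPr_twIn_of_ne _ (Nat.succ_ne_self i) _)).trans
        (add_zero _)
  have h' (i j : ℕ) (m : G i) (hj : j ≠ i) (hij : i ≤ j) : twPr (seqTwist G δ hδ) j
      ((twsum (seqTwist G δ hδ)).d (twIn (seqTwist G δ hδ) i m)) = 0 := by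
    cases i with
    | zero =>
      refine (congrArg _ (seqTot_d_zero G δ hδ m)).trans ?_
      exact twPr_twIn_of_ne _ hj _
    | succ i =>
      refine (congrArg _ (seqTot_d_succ G δ hδ i m)).trans ?_
      refine (map_add (twPr (seqTwist G δ hδ) j) _ _).trans ?_
      refine (congrArg₂ (· + ·) ((map_zsmul (twPr (seqTwist G δ hδ) j) _ _).trans
        (congrArg _ (twPr_twIn_of_ne _ hj _))) (twPr_twIn_of_ne _ (by omega) _)).trans (by simp)
  exact ⟨twsum_isKFlatLeft _ id (fun i => .of_flip (hl i)) h h', twsum_isKFlatRight _ id hr h h'⟩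

/-- The linear map on the total complex with the given components. -/
def seqDesc {X : Type u} [AddCommGroup X] [Module K X] (f : ∀ i, (G i) →ₗ[K] X) :
    (seqTot G δ hδ) →ₗ[K] X := DFinsupp.lsum (M := fun i => (G i)) ℕ f

lemma seqDesc_in {X : Type u} [AddCommGroup X] [Module K X] (f : ∀ i, (G i) →ₗ[K] X)
    (i : ℕ) (m : G i) : seqDesc G δ hδ f (seqIn G δ hδ i m) = f i m :=
  DFinsupp.lsum_single _ _ _ _

lemma seqTot_gr_induction {t : ℤ × ℤ} {x : seqTot G δ hδ}
    (hx : x ∈ (seqTot G δ hδ).gr t) {U : Submodule K (seqTot G δ hδ)}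
    (h : ∀ i, ∀ m ∈ (G i).gr (t.1 + i, t.2), seqIn G δ hδ i m ∈ U) : x ∈ U := by
  obtain ⟨S, hS⟩ := tw_sum _ x
  rw [hS]
  exact sum_mem fun i _ => h i _ ((mem_twsum_gr _).1 hx i)

/-- Maps out of a total complex. -/
def seqHom {X : Cplx A C} (f : ∀ i, (G i) →ₗ[K] X)
    (hf : ∀ i t, ∀ m ∈ (G i).gr t, f i m ∈ X.gr (t.1 - i, t.2))
    (hl : ∀ i a m, f i ((G i).l a m) = X.l a (f i m))
    (hr : ∀ i a m, f i ((G i).r a m) = X.r a (f i m))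
    (h₀ : ∀ m, f 0 ((G 0).d m) = X.d (f 0 m))
    (h₁ : ∀ i m, (((i + 1 : ℕ) : ℤ).negOnePow : ℤ) • f (i + 1) ((G (i + 1)).d m) +
      f i ((δ i).1 m) = X.d (f (i + 1) m)) : (seqTot G δ hδ).homs X :=
  ⟨seqDesc G δ hδ f, fun t x hx => by
    refine seqTot_gr_induction G δ hδ (U := (X.gr t).comap (seqDesc G δ hδ f)) hx fun i m hm => ?_
    rw [Submodule.mem_comap, seqDesc_in]
    simpa using hf i _ m hm,
  fun a x => LinearMap.congr_fun (f := seqDesc G δ hδ f ∘ₗ (seqTot G δ hδ).l a)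
    (g := X.l a ∘ₗ seqDesc G δ hδ f) (seqTot_hom_ext G δ hδ fun i m => by
      simp only [LinearMap.comp_apply, seqTot_l, seqDesc_in, hl]) x,
  fun a x => LinearMap.congr_fun (f := seqDesc G δ hδ f ∘ₗ (seqTot G δ hδ).r a)
    (g := X.r a ∘ₗ seqDesc G δ hδ f) (seqTot_hom_ext G δ hδ fun i m => by
      simp only [LinearMap.comp_apply, seqTot_r, seqDesc_in, hr]) x,
  fun x => LinearMap.congr_fun (f := seqDesc G δ hδ f ∘ₗ (seqTot G δ hδ).d)
    (g := X.d ∘ₗ seqDesc G δ hδ f) (seqTot_hom_ext G δ hδ fun i m => by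
      cases i with
      | zero => simp only [LinearMap.comp_apply, seqTot_d_zero, seqDesc_in, h₀]
      | succ i =>
        simp only [LinearMap.comp_apply, seqTot_d_succ, seqDesc_in, map_add, map_zsmul, h₁]) x⟩

end Seq

section Bar

variable (M : Cplx A C)

/-- The free bimodules of the bar resolution. -/
def barG (i : ℕ) : Cplx A C := frU (syz M i)

/-- The inclusion of a syzygy. -/
def barIncl (i : ℕ) : (syz M (i + 1)).homs (barG M i) := kernelIncl (aug (syz M i))

/-- The augmentations of the free bimodules. -/
def barEps (i : ℕ) : (barG M i).homs (syz M i) := aug (syz M i)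

/-- The generators of the free bimodules. -/
def barGen (i : ℕ) : syz M i →ₗ[K] barG M i := gen (syz M i)

lemma barEps_gen (i : ℕ) (x : syz M i) : (barEps M i).1 (barGen M i x) = x := aug_gen _ _

lemma barGen_d (i : ℕ) (x : syz M i) :
    (barG M i).d (barGen M i x) = barGen M i ((syz M i).d x) := gen_d _ _

lemma barEps_incl (i : ℕ) (x : (syz M (i + 1))) : (barEps M i).1 ((barIncl M i).1 x) = 0 := x.2

lemma barIncl_injective (i : ℕ) : Injective (barIncl M i).1 := Subtype.val_injective

/-- The differentials of the bar resolution. -/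
def barδ (i : ℕ) : (barG M (i + 1)).homs (barG M i) := compHom (barEps M (i + 1)) (barIncl M i)

lemma barδ_apply (i : ℕ) (x : (barG M (i + 1))) :
    (barδ M i).1 x = (barIncl M i).1 ((barEps M (i + 1)).1 x) := rfl

lemma barδ_barδ (i : ℕ) (x : (barG M (i + 2))) : (barδ M i).1 ((barδ M (i + 1)).1 x) = 0 := by
  rw [barδ_apply, barδ_apply, barEps_incl, map_zero]

/-- The bar resolution. -/
def bar : Cplx A C := seqTot (barG M) (barδ M) (barδ_barδ M)

lemma bar_isKFlat : IsKFlatLeft (bar M) ∧ IsKFlatRight (bar M) :=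
  seqTot_isKFlat _ _ _ (fun i => Fr_isKFlatLeft _) fun i => Fr_isKFlatRight _

lemma Below.bar {a : ℤ} (h : Below M a) : Below (bar M) a := fun t ht x hx => by
  have := seqTot_gr_induction _ _ _ hx (U := ⊥) fun i m hm => by
    have : m = 0 := (h.syz i).frU _ (by simp; omega) m hm
    rw [this, map_zero]; exact zero_mem _
  exact this

/-- The inclusions of the summands of the bar resolution. -/
def barIn (i : ℕ) : barG M i →ₗ[K] bar M := seqIn (barG M) (barδ M) (barδ_barδ M) i

lemma bar_d_zero (m : barG M 0) :
    (bar M).d (barIn M 0 m) = barIn M 0 ((barG M 0).d m) := seqTot_d_zero _ _ _ m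

lemma bar_d_succ (i : ℕ) (m : (barG M (i + 1))) :
    (bar M).d (barIn M (i + 1) m) = (((i + 1 : ℕ) : ℤ).negOnePow : ℤ) •
        barIn M (i + 1) ((barG M (i + 1)).d m) +
      barIn M i ((barIncl M i).1 ((barEps M (i + 1)).1 m)) :=
  seqTot_d_succ _ _ _ i m

lemma bar_l (i : ℕ) (a : A) (m : barG M i) :
    (bar M).l a (barIn M i m) = barIn M i ((barG M i).l a m) := seqTot_l _ _ _ i a m

lemma bar_r (i : ℕ) (a : C) (m : barG M i) :
    (bar M).r a (barIn M i m) = barIn M i ((barG M i).r a m) := seqTot_r _ _ _ i a m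

lemma barIn_mem {i : ℕ} {t : ℤ × ℤ} {m : barG M i} (hm : m ∈ (barG M i).gr t) :
    barIn M i m ∈ (bar M).gr (t.1 - i, t.2) := seqIn_mem _ _ _ hm

lemma bar_lin_ext {X : Type*} [AddCommGroup X] [Module K X] {f g : bar M →ₗ[K] X}
    (h : ∀ i m, f (barIn M i m) = g (barIn M i m)) : f = g := seqTot_hom_ext _ _ _ h

/-- The linear map on the bar resolution with the given components. -/
def barDesc {X : Type u} [AddCommGroup X] [Module K X] (f : ∀ i, (barG M i) →ₗ[K] X) :
    (bar M) →ₗ[K] X := seqDesc _ _ _ f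

lemma barDesc_in {X : Type u} [AddCommGroup X] [Module K X]
    (f : ∀ i, (barG M i) →ₗ[K] X) (i : ℕ) (m : barG M i) :
    barDesc M f (barIn M i m) = f i m := seqDesc_in _ _ _ f i m

/-- The components of the augmentation of the bar resolution. -/
def barAugComp : ∀ i, (barG M i) →ₗ[K] syz M 0
  | 0 => (barEps M 0).1
  | _ + 1 => 0

/-- The augmentation of the bar resolution, with values in the zeroth syzygy. -/
def barAug₀ : (bar M).homs (syz M 0) := seqHom (barG M) (barδ M) (barδ_barδ M) (barAugComp M)
    (fun i t m hm => by
      cases i with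
      | zero =>
        have : (t.1 - ((0 : ℕ) : ℤ), t.2) = t := by simp
        rw [this]
        exact hom_gr (barEps M 0) hm
      | succ i => exact zero_mem _)
    (fun i a m => by
      cases i with
      | zero => exact hom_l (barEps M 0) a m
      | succ i => exact (map_zero _).symm)
    (fun i a m => by
      cases i with
      | zero => exact hom_r (barEps M 0) a m
      | succ i => exact (map_zero _).symm)
    (fun m => hom_d (barEps M 0) m)
    (fun i m => by
      cases i with
      | zero =>
        have h : barAugComp M 0 ((barδ M 0).1 m) = 0 := barEps_incl M 0 _
        rw [h, add_zero]
        refine (smul_zero _).trans (map_zero _).symm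
      | succ i =>
        refine ((congrArg₂ (· + ·) (smul_zero _) rfl).trans (add_zero _)).trans (map_zero _).symm)

lemma barAug₀_in_zero (m : barG M 0) :
    (barAug₀ M).1 (barIn M 0 m) = (barEps M 0).1 m := seqDesc_in _ _ _ _ 0 m

lemma barAug₀_in_succ (i : ℕ) (m : (barG M (i + 1))) :
    (barAug₀ M).1 (barIn M (i + 1) m) = 0 := seqDesc_in _ _ _ _ (i + 1) m

/-- The element `m - s (ε m)` of the next syzygy, where `s` is the inclusion of the generators. -/
def barRem (i : ℕ) : barG M i →ₗ[K] (syz M (i + 1)) :=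
  LinearMap.codRestrict (ker (barEps M i).1)
    (LinearMap.id - barGen M i ∘ₗ (barEps M i).1) fun m => by
      rw [mem_ker, LinearMap.sub_apply, map_sub, LinearMap.comp_apply, barEps_gen]
      exact sub_self _

lemma barIncl_barRem (i : ℕ) (m : barG M i) :
    (barIncl M i).1 (barRem M i m) = m - barGen M i ((barEps M i).1 m) := rfl

lemma barRem_d (i : ℕ) (m : barG M i) :
    barRem M i ((barG M i).d m) = (syz M (i + 1)).d (barRem M i m) := by
  apply barIncl_injective
  rw [hom_d, barIncl_barRem, barIncl_barRem, map_sub, barGen_d, hom_d]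

lemma barRem_barIncl (i : ℕ) (x : (syz M (i + 1))) : barRem M i ((barIncl M i).1 x) = x := by
  apply barIncl_injective
  rw [barIncl_barRem, barEps_incl, map_zero, sub_zero]

/-- The contracting homotopy of the bar resolution. -/
def barH : bar M →ₗ[K] bar M := barDesc M fun i => barIn M (i + 1) ∘ₗ barGen M (i + 1) ∘ₗ barRem M i

lemma barH_in (i : ℕ) (m : barG M i) :
    barH M (barIn M i m) = barIn M (i + 1) (barGen M (i + 1) (barRem M i m)) :=
  barDesc_in _ _ i m

lemma barH_homotopy (x : bar M) : x =
    barIn M 0 (barGen M 0 ((barAug₀ M).1 x)) + (bar M).d (barH M x) + barH M ((bar M).d x) := by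
  refine LinearMap.congr_fun (f := LinearMap.id) (g := barIn M 0 ∘ₗ barGen M 0 ∘ₗ (barAug₀ M).1 +
    (bar M).d ∘ₗ barH M + barH M ∘ₗ (bar M).d) (bar_lin_ext _ fun i m => ?_) x
  simp only [LinearMap.add_apply, LinearMap.comp_apply, LinearMap.id_apply]
  have hd (i : ℕ) (m : barG M i) : (bar M).d (barH M (barIn M i m)) =
      (((i + 1 : ℕ) : ℤ).negOnePow : ℤ) •
        barIn M (i + 1) (barGen M (i + 1) (barRem M i ((barG M i).d m))) +
      barIn M i (m - barGen M i ((barEps M i).1 m)) := by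
    rw [barH_in, bar_d_succ, barRem_d, barGen_d, ← barIncl_barRem, barEps_gen]
  rw [hd]
  cases i with
  | zero =>
    rw [bar_d_zero, barH_in, barAug₀_in_zero, map_sub]
    have e : ((0 + 1 : ℕ) : ℤ).negOnePow = -1 := by simp
    rw [e]
    simp only [Units.val_neg, Units.val_one, neg_smul, one_smul]
    abel
  | succ i =>
    rw [bar_d_succ, map_add, map_zsmul, barH_in, barH_in, barRem_barIncl, barAug₀_in_succ, map_zero,
      map_zero, map_sub]
    have e : (((i + 1 + 1 : ℕ) : ℤ).negOnePow : ℤ) = -(((i + 1 : ℕ) : ℤ).negOnePow : ℤ) := by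
      rw [show ((i + 1 + 1 : ℕ) : ℤ) = ((i + 1 : ℕ) : ℤ) + 1 by push_cast; ring, Int.negOnePow_succ]
      simp
    rw [e, neg_smul]
    abel

lemma barAug₀_gen (m : syz M 0) : (barAug₀ M).1 (barIn M 0 (barGen M 0 m)) = m := by
  rw [barAug₀_in_zero, barEps_gen]

lemma barAug₀_isQis : IsQis (barAug₀ M) := by
  rw [isQis_iff]
  refine RelAcyclic.of_homotopy (bar M).d_d (hom_d _) (barIn M 0 ∘ₗ barGen M 0) (barH M) 0
    (fun m => ?_) (barH_homotopy M) fun m => ?_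
  · rw [LinearMap.comp_apply, LinearMap.comp_apply, bar_d_zero, barGen_d]
  · rw [LinearMap.comp_apply, barAug₀_gen]; simp

/-- The augmentation of the bar resolution. -/
def barAug : (bar M).homs M := barAug₀ M

lemma barAug_surjective : Surjective (barAug M).1 := fun m => ⟨_, barAug₀_gen M m⟩

lemma barAug_isQis : IsQis (barAug M) := barAug₀_isQis M

/-- The map of bimodules out of a free bimodule of the bar resolution that is given on the
generators. -/
def barExt {X : Cplx A C} (i : ℕ) (t : syz M i →ₗ[K] X) : barG M i →ₗ[K] X := ext t

section Ext

variable {X : Cplx A C} (i : ℕ) (t : syz M i →ₗ[K] X)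

lemma barExt_gen (m : syz M i) : barExt M i t (barGen M i m) = t m := ext_gen _ _

lemma barExt_l (a : A) (x : barG M i) :
    barExt M i t ((barG M i).l a x) = X.l a (barExt M i t x) := ext_l _ _ _

lemma barExt_r (a : C) (x : barG M i) :
    barExt M i t ((barG M i).r a x) = X.r a (barExt M i t x) := ext_r _ _ _

lemma barExt_d (x : barG M i) :
    barExt M i t ((barG M i).d x) = barExt M i (t ∘ₗ (syz M i).d) x := ext_d _ _

lemma barExt_mem {e : ℤ × ℤ} (ht : ∀ s, ∀ v ∈ (syz M i).gr s, t v ∈ X.gr (s + e)) {s : ℤ × ℤ}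
    {x : barG M i} (hx : x ∈ (barG M i).gr s) : barExt M i t x ∈ X.gr (s + e) :=
  ext_mem _ ht hx

lemma map_barExt {Y : Cplx A C} (f : X →ₗ[K] Y)
    (hl : ∀ a x, f (X.l a x) = Y.l a (f x)) (hr : ∀ c x, f (X.r c x) = Y.r c (f x))
    (x : barG M i) : f (barExt M i t x) = barExt M i (f ∘ₗ t) x := map_ext _ f hl hr x

lemma barExt_comp_gen {f : barG M i →ₗ[K] X} (hl : ∀ a x, f ((barG M i).l a x) = X.l a (f x))
    (hr : ∀ c x, f ((barG M i).r c x) = X.r c (f x)) (x : barG M i) :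
    barExt M i (f ∘ₗ barGen M i) x = f x := ext_comp_gen hl hr x

lemma barExt_eq {f : barG M i →ₗ[K] X} (hl : ∀ a x, f ((barG M i).l a x) = X.l a (f x))
    (hr : ∀ c x, f ((barG M i).r c x) = X.r c (f x)) (h : ∀ v, t v = f (barGen M i v))
    (x : barG M i) : barExt M i t x = f x := by
  rw [show t = f ∘ₗ barGen M i from LinearMap.ext h, barExt_comp_gen M i hl hr]

lemma barGen_mem {s : ℤ × ℤ} {m : syz M i} (hm : m ∈ (syz M i).gr s) :
    barGen M i m ∈ (barG M i).gr s := gen_mem _ hm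

end Ext

end Bar

section Lifting

variable {M N N' : Cplx A C} (f : N.homs N') (g : (bar M).homs N') (σ : N' →ₗ[K] N) (h : N →ₗ[K] N)

/-- The value of `g` on the generators. -/
def liftVal (i : ℕ) : syz M i →ₗ[K] N' := g.1 ∘ₗ barIn M i ∘ₗ barGen M i

/-- The error term in the construction of a lifting. -/
def liftErr (i : ℕ) (γ : syz M i →ₗ[K] N) : syz M i →ₗ[K] N :=
  γ - N.d ∘ₗ σ ∘ₗ liftVal g i + ((i : ℤ).negOnePow : ℤ) • (σ ∘ₗ liftVal g i ∘ₗ (syz M i).d)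

/-- The value of the lifting on the generators, in terms of what its differential should be. -/
def liftGen (i : ℕ) (γ : syz M i →ₗ[K] N) : syz M i →ₗ[K] N :=
  σ ∘ₗ liftVal g i + h ∘ₗ liftErr g σ i γ

/-- The second term of the differential of the lifting on the generators. -/
def liftBdry : ∀ i, (syz M i) →ₗ[K] N
  | 0 => 0
  | i + 1 => barExt M i (liftGen g σ h i (liftBdry i)) ∘ₗ (barIncl M i).1

/-- The bar resolution has the lifting property with respect to surjective quasi-isomorphisms. The
lifting is constructed on one free summand after the other, by means of a section `σ` of `f` and a
contracting homotopy `h` of the kernel of `f`. -/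
lemma exists_bar_lift (hf : IsQis f) (hs : Surjective f.1) :
    ∃ G : (bar M).homs N, ∀ x, f.1 (G.1 x) = g.1 x := by
  obtain ⟨σ, h, hσ, hfσ, hh, hfh⟩ := exists_section_contraction f hf hs
  have hg (i : ℕ) (x : barG M i) : barExt M i (liftVal g i) x = g.1 (barIn M i x) :=
    barExt_eq M i (f := g.1 ∘ₗ barIn M i) _
      (fun a x => (congrArg g.1 (bar_l M i a x)).symm.trans (hom_l g a _))
      (fun a x => (congrArg g.1 (bar_r M i a x)).symm.trans (hom_r g a _)) (fun v => rfl) x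
  have hval (i : ℕ) (s v) (hv : v ∈ (syz M i).gr s) : liftVal g i v ∈ N'.gr (s + (-(i : ℤ), 0)) := by
    have := hom_gr g (barIn_mem M (barGen_mem M i hv))
    rwa [show (s.1 - (i : ℤ), s.2) = s + (-(i : ℤ), 0) by ext <;> simp; ring] at this
  let β := liftBdry g σ h
  let τ (i : ℕ) := liftGen g σ h i (β i)
  let t (i : ℕ) := barExt M i (τ i)
  have hβ₀ (x) : barExt M 0 (β 0) x = 0 :=
    barExt_eq M 0 (f := 0) (β 0) (fun _ _ => by simp) (fun _ _ => by simp) (fun _ => rfl) x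
  have hβ (i : ℕ) (x) : barExt M (i + 1) (β (i + 1)) x = t i ((barδ M i).1 x) :=
    barExt_eq M (i + 1) (f := t i ∘ₗ (barδ M i).1) (β (i + 1))
      (fun a x => (congrArg (t i) (hom_l _ a x)).trans (barExt_l M i _ _ _))
      (fun a x => (congrArg (t i) (hom_r _ a x)).trans (barExt_r M i _ _ _))
      (fun v => (congrArg (t i ∘ₗ (barIncl M i).1) (barEps_gen M (i + 1) v)).symm) x
  -- `β` has the right degrees, is compatible with `g`, and is a cocycle; then `τ` has the right
  -- degrees, lifts `g`, and has the differential that `β` prescribes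
  let Q (i : ℕ) : Prop := (∀ s, ∀ v ∈ (syz M i).gr s, β i v ∈ N.gr (s + (-(i : ℤ) + 1, 0))) ∧
    (∀ v, f.1 (β i v) =
      N'.d (liftVal g i v) - ((i : ℤ).negOnePow : ℤ) • liftVal g i ((syz M i).d v)) ∧
    ∀ v, N.d (β i v) + ((i : ℤ).negOnePow : ℤ) • β i ((syz M i).d v) = 0
  let P (i : ℕ) : Prop := (∀ s, ∀ v ∈ (syz M i).gr s, τ i v ∈ N.gr (s + (-(i : ℤ), 0))) ∧
    (∀ v, f.1 (τ i v) = liftVal g i v) ∧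
    ∀ v, N.d (τ i v) = β i v + ((i : ℤ).negOnePow : ℤ) • τ i ((syz M i).d v)
  have step (i : ℕ) : Q i → P i := by
    rintro ⟨h₁, h₂, h₃⟩
    have εε {Y : Type u} [AddCommGroup Y] (y : Y) :
        ((i : ℤ).negOnePow : ℤ) • ((i : ℤ).negOnePow : ℤ) • y = y := by
      rw [smul_smul, ← Units.val_mul, Int.units_mul_self, Units.val_one, one_smul]
    set ε := ((i : ℤ).negOnePow : ℤ)
    have hE (v) : liftErr g σ i (β i) v =
      β i v - N.d (σ (liftVal g i v)) + ε • σ (liftVal g i ((syz M i).d v)) := rfl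
    have hG (v) : τ i v = σ (liftVal g i v) + h (liftErr g σ i (β i) v) := rfl
    have hfE (v) : f.1 (liftErr g σ i (β i) v) = 0 := by
      rw [hE, map_add, map_sub, h₂, hom_d, hfσ, map_zsmul, hfσ]; abel
    have hdE (v) : N.d (liftErr g σ i (β i) v) = - ε • liftErr g σ i (β i) ((syz M i).d v) := by
      rw [hE, hE, d_d, map_add, map_sub, d_d, eq_neg_of_add_eq_zero_left (h₃ v), map_zero,
        map_zero, smul_zero, map_zsmul, sub_zero, add_zero, smul_sub, neg_smul, neg_smul]
      abel
    refine ⟨fun s v hv => ?_, fun v => ?_, fun v => ?_⟩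
    · rw [hG]
      refine add_mem (hσ _ _ (hval i s v hv)) ?_
      have hE' : liftErr g σ i (β i) v ∈ N.gr (s + (-(i : ℤ) + 1, 0)) := by
        rw [hE]
        refine add_mem (sub_mem (h₁ s v hv) ?_) (zsmul_mem ?_ _)
        · convert N.d_mem' (hσ _ _ (hval i s v hv)) using 2
          ext <;> simp; ring
        · convert hσ _ _ (hval i _ _ ((syz M i).d_mem' hv)) using 2
          ext <;> simp; ring
      convert hh _ _ hE' using 2
      ext <;> simp; ring
    · rw [hG, map_add, hfσ, (hfh _ (hfE v)).1, add_zero]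
    · rw [hG, hG, map_add, eq_sub_of_add_eq (hfh _ (hfE v)).2, hdE, map_zsmul, hE, smul_add,
        neg_smul]
      abel
  have hdt (i : ℕ) (hi : P i) (x) :
      N.d (t i x) = barExt M i (β i) x + ((i : ℤ).negOnePow : ℤ) • t i ((barG M i).d x) := by
    simp only [t]
    rw [map_barExt M i _ N.d N.d_l N.d_r, barExt_d]
    exact barExt_eq M i (f := barExt M i (β i) +
      ((i : ℤ).negOnePow : ℤ) • barExt M i (τ i ∘ₗ (syz M i).d)) _
      (fun a x => by simp [barExt_l]) (fun a x => by simp [barExt_r])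
      (fun v => by simp [barExt_gen, hi.2.2]) x
  have hft (i : ℕ) (hi : P i) (x) : f.1 (t i x) = g.1 (barIn M i x) := by
    rw [← hg, map_barExt M i _ f.1 (hom_l f) (hom_r f)]
    exact congrArg (barExt M i · x) (LinearMap.ext hi.2.1)
  have hQ (i : ℕ) : Q i := by
    induction i with
    | zero =>
      refine ⟨fun _ _ _ => zero_mem _, fun v => ?_, fun v => by simp [β, liftBdry]⟩
      have : N'.d (liftVal g 0 v) = liftVal g 0 ((syz M 0).d v) := by
        simp only [liftVal, LinearMap.comp_apply]
        rw [← barGen_d, ← bar_d_zero, hom_d]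
      rw [this]
      simp [β, liftBdry]
    | succ i ih =>
      have hi := step i ih
      have e : (((i + 1 : ℕ) : ℤ).negOnePow : ℤ) = - ((i : ℤ).negOnePow : ℤ) := by
        push_cast; rw [Int.negOnePow_succ]; simp
      have hB (v) : β (i + 1) v = t i ((barIncl M i).1 v) := rfl
      refine ⟨fun s v hv => ?_, fun v => ?_, fun v => ?_⟩
      · rw [hB]
        convert barExt_mem M i _ hi.1 (hom_gr (barIncl M i) hv) using 2
        ext <;> simp
      · rw [hB, hft i hi]
        simp only [liftVal, LinearMap.comp_apply]
        rw [← hom_d, bar_d_succ, map_add, map_zsmul, barGen_d, barEps_gen]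
        abel
      · have hβ' (x : barG M i) (hx : (barEps M i).1 x = 0) : barExt M i (β i) x = 0 := by
          cases i with
          | zero => exact hβ₀ x
          | succ i => rw [hβ, barδ_apply, hx, map_zero, map_zero]
        rw [hB, hB, hom_d, hdt i hi, hβ' _ (barEps_incl M i v), e, neg_smul]
        abel
  refine ⟨seqHom (barG M) (barδ M) (barδ_barδ M) t (fun i s m hm => ?_)
    (fun i a m => barExt_l M i _ a m) (fun i a m => barExt_r M i _ a m) (fun m => ?_) fun i m => ?_,
    LinearMap.congr_fun (f := f.1 ∘ₗ barDesc M t) (bar_lin_ext M fun i m => ?_)⟩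
  · convert barExt_mem M i _ (step i (hQ i)).1 hm using 2
    ext <;> simp; ring
  · rw [hdt 0 (step 0 (hQ 0)), hβ₀]
    simp
  · rw [hdt _ (step _ (hQ _)), add_comm, hβ]
  · rw [LinearMap.comp_apply, barDesc_in, hft i (step i (hQ i))]

end Lifting

end Cplx

open Cplx Localization.Construction

/-! ### Cones and acyclic complexes -/

namespace Cplx

/-- Every cocycle is a coboundary. -/
def Acyclic (M : Cplx A C) : Prop := ∀ m, M.d m = 0 → ∃ x, m = M.d x

lemma IsQis.acyclic_left {M N : Cplx A C} {f : M.homs N} (hf : IsQis f) (h : Acyclic N) :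
    Acyclic M := fun m hm => hf.1 m hm (h _ (by rw [← hom_d, hm, map_zero]))

lemma IsQis.acyclic_kernel {M N : Cplx A C} {f : M.homs N} (hf : IsQis f)
    (hs : Surjective f.1) : Acyclic (kernel f) := by
  rintro ⟨m, hm⟩ hd
  have hd' : M.d m = 0 := congrArg Subtype.val hd
  obtain ⟨x, y, hx, hy⟩ := (isQis_iff f).1 hf m 0 hd' (by rw [map_zero]; exact hm)
  obtain ⟨y, rfl⟩ := hs y
  refine ⟨⟨x + M.d y, ?_⟩, Subtype.ext ?_⟩
  · rw [mem_ker, map_add, hom_d, ← hy]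
  · change m = M.d (x + M.d y)
    rw [map_add, M.d_d, add_zero, hx]

lemma prod_isInternal {M N : Cplx A C} (a b : ℤ × ℤ) : DirectSum.IsInternal
    fun t : ℤ × ℤ => (N.gr (t + a)).prod (M.gr (t + b)) := by
  refine isInternal_of_projections (fun t => (N.proj (t + a)).prodMap (M.proj (t + b))) ?_ ?_ ?_
  · rintro s ⟨n, m⟩ ⟨hn, hm⟩
    exact Prod.ext (N.proj_of_mem hn) (M.proj_of_mem hm)
  · rintro s t h ⟨n, m⟩ ⟨hn, hm⟩
    exact Prod.ext (N.proj_of_ne hn fun h' => h (add_right_cancel h'))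
      (M.proj_of_ne hm fun h' => h (add_right_cancel h'))
  · rintro ⟨n, m⟩
    have : ((n, m) : N × M) = (n, 0) + (0, m) := by simp
    rw [this]
    refine add_mem ?_ ?_
    · induction n using N.induction with
      | hp s n hn => exact mem_iSup_of_mem (s - a) ⟨by simpa using hn, by simp⟩
      | hadd m m' h h' => simpa using add_mem (h (by simp)) (h' (by simp))
    · induction m using M.induction with
      | hp s n hn => exact mem_iSup_of_mem (s - b) ⟨by simp, by simpa using hn⟩
      | hadd m m' h h' => simpa using add_mem (h (by simp)) (h' (by simp))

/-- The mapping cone of `φ : M → N`, moved by `e` in cohomological degree and with its differential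
multiplied by `ε`. -/
def cone {M N : Cplx A C} (φ : M.homs N) (e : ℤ) (ε : K) : Cplx A C where
  carrier := N × M
  gr t := (N.gr (t + (e, 0))).prod (M.gr (t + (e + 1, 0)))
  internal := prod_isInternal _ _
  l := AlgHom.ofLinearMap
    { toFun := fun a => (N.l a).prodMap (M.l a)
      map_add' := fun a a' => by ext <;> simp
      map_smul' := fun x a => by ext <;> simp }
    (by ext <;> simp) (fun a a' => by ext <;> simp)
  r := AlgHom.ofLinearMap
    { toFun := fun a => (N.r a).prodMap (M.r a)
      map_add' := fun a a' => by ext <;> simp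
      map_smul' := fun x a => by ext <;> simp }
    (by ext <;> simp) (fun a a' => by ext <;> simp)
  l_r a c m := Prod.ext (N.l_r a c m.1) (M.l_r a c m.2)
  l_mem {q a p q' m} ha hm := by
    refine ⟨?_, ?_⟩
    · have h := hm.1
      simp only [Prod.mk_add_mk, add_zero] at h ⊢
      exact N.l_mem ha h
    · have h := hm.2
      simp only [Prod.mk_add_mk, add_zero] at h ⊢
      exact M.l_mem ha h
  r_mem {q a p q' m} ha hm := by
    refine ⟨?_, ?_⟩
    · have h := hm.1
      simp only [Prod.mk_add_mk, add_zero] at h ⊢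
      exact N.r_mem ha h
    · have h := hm.2
      simp only [Prod.mk_add_mk, add_zero] at h ⊢
      exact M.r_mem ha h
  d := (ε • (N.d ∘ₗ LinearMap.fst K _ _ + φ.1 ∘ₗ LinearMap.snd K _ _)).prod
    (-ε • (M.d ∘ₗ LinearMap.snd K _ _))
  d_mem {p q m} hm := by
    have h₁ := hm.1
    have h₂ := hm.2
    simp only [Prod.mk_add_mk, add_zero] at h₁ h₂
    refine ⟨Submodule.smul_mem _ _ (add_mem ?_ ?_), Submodule.smul_mem _ _ ?_⟩
    · simp only [Prod.mk_add_mk, add_zero, add_right_comm p 1 e]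
      exact N.d_mem h₁
    · simp only [Prod.mk_add_mk, add_zero, add_assoc, add_comm (1 : ℤ) e]
      exact hom_gr φ h₂
    · simp only [Prod.mk_add_mk, add_zero, add_right_comm p 1]
      exact M.d_mem h₂
  d_d m := by
    simp [Prod.ext_iff, N.d_d, M.d_d, hom_d]
  d_l a m := by
    simp [N.d_l, M.d_l, hom_l]
  d_r a m := by
    simp [N.d_r, M.d_r, hom_r]

lemma cone_d {M N : Cplx A C} (φ : M.homs N) (e : ℤ) (ε : K) (n : N) (m : M) :
    (cone φ e ε).d (n, m) = (ε • (N.d n + φ.1 m), -ε • M.d m) := rfl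

/-- The contractible complex that maps onto `N`. -/
def path (N : Cplx A C) : Cplx A C := cone (idHom N) (-1) (-1)

lemma path_acyclic (N : Cplx A C) : Acyclic (path N) := by
  rintro ⟨n, m⟩ h
  have h₁ : (-1 : K) • (N.d n + m) = 0 := congrArg Prod.fst h
  rw [smul_eq_zero_iff_right (by simp), add_comm, add_eq_zero_iff_eq_neg] at h₁
  refine ⟨((0, -n) : N × N), Prod.ext ?_ ?_⟩
  · change n = (-1 : K) • (N.d 0 + -n); simp
  · change m = (-(-1 : K)) • N.d (-n); simp [h₁]

/-- The map of the path complex onto `N`. -/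
def pathHom (N : Cplx A C) : (path N).homs N := ⟨LinearMap.snd K _ _, fun t m h => by
      have h' : m.2 ∈ N.gr (t + (0, 0)) := h.2
      rwa [Prod.mk_zero_zero, add_zero] at h',
    fun _ _ => rfl, fun _ _ => rfl, fun m => by
      change (-(-1 : K)) • N.d _ = _
      rw [neg_neg, one_smul]; rfl⟩

lemma pathHom_surjective (N : Cplx A C) : Surjective (pathHom N).1 := fun n =>
  ⟨((0, n) : N × N), rfl⟩

lemma bar_acyclic {M : Cplx A C} (h : Acyclic M) : Acyclic (bar M) :=
  (barAug_isQis M).acyclic_left h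

lemma exists_lift_kernel {M N X : Cplx A C} (f : M.homs N) (g : X.homs M)
    (h : ∀ x, f.1 (g.1 x) = 0) : ∃ g' : X.homs (kernel f), ∀ x, (kernelIncl f).1 (g'.1 x) = g.1 x :=
  ⟨⟨LinearMap.codRestrict (ker f.1) g.1 h, fun t m hm => hom_gr g hm,
    fun a m => Subtype.ext (hom_l g a m), fun a m => Subtype.ext (hom_r g a m),
    fun m => Subtype.ext (hom_d g m)⟩, fun x => rfl⟩

end Cplx

/-! ### Resolutions in the derived category -/

/-- The bar resolution as an object. -/
abbrev Ker.bar (M : Cplx A C) : Ker A C := ⟨Cplx.bar M, (bar_isKFlat M).1, (bar_isKFlat M).2⟩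

/-- A map of complexes as a morphism. -/
def Ker.homMk {M N : Ker A C} (f : M.cplx.homs N.cplx) : M ⟶ N := f

@[simp]
lemma Ker.homMk_apply {M N : Ker A C} (f : M.cplx.homs N.cplx) (m : M.cplx) :
    (Ker.homMk f : M.cplx.homs N.cplx).1 m = f.1 m := rfl

lemma Ker.hom_ext {M N : Ker A C} {f g : M ⟶ N} (h : ∀ m, f.1 m = g.1 m) : f = g := homs_ext h

lemma Ker.sub_apply {M N : Ker A C} (f g : M ⟶ N) (m : M.cplx) :
    (f - g : M ⟶ N).1 m = f.1 m - g.1 m := rfl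

lemma Ker.comp_apply' {M N P : Ker A C} (f : M ⟶ N) (g : N ⟶ P) (m : M.cplx) :
    (f ≫ g : M ⟶ P).1 m = g.1 (f.1 m) := rfl

namespace DKer

lemma isIso_ofHom {M N : Ker A C} {f : M ⟶ N} (hf : IsQis f) : IsIso (ofHom f) :=
  (Ker.qis A C).Q_inverts f hf

lemma ofHom_comp {M N P : Ker A C} (f : M ⟶ N) (g : N ⟶ P) :
    ofHom (f ≫ g) = ofHom f ≫ ofHom g := (Ker.qis A C).Q.map_comp _ _

lemma ofHom_id (M : Ker A C) : ofHom (𝟙 M) = 𝟙 (of M) := (Ker.qis A C).Q.map_id _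

lemma ofHom_zero (M N : Ker A C) : ofHom (0 : M ⟶ N) = 0 := (Ker.qis A C).Q.map_zero _ _

lemma ofHom_add {M N : Ker A C} (f g : M ⟶ N) : ofHom (f + g) = ofHom f + ofHom g :=
  (Ker.qis A C).Q.map_add

lemma ofHom_sub {M N : Ker A C} (f g : M ⟶ N) : ofHom (f - g) = ofHom f - ofHom g :=
  (Ker.qis A C).Q.map_sub

lemma isZero_of {M : Ker A C} (h : Acyclic M.cplx) : Limits.IsZero (of M) := by
  have : IsIso (ofHom (0 : M ⟶ M)) := isIso_ofHom ⟨fun m hm _ => h m hm, fun m hm => by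
    obtain ⟨x, rfl⟩ := h m hm
    exact ⟨0, x, map_zero _, by simp⟩⟩
  rw [Limits.IsZero.iff_id_eq_zero, ← cancel_mono (ofHom (0 : M ⟶ M)), ofHom_zero]
  simp

/-- A map that factors through an acyclic complex vanishes in the derived category. (The acyclic
complex need not be K-flat; the factorization lifts to its resolution.) -/
lemma ofHom_eq_zero {M X : Cplx A C} {N : Ker A C} (hX : Acyclic X) (w : (Cplx.bar M).homs X)
    (v : X.homs N.cplx) (f : Ker.bar M ⟶ N) (hf : ∀ x, f.1 x = v.1 (w.1 x)) : ofHom f = 0 := by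
  obtain ⟨G, hG⟩ := exists_bar_lift (barAug X) w (barAug_isQis X) (barAug_surjective X)
  have : f = (Ker.homMk G : Ker.bar M ⟶ Ker.bar X) ≫
      (Ker.homMk (compHom (barAug X) v) : Ker.bar X ⟶ N) := Ker.hom_ext fun x =>
    (hf x).trans (congrArg v.1 (hG x).symm)
  rw [this, ofHom_comp, (isZero_of (M := Ker.bar X) (bar_acyclic hX)).eq_zero_of_tgt (ofHom _),
    Limits.zero_comp]

lemma ofHom_eq_of_comp {M Y : Cplx A C} {N : Ker A C} (p : N.cplx.homs Y) (hp : IsQis p)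
    (hs : Surjective p.1) (f g : Ker.bar M ⟶ N) (h : ∀ x, p.1 (f.1 x) = p.1 (g.1 x)) :
    ofHom f = ofHom g := by
  rw [← sub_eq_zero, ← ofHom_sub]
  obtain ⟨w, hw⟩ := exists_lift_kernel p (f - g : Ker.bar M ⟶ N) fun x => by
    rw [Ker.sub_apply, map_sub, h, sub_self]
  exact ofHom_eq_zero (hp.acyclic_kernel hs) w (kernelIncl p) _ fun x => (hw x).symm

/-- The canonical isomorphism of an object with its resolution. -/
def aug (M : Ker A C) : of (Ker.bar M.cplx) ≅ of M :=
  have : IsIso (ofHom (Ker.homMk (M := Ker.bar M.cplx) (N := M) (barAug M.cplx))) :=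
    isIso_ofHom (f := Ker.homMk (M := Ker.bar M.cplx) (N := M) (barAug M.cplx)) (barAug_isQis M.cplx)
  asIso (ofHom (Ker.homMk (M := Ker.bar M.cplx) (N := M) (barAug M.cplx)))

lemma aug_hom (M : Ker A C) :
    (aug M).hom = ofHom (Ker.homMk (M := Ker.bar M.cplx) (N := M) (barAug M.cplx)) := rfl

/-- Maps out of a bar resolution lift along quasi-isomorphisms up to homotopy: adding the path
complex of the target makes the quasi-isomorphism surjective. -/
lemma exists_lift_qis {M : Cplx A C} {X Y : Ker A C} (w : X ⟶ Y) (hw : IsQis w)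
    (g : Ker.bar M ⟶ Y) : ∃ g' : Ker.bar M ⟶ X, ofHom g' ≫ ofHom w = ofHom g := by
  let p : (prod X.cplx (path Y.cplx)).homs Y.cplx :=
    compHom (fst X.cplx (path Y.cplx)) w + compHom (snd X.cplx (path Y.cplx)) (pathHom Y.cplx)
  have hp (x : X.cplx) (y : path Y.cplx) :
      p.1 ((x, y) : X.cplx × (path Y.cplx)) = w.1 x + (pathHom Y.cplx).1 y := rfl
  have hs : Surjective p.1 := fun y => by
    obtain ⟨z, rfl⟩ := pathHom_surjective Y.cplx y
    exact ⟨((0, z) : X.cplx × (path Y.cplx)), by rw [hp, map_zero, zero_add]⟩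
  have hq : IsQis p := by
    constructor
    · rintro ⟨x, y⟩ h ⟨z, hz⟩
      obtain ⟨y, rfl⟩ := path_acyclic Y.cplx y (congrArg Prod.snd h)
      rw [hp, hom_d] at hz
      obtain ⟨x, rfl⟩ := hw.1 x (congrArg Prod.fst h) ⟨z - (pathHom Y.cplx).1 y, by
        rw [map_sub, ← hz, add_sub_cancel_right]⟩
      exact ⟨((x, y) : X.cplx × (path Y.cplx)), rfl⟩
    · intro y hy
      obtain ⟨x, z, hx, rfl⟩ := hw.2 y hy
      refine ⟨((x, 0) : X.cplx × (path Y.cplx)), z, Prod.ext hx (map_zero (path Y.cplx).d), ?_⟩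
      rw [hp, map_zero, add_zero]
  obtain ⟨G, hG⟩ := exists_bar_lift p g hq hs
  let g' : Ker.bar M ⟶ X := Ker.homMk (compHom G (fst _ _))
  refine ⟨g', ?_⟩
  have h₀ : ofHom (g - g' ≫ w) = 0 := ofHom_eq_zero (path_acyclic Y.cplx) (compHom G (snd _ _))
    (pathHom Y.cplx) _ fun x => by
      rw [Ker.sub_apply, ← hG]
      exact add_sub_cancel_left _ _
  rw [ofHom_sub, sub_eq_zero, ofHom_comp] at h₀
  exact h₀.symm

/-- All morphisms out of a bar resolution come from maps of complexes. -/
lemma exists_ofHom {M : Cplx A C} {N : Ker A C} (φ : of (Ker.bar M) ⟶ of N) :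
    ∃ f : Ker.bar M ⟶ N, ofHom f = φ := by
  suffices h : ∀ {X Y : Ker A C} (φ : of X ⟶ of Y) (g : Ker.bar M ⟶ X),
      ∃ f : Ker.bar M ⟶ Y, ofHom f = ofHom g ≫ φ by
    obtain ⟨f, hf⟩ := h φ (𝟙 _)
    exact ⟨f, by rw [hf, ofHom_id, Category.id_comp]⟩
  intro X Y φ
  induction φ using loc_induction with
  | h f => exact fun g => ⟨g ≫ f, ofHom_comp _ _⟩
  | hinv w hw =>
    intro g
    obtain ⟨g', hg'⟩ := exists_lift_qis w hw g
    refine ⟨g', ?_⟩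
    rw [Iso.eq_comp_inv]
    exact hg'
  | hcomp f f' h h' =>
    intro g
    obtain ⟨g₁, h₁⟩ := h g
    obtain ⟨g₂, h₂⟩ := h' g₁
    exact ⟨g₂, by rw [h₂, h₁, Category.assoc]⟩

end DKer

/-! ### Cohomology -/

namespace Cplx

/-- The total cohomology as a vector space. -/
abbrev Coh (M : Cplx A C) : Type u :=
  ker M.d ⧸ (range M.d).comap (ker M.d).subtype

/-- The cohomology class of a cocycle. -/
def cls (M : Cplx A C) (m : M) (hm : M.d m = 0) : Coh M := Submodule.Quotient.mk ⟨m, hm⟩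

lemma cls_eq {M : Cplx A C} {m m' : M} {hm : M.d m = 0} {hm' : M.d m' = 0} :
    cls M m hm = cls M m' hm' ↔ ∃ x, M.d x = m - m' := by
  rw [cls, cls, Submodule.Quotient.eq]; rfl

lemma cls_eq_zero {M : Cplx A C} {m : M} {hm : M.d m = 0} : cls M m hm = 0 ↔ ∃ x, M.d x = m := by
  rw [cls, Submodule.Quotient.mk_eq_zero]; rfl

lemma exists_cls {M : Cplx A C} (h : Coh M) : ∃ m hm, h = cls M m hm := by
  obtain ⟨⟨m, hm⟩, rfl⟩ := Submodule.Quotient.mk_surjective _ h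
  exact ⟨m, hm, rfl⟩

/-- The map on cohomology. -/
def cohMap {M N : Cplx A C} (f : M.homs N) : Coh M →ₗ[K] Coh N :=
  Submodule.mapQ _ _ (f.1.restrict (p := ker M.d) (q := ker N.d)
    fun m hm => by rw [mem_ker, ← hom_d, mem_ker.1 hm, map_zero]) (by
    rintro ⟨m, hm⟩ ⟨x, hx⟩
    exact ⟨f.1 x, by rw [← hom_d]; exact congrArg f.1 hx⟩)

lemma cohMap_cls {M N : Cplx A C} (f : M.homs N) (m : M) (hm : M.d m = 0) :
    cohMap f (cls M m hm) = cls N (f.1 m) (by rw [← hom_d, hm, map_zero]) := rfl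

/-- `IsQis` is the usual notion, an isomorphism on cohomology. -/
lemma cohMap_bijective {M N : Cplx A C} (f : M.homs N) :
    Bijective (cohMap f) ↔ IsQis f := by
  constructor
  · rintro ⟨h₁, h₂⟩
    refine ⟨fun m hm ⟨y, hy⟩ => ?_, fun y hy => ?_⟩
    · have : cls M m hm = 0 := h₁ (by
        rw [map_zero, cohMap_cls, cls_eq_zero]; exact ⟨y, hy.symm⟩)
      obtain ⟨x, hx⟩ := cls_eq_zero.1 this
      exact ⟨x, hx.symm⟩
    · obtain ⟨h, hh⟩ := h₂ (cls N y hy)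
      obtain ⟨m, hm, rfl⟩ := exists_cls h
      rw [cohMap_cls, eq_comm, cls_eq] at hh
      obtain ⟨x, hx⟩ := hh
      exact ⟨m, x, hm, by rw [hx, add_sub_cancel]⟩
  · rintro ⟨h₁, h₂⟩
    constructor
    · rw [injective_iff_map_eq_zero]
      intro h hh
      obtain ⟨m, hm, rfl⟩ := exists_cls h
      rw [cohMap_cls, cls_eq_zero] at hh
      obtain ⟨y, hy⟩ := hh
      obtain ⟨x, hx⟩ := h₁ m hm ⟨y, hy.symm⟩
      exact cls_eq_zero.2 ⟨x, hx.symm⟩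
    · intro h
      obtain ⟨y, hy, rfl⟩ := exists_cls h
      obtain ⟨m, x, hm, rfl⟩ := h₂ y hy
      exact ⟨cls M m hm, by rw [cohMap_cls, eq_comm, cls_eq]; exact ⟨x, by rw [add_sub_cancel_left]⟩⟩

end Cplx

/-- Cohomology as a functor to vector spaces. -/
def Ker.coh (A C : GrAlg K) : Ker A C ⥤ ModuleCat.{u} K where
  obj M := ModuleCat.of K (Coh M.cplx)
  map f := ModuleCat.ofHom (cohMap f)
  map_id M := ModuleCat.hom_ext (LinearMap.ext fun h => by
    obtain ⟨m, hm, rfl⟩ := exists_cls (M := M.cplx) h; rfl)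
  map_comp {M _ _} f g := ModuleCat.hom_ext (LinearMap.ext fun h => by
    obtain ⟨m, hm, rfl⟩ := exists_cls (M := M.cplx) h; rfl)

lemma Ker.coh_inverts (A C : GrAlg K) : (Ker.qis A C).IsInvertedBy (Ker.coh A C) :=
  fun M N f hf => by
    rw [ConcreteCategory.isIso_iff_bijective]
    exact (cohMap_bijective _).2 hf

instance : (Ker.coh A C).Additive where
  map_add {M _} f g := ModuleCat.hom_ext (LinearMap.ext fun h => by
    obtain ⟨m, hm, rfl⟩ := exists_cls (M := M.cplx) h; rfl)

instance : (Ker.coh A C).Linear K where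
  map_smul {M _} f g := ModuleCat.hom_ext (LinearMap.ext fun h => by
    obtain ⟨m, hm, rfl⟩ := exists_cls (M := M.cplx) h; rfl)

namespace DKer

/-- Cohomology as a functor on the derived category. -/
def coh (A C : GrAlg K) : DKer A C ⥤ ModuleCat.{u} K := lift _ (Ker.coh_inverts A C)

/-- The map on cohomology of a morphism of the derived category. -/
def cohMap {M N : Ker A C} (φ : of M ⟶ of N) : Coh M.cplx →ₗ[K] Coh N.cplx := ((coh A C).map φ).hom

lemma cohMap_ofHom {M N : Ker A C} (f : M ⟶ N) : cohMap (ofHom f) = Cplx.cohMap f := by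
  have h := Functor.congr_hom (fac _ (Ker.coh_inverts A C)) f
  have h' : (coh A C).map (ofHom f) = (Ker.coh A C).map f := by simpa using! h
  exact congrArg ModuleCat.Hom.hom h'

lemma cohMap_comp {M N P : Ker A C} (φ : of M ⟶ of N) (ψ : of N ⟶ of P) :
    cohMap (φ ≫ ψ) = cohMap ψ ∘ₗ cohMap φ := by
  rw [cohMap, Functor.map_comp, ModuleCat.hom_comp]; rfl

lemma cohMap_bijective {M N : Ker A C} (φ : of M ⟶ of N) [IsIso φ] :
    Bijective (cohMap φ) :=
  (ConcreteCategory.isIso_iff_bijective ((coh A C).map φ)).1 inferInstance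

lemma isQis_of_isIso {M N : Ker A C} (f : M ⟶ N) [IsIso (ofHom f)] : IsQis f := by
  rw [← Cplx.cohMap_bijective, ← cohMap_ofHom]
  exact cohMap_bijective _

lemma coh_map_ofHom {M N : Ker A C} (f : M ⟶ N) :
    (coh A C).map (ofHom f) = (Ker.coh A C).map f := ModuleCat.hom_ext (cohMap_ofHom f)

instance : (coh A C).Additive := loc_additive _ fun f g => by
  rw [coh_map_ofHom, coh_map_ofHom, coh_map_ofHom, Functor.map_add]; rfl

instance : (coh A C).Linear K := loc_linear _ fun f x => by
  rw [coh_map_ofHom, coh_map_ofHom, Functor.map_smul]; rfl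

lemma cohMap_add {M N : Ker A C} (φ ψ : of M ⟶ of N) : cohMap (φ + ψ) = cohMap φ + cohMap ψ := by
  rw [cohMap, Functor.map_add]; rfl

lemma cohMap_smul {M N : Ker A C} (x : K) (φ : of M ⟶ of N) : cohMap (x • φ) = x • cohMap φ := by
  rw [cohMap, Functor.map_smul]; rfl

lemma exists_sub_of_ofHom_eq {M N : Ker A C} {f g : M ⟶ N} (h : ofHom f = ofHom g)
    (m : M.cplx) (hm : M.cplx.d m = 0) : ∃ x, N.cplx.d x = f.1 m - g.1 m := by
  have h' := congrArg cohMap h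
  rw [cohMap_ofHom, cohMap_ofHom] at h'
  exact cls_eq.1 (LinearMap.congr_fun h' (cls M.cplx m hm))

end DKer

namespace Cplx

/-- The classes that are represented by cocycles of degree `t`. -/
def cohGr (M : Cplx A C) (t : ℤ × ℤ) : Submodule K (Coh M) :=
  ((M.gr t).comap (ker M.d).subtype).map (Submodule.mkQ _)

lemma cls_mem {M : Cplx A C} {t : ℤ × ℤ} {m : M} (hm : M.d m = 0) (h : m ∈ M.gr t) :
    cls M m hm ∈ cohGr M t := ⟨⟨m, hm⟩, h, rfl⟩

lemma exists_of_mem_cohGr {M : Cplx A C} {t : ℤ × ℤ} {h : Coh M} (hh : h ∈ cohGr M t) :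
    ∃ m hm, m ∈ M.gr t ∧ h = cls M m hm := by
  obtain ⟨⟨m, hm⟩, h, rfl⟩ := hh
  exact ⟨m, hm, h, rfl⟩

lemma IsQis.exists_preimage {M N : Cplx A C} {f : M.homs N} (hf : IsQis f) {t : ℤ × ℤ}
    {y : N} (hy : N.d y = 0) (ht : y ∈ N.gr t) :
    ∃ m x, m ∈ M.gr t ∧ M.d m = 0 ∧ y = f.1 m + N.d x := by
  obtain ⟨m, x, hm, h⟩ := hf.2 y hy
  refine ⟨M.proj t m, N.proj (t - (1, 0)) x, M.proj_mem _ _, ?_, ?_⟩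
  · rw [d_proj, hm, map_zero]
  · rw [d_proj, hom_proj, sub_add_cancel, ← map_add, ← h, N.proj_of_mem ht]

/-- The span of the elements `a y c` for `y ∈ s`. -/
def bispan (M : Cplx A C) (s : Set M) : Submodule K M :=
  span K {m | ∃ y ∈ s, ∃ a c, m = M.l a (M.r c y)}

lemma mem_bispan (M : Cplx A C) {s : Set M} {y : M} (hy : y ∈ s) :
    y ∈ bispan M s := subset_span ⟨y, hy, 1, 1, by simp⟩

lemma bispan_l (M : Cplx A C) {s : Set M} (a : A) {m : M}
    (hm : m ∈ bispan M s) : M.l a m ∈ bispan M s := by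
  have : bispan M s ≤ (bispan M s).comap (M.l a) := span_le.2 (by
    rintro _ ⟨y, hy, a', c, rfl⟩
    exact subset_span ⟨y, hy, a * a', c, by rw [map_mul]; rfl⟩)
  exact this hm

lemma bispan_r (M : Cplx A C) {s : Set M} (a : C) {m : M}
    (hm : m ∈ bispan M s) : M.r a m ∈ bispan M s := by
  have : bispan M s ≤ (bispan M s).comap (M.r a) := span_le.2 (by
    rintro _ ⟨y, hy, a', c, rfl⟩
    exact subset_span ⟨y, hy, a', a * c, by rw [map_mul, ← M.l_r]; rfl⟩)
  exact this hm

lemma bispan_le (M : Cplx A C) {s : Set M} {U : Submodule K M}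
    (h : ∀ y ∈ s, y ∈ U) (hl : ∀ a, ∀ m ∈ U, M.l a m ∈ U) (hr : ∀ c, ∀ m ∈ U, M.r c m ∈ U) :
    bispan M s ≤ U := span_le.2 (by
  rintro _ ⟨y, hy, a, c, rfl⟩
  exact hl _ _ (hr _ _ (h y hy)))

lemma isCoherent_iff (M : Cplx A C) : IsCoherent M ↔ ∃ s : Finset M,
    (∀ y ∈ s, M.d y = 0) ∧ ∀ m, M.d m = 0 → m ∈ bispan M s ⊔ range M.d := by
  refine exists_congr fun s => and_congr_right fun _ => forall_congr' fun m => ?_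
  have : bispan M s = span K {x | ∃ a c, ∃ y ∈ s, x = M.l a (M.r c y)} := by
    refine congrArg (span K) (Set.ext fun x => ?_)
    constructor
    · rintro ⟨y, hy, a, c, rfl⟩; exact ⟨a, c, y, hy, rfl⟩
    · rintro ⟨a, c, y, hy, rfl⟩; exact ⟨y, hy, a, c, rfl⟩
  rw [this]

lemma IsCoherent.of_qis {M N : Cplx A C} {f : M.homs N} (hf : IsQis f) (h : IsCoherent M) :
    IsCoherent N := by
  classical
  rw [isCoherent_iff] at h ⊢
  obtain ⟨s, hs, h⟩ := h
  refine ⟨s.image f.1, fun y hy => ?_, fun y hy => ?_⟩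
  · obtain ⟨y', hy', rfl⟩ := mem_image.1 hy
    rw [← hom_d, hs y' hy', map_zero]
  · obtain ⟨m, x, hm, rfl⟩ := hf.2 y hy
    refine add_mem ?_ (mem_sup_right ⟨x, rfl⟩)
    obtain ⟨m₁, h₁, m₂, ⟨z, rfl⟩, rfl⟩ := mem_sup.1 (h m hm)
    rw [map_add, hom_d]
    refine add_mem (mem_sup_left ?_) (mem_sup_right ⟨_, rfl⟩)
    exact bispan_le M (U := (bispan N (s.image f.1)).comap f.1)
      (fun y hy => mem_bispan N (mem_image_of_mem _ hy))
      (fun a m hm => by rw [Submodule.mem_comap, hom_l]; exact bispan_l N a hm)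
      (fun a m hm => by rw [Submodule.mem_comap, hom_r]; exact bispan_r N a hm) h₁

lemma IsCoherent.of_qis' {M N : Cplx A C} {f : M.homs N} (hf : IsQis f) (h : IsCoherent N) :
    IsCoherent M := by
  classical
  rw [isCoherent_iff] at h ⊢
  obtain ⟨s, hs, h⟩ := h
  have hp (y : s) : ∃ m, M.d m = 0 ∧ ∃ x, y.1 = f.1 m + N.d x := by
    obtain ⟨m, x, hm, hx⟩ := hf.2 y.1 (hs y.1 y.2)
    exact ⟨m, hm, x, hx⟩
  choose p hp hp' using hp
  refine ⟨Finset.univ.image p, fun y hy => ?_, fun m hm => ?_⟩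
  · obtain ⟨y, -, rfl⟩ := mem_image.1 hy
    exact hp y
  · -- the cocycles of `N` that are cohomologous to the image of a combination of the chosen lifts
    let T := bispan M (Finset.univ.image p)
    have hT : bispan N s ≤ T.map f.1 ⊔ range N.d := by
      refine bispan_le N (fun y hy => ?_) ?_ ?_
      · obtain ⟨x, hx⟩ := hp' ⟨y, hy⟩
        rw [show y = _ from hx]
        exact add_mem (mem_sup_left ⟨_, mem_bispan M (by simp), rfl⟩)
          (mem_sup_right ⟨x, rfl⟩)
      · rintro a m hm
        obtain ⟨_, ⟨m', hm', rfl⟩, _, ⟨x, rfl⟩, rfl⟩ := mem_sup.1 hm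
        rw [map_add, ← hom_l, ← N.d_l]
        exact add_mem (mem_sup_left ⟨_, bispan_l M a hm', rfl⟩)
          (mem_sup_right ⟨_, rfl⟩)
      · rintro a m hm
        obtain ⟨_, ⟨m', hm', rfl⟩, _, ⟨x, rfl⟩, rfl⟩ := mem_sup.1 hm
        rw [map_add, ← hom_r, ← N.d_r]
        exact add_mem (mem_sup_left ⟨_, bispan_r M a hm', rfl⟩)
          (mem_sup_right ⟨_, rfl⟩)
    have hm' := h (f.1 m) (by rw [← hom_d, hm, map_zero])
    obtain ⟨_, ⟨m', hm', rfl⟩, _, ⟨x, rfl⟩, e⟩ := mem_sup.1 (sup_le hT le_sup_right hm')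
    have hc : ∀ m ∈ T, M.d m = 0 := fun m hm => bispan_le M (U := ker M.d) (fun y hy => by
        obtain ⟨y, -, rfl⟩ := mem_image.1 hy
        exact hp y)
      (fun a m hm => by rw [mem_ker, M.d_l, mem_ker.1 hm, map_zero])
      (fun a m hm => by rw [mem_ker, M.d_r, mem_ker.1 hm, map_zero]) hm
    obtain ⟨z, hz⟩ := hf.1 (m - m') (by rw [map_sub, hm, hc m' hm', sub_zero])
      ⟨x, by rw [map_sub, ← e, add_sub_cancel_left]⟩
    rw [← add_sub_cancel m' m, hz]
    exact add_mem (mem_sup_left hm') (mem_sup_right ⟨z, rfl⟩)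

end Cplx

namespace DKer

/-- Isomorphic objects of the derived category are related by quasi-isomorphisms. -/
lemma exists_qis_of_iso {M N : Ker A C} (e : of M ≅ of N) :
    ∃ f : (Cplx.bar M.cplx).homs N.cplx, IsQis f := by
  obtain ⟨f, hf⟩ := exists_ofHom ((aug M).hom ≫ e.hom)
  have : IsIso (ofHom f) := by rw [hf]; infer_instance
  exact ⟨f, isQis_of_isIso f⟩

lemma isCoherent_of_iso {M N : Ker A C} (e : of M ≅ of N) (h : IsCoherent M.cplx) :
    IsCoherent N.cplx := by
  obtain ⟨f, hf⟩ := exists_qis_of_iso e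
  exact (h.of_qis' (barAug_isQis _)).of_qis hf

lemma cohMap_mem {M N : Ker A C} (φ : of M ⟶ of N) {t : ℤ × ℤ} {h : Coh M.cplx}
    (hh : h ∈ cohGr M.cplx t) : cohMap φ h ∈ cohGr N.cplx t := by
  obtain ⟨f, hf⟩ := exists_ofHom ((aug M).hom ≫ φ)
  obtain ⟨m, hm, ht, rfl⟩ := exists_of_mem_cohGr hh
  obtain ⟨m', x, ht', hm', rfl⟩ := (barAug_isQis M.cplx).exists_preimage hm ht
  have e : Cplx.cohMap (barAug M.cplx) (cls _ m' hm') = cls M.cplx _ hm := by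
    rw [Cplx.cohMap_cls, eq_comm, cls_eq]; exact ⟨x, by rw [add_sub_cancel_left]⟩
  have e' : cohMap φ (Cplx.cohMap (barAug M.cplx) (cls _ m' hm')) =
      Cplx.cohMap f (cls _ m' hm') := by
    rw [← cohMap_ofHom f, hf, cohMap_comp, aug_hom, cohMap_ofHom]; rfl
  rw [← e, e', Cplx.cohMap_cls]
  exact cls_mem _ (hom_gr f ht')

end DKer

/-! ### Endomorphisms of the diagonal -/

namespace DKer

/-- A map out of the resolution of the diagonal is determined by its value on a cocycle that
represents `1`, because the resolution vanishes in positive degrees. -/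
lemma exists_eq_unitMul (A : GrAlg K) (s : ℤ)
    (f : (Cplx.bar (Cplx.unit A)).homs ((Cplx.unit A).shift s)) :
    ∃ a : A.gr s, ∀ y, f.1 y = (unitMul A s a).1 ((barAug (Cplx.unit A)).1 y) := by
  have hb : Below (Cplx.unit A) 1 := fun t ht x hx => by
    rcases mem_unit_gr hx with h | ⟨h, -⟩
    · exact h
    · omega
  have hb' := hb.bar
  have hd {q : ℤ} {x} (hx : x ∈ (Cplx.bar (Cplx.unit A)).gr (0, q)) :
      (Cplx.bar (Cplx.unit A)).d x = 0 :=
    hb' (0 + 1, q) (by simp) _ ((Cplx.bar (Cplx.unit A)).d_mem hx)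
  obtain ⟨m, x, hm, hm', e⟩ := (barAug_isQis (Cplx.unit A)).exists_preimage
    (y := unitOne A) rfl (unitOne_mem A)
  have e : (barAug (Cplx.unit A)).1 m = unitOne A := by
    rw [e]; exact (add_zero _).symm
  have hfm : f.1 m ∈ (Cplx.unit A).gr (0, 0 + s) := hom_gr f hm
  rw [zero_add] at hfm
  let a : A.gr s := ⟨f.1 m, by
    rcases mem_unit_gr hfm with h | ⟨-, h⟩
    · have h' : (f.1 m : A) = 0 := h
      rw [h']; exact zero_mem _
    · exact h⟩
  refine ⟨a, fun y => ?_⟩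
  induction y using (Cplx.bar (Cplx.unit A)).induction with
  | hadd y y' h h' => rw [map_add, map_add, map_add, h, h']
  | hp t y hy =>
    obtain ⟨p, q⟩ := t
    by_cases hp : p = 0
    · subst hp
      -- the two maps agree on `m`, hence on its multiples, hence on all elements of degree zero
      let b : A := (barAug (Cplx.unit A)).1 y
      have hb : (barAug (Cplx.unit A)).1 ((Cplx.bar (Cplx.unit A)).l b m) =
          (barAug (Cplx.unit A)).1 y := by
        rw [hom_l, e]; exact mul_one b
      obtain ⟨z, hz⟩ := (barAug_isQis (Cplx.unit A)).1 (y - (Cplx.bar (Cplx.unit A)).l b m)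
        (by rw [map_sub, Cplx.d_l, hm', map_zero, sub_zero, hd hy])
        ⟨0, by rw [map_sub, hb, map_zero, sub_self]⟩
      have hfz : f.1 ((Cplx.bar (Cplx.unit A)).d z) = 0 := by rw [hom_d]; rfl
      rw [← add_sub_cancel ((Cplx.bar (Cplx.unit A)).l b m) y, hz, map_add, hfz, add_zero, hom_l,
        map_add, hb, hom_d (barAug (Cplx.unit A)) z]
      change b * a.1 = a.1 * (b + 0)
      rw [add_zero, mul_comm]
    · have h (s') {x : Cplx.unit A} (hx : x ∈ (Cplx.unit A).gr (p, s')) : x = 0 := by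
        rcases mem_unit_gr hx with h | ⟨h, -⟩
        · exact h
        · exact absurd h hp
      have h₁ : f.1 y = 0 := h _ (show f.1 y ∈ (Cplx.unit A).gr (p, q + s) from hom_gr f hy)
      have h₂ := h _ (hom_gr (barAug (Cplx.unit A)) hy)
      rw [h₁, h₂, map_zero]

/-- Every morphism from the structure sheaf of the diagonal to one of its shifts is the
multiplication by a function. -/
lemma exists_unitMul (A : GrAlg K) (s : ℤ)
    (φ : of (Ker.unit A) ⟶ of ((Ker.shift s).obj (Ker.unit A))) :
    ∃ a : A.gr s, φ = ofHom (Ker.homMk (unitMul A s a)) := by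
  obtain ⟨f, hf⟩ := exists_ofHom ((aug (Ker.unit A)).hom ≫ φ)
  obtain ⟨a, ha⟩ := exists_eq_unitMul A s f
  refine ⟨a, ?_⟩
  rw [← cancel_epi (aug (Ker.unit A)).hom, ← hf, aug_hom, ← ofHom_comp]
  exact congrArg _ (Ker.hom_ext ha)

end DKer

/-! ### Truncations -/

lemma Cplx.isQis_comp {M N P : Cplx A C} {f : M.homs N} {g : N.homs P} (hf : IsQis f)
    (hg : IsQis g) : IsQis (compHom f g) := by
  constructor
  · rintro m hm ⟨y, hy⟩
    exact hf.1 m hm (hg.1 _ (by rw [← hom_d, hm, map_zero]) ⟨y, hy⟩)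
  · intro y hy
    obtain ⟨n, x, hn, rfl⟩ := hg.2 y hy
    obtain ⟨m, z, hm, rfl⟩ := hf.2 n hn
    refine ⟨m, g.1 z + x, hm, ?_⟩
    rw [compHom_apply, map_add, map_add, hom_d, add_assoc]

namespace Cplx

/-- The part of cohomological degree less than `a`. -/
def low (M : Cplx A C) (a : ℤ) : M →ₗ[K] M := M.scale fun t => if t.1 < a then 1 else 0

variable (M : Cplx A C) (a : ℤ)

lemma low_of_lt {t : ℤ × ℤ} {m : M} (hm : m ∈ M.gr t) (h : t.1 < a) : M.low a m = m := by
  rw [low, scale_apply _ _ hm, if_pos h, one_smul]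

lemma low_of_le {t : ℤ × ℤ} {m : M} (hm : m ∈ M.gr t) (h : a ≤ t.1) : M.low a m = 0 := by
  rw [low, scale_apply _ _ hm, if_neg (by omega), zero_smul]

lemma low_mem {t : ℤ × ℤ} {m : M} (hm : m ∈ M.gr t) : M.low a m ∈ M.gr t := by
  rw [low, scale_apply _ _ hm]; exact Submodule.smul_mem _ _ hm

lemma low_low (m : M) : M.low a (M.low a m) = M.low a m := by
  induction m using M.induction with
  | hp t m hm =>
    by_cases h : t.1 < a
    · rw [M.low_of_lt a hm h, M.low_of_lt a hm h]
    · rw [M.low_of_le a hm (by omega), map_zero]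
  | hadd m m' h h' => rw [map_add, map_add, h, h']

lemma low_d (m : M) : M.low (a + 1) (M.d m) = M.d (M.low a m) := by
  induction m using M.induction with
  | hp t m hm =>
    by_cases h : t.1 < a
    · rw [M.low_of_lt a hm h, M.low_of_lt _ (M.d_mem' hm) (by simpa using h)]
    · rw [M.low_of_le a hm (by omega), M.low_of_le _ (M.d_mem' hm) (by simpa using h), map_zero]
  | hadd m m' h h' => rw [map_add, map_add, map_add, map_add, h, h']

lemma low_low_succ (m : M) : M.low (a + 1) (M.low a m) = M.low a m := by
  induction m using M.induction with
  | hp t m hm =>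
    by_cases h : t.1 < a
    · rw [M.low_of_lt a hm h, M.low_of_lt _ hm (by omega)]
    · rw [M.low_of_le a hm (by omega), map_zero]
  | hadd m m' h h' => rw [map_add, map_add, h, h']

lemma low_proj (t : ℤ × ℤ) (m : M) : M.low a (M.proj t m) = M.proj t (M.low a m) := by
  have := map_proj (M.low a) 0 (fun t m hm => by rw [add_zero]; exact M.low_mem a hm) t m
  rwa [add_zero] at this

lemma low_l (x : A) (m : M) : M.low a (M.l x m) = M.l x (M.low a m) := by
  induction m using M.induction with
  | hp t m hm =>
    induction x using homogeneous_induction A.internal with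
    | hp q x hx =>
      by_cases h : t.1 < a
      · rw [M.low_of_lt a hm h, M.low_of_lt a (M.l_mem (p := t.1) (q' := t.2) hx hm) h]
      · rw [M.low_of_le a hm (by omega),
          M.low_of_le a (M.l_mem (p := t.1) (q' := t.2) hx hm) (by simpa using h), map_zero]
    | hadd x x' h h' => simp only [map_add, LinearMap.add_apply, h, h']
  | hadd m m' h h' => rw [map_add, map_add, map_add, map_add, h, h']

lemma low_r (x : C) (m : M) : M.low a (M.r x m) = M.r x (M.low a m) := by
  induction m using M.induction with
  | hp t m hm =>
    induction x using homogeneous_induction C.internal with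
    | hp q x hx =>
      by_cases h : t.1 < a
      · rw [M.low_of_lt a hm h, M.low_of_lt a (M.r_mem (p := t.1) (q' := t.2) hx hm) h]
      · rw [M.low_of_le a hm (by omega),
          M.low_of_le a (M.r_mem (p := t.1) (q' := t.2) hx hm) (by simpa using h), map_zero]
    | hadd x x' h h' => simp only [map_add, LinearMap.add_apply, h, h']
  | hadd m m' h h' => rw [map_add, map_add, map_add, map_add, h, h']

/-- The cohomology of `M` vanishes in degrees `≥ a`. -/
def CohBelow (M : Cplx A C) (a : ℤ) : Prop :=
  ∀ t : ℤ × ℤ, a ≤ t.1 → ∀ m ∈ M.gr t, M.d m = 0 → ∃ x, M.d x = m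

/-- The cohomology of `M` vanishes in degrees `< a`. -/
def CohAbove (M : Cplx A C) (a : ℤ) : Prop :=
  ∀ t : ℤ × ℤ, t.1 < a → ∀ m ∈ M.gr t, M.d m = 0 → ∃ x, M.d x = m

variable {M a}

lemma CohBelow.exists_eq (h : CohBelow M a) (m : M) (hm : M.d m = 0)
    (hl : M.low a m = 0) : ∃ x, M.d x = m := by
  obtain ⟨S, hS⟩ := M.exists_sum_proj m
  have : m ∈ range M.d := by
    rw [hS S subset_rfl]
    refine Submodule.sum_mem _ fun t _ => ?_
    by_cases ht : a ≤ t.1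
    · exact h t ht _ (M.proj_mem t m) (by rw [d_proj, hm, map_zero])
    · have : M.proj t m = 0 := by
        rw [← M.low_of_lt a (M.proj_mem t m) (by omega), low_proj, hl, map_zero]
      rw [this]; exact zero_mem _
  exact this

lemma CohAbove.exists_eq (h : CohAbove M a) (m : M) (hm : M.d m = 0)
    (hl : M.low a m = m) : ∃ x, M.d x = m := by
  obtain ⟨S, hS⟩ := M.exists_sum_proj m
  have : m ∈ range M.d := by
    rw [hS S subset_rfl]
    refine Submodule.sum_mem _ fun t _ => ?_
    by_cases ht : t.1 < a
    · exact h t ht _ (M.proj_mem t m) (by rw [d_proj, hm, map_zero])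
    · have : M.proj t m = 0 := by
        rw [← hl, ← low_proj, M.low_of_le a (M.proj_mem t m) (by omega)]
      rw [this]; exact zero_mem _
  exact this

variable (M a)

/-- The largest subcomplex that is concentrated in degrees less than `a`; it has the cohomology of
`M` in these degrees. -/
def truncLow : Cplx A C :=
  M.sub (ker (M.low a - LinearMap.id) ⊓ ker (M.low a ∘ₗ M.d - M.d))
    (fun t m hm => by
      simp only [Submodule.mem_inf, mem_ker, LinearMap.sub_apply, LinearMap.id_apply,
        sub_eq_zero, LinearMap.comp_apply] at hm ⊢
      rw [low_proj, hm.1, d_proj, low_proj, hm.2]; exact ⟨rfl, rfl⟩)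
    (fun x m hm => by
      simp only [Submodule.mem_inf, mem_ker, LinearMap.sub_apply, LinearMap.id_apply,
        sub_eq_zero, LinearMap.comp_apply] at hm ⊢
      rw [low_l, hm.1, M.d_l, low_l, hm.2]; exact ⟨rfl, rfl⟩)
    (fun x m hm => by
      simp only [Submodule.mem_inf, mem_ker, LinearMap.sub_apply, LinearMap.id_apply,
        sub_eq_zero, LinearMap.comp_apply] at hm ⊢
      rw [low_r, hm.1, M.d_r, low_r, hm.2]; exact ⟨rfl, rfl⟩)
    (fun m hm => by
      simp only [Submodule.mem_inf, mem_ker, LinearMap.sub_apply, LinearMap.id_apply,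
        sub_eq_zero, LinearMap.comp_apply] at hm ⊢
      rw [M.d_d, map_zero]; exact ⟨hm.2, rfl⟩)

/-- The inclusion of the truncation. -/
def truncLowIncl : (truncLow M a).homs M := subIncl _ _ _ _ _ _

lemma mem_truncLow {m : M} :
    m ∈ ker (M.low a - LinearMap.id) ⊓ ker (M.low a ∘ₗ M.d - M.d) ↔
      M.low a m = m ∧ M.low a (M.d m) = M.d m := by
  simp only [Submodule.mem_inf, mem_ker, LinearMap.sub_apply, LinearMap.id_apply,
        sub_eq_zero, LinearMap.comp_apply]

lemma truncLow_below : Below (truncLow M a) a := by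
  rintro t ht ⟨m, hm⟩ hm'
  have h := ((M.mem_truncLow a).1 hm).1
  exact Subtype.ext (h.symm.trans (M.low_of_le a hm' ht))

variable {M a} in
lemma truncLowIncl_isQis (h : CohBelow M a) : IsQis (truncLowIncl M a) := by
  have hlow (y : M) (hy : M.d y = 0) : ∃ m hm, M.d m = 0 ∧ m = M.low a y ∧
      (truncLowIncl M a).1 ⟨m, hm⟩ = m ∧ ∃ x, M.d x = y - m := by
    have hd : M.d (M.low a y) = 0 := by rw [← low_d, hy, map_zero]
    refine ⟨M.low a y, (M.mem_truncLow a).2 ⟨low_low _ _ _, by rw [hd, map_zero]⟩, hd, rfl, rfl, ?_⟩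
    exact h.exists_eq _ (by rw [map_sub, hy, hd, sub_zero]) (by rw [map_sub, low_low, sub_self])
  constructor
  · rintro ⟨m, hm⟩ hd ⟨y, hy⟩
    have hm' := (M.mem_truncLow a).1 hm
    have hy' : m = M.d y := hy
    -- only the part of the primitive in degrees `< a - 1` matters
    obtain ⟨b, rfl⟩ : ∃ b, a = b + 1 := ⟨a - 1, by ring⟩
    have e : M.d (M.low b y) = m := by rw [← low_d, ← hy', hm'.1]
    exact ⟨⟨M.low b y, (M.mem_truncLow _).2 ⟨low_low_succ _ _ _, by rw [e, hm'.1]⟩⟩,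
      Subtype.ext e.symm⟩
  · intro y hy
    obtain ⟨m, hm, hd, -, e, x, hx⟩ := hlow y hy
    exact ⟨⟨m, hm⟩, x, Subtype.ext hd, by rw [e, hx, add_sub_cancel]⟩

/-- The subcomplex that is generated by the elements of degree less than `a`. -/
def genLow : Cplx A C := M.sub (range (M.low a) ⊔ range (M.d ∘ₗ M.low a))
    (fun t m hm => by
      obtain ⟨_, ⟨x, rfl⟩, _, ⟨y, rfl⟩, rfl⟩ := mem_sup.1 hm
      rw [map_add, ← low_proj, LinearMap.comp_apply, ← sub_add_cancel t (1, 0), ← d_proj,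
        ← low_proj]
      exact add_mem (mem_sup_left ⟨_, rfl⟩) (mem_sup_right ⟨_, rfl⟩))
    (fun x m hm => by
      obtain ⟨_, ⟨x, rfl⟩, _, ⟨y, rfl⟩, rfl⟩ := mem_sup.1 hm
      rw [map_add, ← low_l, LinearMap.comp_apply, ← M.d_l, ← low_l]
      exact add_mem (mem_sup_left ⟨_, rfl⟩) (mem_sup_right ⟨_, rfl⟩))
    (fun x m hm => by
      obtain ⟨_, ⟨x, rfl⟩, _, ⟨y, rfl⟩, rfl⟩ := mem_sup.1 hm
      rw [map_add, ← low_r, LinearMap.comp_apply, ← M.d_r, ← low_r]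
      exact add_mem (mem_sup_left ⟨_, rfl⟩) (mem_sup_right ⟨_, rfl⟩))
    (fun m hm => by
      obtain ⟨_, ⟨x, rfl⟩, _, ⟨y, rfl⟩, rfl⟩ := mem_sup.1 hm
      rw [map_add, LinearMap.comp_apply, M.d_d, add_zero]
      exact mem_sup_right ⟨_, rfl⟩)

variable {M a} in
lemma genLow_acyclic (h : CohAbove M a) : Acyclic (genLow M a) := by
  rintro ⟨m, hm⟩ hd
  have hd' : M.d m = 0 := congrArg Subtype.val hd
  obtain ⟨_, ⟨x, rfl⟩, _, ⟨y, rfl⟩, rfl⟩ := mem_sup.1 hm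
  rw [map_add, LinearMap.comp_apply, M.d_d, add_zero] at hd'
  obtain ⟨z, hz⟩ := h.exists_eq _ hd' (low_low _ _ _)
  refine ⟨⟨M.low a (z + y), mem_sup_left ⟨_, rfl⟩⟩, Subtype.ext ?_⟩
  change M.low a x + M.d (M.low a y) = M.d (M.low a (z + y))
  rw [map_add, map_add, ← low_d M a z, hz, low_low_succ]

lemma exists_factor_genLow {P : Cplx A C} (hP : Below P a) (f : P.homs M) :
    ∃ (w : P.homs (genLow M a)) (v : (genLow M a).homs M), ∀ x, f.1 x = v.1 (w.1 x) := by
  have hf (x : P) : f.1 x ∈ range (M.low a) ⊔ range (M.d ∘ₗ M.low a) := by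
    refine mem_sup_left ⟨f.1 x, ?_⟩
    induction x using P.induction with
    | hp t x hx =>
      by_cases ht : t.1 < a
      · exact M.low_of_lt a (hom_gr f hx) ht
      · rw [hP t (by omega) x hx, map_zero, map_zero]
    | hadd x y hx hy => rw [map_add, map_add, hx, hy]
  exact ⟨⟨LinearMap.codRestrict _ f.1 hf, fun t m hm => hom_gr f hm,
    fun a m => Subtype.ext (hom_l f a m), fun a m => Subtype.ext (hom_r f a m),
    fun m => Subtype.ext (hom_d f m)⟩, subIncl _ _ _ _ _ _, fun x => rfl⟩

end Cplx

namespace DKer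

/-- There are no morphisms from an object with cohomology in degrees `< a` to one with cohomology in
degrees `≥ a`. -/
lemma eq_zero_of_coh {M N : Ker A C} {a : ℤ} (hM : CohBelow M.cplx a) (hN : CohAbove N.cplx a)
    (φ : of M ⟶ of N) : φ = 0 := by
  let i : Ker.bar (truncLow M.cplx a) ⟶ M := Ker.homMk (compHom (barAug _) (truncLowIncl M.cplx a))
  have hi : IsQis i := (isQis_comp (barAug_isQis _) (truncLowIncl_isQis hM) :)
  have : IsIso (ofHom i) := isIso_ofHom hi
  obtain ⟨f, hf⟩ := exists_ofHom (ofHom i ≫ φ)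
  obtain ⟨w, v, h⟩ := exists_factor_genLow N.cplx a (truncLow_below M.cplx a).bar f
  rw [← cancel_epi (ofHom i), ← hf, Limits.comp_zero]
  exact ofHom_eq_zero (genLow_acyclic hN) w v f h

end DKer

/-! ### Finiteness of the space of morphisms between coherent objects -/

namespace Cplx

variable (M : Cplx A C)

lemma exists_common_support (s : Finset M) :
    ∃ S : Finset (ℤ × ℤ), ∀ y ∈ s, y = ∑ t ∈ S, M.proj t y := by
  classical
  choose S hS using M.exists_sum_proj
  exact ⟨s.biUnion S, fun y hy => hS y _ (Finset.subset_biUnion_of_mem S hy)⟩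

lemma IsCoherent.exists_cohBelow {M : Cplx A C} (h : IsCoherent M) : ∃ b, CohBelow M b := by
  obtain ⟨s, hs, h⟩ := (isCoherent_iff M).1 h
  obtain ⟨S, hS⟩ := M.exists_common_support s
  obtain ⟨b, hb⟩ : ∃ b, ∀ t ∈ S, t.1 < b := by
    obtain ⟨b, hb⟩ := (S.image Prod.fst).bddAbove
    exact ⟨b + 1, fun t ht => Int.lt_add_one_iff.2 (hb (by
      exact_mod_cast mem_image_of_mem _ ht))⟩
  refine ⟨b, fun t ht m hm hd => ?_⟩
  obtain ⟨m₁, h₁, _, ⟨x, rfl⟩, e⟩ := mem_sup.1 (h m hd)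
  have hlow : bispan M s ≤ ker (M.low b - LinearMap.id) := by
    refine bispan_le M (fun y hy => ?_) (fun a m hm => ?_) fun a m hm => ?_
    · rw [mem_ker, LinearMap.sub_apply, sub_eq_zero, LinearMap.id_apply]
      conv_lhs => rw [hS y hy, map_sum]
      conv_rhs => rw [hS y hy]
      exact sum_congr rfl fun t ht => M.low_of_lt b (M.proj_mem t y) (hb t ht)
    · rw [mem_ker, LinearMap.sub_apply, sub_eq_zero, LinearMap.id_apply] at hm ⊢
      rw [low_l, hm]
    · rw [mem_ker, LinearMap.sub_apply, sub_eq_zero, LinearMap.id_apply] at hm ⊢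
      rw [low_r, hm]
  have h₂ := hlow h₁
  rw [mem_ker, LinearMap.sub_apply, sub_eq_zero, LinearMap.id_apply] at h₂
  refine ⟨M.proj (t - (1, 0)) x, ?_⟩
  rw [d_proj, sub_add_cancel]
  conv_rhs => rw [← M.proj_of_mem hm, ← e, map_add, ← h₂, ← low_proj,
    M.low_of_le b (M.proj_mem t m₁) ht, zero_add]

lemma IsCoherent.exists_cohAbove {M : Cplx A C} (h : IsCoherent M) : ∃ b, CohAbove M b := by
  obtain ⟨s, hs, h⟩ := (isCoherent_iff M).1 h
  obtain ⟨S, hS⟩ := M.exists_common_support s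
  obtain ⟨b, hb⟩ : ∃ b, ∀ t ∈ S, b ≤ t.1 := by
    obtain ⟨b, hb⟩ := (S.image Prod.fst).bddBelow
    exact ⟨b, fun t ht => hb (by exact_mod_cast mem_image_of_mem _ ht)⟩
  refine ⟨b, fun t ht m hm hd => ?_⟩
  obtain ⟨m₁, h₁, _, ⟨x, rfl⟩, e⟩ := mem_sup.1 (h m hd)
  have hlow : bispan M s ≤ ker (M.low b) := by
    refine bispan_le M (fun y hy => ?_) (fun a m hm => ?_) fun a m hm => ?_
    · rw [mem_ker, hS y hy, map_sum]
      exact sum_eq_zero fun t ht => M.low_of_le b (M.proj_mem t y) (hb t ht)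
    · rw [mem_ker] at hm ⊢
      rw [low_l, hm, map_zero]
    · rw [mem_ker] at hm ⊢
      rw [low_r, hm, map_zero]
  have h₂ : M.low b m₁ = 0 := hlow h₁
  refine ⟨M.proj (t - (1, 0)) x, ?_⟩
  have h₃ : M.proj t m₁ = 0 := by
    rw [← M.low_of_lt b (M.proj_mem t m₁) ht, low_proj, h₂, map_zero]
  rw [d_proj, sub_add_cancel]
  conv_rhs => rw [← M.proj_of_mem hm, ← e, map_add, h₃, zero_add]

/-- A graded algebra with finite-dimensional pieces that vanish in negative degrees. -/
def _root_.GrAlg.LocallyFinite (A : GrAlg K) : Prop :=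
  (∀ q, q < 0 → A.gr q = ⊥) ∧ ∀ q, Module.Finite K (A.gr q)

/-- The multiples `a y c` with `a` and `c` homogeneous of given degrees. -/
def mulSpan (y : M) (q q' : ℤ) : Submodule K M :=
  Submodule.map₂ (LinearMap.mk₂ K (fun a c => M.l a (M.r c y)) (by simp) (by simp) (by simp)
    (by simp)) (A.gr q) (C.gr q')

lemma mulSpan_finite (hA : A.LocallyFinite) (hC : C.LocallyFinite) (y : M) (q q' : ℤ) :
    (mulSpan M y q q').FG :=
  Submodule.FG.map₂ _ (Module.Finite.iff_fg.1 (hA.2 q)) (Module.Finite.iff_fg.1 (hC.2 q'))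

/-- The part of degree `t` of the cohomology of a coherent complex is finite-dimensional. -/
lemma IsCoherent.cohGr_finite {M : Cplx A C} (hA : A.LocallyFinite) (hC : C.LocallyFinite)
    (h : IsCoherent M) (t : ℤ × ℤ) : (cohGr M t).FG := by
  obtain ⟨s, hs, h⟩ := (isCoherent_iff M).1 h
  obtain ⟨S, hS⟩ := M.exists_common_support s
  let U : Submodule K M := ⨆ y : s, ⨆ u : S, ⨆ q : Finset.Icc 0 (t.2 - u.1.2),
    mulSpan M (M.proj u.1 y.1) q.1 (t.2 - u.1.2 - q.1)
  have hU : U.FG := Submodule.fg_iSup _ fun y => Submodule.fg_iSup _ fun u =>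
    Submodule.fg_iSup _ fun q => mulSpan_finite M hA hC _ _ _
  have key : bispan M s ≤ U.comap (M.proj t) := by
    refine span_le.2 ?_
    rintro _ ⟨y, hy, a, c, rfl⟩
    change M.proj t _ ∈ U
    rw [hS y hy]
    simp only [map_sum]
    refine Submodule.sum_mem _ fun u hu => ?_
    induction a using homogeneous_induction A.internal with
    | hadd a a' h h' => rw [map_add, LinearMap.add_apply, map_add]; exact add_mem h h'
    | hp q a ha =>
      induction c using homogeneous_induction C.internal with
      | hadd a a' h h' =>
        rw [map_add, LinearMap.add_apply, map_add, map_add]; exact add_mem h h'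
      | hp q' c hc =>
        have hm := M.l_mem ha (M.r_mem hc (M.proj_mem u y))
        by_cases e : (u.1, q + (q' + u.2)) = t
        · subst e
          rw [M.proj_of_mem hm]
          by_cases hq : q < 0
          · rw [hA.1 q hq, Submodule.mem_bot] at ha
            rw [ha, map_zero]; exact zero_mem _
          by_cases hq' : q' < 0
          · rw [hC.1 q' hq', Submodule.mem_bot] at hc
            rw [hc, map_zero, LinearMap.zero_apply, map_zero]; exact zero_mem _
          refine mem_iSup_of_mem ⟨y, hy⟩ (mem_iSup_of_mem ⟨u, hu⟩
            (mem_iSup_of_mem ⟨q, by rw [Finset.mem_Icc]; dsimp only; omega⟩ ?_))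
          refine Submodule.apply_mem_map₂ (LinearMap.mk₂ K (fun a c => M.l a (M.r c (M.proj u y)))
            (by simp) (by simp) (by simp) (by simp)) ha ?_
          convert hc using 2
          dsimp only
          ring
        · rw [M.proj_of_ne hm e]; exact zero_mem _
  have hle : cohGr M t ≤ (U.comap (ker M.d).subtype).map (Submodule.mkQ _) := by
    intro x hx
    obtain ⟨m, hm, ht, rfl⟩ := exists_of_mem_cohGr hx
    obtain ⟨m₁, h₁, _, ⟨x, rfl⟩, e⟩ := mem_sup.1 (h m hm)
    have e' : m = M.proj t m₁ + M.d (M.proj (t - (1, 0)) x) := by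
      rw [d_proj, sub_add_cancel, ← map_add, e, M.proj_of_mem ht]
    have hd : M.d (M.proj t m₁) = 0 := by
      have := hm
      rwa [e', map_add, M.d_d, add_zero] at this
    refine ⟨⟨_, hd⟩, key h₁, ?_⟩
    exact cls_eq (hm := hd) (hm' := hm) |>.2 ⟨- M.proj (t - (1, 0)) x, by
      rw [map_neg, eq_sub_iff_add_eq]
      conv_lhs => rw [e']
      abel⟩
  have hfin : Module.Finite K U := Module.Finite.iff_fg.2 hU
  have : Module.Finite K (U.comap (ker M.d).subtype) :=
    Module.Finite.of_injective (((ker M.d).subtype ∘ₗ Submodule.subtype _).codRestrict U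
      fun x => x.2) fun x y hxy => by
        have h := Subtype.ext_iff.1 hxy
        exact Subtype.ext (Subtype.ext h)
  have : Module.Finite K ((U.comap (ker M.d).subtype).map (Submodule.mkQ
    ((range M.d).comap (ker M.d).subtype))) := inferInstance
  exact Submodule.FG.of_le (Module.Finite.iff_fg.1 this) hle

/-- Generators of the cohomology in the top degree. -/
lemma IsCoherent.exists_generators {M : Cplx A C} (h : IsCoherent M) (b : ℤ) :
    ∃ G : Finset M, (∀ y ∈ G, M.d y = 0 ∧ ∃ q, y ∈ M.gr (b, q)) ∧
      ∀ q, ∀ m ∈ M.gr (b, q), M.d m = 0 → m ∈ bispan M G ⊔ range M.d := by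
  classical
  obtain ⟨s, hs, h⟩ := (isCoherent_iff M).1 h
  obtain ⟨S, hS⟩ := M.exists_common_support s
  refine ⟨s.biUnion fun y => (S.filter fun u => u.1 = b).image fun u => M.proj u y, ?_, ?_⟩
  · intro y hy
    simp only [Finset.mem_biUnion, mem_image, mem_filter] at hy
    obtain ⟨y, hy, u, ⟨-, rfl⟩, rfl⟩ := hy
    exact ⟨by rw [d_proj, hs y hy, map_zero], u.2, M.proj_mem u y⟩
  · intro q m hm hd
    obtain ⟨m₁, h₁, _, ⟨x, rfl⟩, e⟩ := mem_sup.1 (h m hd)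
    have key : bispan M s ≤ (bispan M (s.biUnion fun y => (S.filter fun u => u.1 = b).image
        fun u => M.proj u y : Finset M)).comap (M.proj (b, q)) := by
      refine span_le.2 ?_
      rintro _ ⟨y, hy, a, c, rfl⟩
      change M.proj (b, q) _ ∈ bispan M _
      rw [hS y hy]
      simp only [map_sum]
      refine Submodule.sum_mem _ fun u hu => ?_
      induction a using homogeneous_induction A.internal with
      | hadd a a' h h' => rw [map_add, LinearMap.add_apply, map_add]; exact add_mem h h'
      | hp p a ha =>
        induction c using homogeneous_induction C.internal with
        | hadd a a' h h' =>
          rw [map_add, LinearMap.add_apply, map_add, map_add]; exact add_mem h h'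
        | hp p' c hc =>
          have hm := M.l_mem ha (M.r_mem hc (M.proj_mem u y))
          by_cases e : (u.1, p + (p' + u.2)) = (b, q)
          · rw [← e, M.proj_of_mem hm]
            refine bispan_l M _ (bispan_r M _ (mem_bispan M ?_))
            simp only [Finset.coe_biUnion, Set.mem_iUnion, Finset.mem_coe, mem_image,
              mem_filter]
            exact ⟨y, hy, u, ⟨hu, congrArg Prod.fst e⟩, rfl⟩
          · rw [M.proj_of_ne hm e]; exact zero_mem _
    rw [← M.proj_of_mem hm, ← e, map_add, ← sub_add_cancel (b, q) (1, 0), ← d_proj, sub_add_cancel]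
    exact add_mem (mem_sup_left (key h₁)) (mem_sup_right ⟨_, rfl⟩)

end Cplx

namespace Cplx

variable (K) in
/-- Scalars acting on a vector space. -/
def scalarHom (V : Type u) [AddCommGroup V] [Module K V] :
    (GrAlg.base K) →ₐ[K] Module.End K V := Algebra.ofId K (Module.End K V)

lemma scalarHom_apply (V : Type u) [AddCommGroup V] [Module K V] (x : GrAlg.base K)
    (v : V) : scalarHom K V x v = (show K from x) • v := by
  change (algebraMap K (Module.End K V) x) v = _
  rw [Module.algebraMap_end_apply]

lemma base_smul_mem {V : Type u} [AddCommGroup V] [Module K V] {gr : ℤ × ℤ → Submodule K V}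
    {q p q' : ℤ} {x : GrAlg.base K} {v : V} (hx : x ∈ (GrAlg.base K).gr q)
    (hv : v ∈ gr (p, q')) : scalarHom K V x v ∈ gr (p, q + q') := by
  rw [scalarHom_apply]
  by_cases h : q = 0
  · subst h
    rw [zero_add]; exact Submodule.smul_mem _ _ hv
  · rw [GrAlg.base_gr, if_neg h] at hx
    have : (show K from x) = 0 := hx
    rw [this, zero_smul]; exact zero_mem _

variable (M : Cplx A C) (G : Finset M)

lemma span_proj (hG : ∀ y ∈ G, ∃ t : ℤ × ℤ, y ∈ M.gr t) (t : ℤ × ℤ) {m : M}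
    (hm : m ∈ span K (G : Set M)) :
    M.proj t m ∈ span K (G : Set M) := by
  have : span K (G : Set M) ≤ (span K (G : Set M)).comap
      (M.proj t) := span_le.2 fun y hy => by
    obtain ⟨s, hs⟩ := hG y hy
    change M.proj t y ∈ span K (G : Set M)
    by_cases h : s = t
    · rw [M.proj_of_mem (h ▸ hs)]; exact subset_span hy
    · rw [M.proj_of_ne hs h]; exact zero_mem _
  exact this hm

/-- The span of a finite set of homogeneous elements, as a complex of graded vector spaces with zero
differential. -/
def genSpan (hG : ∀ y ∈ G, ∃ t : ℤ × ℤ, y ∈ M.gr t) : Cplx (GrAlg.base K) (GrAlg.base K) where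
  carrier := span K (G : Set M)
  gr t := (M.gr t).comap (Submodule.subtype _)
  internal := by
    refine isInternal_of_projections
      (fun t => (M.proj t).restrict fun m hm => M.span_proj G hG t hm) ?_ ?_ ?_
    · exact fun t m hm => Subtype.ext (M.proj_of_mem hm)
    · exact fun s t h m hm => Subtype.ext (M.proj_of_ne hm h)
    · intro m
      obtain ⟨T, hT⟩ := M.exists_sum_proj m.1
      have : m = ∑ t ∈ T, (M.proj t).restrict (fun m hm => M.span_proj G hG t hm) m :=
        Subtype.ext (by rw [AddSubmonoidClass.coe_finset_sum]; exact hT T subset_rfl)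
      rw [this]
      exact sum_mem fun t _ => mem_iSup_of_mem t (M.proj_mem t m.1)
  l := scalarHom K _
  r := scalarHom K _
  l_r a c m := by rw [scalarHom_apply, scalarHom_apply, scalarHom_apply, scalarHom_apply, smul_comm]
  l_mem ha hm := base_smul_mem (gr := fun t => (M.gr t).comap (Submodule.subtype _)) ha hm
  r_mem ha hm := base_smul_mem (gr := fun t => (M.gr t).comap (Submodule.subtype _)) ha hm
  d := 0
  d_mem _ := zero_mem _
  d_d _ := rfl
  d_l _ _ := by simp
  d_r _ _ := by simp

variable {G} (hG : ∀ y ∈ G, ∃ t : ℤ × ℤ, y ∈ M.gr t)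

/-- The inclusion of the span of the generators. -/
def genSpanIncl : genSpan M G hG →ₗ[K] M := Submodule.subtype _

lemma genSpan_induction {p : genSpan M G hG → Prop} (h : ∀ v, genSpanIncl M hG v ∈ G → p v)
    (hadd : ∀ v w, p v → p w → p (v + w)) (hsmul : ∀ (x : K) v, p v → p (x • v)) (h0 : p 0)
    (v : genSpan M G hG) : p v := by
  obtain ⟨v, hv⟩ := v
  induction hv using Submodule.span_induction with
  | mem v hv => exact h ⟨v, subset_span hv⟩ hv
  | zero => exact h0
  | add x y hx hy h h' => exact hadd _ _ h h'
  | smul x v hv h => exact hsmul x _ h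

/-- A generator as an element of the span. -/
def genMk (y : G) : genSpan M G hG := ⟨y.1, subset_span y.2⟩

lemma exists_gen {y : M} (hy : y ∈ G) : ∃ v, genSpanIncl M hG v = y :=
  ⟨⟨y, subset_span hy⟩, rfl⟩

lemma genSpan_d (v : genSpan M G hG) : (genSpan M G hG).d v = 0 := rfl

lemma fr_d_zero {V : Cplx (GrAlg.base K) (GrAlg.base K)} (hV : ∀ v, V.d v = 0)
    (x : Fr A C V) : (Fr A C V).d x = 0 := by
  induction x using fr_induction with
  | h a v c => rw [d_l, d_r, frGen_d, hV, map_zero, map_zero, map_zero]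
  | hadd x y hx hy => rw [map_add, hx, hy, add_zero]

lemma Below.fr {V : Cplx (GrAlg.base K) (GrAlg.base K)} {a : ℤ} (h : Below V a) :
    Below (Fr A C V) a := fun t ht x hx => by
  have : (LinearMap.id : Fr A C V →ₗ[K] _) x ∈ (⊥ : Submodule K (Fr A C V)) :=
    fr_map_mem V (fun a q v s c q' ha hv hc hs => by
      have : v = 0 := h s (by rw [← hs] at ht; simpa using ht) v hv
      rw [this, map_zero, map_zero, map_zero, map_zero]; exact zero_mem _) hx
  exact this

/-- The map from the free bimodule on the generators. -/
def genHom (hd : ∀ y ∈ G, M.d y = 0) : (Fr A C (genSpan M G hG)).homs M :=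
  frHom (genSpanIncl M hG) (fun _ _ h => h) fun v => by
    rw [genSpan_d, map_zero]
    induction v using genSpan_induction with
    | h v hv => exact (hd _ hv).symm
    | hadd v w hv hw => rw [map_add, map_add, ← hv, ← hw, add_zero]
    | hsmul x v hv => rw [map_smul, map_smul, ← hv, smul_zero]
    | h0 => rw [map_zero, map_zero]

lemma genHom_gen (hd : ∀ y ∈ G, M.d y = 0) (v : genSpan M G hG) :
    (genHom M hG hd).1 (frGen _ v) = genSpanIncl M hG v := frLin_gen _ _

lemma bispan_le_genHom (hd : ∀ y ∈ G, M.d y = 0) :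
    bispan M G ≤ range (genHom M hG hd).1 := by
  refine bispan_le M (fun y hy => ?_) ?_ ?_
  · obtain ⟨v, rfl⟩ := exists_gen M hG hy
    exact ⟨_, genHom_gen M hG hd v⟩
  · rintro a _ ⟨x, rfl⟩
    exact ⟨_, hom_l _ _ _⟩
  · rintro a _ ⟨x, rfl⟩
    exact ⟨_, hom_r _ _ _⟩

/-- The map `(a ⊗ c) ↦ a x c`. -/
def biact (x : M) : A ⊗[K] C →ₗ[K] M :=
  TensorProduct.lift (LinearMap.mk₂ K (fun a c => M.l a (M.r c x)) (by simp) (by simp) (by simp)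
    (by simp))

lemma biact_tmul (x : M) (a : A) (c : C) : biact M x (a ⊗ₜ c) = M.l a (M.r c x) := by simp [biact]

lemma biact_mul (x : M) (a : A) (c : C) (w : A ⊗[K] C) :
    biact M x ((a ⊗ₜ c) * w) = M.l a (M.r c (biact M x w)) := by
  induction w using TensorProduct.induction_on with
  | zero => simp
  | tmul a' c' =>
    rw [Algebra.TensorProduct.tmul_mul_tmul, biact_tmul, biact_tmul, map_mul, map_mul,
      mul_apply, mul_apply, ← M.l_r]
  | add w w' h h' => rw [mul_add, map_add, h, h', map_add, map_add, map_add]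

/-- The combinations of finitely many elements with coefficients in `A ⊗ C`. -/
def biactSum {ι : Type*} [Fintype ι] (x : ι → M) :
    (ι → A ⊗[K] C) →ₗ[K] M := ∑ i, biact M (x i) ∘ₗ LinearMap.proj i

lemma biactSum_smul {ι : Type*} [Fintype ι] (x : ι → M) (a : A) (c : C) (w : ι → A ⊗[K] C) :
    biactSum M x ((a ⊗ₜ[K] c : A ⊗[K] C) • w) = M.l a (M.r c (biactSum M x w)) := by
  simp [biactSum, biact_mul]

lemma biactSum_surjective {ι : Type*} [Fintype ι] [DecidableEq ι] (x : ι → M)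
    {m : M} (hm : m ∈ bispan M (Set.range x)) : ∃ w, biactSum M x w = m := by
  have : bispan M (Set.range x) ≤ range (biactSum M x) := by
    refine span_le.2 ?_
    rintro _ ⟨_, ⟨i, rfl⟩, a, c, rfl⟩
    refine ⟨Pi.single i (a ⊗ₜ c), ?_⟩
    rw [biactSum, LinearMap.sum_apply, sum_eq_single i]
    · rw [LinearMap.comp_apply, LinearMap.proj_apply, Pi.single_eq_same, biact_tmul]
    · intro j _ hj
      rw [LinearMap.comp_apply, LinearMap.proj_apply, Pi.single_eq_of_ne hj, map_zero]
    · simp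
  exact this hm

lemma fr_mem_bispan (x : Fr A C (genSpan M G hG)) : x ∈ bispan (Fr A C (genSpan M G hG))
      (Set.range fun y : G => frGen _ (genMk M hG y)) := by
  induction x using fr_induction with
  | hadd x y hx hy => exact add_mem hx hy
  | h a v c =>
    refine bispan_l _ _ (bispan_r _ _ ?_)
    induction v using genSpan_induction with
    | h v hv => exact mem_bispan _ ⟨⟨_, hv⟩, rfl⟩
    | hadd v w hv hw => rw [map_add]; exact add_mem hv hw
    | hsmul x v hv => rw [map_smul]; exact Submodule.smul_mem _ _ hv
    | h0 => rw [map_zero]; exact zero_mem _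

variable {M}

/-- The cone of the map from a free bimodule of finite rank to a coherent complex is coherent, since
`A ⊗ C` is noetherian. -/
lemma IsCoherent.cone (h : IsCoherent M) [IsNoetherianRing (A ⊗[K] C)]
    (hd : ∀ y ∈ G, M.d y = 0) : IsCoherent (cone (genHom M hG hd) 0 1) := by
  classical
  obtain ⟨s, hs, h⟩ := (isCoherent_iff M).1 h
  let φ := genHom M hG hd
  let θ := biactSum (Fr A C (genSpan M G hG)) fun y : G => frGen _ (genMk M hG y)
  have hθ (x) : ∃ w, θ w = x := biactSum_surjective _ _ (fr_mem_bispan M hG x)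
  -- the cocycles of the cone have the second components `θ w` with `w ∈ L`
  let L : Submodule (A ⊗[K] C) (G → A ⊗[K] C) := {
      carrier := {w | ∃ m, M.d m + φ.1 (θ w) = 0}
      zero_mem' := ⟨0, by simp⟩
      add_mem' := by
        rintro w w' ⟨m, hm⟩ ⟨m', hm'⟩
        refine ⟨m + m', ?_⟩
        rw [map_add, map_add, map_add, add_add_add_comm, hm, hm', add_zero]
      smul_mem' := by
        rintro z w ⟨m, hm⟩
        change ∃ m, M.d m + φ.1 (θ (z • w)) = 0
        induction z using TensorProduct.induction_on with
        | zero => exact ⟨0, by simp⟩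
        | tmul a c =>
          refine ⟨M.l a (M.r c m), ?_⟩
          rw [biactSum_smul, hom_l, hom_r, M.d_l, M.d_r, ← map_add, ← map_add, hm, map_zero,
            map_zero]
        | add z z' h h' =>
          obtain ⟨m, hm⟩ := h
          obtain ⟨m', hm'⟩ := h'
          refine ⟨m + m', ?_⟩
          rw [add_smul, map_add, map_add, map_add, add_add_add_comm, hm, hm', add_zero] }
  obtain ⟨R, hR⟩ : L.FG := IsNoetherian.noetherian L
  have hRK (w : R) : ∃ m, M.d m + φ.1 (θ w.1) = 0 := by
    have : w.1 ∈ L := by rw [← hR]; exact subset_span w.2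
    exact this
  choose p hp using hRK
  have hc (m x) (hm : M.d m + φ.1 x = 0) : (Cplx.cone φ 0 1).d (m, x) = 0 := by
    rw [cone_d, hm, smul_zero, fr_d_zero (genSpan_d M hG), smul_zero]; rfl
  let in₁ : M →ₗ[K] Cplx.cone φ 0 1 := LinearMap.inl K _ _
  let mk (m : M) (x : Fr A C (genSpan M G hG)) : Cplx.cone φ 0 1 := (m, x)
  let T : Finset (Cplx.cone φ 0 1) := s.image in₁ ∪ Finset.univ.image fun w : R => mk (p w) (θ w.1)
  have hT : ∀ w ∈ L, ∃ m, mk m (θ w) ∈ bispan (Cplx.cone φ 0 1) T := by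
    intro w hw
    rw [← hR] at hw
    induction hw using Submodule.span_induction with
    | mem w hw =>
      let w' : R := ⟨w, hw⟩
      exact ⟨p w', mem_bispan _ (Finset.mem_union_right _
        (mem_image_of_mem (fun w : R => mk (p w) (θ w.1)) (Finset.mem_univ w')))⟩
    | zero => exact ⟨0, by rw [map_zero]; exact zero_mem _⟩
    | add w w' _ _ h h' =>
      obtain ⟨m, hm⟩ := h
      obtain ⟨m', hm'⟩ := h'
      exact ⟨m + m', by rw [map_add]; exact add_mem hm hm'⟩
    | smul z w _ h =>
      obtain ⟨m, hm⟩ := h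
      induction z using TensorProduct.induction_on with
      | zero => exact ⟨0, by rw [zero_smul, map_zero]; exact zero_mem _⟩
      | tmul a c =>
        exact ⟨M.l a (M.r c m), by rw [biactSum_smul]; exact bispan_l _ a (bispan_r _ c hm)⟩
      | add z z' h h' =>
        obtain ⟨m, hm⟩ := h
        obtain ⟨m', hm'⟩ := h'
        exact ⟨m + m', by rw [add_smul, map_add]; exact add_mem hm hm'⟩
  have hin : ∀ m ∈ bispan M s, in₁ m ∈ bispan (Cplx.cone φ 0 1) T := by
    intro m hm
    refine bispan_le M (U := (bispan (Cplx.cone φ 0 1) T).comap in₁) (fun y hy => ?_)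
      (fun a m hm => ?_) (fun a m hm => ?_) hm
    · exact mem_bispan _ (Finset.mem_union_left _ (mem_image_of_mem _ hy))
    · have := bispan_l _ a hm
      have e : (Cplx.cone φ 0 1).l a (in₁ m) = in₁ (M.l a m) :=
        Prod.ext rfl (map_zero ((Fr A C (genSpan M G hG)).l a))
      rwa [e] at this
    · have := bispan_r _ a hm
      have e : (Cplx.cone φ 0 1).r a (in₁ m) = in₁ (M.r a m) :=
        Prod.ext rfl (map_zero ((Fr A C (genSpan M G hG)).r a))
      rwa [e] at this
  have hTd : ∀ y ∈ T, (Cplx.cone φ 0 1).d y = 0 := by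
    intro y hy
    rcases Finset.mem_union.1 hy with hy | hy
    · obtain ⟨y', hy', rfl⟩ := mem_image.1 hy
      exact hc y' 0 (by rw [hs y' hy', map_zero, add_zero])
    · obtain ⟨w, -, rfl⟩ := mem_image.1 hy
      exact hc _ _ (hp w)
  refine (isCoherent_iff _).2 ⟨T, hTd, ?_⟩
  rintro ⟨m, x⟩ hm
  have hm₁ : (1 : K) • (M.d m + φ.1 x) = 0 := congrArg Prod.fst hm
  rw [one_smul] at hm₁
  obtain ⟨w, rfl⟩ := hθ x
  obtain ⟨m', hm'⟩ := hT w ⟨m, hm₁⟩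
  have hd' : M.d m' + φ.1 (θ w) = 0 := by
    have : bispan (Cplx.cone φ 0 1) T ≤ ker (Cplx.cone φ 0 1).d :=
      bispan_le _ hTd (fun a m hm => by
        rw [mem_ker] at hm ⊢; rw [Cplx.d_l, hm, map_zero])
        fun a m hm => by
        rw [mem_ker] at hm ⊢; rw [Cplx.d_r, hm, map_zero]
    have h' : (1 : K) • (M.d m' + φ.1 (θ w)) = 0 := congrArg Prod.fst (this hm')
    rwa [one_smul] at h'
  obtain ⟨m₁, h₁, _, ⟨z, rfl⟩, e⟩ := mem_sup.1 (h (m - m') (by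
    rw [map_sub, sub_eq_zero]; exact add_right_cancel (hm₁.trans hd'.symm)))
  have : mk m (θ w) = mk m' (θ w) + in₁ m₁ + (Cplx.cone φ 0 1).d (mk z 0) := by
    refine Prod.ext ?_ ?_
    · change m = m' + m₁ + (1 : K) • (M.d z + φ.1 0)
      rw [map_zero, add_zero, one_smul, add_assoc, e, add_sub_cancel]
    · change θ w = θ w + 0 + (-1 : K) • (Fr A C (genSpan M G hG)).d 0
      rw [map_zero, smul_zero, add_zero, add_zero]
  change mk m (θ w) ∈ _
  rw [this]
  exact add_mem (mem_sup_left (add_mem hm' (hin m₁ h₁))) (mem_sup_right ⟨_, rfl⟩)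

/-- Killing generators of the top cohomology lowers the bound by one. -/
lemma CohBelow.cone {b : ℤ} (h : CohBelow M (b + 1)) (hd : ∀ y ∈ G, M.d y = 0)
    (hb : ∀ y ∈ G, ∃ q, y ∈ M.gr (b, q))
    (hgen : ∀ q, ∀ m ∈ M.gr (b, q), M.d m = 0 → m ∈ bispan M G ⊔ range M.d) :
    CohBelow (cone (genHom M hG hd) 0 1) b := by
  have hV : Below (genSpan M G hG) (b + 1) := by
    rintro t ht ⟨v, hv⟩ hv'
    refine Subtype.ext ?_
    change v = 0
    have hv'' : v ∈ M.gr t := hv'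
    have : ∀ m ∈ span K (G : Set M), M.proj t m = 0 := by
      intro m hm
      have : span K (G : Set M) ≤ ker (M.proj t) :=
        span_le.2 fun y hy => by
          obtain ⟨q, hq⟩ := hb y hy
          exact M.proj_of_ne hq fun e => by rw [← e] at ht; dsimp at ht; omega
      exact this hm
    rw [← M.proj_of_mem hv'', this v hv]
  rintro ⟨p, q⟩ hp ⟨m, x⟩ ⟨hm, hx⟩ hmx
  dsimp only at hp
  have hm' : m ∈ M.gr ((p, q) + (0, 0)) := hm
  rw [Prod.mk_zero_zero, add_zero] at hm'
  obtain rfl : x = 0 := hV.fr ((p, q) + (0 + 1, 0)) (by dsimp; omega) x hx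
  have hmd : (1 : K) • (M.d m + (genHom M hG hd).1 0) = 0 := congrArg Prod.fst hmx
  rw [map_zero, add_zero, one_smul] at hmd
  have hfin (z x) (e : M.d z + (genHom M hG hd).1 x = m) : ∃ y,
      (Cplx.cone (genHom M hG hd) 0 1).d y = (m, 0) := by
    refine ⟨((z, x) : M × (Fr A C (genSpan M G hG))), ?_⟩
    rw [cone_d, e, fr_d_zero (genSpan_d M hG), smul_zero, one_smul]
  by_cases hpb : p = b
  · subst hpb
    obtain ⟨m₁, h₁, _, ⟨z, rfl⟩, e⟩ := mem_sup.1 (hgen q m hm' hmd)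
    obtain ⟨x, rfl⟩ := bispan_le_genHom M hG hd h₁
    exact hfin z x (by rw [add_comm, e])
  · obtain ⟨z, hz⟩ := h (p, q) (by dsimp only; omega) m hm' hmd
    exact hfin z 0 (by rw [map_zero, add_zero, hz])

/-- A map out of a complex extends to the cone of a map from a free bimodule if it sends the
generators to coboundaries. -/
lemma exists_cone_ext {N : Cplx A C} (hd : ∀ y ∈ G, M.d y = 0) (g : M.homs N)
    (hg : ∀ y ∈ G, ∃ n, N.d n = g.1 y) :
    ∃ g' : (cone (genHom M hG hd) 0 1).homs N, ∀ m, g'.1 ((m, 0) : M × _) = g.1 m := by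
  let V := genSpan M G hG
  -- choose the primitives linearly, then homogeneously
  have hv (v : V) : g.1 (genSpanIncl M hG v) ∈ range N.d := by
    induction v using genSpan_induction with
    | h v hv => exact hg _ hv
    | hadd v w hv hw => rw [map_add, map_add]; exact add_mem hv hw
    | hsmul x v hv => rw [map_smul, map_smul]; exact Submodule.smul_mem _ _ hv
    | h0 => rw [map_zero, map_zero]; exact zero_mem _
  obtain ⟨σ, hσ⟩ := N.d.rangeRestrict.exists_rightInverse_of_surjective
    (LinearMap.range_rangeRestrict _)
  let ν₀ : V →ₗ[K] N :=
    σ ∘ₗ LinearMap.codRestrict (range N.d) (g.1 ∘ₗ genSpanIncl M hG) hv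
  have hν₀ (v) : N.d (ν₀ v) = g.1 (genSpanIncl M hG v) :=
    congrArg Subtype.val (LinearMap.congr_fun hσ ⟨_, hv v⟩)
  let ν := degPart V N (-1, 0) ν₀
  have hν (v) : N.d (ν v) = g.1 (genSpanIncl M hG v) := by
    induction v using V.induction with
    | hp t v hv' =>
      have hv'' : genSpanIncl M hG v ∈ M.gr t := hv'
      have e : t + (-1, 0) + (1, 0) = t := by simp [Prod.ext_iff]
      rw [degPart_apply _ _ hv', d_proj, hν₀, e, N.proj_of_mem (hom_gr g hv'')]
    | hadd v w hv hw => rw [map_add, map_add, map_add, map_add, hv, hw]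
  have hνφ (x) : N.d (frLin ν x) = g.1 ((genHom M hG hd).1 x) := by
    rw [map_frLin ν N.d (fun a x => N.d_l a x) fun c x => N.d_r c x]
    have : N.d ∘ₗ ν = g.1 ∘ₗ genSpanIncl M hG := LinearMap.ext hν
    rw [this]
    exact (map_frLin (genSpanIncl M hG) g.1 (hom_l g) (hom_r g) x).symm
  refine ⟨⟨g.1 ∘ₗ LinearMap.fst K _ _ + frLin ν ∘ₗ LinearMap.snd K _ _, ?_, ?_, ?_, ?_⟩, ?_⟩
  · rintro t ⟨m, x⟩ ⟨hm, hx⟩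
    refine add_mem ?_ ?_
    · have := hom_gr g hm
      rwa [Prod.mk_zero_zero, add_zero] at this
    · have := frLin_mem (t := ν) (fun s v hv => degPart_mem (M := V) (-1, 0) ν₀ hv) hx
      have e : t + (0 + 1, 0) + (-1, 0) = t := by simp [Prod.ext_iff]
      rwa [e] at this
  · rintro a ⟨m, x⟩
    change g.1 (M.l a m) + frLin ν (_) = N.l a (g.1 m + frLin ν x)
    rw [hom_l, map_add, ← frLin_l]; rfl
  · rintro a ⟨m, x⟩
    change g.1 (M.r a m) + frLin ν (_) = N.r a (g.1 m + frLin ν x)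
    rw [hom_r, map_add, ← frLin_r]; rfl
  · rintro ⟨m, x⟩
    change g.1 ((1 : K) • (M.d m + (genHom M hG hd).1 x)) + frLin ν (-(1 : K) • _) =
      N.d (g.1 m + frLin ν x)
    rw [LinearMap.comp_apply, fr_d_zero (genSpan_d M hG), smul_zero, map_zero, add_zero, one_smul,
      map_add, map_add, hom_d, hνφ]
  · intro m
    change g.1 m + frLin ν 0 = _
    rw [map_zero, add_zero]

end Cplx

lemma Cplx.CohBelow.of_qis {M N : Cplx A C} {f : M.homs N} (hf : IsQis f) {a : ℤ}
    (h : CohBelow N a) : CohBelow M a := fun t ht m hm hd => by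
  obtain ⟨y, hy⟩ := h t ht (f.1 m) (hom_gr f hm) (by rw [← hom_d, hd, map_zero])
  obtain ⟨x, hx⟩ := hf.1 m hd ⟨y, hy.symm⟩
  exact ⟨x, hx.symm⟩

namespace DKer

/-- The evaluation of morphisms on cohomology classes. -/
def evalCoh (M N : Ker A C) {ι : Type*} (h : ι → Coh M.cplx) :
    (of M ⟶ of N) →ₗ[K] (ι → Coh N.cplx) where
  toFun φ i := cohMap φ (h i)
  map_add' φ ψ := by
    funext i; rw [cohMap_add]; rfl
  map_smul' x φ := by
    funext i; rw [cohMap_smul]; rfl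

variable [IsNoetherianRing (A ⊗[K] C)]

/-- Induction on `k`, where the cohomology of `M` lives in degrees `< a + k` and that of `N` in
degrees `≥ a`. The cone `X` of the map from the free bimodule on generators of the top cohomology of `M` has
one degree less, and a morphism out of `M` that kills the generators comes from `X`. -/
lemma hom_finite_aux (hA : A.LocallyFinite) (hC : C.LocallyFinite) {N : Ker A C}
    (hN : IsCoherent N.cplx) {a : ℤ} (ha : CohAbove N.cplx a) (k : ℕ) :
    ∀ M : Ker A C, IsCoherent M.cplx → CohBelow M.cplx (a + k) → Module.Finite K (of M ⟶ of N) := by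
  induction k with
  | zero =>
    intro M _ hM
    have : Subsingleton (of M ⟶ of N) := ⟨fun φ ψ => by
      rw [eq_zero_of_coh (by simpa using hM) ha φ, eq_zero_of_coh (by simpa using hM) ha ψ]⟩
    infer_instance
  | succ k ih =>
    intro M hM hMb
    have hP := hM.of_qis' (barAug_isQis M.cplx)
    have hPb : CohBelow (Cplx.bar M.cplx) (a + k + 1) := by
      have := CohBelow.of_qis (barAug_isQis M.cplx) hMb
      rwa [Nat.cast_succ, ← add_assoc] at this
    obtain ⟨G, hG, hgen⟩ := hP.exists_generators (a + k)
    have hGd : ∀ y ∈ G, (Cplx.bar M.cplx).d y = 0 := fun y hy => (hG y hy).1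
    have hGt : ∀ y ∈ G, ∃ q, y ∈ (Cplx.bar M.cplx).gr (a + k, q) := fun y hy => (hG y hy).2
    have hGs : ∀ y ∈ G, ∃ t : ℤ × ℤ, y ∈ (Cplx.bar M.cplx).gr t := fun y hy =>
      ⟨_, (hGt y hy).choose_spec⟩
    let X := Cplx.cone (genHom (Cplx.bar M.cplx) hGs hGd) 0 1
    have hX : IsCoherent X := hP.cone hGs hGd
    have hXb : CohBelow X (a + k) := hPb.cone hGs hGd hGt hgen
    have hfin : Module.Finite K (of (Ker.bar X) ⟶ of N) :=
      ih (Ker.bar X) (hX.of_qis' (barAug_isQis X)) (hXb.of_qis (barAug_isQis X))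
    -- the inclusion of the complex into the cone, lifted to the resolutions
    let i : (Cplx.bar M.cplx).homs X := ⟨LinearMap.inl K _ _,
      fun t m hm => ⟨by rwa [Prod.mk_zero_zero, add_zero], zero_mem _⟩,
      fun a m => Prod.ext rfl (map_zero ((Fr A C _).l a)).symm,
      fun a m => Prod.ext rfl (map_zero ((Fr A C _).r a)).symm,
      fun m => by
        change ((_, 0) : (Cplx.bar M.cplx) × (Fr A C _)) =
          (Cplx.cone (genHom (Cplx.bar M.cplx) hGs hGd) 0 1).d (m, 0)
        rw [cone_d, map_zero, map_zero, add_zero, one_smul, smul_zero]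
        rfl⟩
    obtain ⟨j, hj⟩ := exists_bar_lift (barAug X) i (barAug_isQis X) (barAug_surjective X)
    let pre : (of (Ker.bar X) ⟶ of N) →ₗ[K] (of (Ker.bar M.cplx) ⟶ of N) :=
      Linear.leftComp K (of N) (ofHom (Ker.homMk j : Ker.bar M.cplx ⟶ Ker.bar X))
    let ev := evalCoh (Ker.bar M.cplx) N fun y : G => cls (Cplx.bar M.cplx) y.1 (hGd y.1 y.2)
    have hker : ker ev ≤ range pre := by
      intro φ hφ
      obtain ⟨g, rfl⟩ := exists_ofHom φ
      obtain ⟨g', hg'⟩ := exists_cone_ext hGs hGd (N := N.cplx) g fun y hy => by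
        have h : cohMap (ofHom g) (cls _ y (hGd y hy)) = 0 := congrFun hφ ⟨y, hy⟩
        rw [cohMap_ofHom, cohMap_cls, cls_eq_zero] at h
        exact h
      refine ⟨ofHom (Ker.homMk (compHom (barAug X) g') : Ker.bar X ⟶ N), ?_⟩
      change ofHom _ ≫ ofHom _ = _
      rw [← ofHom_comp]
      refine congrArg _ (Ker.hom_ext fun m => ?_)
      exact (congrArg g'.1 (hj m)).trans (hg' m)
    have hrange : range ev ≤
        Submodule.pi Set.univ fun y : G => cohGr N.cplx (a + k, (hGt y.1 y.2).choose) := by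
      rintro _ ⟨φ, rfl⟩ y -
      exact cohMap_mem φ (cls_mem (hGd y.1 y.2) (hGt y.1 y.2).choose_spec)
    have hpi : (Submodule.pi Set.univ fun y : G =>
        cohGr N.cplx (a + k, (hGt y.1 y.2).choose)).FG :=
      Submodule.fg_pi fun y => hN.cohGr_finite hA hC _
    have : Module.Finite K (of (Ker.bar M.cplx) ⟶ of N) := by
      refine ⟨Submodule.fg_of_fg_map_of_fg_inf_ker ev ?_ ?_⟩
      · rw [Submodule.map_top]; exact Submodule.FG.of_le hpi hrange
      · rw [top_inf_eq]
        refine Submodule.FG.of_le ?_ hker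
        rw [LinearMap.range_eq_map]
        exact hfin.fg_top.map _
    exact Module.Finite.equiv (Linear.homCongr K (aug M) (Iso.refl (of N)))

/-- The space of morphisms between coherent objects is finite-dimensional: a coherent object is
built from finitely many shifts of `A ⊗ C` in finitely many steps, up to an object without
morphisms to the target. -/
lemma hom_finite (hA : A.LocallyFinite) (hC : C.LocallyFinite) {M N : Ker A C}
    (hM : IsCoherent M.cplx) (hN : IsCoherent N.cplx) : Module.Finite K (of M ⟶ of N) := by
  obtain ⟨b, hb⟩ := hM.exists_cohBelow
  obtain ⟨a, ha⟩ := hN.exists_cohAbove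
  refine hom_finite_aux hA hC hN ha (b - a).toNat M hM fun t ht => hb t ?_
  have := Int.self_le_toNat (b - a)
  omega

end DKer

/-! ### Splitting of idempotents -/

namespace Cplx

section Telescope

variable (M : Cplx A C) (g : M.homs M)

/-- The transition maps of the sequence `M → M → ⋯`. -/
def telMap (i j : ℕ) (_ : i ≤ j) : M →ₗ[K] M := g.1 ^ (j - i)

instance : DirectedSystem (fun _ : ℕ => M) fun i j h => telMap M g i j h where
  map_self i x := by simp [telMap]
  map_map i j k hij hjk x := by
    rw [telMap, telMap, telMap, ← mul_apply, ← pow_add]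
    congr 2; omega

/-- The direct limit of the sequence `M → M → ⋯` with transition maps `g`, as a vector space. -/
def Tel : Type u := Module.DirectLimit (fun _ : ℕ => M) (telMap M g)

instance : AddCommGroup (Tel M g) :=
  inferInstanceAs (AddCommGroup (Module.DirectLimit (fun _ : ℕ => M) (telMap M g)))
instance : Module K (Tel M g) :=
  inferInstanceAs (Module K (Module.DirectLimit (fun _ : ℕ => M) (telMap M g)))

/-- The maps into the direct limit. -/
def telIn (i : ℕ) : M →ₗ[K] Tel M g := Module.DirectLimit.of K ℕ (fun _ : ℕ => M) (telMap M g) i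

lemma exists_telIn (x : Tel M g) : ∃ i m, telIn M g i m = x :=
  Module.DirectLimit.exists_of (G := fun _ : ℕ => M) (f := telMap M g) x

lemma telIn_add (i k : ℕ) (m : M) : telIn M g (i + k) ((g.1 ^ k) m) = telIn M g i m := by
  have h : telMap M g i (i + k) (by omega) m = (g.1 ^ k) m := by rw [telMap]; congr 2; omega
  rw [← h]
  exact Module.DirectLimit.of_f (G := fun _ : ℕ => M) (f := telMap M g)

lemma telIn_succ (i : ℕ) (m : M) : telIn M g (i + 1) (g.1 m) = telIn M g i m := by
  have := telIn_add M g i 1 m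
  rwa [pow_one] at this

lemma exists_pow_eq_zero {i : ℕ} {m : M} (h : telIn M g i m = 0) : ∃ k, (g.1 ^ k) m = 0 := by
  obtain ⟨j, hij, hj⟩ := Module.DirectLimit.of.zero_exact (R := K) (G := fun _ : ℕ => M) (f := telMap M g) h
  exact ⟨j - i, hj⟩

/-- The map on the direct limit that is induced by a map that commutes with `g`. -/
def telEnd (T : M →ₗ[K] M) (hT : ∀ m, T (g.1 m) = g.1 (T m)) : Tel M g →ₗ[K] Tel M g :=
  Module.DirectLimit.map (G := fun _ : ℕ => M) (f := telMap M g)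
    (G' := fun _ : ℕ => M) (f' := telMap M g) (fun _ => T) fun i j h => by
    refine LinearMap.ext fun m => ?_
    change T ((g.1 ^ (j - i)) m) = (g.1 ^ (j - i)) (T m)
    induction j - i with
    | zero => simp
    | succ k ih => rw [pow_succ', mul_apply, mul_apply, hT, ih]

lemma telEnd_in (T : M →ₗ[K] M) (hT : ∀ m, T (g.1 m) = g.1 (T m)) (i : ℕ)
    (m : M) : telEnd M g T hT (telIn M g i m) = telIn M g i (T m) :=
  Module.DirectLimit.map_apply_of (G := fun _ : ℕ => M) (f := telMap M g)
    (G' := fun _ : ℕ => M) (f' := telMap M g) _ _ _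

lemma tel_ext {X : Type*} [AddCommGroup X] [Module K X] {f f' : Tel M g →ₗ[K] X}
    (h : ∀ i m, f (telIn M g i m) = f' (telIn M g i m)) : f = f' := LinearMap.ext fun x => by
  obtain ⟨i, m, rfl⟩ := exists_telIn M g x
  exact h i m

/-- The part of degree `t` of the direct limit. -/
def telGr (t : ℤ × ℤ) : Submodule K (Tel M g) := ⨆ i, (M.gr t).map (telIn M g i)

lemma telIn_mem (i : ℕ) {t : ℤ × ℤ} {m : M} (hm : m ∈ M.gr t) : telIn M g i m ∈ telGr M g t :=
  mem_iSup_of_mem (p := fun i => (M.gr t).map (telIn M g i)) i ⟨m, hm, rfl⟩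

lemma tel_map_mem {X : Type u} [AddCommGroup X] [Module K X] {f : Tel M g →ₗ[K] X}
    {U : Submodule K X} {t : ℤ × ℤ} (h : ∀ i, ∀ m ∈ M.gr t, f (telIn M g i m) ∈ U) {x : Tel M g}
    (hx : x ∈ telGr M g t) : f x ∈ U := by
  have : telGr M g t ≤ U.comap f := iSup_le fun i => by
    rintro _ ⟨m, hm, rfl⟩
    exact h i m hm
  exact this hx

lemma telEnd_mem {T : M →ₗ[K] M} (hT : ∀ m, T (g.1 m) = g.1 (T m))
    {t t' : ℤ × ℤ} (h : ∀ m ∈ M.gr t, T m ∈ M.gr t') {x : Tel M g} (hx : x ∈ telGr M g t) :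
    telEnd M g T hT x ∈ telGr M g t' :=
  tel_map_mem M g (fun i m hm => by rw [telEnd_in]; exact telIn_mem M g i (h m hm)) hx

lemma telGr_internal : DirectSum.IsInternal (telGr M g) := by
  refine isInternal_of_projections (fun t => telEnd M g (M.proj t) fun m => (hom_proj g t m).symm)
    (fun t x hx => ?_) (fun s t h x hx => ?_) fun x => ?_
  · rw [← sub_eq_zero, ← Submodule.mem_bot K]
    exact tel_map_mem M g (f := telEnd M g (M.proj t) (fun m => (hom_proj g t m).symm) -
      LinearMap.id) (U := ⊥) (fun i m hm => by
        rw [LinearMap.sub_apply, telEnd_in, M.proj_of_mem hm, LinearMap.id_apply, sub_self]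
        exact zero_mem _) hx
  · rw [← Submodule.mem_bot K]
    exact tel_map_mem M g (U := ⊥) (fun i m hm => by
        rw [telEnd_in, M.proj_of_ne hm h, map_zero]
        exact zero_mem _) hx
  · obtain ⟨i, m, rfl⟩ := exists_telIn M g x
    induction m using M.induction with
    | hp t m hm => exact mem_iSup_of_mem t (telIn_mem M g i hm)
    | hadd m m' h h' => rw [map_add]; exact add_mem h h'

/-- An action that commutes with `g`, on the direct limit. -/
def telAct {R : Type*} [Ring R] [Algebra K R] (ρ : R →ₐ[K] Module.End K M)
    (h : ∀ a m, ρ a (g.1 m) = g.1 (ρ a m)) : R →ₐ[K] Module.End K (Tel M g) :=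
  AlgHom.ofLinearMap
    { toFun := fun a => telEnd M g (ρ a) (h a)
      map_add' := fun a a' => tel_ext M g fun i m => by
        simp only [telEnd_in, LinearMap.add_apply, map_add]
      map_smul' := fun x a => tel_ext M g fun i m => by
        simp only [telEnd_in, LinearMap.smul_apply, map_smul, RingHom.id_apply] }
    (tel_ext M g fun i m => by
      simp only [LinearMap.coe_mk, AddHom.coe_mk, telEnd_in, map_one, Module.End.one_apply])
    (fun a a' => tel_ext M g fun i m => by
      simp only [LinearMap.coe_mk, AddHom.coe_mk, telEnd_in, map_mul, mul_apply])

lemma telAct_in {R : Type*} [Ring R] [Algebra K R] (ρ : R →ₐ[K] Module.End K M)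
    (h : ∀ a m, ρ a (g.1 m) = g.1 (ρ a m)) (a : R) (i : ℕ) (m : M) :
    telAct M g ρ h a (telIn M g i m) = telIn M g i (ρ a m) := telEnd_in M g (ρ a) (h a) i m

/-- The direct limit of the sequence `M → M → ⋯` with transition maps `g`. -/
def tel : Cplx A C where
  carrier := Tel M g
  gr := telGr M g
  internal := telGr_internal M g
  l := telAct M g M.l fun a m => (hom_l g a m).symm
  r := telAct M g M.r fun a m => (hom_r g a m).symm
  l_r a c x := by
    obtain ⟨i, m, rfl⟩ := exists_telIn M g x
    rw [telAct_in, telAct_in, telAct_in, telAct_in, M.l_r]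
  l_mem ha hx := telEnd_mem M g (fun m => (hom_l g _ m).symm) (fun _ hm => M.l_mem ha hm) hx
  r_mem ha hx := telEnd_mem M g (fun m => (hom_r g _ m).symm) (fun _ hm => M.r_mem ha hm) hx
  d := telEnd M g M.d fun m => (hom_d g m).symm
  d_mem hx := telEnd_mem M g (fun m => (hom_d g m).symm) (fun _ hm => M.d_mem hm) hx
  d_d x := by
    obtain ⟨i, m, rfl⟩ := exists_telIn M g x
    rw [telEnd_in, telEnd_in, M.d_d, map_zero]
  d_l a x := by
    obtain ⟨i, m, rfl⟩ := exists_telIn M g x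
    rw [telAct_in, telEnd_in, telEnd_in, telAct_in, M.d_l]
  d_r a x := by
    obtain ⟨i, m, rfl⟩ := exists_telIn M g x
    rw [telAct_in, telEnd_in, telEnd_in, telAct_in, M.d_r]

/-- The maps into the direct limit. -/
def telOf (i : ℕ) : M.homs (tel M g) := ⟨telIn M g i, fun t m hm => telIn_mem M g i hm,
    fun a m => (telAct_in M g M.l (fun a m => (hom_l g a m).symm) a i m).symm,
    fun a m => (telAct_in M g M.r (fun a m => (hom_r g a m).symm) a i m).symm,
    fun m => (telEnd_in M g M.d (fun m => (hom_d g m).symm) i m).symm⟩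

lemma exists_telOf (x : tel M g) : ∃ i m, (telOf M g i).1 m = x := exists_telIn M g x

lemma telOf_add (i k : ℕ) (m : M) :
    (telOf M g (i + k)).1 ((g.1 ^ k) m) = (telOf M g i).1 m := telIn_add M g i k m

lemma telOf_succ (i : ℕ) (m : M) : (telOf M g (i + 1)).1 (g.1 m) = (telOf M g i).1 m :=
  telIn_succ M g i m

lemma exists_pow_eq_zero' {i : ℕ} {m : M} (h : (telOf M g i).1 m = 0) :
    ∃ k, (g.1 ^ k) m = 0 := exists_pow_eq_zero M g h

lemma telEnd_comm {S T : M →ₗ[K] M} (hS : ∀ m, S (g.1 m) = g.1 (S m))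
    (hT : ∀ m, T (g.1 m) = g.1 (T m)) (h : ∀ m, S (T m) = T (S m)) (x : Tel M g) :
    telEnd M g S hS (telEnd M g T hT x) = telEnd M g T hT (telEnd M g S hS x) := by
  obtain ⟨i, m, rfl⟩ := exists_telIn M g x
  rw [telEnd_in, telEnd_in, telEnd_in, telEnd_in, h]

/-- The action of `g` on the direct limit. -/
def telHom : (tel M g).homs (tel M g) :=
  ⟨telEnd M g g.1 fun _ => rfl, fun t x hx => telEnd_mem M g (fun _ => rfl)
      (fun _ hm => hom_gr g hm) hx,
    fun a => telEnd_comm M g (fun _ => rfl) (fun m => (hom_l g a m).symm) (hom_l g a),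
    fun a => telEnd_comm M g (fun _ => rfl) (fun m => (hom_r g a m).symm) (hom_r g a),
    telEnd_comm M g (fun _ => rfl) (fun m => (hom_d g m).symm) (hom_d g)⟩

lemma telHom_of (i : ℕ) (m : M) : (telHom M g).1 ((telOf M g i).1 m) = (telOf M g i).1 (g.1 m) :=
  telEnd_in M g g.1 (fun _ => rfl) i m

lemma telHom_bijective : Bijective (telHom M g).1 := by
  constructor
  · rw [injective_iff_map_eq_zero]
    intro x hx
    obtain ⟨i, m, rfl⟩ := exists_telOf M g x
    rw [telHom_of] at hx
    obtain ⟨k, hk⟩ := exists_pow_eq_zero' M g hx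
    rw [← telOf_add M g i (k + 1), pow_succ, mul_apply, hk, map_zero]
  · intro x
    obtain ⟨i, m, rfl⟩ := exists_telOf M g x
    exact ⟨(telOf M g (i + 1)).1 m, by rw [telHom_of, telOf_succ]⟩

end Telescope

lemma isQis_of_bijective {M N : Cplx A C} (f : M.homs N) (hf : Bijective f.1) :
    IsQis f := by
  constructor
  · rintro m hm ⟨y, hy⟩
    obtain ⟨x, rfl⟩ := hf.2 y
    exact ⟨x, hf.1 (by rw [hy, hom_d])⟩
  · intro y hy
    obtain ⟨m, rfl⟩ := hf.2 y
    exact ⟨m, 0, hf.1 (by rw [hom_d, hy, map_zero]), by rw [map_zero, add_zero]⟩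

lemma IsQis.of_comp {M N P : Cplx A C} {f : M.homs N} {g : N.homs P} (hg : IsQis g)
    (h : IsQis (compHom f g)) : IsQis f := by
  constructor
  · rintro m hm ⟨y, hy⟩
    exact h.1 m hm ⟨g.1 y, by rw [compHom_apply, hy, hom_d]⟩
  · intro y hy
    obtain ⟨m, x, hm, hx⟩ := h.2 (g.1 y) (by rw [← hom_d, hy, map_zero])
    obtain ⟨z, hz⟩ := hg.1 (y - f.1 m) (by rw [map_sub, hy, ← hom_d, hm, map_zero, sub_zero])
      ⟨x, by rw [map_sub, hx, compHom_apply, add_sub_cancel_left]⟩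
    exact ⟨m, z, hm, by rw [← hz, add_sub_cancel]⟩

/-- The map to a product. -/
def pairHom {X M N : Cplx A C} (f : X.homs M) (g : X.homs N) : X.homs (prod M N) :=
  ⟨f.1.prod g.1, fun _ _ h => ⟨hom_gr f h, hom_gr g h⟩, fun a m => Prod.ext (hom_l f a m) (hom_l g a m),
    fun a m => Prod.ext (hom_r f a m) (hom_r g a m), fun m => Prod.ext (hom_d f m) (hom_d g m)⟩

section Split

variable {M : Cplx A C}

lemma pow_sub_mem (g : M.homs M)
    (hg : ∀ m, M.d m = 0 → g.1 (g.1 m) - g.1 m ∈ range M.d) (k : ℕ) :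
    ∀ m, M.d m = 0 → (g.1 ^ (k + 1)) m - g.1 m ∈ range M.d := by
  induction k with
  | zero => intro m _; rw [zero_add, pow_one, sub_self]; exact zero_mem _
  | succ k ih =>
    intro m hm
    rw [pow_succ, mul_apply, ← sub_add_sub_cancel _ (g.1 (g.1 m))]
    exact add_mem (ih _ (by rw [← hom_d, hm, map_zero])) (hg m hm)

lemma map_range_d {M N : Cplx A C} (f : M.homs N) {m : M} (hm : m ∈ range M.d) :
    f.1 m ∈ range N.d := by
  obtain ⟨x, rfl⟩ := hm
  exact ⟨f.1 x, (hom_d f x).symm⟩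

/-- If the sum of `g` and `h` is the identity and if `g` and `h` are idempotent on cohomology, the
complex is the sum of their telescopes up to quasi-isomorphism. -/
lemma pair_telOf_isQis (g h : M.homs M) (hgh : ∀ m, g.1 m + h.1 m = m)
    (hg : ∀ m, M.d m = 0 → g.1 (g.1 m) - g.1 m ∈ range M.d) :
    IsQis (pairHom (telOf M g 0) (telOf M h 0)) := by
  have e (m) : h.1 m = m - g.1 m := by rw [eq_sub_iff_add_eq, add_comm, hgh]
  have hh : ∀ m, M.d m = 0 → h.1 (h.1 m) - h.1 m ∈ range M.d := fun m hm => by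
    have := hg m hm
    rw [e (h.1 m), e m, map_sub]
    convert this using 1
    abel
  have hgh₀ : ∀ m, M.d m = 0 → g.1 (h.1 m) ∈ range M.d := fun m hm => by
    rw [e m, map_sub, ← Submodule.neg_mem_iff, neg_sub]
    exact hg m hm
  have hhg₀ : ∀ m, M.d m = 0 → h.1 (g.1 m) ∈ range M.d := fun m hm => by
    rw [e (g.1 m), ← Submodule.neg_mem_iff, neg_sub]
    exact hg m hm
  -- a class that dies in the telescope of `f` is killed by `f`
  have inj (f : M.homs M) (hf : ∀ m, M.d m = 0 → f.1 (f.1 m) - f.1 m ∈ range M.d)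
      (m) (hm : M.d m = 0) (y) (hy : (telOf M f 0).1 m = (tel M f).d y) :
      f.1 m ∈ range M.d := by
    obtain ⟨i, y, rfl⟩ := exists_telOf M f y
    have h₀ : (telOf M f i).1 ((f.1 ^ i) m - M.d y) = 0 := by
      have := telOf_add M f 0 i m
      rw [zero_add] at this
      rw [map_sub, this, hy, hom_d, sub_self]
    obtain ⟨k, hk⟩ := exists_pow_eq_zero' M f h₀
    have h₁ : (f.1 ^ (k + i + 1)) m ∈ range M.d := by
      rw [map_sub, sub_eq_zero] at hk
      rw [pow_succ', mul_apply, pow_add, mul_apply, hk]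
      refine map_range_d f ?_
      clear hk h₀ hy
      induction k with
      | zero => exact ⟨y, rfl⟩
      | succ k ih => rw [pow_succ', mul_apply]; exact map_range_d f ih
    have := sub_mem h₁ (pow_sub_mem f hf (k + i) m hm)
    rwa [sub_sub_cancel] at this
  -- a cocycle in the telescope of `f` comes from a cocycle
  have surj (f : M.homs M) (y) (hy : (tel M f).d y = 0) : ∃ i m, M.d m = 0 ∧
      (telOf M f i).1 m = y := by
    obtain ⟨i, y, rfl⟩ := exists_telOf M f y
    rw [← hom_d] at hy
    obtain ⟨k, hk⟩ := exists_pow_eq_zero' M f hy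
    refine ⟨i + k, (f.1 ^ k) y, ?_, telOf_add M f i k y⟩
    rw [← hk]
    clear hk hy
    induction k with
    | zero => rfl
    | succ k ih => rw [pow_succ', mul_apply, mul_apply, ← hom_d, ih]
  have cocycle (f : M.homs M) {m} (hm : M.d m = 0) : M.d (f.1 m) = 0 := by
    rw [← hom_d, hm, map_zero]
  have comp (f f' : M.homs M) (hf : ∀ m, M.d m = 0 → f.1 (f.1 m) - f.1 m ∈ range M.d)
      (hff' : ∀ m, M.d m = 0 → f.1 (f'.1 m) ∈ range M.d) (i) (p p') (hp : M.d p = 0)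
      (hp' : M.d p' = 0) : (telOf M f i).1 p - (telOf M f 0).1 (f.1 p + f'.1 p') ∈
        range (tel M f).d := by
    have h₁ := telOf_succ M f i p
    have h₂ := telOf_add M f 0 (i + 1) (f.1 p + f'.1 p')
    rw [zero_add] at h₂
    rw [← h₁, ← h₂, ← map_sub]
    refine map_range_d _ ?_
    have h₃ := pow_sub_mem f hf i (f.1 p + f'.1 p') (by
      rw [map_add, cocycle f hp, cocycle f' hp', add_zero])
    rw [map_add f.1] at h₃
    have h₄ := add_mem (add_mem h₃ (hf p hp)) (hff' p' hp')
    rw [← Submodule.neg_mem_iff]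
    convert h₄ using 1
    abel
  constructor
  · rintro m hm ⟨⟨y, y'⟩, hy⟩
    obtain ⟨x, hx⟩ := inj g hg m hm y (congrArg Prod.fst hy)
    obtain ⟨x', hx'⟩ := inj h hh m hm y' (congrArg Prod.snd hy)
    exact ⟨x + x', by rw [map_add, hx, hx', hgh]⟩
  · rintro ⟨y, y'⟩ hy
    obtain ⟨i, p, hp, rfl⟩ := surj g y (congrArg Prod.fst hy)
    obtain ⟨j, p', hp', rfl⟩ := surj h y' (congrArg Prod.snd hy)
    obtain ⟨z, hz⟩ := comp g h hg hgh₀ i p p' hp hp'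
    obtain ⟨z', hz'⟩ := comp h g hh hhg₀ j p' p hp' hp
    refine ⟨g.1 p + h.1 p', ((z, z') : (tel M g) × (tel M h)), ?_, ?_⟩
    · rw [map_add, cocycle g hp, cocycle h hp', add_zero]
    · refine Prod.ext ?_ ?_
      · change _ = (telOf M g 0).1 _ + (tel M g).d z
        rw [hz, add_sub_cancel]
      · change _ = (telOf M h 0).1 _ + (tel M h).d z'
        rw [hz', add_comm (g.1 p), add_sub_cancel]

end Split

end Cplx

namespace DKer

/-- The map `g` becomes invertible on its telescope. -/
lemma exists_tel {M : Cplx A C} (g : Ker.bar M ⟶ Ker.bar M) :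
    ∃ (U : Ker.bar M ⟶ Ker.bar (tel (Cplx.bar M) g))
      (G : Ker.bar (tel (Cplx.bar M) g) ⟶ Ker.bar (tel (Cplx.bar M) g)),
      (∀ m, (barAug _).1 (U.1 m) = (telOf (Cplx.bar M) g 0).1 m) ∧ IsIso (ofHom G) ∧
      ofHom g ≫ ofHom U = ofHom U ≫ ofHom G := by
  let T := tel (Cplx.bar M) g
  obtain ⟨U, hU⟩ := exists_bar_lift (barAug T) (telOf (Cplx.bar M) g 0) (barAug_isQis T)
    (barAug_surjective T)
  obtain ⟨G, hG⟩ := exists_bar_lift (barAug T) (compHom (barAug T) (telHom (Cplx.bar M) g))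
    (barAug_isQis T) (barAug_surjective T)
  have hGq : IsQis G := by
    refine (barAug_isQis T).of_comp ?_
    rw [show compHom G (barAug T) = compHom (barAug T) (telHom (Cplx.bar M) g) from homs_ext hG]
    exact isQis_comp (barAug_isQis T) (isQis_of_bijective _ (telHom_bijective _ _))
  refine ⟨Ker.homMk U, Ker.homMk G, hU, isIso_ofHom (M := Ker.bar T) (N := Ker.bar T) (f := G) hGq, ?_⟩
  rw [← ofHom_comp, ← ofHom_comp]
  refine ofHom_eq_of_comp (barAug T) (barAug_isQis T) (barAug_surjective T) _ _ fun m => ?_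
  rw [Ker.comp_apply', Ker.comp_apply', Ker.homMk_apply, Ker.homMk_apply, Ker.homMk_apply, hU,
    hG, compHom_apply, hU]
  exact (telHom_of _ g 0 m).symm

/-- Idempotents split: an idempotent `e` is represented by an endomorphism `g` of a resolution, and
the object is the sum of the telescopes of `g` and `1 - g`. On the former, `e` is an idempotent
isomorphism, hence the identity; likewise `1 - e` on the latter. -/
lemma exists_split {M : Cplx A C} (e : of (Ker.bar M) ⟶ of (Ker.bar M)) (he : e ≫ e = e) :
    ∃ (Y : DKer A C) (i : Y ⟶ of (Ker.bar M)) (p : of (Ker.bar M) ⟶ Y), i ≫ p = 𝟙 Y ∧ p ≫ i = e := by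
  obtain ⟨g, rfl⟩ := exists_ofHom e
  let h : Ker.bar M ⟶ Ker.bar M := 𝟙 _ - g
  have hgh (m) : g.1 m + h.1 m = m := add_sub_cancel _ _
  have hg (m) (hm : (Cplx.bar M).d m = 0) :
      g.1 (g.1 m) - g.1 m ∈ range (Cplx.bar M).d := by
    rw [← ofHom_comp] at he
    exact exists_sub_of_ofHom_eq he m hm
  -- the telescopes of `g` and of `h = 1 - g`
  obtain ⟨U, G, hU, hG, hUG⟩ := exists_tel g
  obtain ⟨V, H, hV, hH, hVH⟩ := exists_tel h
  let T := tel (Cplx.bar M) g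
  let T' := tel (Cplx.bar M) h
  have hq : IsQis (pairHom U V) := by
    have h₀ : IsQis (pairHom (compHom (fst (Cplx.bar T) (Cplx.bar T')) (barAug T))
        (compHom (snd (Cplx.bar T) (Cplx.bar T')) (barAug T'))) :=
      IsQis.of_sum _ (barAug_isQis T) (barAug_isQis T') (inl _ _) (inr _ _) (fst _ _) (snd _ _)
        (inl _ _) (inr _ _) (fst _ _) (snd _ _) (inl_fst_add _ _) (inl_fst_add _ _) (fun _ => rfl)
        (fun _ => rfl) (fun x => Prod.ext rfl (map_zero (barAug T').1)) fun x =>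
        Prod.ext (map_zero (barAug T).1) rfl
    refine h₀.of_comp ?_
    have : compHom (pairHom U V) (pairHom (compHom (fst (Cplx.bar T) (Cplx.bar T')) (barAug T))
        (compHom (snd (Cplx.bar T) (Cplx.bar T')) (barAug T'))) =
        pairHom (telOf (Cplx.bar M) g 0) (telOf (Cplx.bar M) h 0) :=
      homs_ext fun m => Prod.ext (hU m) (hV m)
    rw [this]
    exact pair_telOf_isQis g h hgh hg
  let W : Ker.bar M ⟶ (Ker.bar T).prod (Ker.bar T') := Ker.homMk (pairHom U V)
  have hW : IsIso (ofHom W) := isIso_ofHom (f := W) hq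
  let f₁ : (Ker.bar T).prod (Ker.bar T') ⟶ Ker.bar T := Ker.homMk (fst _ _)
  let f₂ : (Ker.bar T).prod (Ker.bar T') ⟶ Ker.bar T' := Ker.homMk (snd _ _)
  let i₁ : Ker.bar T ⟶ (Ker.bar T).prod (Ker.bar T') := Ker.homMk (inl _ _)
  let i₂ : Ker.bar T' ⟶ (Ker.bar T).prod (Ker.bar T') := Ker.homMk (inr _ _)
  have hWU : ofHom U = ofHom W ≫ ofHom f₁ := by rw [← ofHom_comp]; rfl
  have hWV : ofHom V = ofHom W ≫ ofHom f₂ := by rw [← ofHom_comp]; rfl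
  have h₁₁ : ofHom i₁ ≫ ofHom f₁ = 𝟙 _ := by rw [← ofHom_comp, ← ofHom_id]; rfl
  have h₁₂ : ofHom i₁ ≫ ofHom f₂ = 0 := by rw [← ofHom_comp, ← ofHom_zero]; rfl
  have htot : ofHom f₁ ≫ ofHom i₁ + ofHom f₂ ≫ ofHom i₂ = 𝟙 _ := by
    rw [← ofHom_comp, ← ofHom_comp, ← ofHom_add, ← ofHom_id]
    exact congrArg _ (Ker.hom_ext (inl_fst_add _ _))
  have h₂₂ : ofHom i₂ ≫ ofHom f₂ = 𝟙 _ := by rw [← ofHom_comp, ← ofHom_id]; rfl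
  have key {Z : DKer A C} (e u : _) (i : Z ⟶ of (Ker.bar M)) (v : Z ⟶ Z) [IsIso v] (he : e ≫ e = e)
      (hi : i ≫ u = 𝟙 Z) (hK : e ≫ u = u ≫ v) : e ≫ u = u := by
    have h₁ : v = i ≫ e ≫ u := by rw [hK, reassoc_of% hi]
    have h₂ : v ≫ v = v := by
      calc v ≫ v = i ≫ e ≫ u ≫ v := by nth_rw 1 [h₁]; simp only [Category.assoc]
        _ = v := by rw [← hK, reassoc_of% he, h₁]
    have h₃ : v = 𝟙 Z := by rw [← cancel_epi v, h₂, Category.comp_id]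
    rw [hK, h₃, Category.comp_id]
  have hh : ofHom h = 𝟙 _ - ofHom g := by rw [ofHom_sub, ofHom_id]
  have eU := key (ofHom g) (ofHom U) (ofHom i₁ ≫ inv (ofHom W)) (ofHom G) he
    (by rw [hWU, Category.assoc, IsIso.inv_hom_id_assoc, h₁₁]) hUG
  have eV := key (ofHom h) (ofHom V) (ofHom i₂ ≫ inv (ofHom W)) (ofHom H) (by rw [hh]; simp [he])
    (by rw [hWV, Category.assoc, IsIso.inv_hom_id_assoc, h₂₂]) hVH
  rw [hh, Preadditive.sub_comp, Category.id_comp, sub_eq_self] at eV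
  refine ⟨_, ofHom i₁ ≫ inv (ofHom W), ofHom U, ?_, ?_⟩
  · rw [hWU, Category.assoc, IsIso.inv_hom_id_assoc, h₁₁]
  · have h₀ : 𝟙 _ = ofHom U ≫ ofHom i₁ ≫ inv (ofHom W) + ofHom V ≫ ofHom i₂ ≫ inv (ofHom W) := by
      rw [hWU, hWV, Category.assoc, Category.assoc, ← Preadditive.comp_add, ← Category.assoc (ofHom f₁),
        ← Category.assoc (ofHom f₂), ← Preadditive.add_comp, htot, Category.id_comp,
        IsIso.hom_inv_id]
    have := congrArg (ofHom g ≫ ·) h₀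
    rw [Category.comp_id, Preadditive.comp_add, reassoc_of% eU, reassoc_of% eV, Limits.zero_comp,
      add_zero] at this
    exact this.symm

instance : IsIdempotentComplete (DKer A C) where
  idempotents_split X p hp := by
    let M : Ker A C := locObj X
    let p' : of M ⟶ of M := p
    have hp' : p' ≫ p' = p' := hp
    obtain ⟨Y, i, q, h₁, h₂⟩ := exists_split ((aug M).hom ≫ p' ≫ (aug M).inv) (by
      simp only [Category.assoc, Iso.inv_hom_id_assoc, reassoc_of% hp'])
    have h₃ : ((aug M).inv ≫ q) ≫ i ≫ (aug M).hom = p' := by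
      simp only [Category.assoc, reassoc_of% h₂, Iso.inv_hom_id_assoc, Iso.inv_hom_id,
        Category.comp_id]
    have h₄ : (i ≫ (aug M).hom) ≫ (aug M).inv ≫ q = 𝟙 Y := by
      rw [Category.assoc, Iso.hom_inv_id_assoc, h₁]
    exact ⟨Y, i ≫ (aug M).hom, (aug M).inv ≫ q, h₄, h₃⟩

/-! ### Finite direct sums -/

/-- The complex zero. -/
def zeroCplx (A C : GrAlg K) : Cplx A C where
  carrier := PUnit
  gr _ := ⊥
  internal := isInternal_of_projections 0 (fun _ _ _ => rfl) (fun _ _ _ _ _ => rfl)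
    fun m => zero_mem _
  l := AlgHom.ofLinearMap 0 (Subsingleton.elim _ _) fun _ _ => Subsingleton.elim _ _
  r := AlgHom.ofLinearMap 0 (Subsingleton.elim _ _) fun _ _ => Subsingleton.elim _ _
  l_r _ _ _ := rfl
  l_mem _ _ := zero_mem _
  r_mem _ _ := zero_mem _
  d := 0
  d_mem _ := zero_mem _
  d_d _ := rfl
  d_l _ _ := rfl
  d_r _ _ := rfl

lemma zeroCplx_acyclic (A C : GrAlg K) : Acyclic (zeroCplx A C) := fun m _ => ⟨m, rfl⟩

instance : Limits.HasZeroObject (DKer A C) :=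
  ⟨_, isZero_of (M := Ker.bar (zeroCplx A C)) (bar_acyclic (zeroCplx_acyclic A C))⟩

/-- A sum in the category of complexes is a sum in the derived category. -/
def isBilimitMap {J : Type} [Finite J] {f : J → Ker A C} (b : Limits.Bicone f) (hb : b.IsBilimit) :
    ((Ker.qis A C).Q.mapBicone b).IsBilimit :=
  have := Fintype.ofFinite J
  Limits.isBilimitOfTotal _ (by
    have h : ∑ j, b.π j ≫ b.ι j = 𝟙 b.pt := Limits.IsBilimit.total hb
    have := congrArg (Ker.qis A C).Q.map h
    rw [Functor.map_sum, CategoryTheory.Functor.map_id] at this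
    simp only [CategoryTheory.Functor.map_comp] at this
    exact this)

instance : Limits.HasBinaryBiproducts (DKer A C) where
  has_binary_biproduct X Y := by
    let M : Ker A C := locObj X
    let N : Ker A C := locObj Y
    exact Limits.HasBinaryBiproduct.mk (P := of M) (Q := of N)
      { bicone := (Ker.qis A C).Q.mapBinaryBicone (Limits.BinaryBiproduct.bicone M N)
        isBilimit := Limits.isBinaryBilimitOfTotal _ (by
          have := congrArg (Ker.qis A C).Q.map (Limits.biprod.total (X := M) (Y := N))
          rw [Functor.map_add, CategoryTheory.Functor.map_comp, CategoryTheory.Functor.map_comp,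
            CategoryTheory.Functor.map_id] at this
          exact this) }

instance : Limits.HasFiniteBiproducts (DKer A C) :=
  have : Limits.HasFiniteProducts (DKer A C) :=
    hasFiniteProducts_of_has_binary_and_terminal
  Limits.HasFiniteBiproducts.of_hasFiniteProducts

end DKer

/-! ### Algebras with a basis of powers -/

section IsPow

variable {Z Y : GrAlg K}

/-- The algebra `Z` is free over `A` with basis `1, x, …, x^(r-1)`, where `x` has degree `2`. If
`r = 0`, then `Z` is zero. -/
structure IsPow (f : A.GrHom Z) (x : Z) (r : ℕ) : Prop where
  mem : x ∈ Z.gr 2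
  bijective : Bijective fun c : Fin r → A => ∑ j, f.hom (c j) * x ^ (j : ℕ)

namespace IsPow

variable {f : A.GrHom Z} {x : Z} {r : ℕ} (h : IsPow f x r)
include h

/-- The coefficients with respect to the basis of powers. -/
def coef : Z ≃ₗ[K] (Fin r → A) := (LinearEquiv.ofBijective
    { toFun := fun c : Fin r → A => ∑ j, f.hom (c j) * x ^ (j : ℕ)
      map_add' := fun c c' => by simp [add_mul, sum_add_distrib]
      map_smul' := fun a c => by simp [smul_sum] } h.bijective).symm

lemma sum_coef (z : Z) : ∑ j, f.hom (h.coef z j) * x ^ (j : ℕ) = z := h.coef.symm_apply_apply z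

lemma coef_sum (c : Fin r → A) : h.coef (∑ j, f.hom (c j) * x ^ (j : ℕ)) = c :=
  h.coef.apply_symm_apply c

lemma coef_l (a : A) (z : Z) (j : Fin r) : h.coef (f.hom a * z) j = a * h.coef z j := by
  have : f.hom a * z = ∑ j, f.hom (a * h.coef z j) * x ^ (j : ℕ) := by
    conv_lhs => rw [← h.sum_coef z, mul_sum]
    exact sum_congr rfl fun j _ => by rw [map_mul, mul_assoc]
  rw [this, h.coef_sum]

lemma coef_pow (i : Fin r) : h.coef (x ^ (i : ℕ)) = Pi.single i 1 := by
  rw [← h.coef_sum (Pi.single i 1), sum_eq_single i]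
  · simp
  · intro j _ hj; simp [Pi.single_eq_of_ne hj]
  · simp

lemma pow_mem (j : ℕ) : x ^ j ∈ Z.gr (2 * j) := by
  have := SetLike.pow_mem_graded j h.mem
  rwa [nsmul_eq_mul, mul_comm] at this

lemma proj_mul_pow (q : ℤ) (a : A) (j : ℕ) : GradedAlgebra.proj Z.gr q (f.hom a * x ^ j) =
      f.hom (GradedAlgebra.proj A.gr (q - 2 * j) a) * x ^ j := by
  induction a using homogeneous_induction A.internal with
  | hp p a ha =>
    have hm : f.hom a * x ^ j ∈ Z.gr (p + 2 * j) := SetLike.mul_mem_graded (f.hom_mem ha) (h.pow_mem j)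
    by_cases hq : p + 2 * j = q
    · subst hq
      rw [GradedAlgebra.proj_apply, GradedAlgebra.proj_apply, DirectSum.decompose_of_mem_same _ hm,
        add_sub_cancel_right, DirectSum.decompose_of_mem_same _ ha]
    · rw [GradedAlgebra.proj_apply, GradedAlgebra.proj_apply, DirectSum.decompose_of_mem_ne _ hm hq,
        DirectSum.decompose_of_mem_ne _ ha (by omega), map_zero, zero_mul]
  | hadd a a' h h' => simp only [map_add, add_mul, h, h']

lemma coef_mem {q : ℤ} {z : Z} (hz : z ∈ Z.gr q) (j : Fin r) : h.coef z j ∈ A.gr (q - 2 * j) := by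
  have e : ∑ j : Fin r, f.hom (GradedAlgebra.proj A.gr (q - 2 * j) (h.coef z j)) * x ^ (j : ℕ) = z := by
    have : GradedAlgebra.proj Z.gr q z = z := DirectSum.decompose_of_mem_same _ hz
    conv_rhs => rw [← this, ← h.sum_coef z, map_sum]
    exact sum_congr rfl fun j _ => (h.proj_mul_pow q _ _).symm
  have h₁ := h.coef_sum fun j : Fin r => GradedAlgebra.proj A.gr (q - 2 * j) (h.coef z j)
  rw [e] at h₁
  rw [h₁]
  exact SetLike.coe_mem _

lemma isKFlatRight (g : C.GrHom Z) : IsKFlatRight (corr g f) :=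
  corr_isKFlatRight g f (fun j => x ^ (j : ℕ)) h.bijective

lemma isKFlatLeft (g : C.GrHom Z) : IsKFlatLeft (corr f g) :=
  corr_isKFlatLeft f g (fun j => x ^ (j : ℕ)) h.bijective

lemma tensor_bijective (g : C.GrHom Z) (M : Cplx A B) :
    Bijective fun m : Fin r → M => ∑ j : Fin r, tm (toCorr g f (x ^ (j : ℕ))) (m j) :=
  tensor_basis_bijective (corr g f) (fun j : Fin r => toCorr g f (x ^ (j : ℕ))) h.bijective M

end IsPow

end IsPow

namespace Cplx

/-- The map `n ⊗ m ↦ (-1)^(|n||m|) m ⊗ n`, as a map of complexes. -/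
def swapHom (N : Cplx A B) (M : Cplx B C) : (tensor N M).flip.homs (tensor M.flip N.flip) :=
  ⟨swapLin N M, fun t x hx => map_mem_of_tensor_gr (f := swapLin N M) (fun i j n m h hn hm => by
        have hp (φ : ℤ → K) : N.par φ n ∈ N.gr i := by
          rw [par_apply _ _ hn]; exact Submodule.smul_mem _ _ hn
        rw [swapLin_tm]
        exact add_mem (tm_mem (M := M.flip) (N := N.flip) hm (hp _) (by rw [← h, add_comm]))
          (tm_mem (M := M.flip) (N := N.flip) (M.sgn_mem hm) (hp _) (by rw [← h, add_comm]))) hx,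
    fun c x => by
      induction x using tensor_induction with
      | h n m =>
        change swapLin N M ((tensor N M).r c (tm n m)) =
          (tensor M.flip N.flip).l c (swapLin N M (tm n m))
        rw [tensor_r, swapLin_tm, swapLin_tm, map_add, sgn_r]
        exact congrArg₂ (· + ·) (tensor_l (M := M.flip) (N := N.flip) c _ _).symm
          (tensor_l (M := M.flip) (N := N.flip) c _ _).symm
      | hadd x y hx hy => simp only [map_add, hx, hy],
    fun a x => by
      induction x using tensor_induction with
      | h n m =>
        change swapLin N M ((tensor N M).l a (tm n m)) =
          (tensor M.flip N.flip).r a (swapLin N M (tm n m))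
        rw [tensor_l, swapLin_tm, swapLin_tm, map_add, ev, od, par_l, par_l]
        exact congrArg₂ (· + ·) (tensor_r (M := M.flip) (N := N.flip) a _ _).symm
          (tensor_r (M := M.flip) (N := N.flip) a _ _).symm
      | hadd x y hx hy => simp only [map_add, hx, hy],
    swapLin_d N M⟩

lemma IsCoherent.flip {M : Cplx A C} (h : IsCoherent M) : IsCoherent M.flip := by
  obtain ⟨s, hs, h⟩ := h
  refine ⟨s, hs, fun z hz => ?_⟩
  refine mem_sup.2 ?_
  obtain ⟨y, hy, w, hw, e⟩ := mem_sup.1 (h z hz)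
  refine ⟨y, Submodule.span_mono ?_ hy, w, hw, e⟩
  rintro x ⟨a, c, y, hy, rfl⟩
  exact ⟨c, a, y, hy, M.l_r a c y⟩

lemma tm_mem_of_mem_bispan {Z : GrAlg K} {f : A.GrHom Z} {g : C.GrHom Z} {x : Z}
    {r : ℕ} (h : IsPow f x r) {N : Cplx C D} {s : Set N}
    {T : Submodule K (tensor (corr f g) N)}
    (hl : ∀ a, ∀ y ∈ T, (tensor (corr f g) N).l a y ∈ T)
    (hr : ∀ a, ∀ y ∈ T, (tensor (corr f g) N).r a y ∈ T)
    (hs : ∀ j : Fin r, ∀ y ∈ s, tm (toCorr f g (x ^ (j : ℕ))) y ∈ T) (z : Z)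
    {n : N} (hn : n ∈ bispan N s) : tm (toCorr f g z) n ∈ T := by
  have h₁ (z : Z) (y) (hy : y ∈ s) : tm (toCorr f g z) y ∈ T := by
    rw [← h.sum_coef z, map_sum, map_sum, LinearMap.sum_apply]
    refine sum_mem fun j _ => ?_
    rw [← corr_l, ← tensor_l]
    exact hl _ _ (hs j y hy)
  have h₂ : bispan N s ≤ ⨅ z, T.comap (tm (toCorr f g z)) := by
    refine bispan_le N (fun y hy => (Submodule.mem_iInf _).2 fun z => h₁ z y hy)
      (fun c m hm => (Submodule.mem_iInf _).2 fun z => ?_)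
      (fun c m hm => (Submodule.mem_iInf _).2 fun z => ?_)
    · have := (Submodule.mem_iInf _).1 hm (g.hom c * z)
      rw [Submodule.mem_comap, ← corr_r, tm_balance] at this
      exact this
    · have := hr c _ ((Submodule.mem_iInf _).1 hm z)
      rw [tensor_r] at this
      exact this
  exact (Submodule.mem_iInf _).1 (h₂ hn) z

/-- The structure sheaf of a correspondence that is finite over the left factor and free over the
right factor preserves coherence. -/
lemma IsCoherent.corr_tensor {Z : GrAlg K} {f : A.GrHom Z} {g : C.GrHom Z} {x x' : Z}
    {r r' : ℕ} (h : IsPow f x r) (h' : IsPow g x' r') {N : Cplx C D} (hN : IsCoherent N) :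
    IsCoherent (tensor (corr f g) N) := by
  classical
  rw [isCoherent_iff] at hN ⊢
  obtain ⟨s, hs, hN⟩ := hN
  let b : Fin r × N → tensor (corr f g) N := fun p => tm (toCorr f g (x ^ (p.1 : ℕ))) p.2
  refine ⟨(Finset.univ ×ˢ s).image b, fun y hy => ?_, fun m hm => ?_⟩
  · obtain ⟨⟨j, n⟩, hn, rfl⟩ := mem_image.1 hy
    refine (tensor_d _ _).trans ?_
    rw [corr_d, sgn_corr, hs _ (Finset.mem_product.1 hn).2, map_zero, LinearMap.map_zero,
      LinearMap.zero_apply, add_zero]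
  · have hb (j : Fin r) (y) (hy : y ∈ (s : Set N)) : tm (toCorr f g (x ^ (j : ℕ))) y ∈
        bispan (tensor (corr f g) N) ((Finset.univ ×ˢ s).image b) :=
      mem_bispan _ (Finset.mem_coe.2 (mem_image.2
        ⟨(j, y), Finset.mem_product.2 ⟨Finset.mem_univ j, hy⟩, rfl⟩))
    obtain ⟨T, hT⟩ : ∃ T, T = bispan (tensor (corr f g) N) ((Finset.univ ×ˢ s).image b) := ⟨_, rfl⟩
    rw [← hT]
    simp only [← hT] at hb
    obtain ⟨n, rfl⟩ := (h'.tensor_bijective f N).2 m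
    have hn : ∀ j, N.d (n j) = 0 := by
      have h₁ := tensor_basis_d (corr f g) (sgn_corr f g) (fun _ => rfl)
        (fun j : Fin r' => toCorr f g (x' ^ (j : ℕ))) N n
      refine congrFun ((h'.tensor_bijective f N).1 (a₂ := 0) ?_)
      exact (h₁.symm.trans hm).trans (by simp)
    refine sum_mem fun j _ => ?_
    obtain ⟨y, hy, w, ⟨v, rfl⟩, e⟩ := mem_sup.1 (hN _ (hn j))
    rw [← e, map_add]
    refine add_mem (mem_sup_left (tm_mem_of_mem_bispan h (fun a y hy => ?_)
      (fun a y hy => ?_) hb _ hy)) (mem_sup_right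
      ⟨tm (toCorr f g (x' ^ (j : ℕ))) v, ?_⟩)
    · rw [hT] at hy ⊢; exact bispan_l _ a hy
    · rw [hT] at hy ⊢; exact bispan_r _ a hy
    · rw [tensor_d, corr_d, sgn_corr, map_zero, LinearMap.zero_apply, zero_add]

lemma IsCoherent.tensor_corr {Z : GrAlg K} {f : A.GrHom Z} {g : C.GrHom Z} {x x' : Z}
    {r r' : ℕ} (h : IsPow f x r) (h' : IsPow g x' r') {N : Cplx D A} (hN : IsCoherent N) :
    IsCoherent (tensor N (corr f g)) := by
  have h₁ : IsCoherent (tensor (corr f g).flip N.flip) := IsCoherent.corr_tensor h' h hN.flip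
  exact (h₁.of_qis' (isQis_of_bijective (swapHom N (corr f g)) (swapLin_bijective _ _))).flip

end Cplx

/-! ### Adjunctions between kernels -/

section Adjunction

open Bicategory

lemma leftZigzag_eq {B : Type*} [Bicategory B] {a b : B} {f : a ⟶ b} {g : b ⟶ a}
    (η : 𝟙 a ⟶ f ≫ g) (κ : g ≫ f ⟶ 𝟙 b) :
    leftZigzag η κ = η ▷ f ≫ (α_ f g f).hom ≫ f ◁ κ := by
  simp [leftZigzag, bicategoricalComp]

lemma rightZigzag_eq {B : Type*} [Bicategory B] {a b : B} {f : a ⟶ b} {g : b ⟶ a}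
    (η : 𝟙 a ⟶ f ≫ g) (κ : g ≫ f ⟶ 𝟙 b) :
    rightZigzag η κ = g ◁ η ≫ (α_ g f g).inv ≫ κ ▷ g := by
  simp [rightZigzag, bicategoricalComp]

lemma Cplx.tm_unitOne (M : Cplx A C) (c : C) (m : M) :
    tm (M.r c m) (unitOne C) = tm (N := unit C) m c :=
  (tm_balance (N := unit C) _ _ _).trans (congrArg (tm (N := unit C) m) (mul_one c))

lemma Cplx.unitOne_tm (M : Cplx A C) (a : A) (m : M) :
    tm (unitOne A) (M.l a m) = tm (M := unit A) a m :=
  (tm_balance (M := unit A) _ _ _).symm.trans (congrArg (fun x => tm (M := unit A) x m) (mul_one a))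

/-- Two kernels are adjoint if there are maps `η` and `κ` of complexes that satisfy the triangle
identities, where `η` sends `1` to `∑ p_j ⊗ q_j`. -/
lemma DKer.nonempty_adjunction {ι : Type} {F : ι → GrAlg K} {a c : ι} (M : Ker (F a) (F c))
    (N : Ker (F c) (F a)) (η : (unit (F a)).homs (tensor M.cplx N.cplx))
    (κ : (tensor N.cplx M.cplx).homs (unit (F c))) {r : ℕ} (p : Fin r → M.cplx)
    (q : Fin r → N.cplx) (hη : η.1 (unitOne (F a)) = ∑ j, tm (p j) (q j))
    (h₁ : ∀ m, ∑ j, M.cplx.r (κ.1 (tm (q j) m) : F c) (p j) = m)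
    (h₂ : ∀ n, ∑ j, N.cplx.l (κ.1 (tm n (p j)) : F c) (q j) = n) :
    Nonempty (Adjunction (show (⟨a⟩ : DerBicat F) ⟶ ⟨c⟩ from DKer.of M)
      (show (⟨c⟩ : DerBicat F) ⟶ ⟨a⟩ from DKer.of N)) := by
  let η' : Ker.unit (F a) ⟶ M.tensor N := η
  let κ' : N.tensor M ⟶ Ker.unit (F c) := κ
  let φ : (Ker.unit (F a)).tensor M ⟶ M.tensor (Ker.unit (F c)) :=
    M.tensorRight.map η' ≫ (M.assocIso N M).hom ≫ M.tensorLeft.map κ'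
  let ψ : N.tensor (Ker.unit (F a)) ⟶ (Ker.unit (F c)).tensor N :=
    N.tensorLeft.map η' ≫ (N.assocIso M N).inv ≫ N.tensorRight.map κ'
  have e₁ : M.leftUnitIso.inv ≫ φ = M.rightUnitIso.inv := by
    refine homs_ext fun m => ?_
    change (tmap (idHom M.cplx) κ).1 ((assocHom M.cplx N.cplx M.cplx).1
      ((tmap η (idHom M.cplx)).1 (tm (unitOne (F a)) m))) = tm m (unitOne (F c))
    rw [tmap_tm, hη, idHom_apply]
    simp only [map_sum, LinearMap.sum_apply, assocHom_tm, tmap_tm, idHom_apply]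
    conv_rhs => rw [← h₁ m, map_sum, LinearMap.sum_apply]
    exact sum_congr rfl fun j _ => (tm_unitOne M.cplx _ _).symm
  have e₂ : N.rightUnitIso.inv ≫ ψ = N.leftUnitIso.inv := by
    refine homs_ext fun n => ?_
    change (tmap κ (idHom N.cplx)).1 ((assocInvHom N.cplx M.cplx N.cplx).1
      ((tmap (idHom N.cplx) η).1 (tm n (unitOne (F a))))) = tm (unitOne (F c)) n
    rw [tmap_tm, hη, idHom_apply]
    simp only [map_sum, assocInvHom_tm, tmap_tm, idHom_apply]
    conv_rhs => rw [← h₂ n, map_sum]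
    exact sum_congr rfl fun j _ => (unitOne_tm N.cplx _ _).symm
  refine ⟨{ unit := ofHom η', counit := ofHom κ', left_triangle := ?_, right_triangle := ?_ }⟩
  · exact (leftZigzag_eq _ _).trans (ofHom_pentagon ((Iso.inv_comp_eq _).1 e₁)
      (tensorRight_map M η') (tensorLeft_map M κ'))
  · exact (rightZigzag_eq _ _).trans (ofHom_pentagon ((Iso.inv_comp_eq _).1 e₂)
      (tensorLeft_map N η') (tensorRight_map N κ'))

end Adjunction

/-! ### Shifted structure sheaves of correspondences -/

namespace Cplx

lemma shift_shift (M : Cplx A C) (s t : ℤ) : (M.shift s).shift t = M.shift (t + s) := by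
  have h : (fun u : ℤ × ℤ => M.gr (u.1, u.2 + t + s)) = fun u : ℤ × ℤ => M.gr (u.1, u.2 + (t + s)) := by
    simp only [add_assoc]
  unfold shift
  congr 1

variable {Z Y : GrAlg K}

/-- The shifted structure sheaf of a correspondence. -/
abbrev sc (f : A.GrHom Z) (g : C.GrHom Z) (s : ℤ) : Cplx A C := (corr f g).shift s

section Sc

variable (f : A.GrHom Z) (g : C.GrHom Z) (s : ℤ)

/-- The elements of the shifted structure sheaf. -/
def toSc : Z ≃ₗ[K] (sc f g s) := LinearEquiv.refl K Z

lemma sc_l (a : A) (z : Z) : (sc f g s).l a (toSc f g s z) = toSc f g s (f.hom a * z) := rfl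

lemma sc_r (c : C) (z : Z) : (sc f g s).r c (toSc f g s z) = toSc f g s (g.hom c * z) := rfl

lemma sc_d (x : sc f g s) : (sc f g s).d x = 0 := rfl

lemma toSc_mem {q : ℤ} {z : Z} (hz : z ∈ Z.gr (q + s)) :
    toSc f g s z ∈ (sc f g s).gr (0, q) := toCorr_mem f g hz

lemma exists_of_mem_sc {t : ℤ × ℤ} {x : sc f g s} (hx : x ∈ (sc f g s).gr t) :
    x = 0 ∨ t.1 = 0 ∧ ∃ z ∈ Z.gr (t.2 + s), toSc f g s z = x :=
  (exists_of_mem_corr f g hx).imp_right fun ⟨h, z, hz, e⟩ => ⟨h, z, hz, e.symm⟩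

lemma exists_toSc (x : sc f g s) : ∃ z : Z, toSc f g s z = x := (toSc f g s).surjective x

/-- A linear map that commutes with both actions and raises degrees by `t - s`, as a map of shifted
structure sheaves. -/
def scHom {f : A.GrHom Z} {g : C.GrHom Z} {f' : A.GrHom Y} {g' : C.GrHom Y} {s t : ℤ}
    (φ : Z →ₗ[K] Y) (hl : ∀ a z, φ (f.hom a * z) = f'.hom a * φ z)
    (hr : ∀ c z, φ (g.hom c * z) = g'.hom c * φ z)
    (hm : ∀ q, ∀ z ∈ Z.gr (q + s), φ z ∈ Y.gr (q + t)) : (sc f g s).homs (sc f' g' t) :=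
  ⟨(toSc f' g' t).toLinearMap ∘ₗ φ ∘ₗ (toSc f g s).symm.toLinearMap, fun u x hx => by
    rcases exists_of_mem_sc f g s hx with rfl | ⟨hu, z, hz, rfl⟩
    · rw [map_zero]; exact zero_mem _
    · obtain ⟨u₁, u₂⟩ := u
      obtain rfl : u₁ = 0 := hu
      exact toSc_mem f' g' t (hm _ z hz), fun a z => congrArg (toSc f' g' t) (hl a z),
    fun c z => congrArg (toSc f' g' t) (hr c z), fun z => congrArg (toSc f' g' t) (map_zero φ)⟩

end Sc

section Mul

variable {Z₁ Z₂ : GrAlg K} {f₁ : A.GrHom Z₁} {g₁ : B.GrHom Z₁} {f₂ : B.GrHom Z₂} {g₂ : C.GrHom Z₂}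
  {p : A.GrHom Y} {q : C.GrHom Y} (j₁ : Z₁.GrHom Y) (j₂ : Z₂.GrHom Y) {s₁ s₂ s : ℤ}

variable (f₁ g₁ f₂ g₂ p q s₁ s₂ s) in
/-- The bilinear map `(z₁, z₂) ↦ z₁ z₂`, in `Y`. -/
def mulBil : sc f₁ g₁ s₁ →ₗ[K] sc f₂ g₂ s₂ →ₗ[K] sc p q s :=
  LinearMap.compr₂ ((LinearMap.mul K Y).compl₁₂
    (j₁.hom.toLinearMap ∘ₗ (toSc f₁ g₁ s₁).symm.toLinearMap)
    (j₂.hom.toLinearMap ∘ₗ (toSc f₂ g₂ s₂).symm.toLinearMap)) (toSc p q s).toLinearMap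

lemma mulBil_apply (z₁ : Z₁) (z₂ : Z₂) :
    mulBil f₁ g₁ f₂ g₂ p q j₁ j₂ s₁ s₂ s (toSc f₁ g₁ s₁ z₁) (toSc f₂ g₂ s₂ z₂) =
      toSc p q s (j₁.hom z₁ * j₂.hom z₂) := rfl

lemma mulBil_balance (hj : ∀ b, j₁.hom (g₁.hom b) = j₂.hom (f₂.hom b)) (m b n) :
    mulBil f₁ g₁ f₂ g₂ p q j₁ j₂ s₁ s₂ s ((sc f₁ g₁ s₁).r b m) n =
      mulBil f₁ g₁ f₂ g₂ p q j₁ j₂ s₁ s₂ s m ((sc f₂ g₂ s₂).l b n) := by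
  obtain ⟨m, rfl⟩ := exists_toSc f₁ g₁ s₁ m
  obtain ⟨n, rfl⟩ := exists_toSc f₂ g₂ s₂ n
  rw [sc_r, sc_l, mulBil_apply, mulBil_apply, map_mul j₁.hom, map_mul j₂.hom, hj, mul_assoc,
    mul_left_comm]

/-- The map `𝒪_{Z₁} ⊗ 𝒪_{Z₂} → 𝒪_Y` that is given by a map from `Y` to the fibre product of `Z₁` and
`Z₂`. -/
def mulHom (hj : ∀ b, j₁.hom (g₁.hom b) = j₂.hom (f₂.hom b)) (hp : ∀ a, p.hom a = j₁.hom (f₁.hom a))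
    (hq : ∀ c, q.hom c = j₂.hom (g₂.hom c)) (hs : s = s₁ + s₂) :
    (tensor (sc f₁ g₁ s₁) (sc f₂ g₂ s₂)).homs (sc p q s) :=
  tensorHom (tensorLift (mulBil f₁ g₁ f₂ g₂ p q j₁ j₂ s₁ s₂ s) (mulBil_balance j₁ j₂ hj))
    (fun i j m n hm hn => by
      rw [tensorLift_tm]
      rcases exists_of_mem_sc f₁ g₁ s₁ hm with rfl | ⟨hi, z, hz, rfl⟩
      · rw [map_zero, LinearMap.zero_apply]; exact zero_mem _
      rcases exists_of_mem_sc f₂ g₂ s₂ hn with rfl | ⟨hj', z', hz', rfl⟩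
      · rw [map_zero]; exact zero_mem _
      obtain ⟨i₁, i₂⟩ := i
      obtain ⟨k₁, k₂⟩ := j
      obtain rfl : i₁ = 0 := hi
      obtain rfl : k₁ = 0 := hj'
      refine toSc_mem p q s ?_
      have := SetLike.mul_mem_graded (j₁.hom_mem hz) (j₂.hom_mem hz')
      rwa [show i₂ + s₁ + (k₂ + s₂) = i₂ + k₂ + s by rw [hs]; ring] at this)
    (fun a m n => by
      obtain ⟨m, rfl⟩ := exists_toSc f₁ g₁ s₁ m
      obtain ⟨n, rfl⟩ := exists_toSc f₂ g₂ s₂ n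
      rw [sc_l, tensorLift_tm, tensorLift_tm, mulBil_apply, mulBil_apply, sc_l, map_mul j₁.hom, hp,
        mul_assoc])
    (fun c m n => by
      obtain ⟨m, rfl⟩ := exists_toSc f₁ g₁ s₁ m
      obtain ⟨n, rfl⟩ := exists_toSc f₂ g₂ s₂ n
      rw [sc_r, tensorLift_tm, tensorLift_tm, mulBil_apply, mulBil_apply, sc_r, map_mul j₂.hom, hq,
        mul_left_comm])
    (fun m n => by
      rw [sc_d, sc_d, sc_d, map_zero, map_zero, LinearMap.zero_apply, map_zero, add_zero])

lemma mulHom_tm (hj : ∀ b, j₁.hom (g₁.hom b) = j₂.hom (f₂.hom b))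
    (hp : ∀ a, p.hom a = j₁.hom (f₁.hom a)) (hq : ∀ c, q.hom c = j₂.hom (g₂.hom c))
    (hs : s = s₁ + s₂) (z₁ : Z₁) (z₂ : Z₂) :
    (mulHom j₁ j₂ hj hp hq hs : (tensor (sc f₁ g₁ s₁) (sc f₂ g₂ s₂)).homs (sc p q s)).1
      (tm (toSc f₁ g₁ s₁ z₁) (toSc f₂ g₂ s₂ z₂)) = toSc p q s (j₁.hom z₁ * j₂.hom z₂) :=
  tensorLift_tm (mulBil f₁ g₁ f₂ g₂ p q j₁ j₂ s₁ s₂ s) (mulBil_balance j₁ j₂ hj) _ _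

variable (g₁ g₂ s₁ s₂) in
/-- The tensor product is generated over `Z₁` by the powers of `x`. -/
lemma exists_eq_sum_tm {x : Z₂} {r : ℕ} (h : IsPow f₂ x r)
    (y : tensor (sc f₁ g₁ s₁) (sc f₂ g₂ s₂)) : ∃ z : Fin r → Z₁,
      y = ∑ j : Fin r, tm (toSc f₁ g₁ s₁ (z j)) (toSc f₂ g₂ s₂ (x ^ (j : ℕ))) := by
  induction y using tensor_induction with
  | h m n =>
    obtain ⟨m, rfl⟩ := exists_toSc f₁ g₁ s₁ m
    obtain ⟨n, rfl⟩ := exists_toSc f₂ g₂ s₂ n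
    refine ⟨fun j => g₁.hom (h.coef n j) * m, ?_⟩
    conv_lhs => rw [← h.sum_coef n, map_sum, map_sum]
    refine sum_congr rfl fun j _ => ?_
    rw [← sc_l, ← sc_r, tm_balance]
  | hadd y y' hy hy' =>
    obtain ⟨z, rfl⟩ := hy
    obtain ⟨z', rfl⟩ := hy'
    refine ⟨z + z', ?_⟩
    rw [← sum_add_distrib]
    exact sum_congr rfl fun j _ => by
      rw [Pi.add_apply, map_add, map_add, LinearMap.add_apply]

/-- A map from `𝒪_{Z₁} ⊗ 𝒪_{Z₂}`, where `Z₂` is free over the base with basis `x^j`, is bijective if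
it is so on the elements `∑ z_j ⊗ x^j`. -/
lemma bijective_of_isPow {x : Z₂} {r : ℕ} (h : IsPow f₂ x r) {X : Cplx A C}
    (F : (tensor (sc f₁ g₁ s₁) (sc f₂ g₂ s₂)).homs X)
    (hF : Bijective fun z : Fin r → Z₁ =>
      ∑ j : Fin r, F.1 (tm (toSc f₁ g₁ s₁ (z j)) (toSc f₂ g₂ s₂ (x ^ (j : ℕ))))) :
    Bijective F.1 := by
  constructor
  · intro y y' hy
    obtain ⟨z, rfl⟩ := exists_eq_sum_tm g₁ g₂ s₁ s₂ h y
    obtain ⟨z', rfl⟩ := exists_eq_sum_tm g₁ g₂ s₁ s₂ h y'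
    rw [map_sum, map_sum] at hy
    rw [hF.1 hy]
  · intro y
    obtain ⟨z, rfl⟩ := hF.2 y
    exact ⟨_, map_sum _ _ _⟩

/-- The fibre product of `Z₁` and `Z₂` is `Y` if `Z₂` and `Y` have the same basis of powers over the
base and over `Z₁`. -/
lemma mulHom_bijective {x : Z₂} {r : ℕ} (h : IsPow f₂ x r) (h' : IsPow j₁ (j₂.hom x) r)
    (hj : ∀ b, j₁.hom (g₁.hom b) = j₂.hom (f₂.hom b)) (hp : ∀ a, p.hom a = j₁.hom (f₁.hom a))
    (hq : ∀ c, q.hom c = j₂.hom (g₂.hom c)) (hs : s = s₁ + s₂) :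
    Bijective (mulHom j₁ j₂ hj hp hq hs :
      (tensor (sc f₁ g₁ s₁) (sc f₂ g₂ s₂)).homs (sc p q s)).1 := by
  refine bijective_of_isPow h _ ?_
  have e (z : Fin r → Z₁) : (∑ j : Fin r, (mulHom j₁ j₂ hj hp hq hs :
      (tensor (sc f₁ g₁ s₁) (sc f₂ g₂ s₂)).homs (sc p q s)).1
      (tm (toSc f₁ g₁ s₁ (z j)) (toSc f₂ g₂ s₂ (x ^ (j : ℕ))))) =
      toSc p q s (∑ j : Fin r, j₁.hom (z j) * j₂.hom x ^ (j : ℕ)) := by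
    rw [map_sum]
    exact sum_congr rfl fun j _ => by rw [mulHom_tm, map_pow]
  simp only [e]
  exact (toSc p q s).bijective.comp h'.bijective

end Mul

end Cplx

section Frobenius

variable {Z : GrAlg K}

/-- The trace form `ε`, the coefficient of the highest power, is nondegenerate: the powers `x^j`
have a dual basis `b_j`. It is computed by Horner's scheme from the coefficients of `x^r`. -/
lemma IsPow.exists_dual {g : C.GrHom Z} {x : Z} {r : ℕ} (h : IsPow g x r) {e : ℤ}
    (he : Subsingleton Z ∨ 0 < r ∧ e = 2 * r - 2) :
    ∃ (κ : Z →ₗ[K] C) (b : Fin r → Z),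
      (∀ c z, κ (g.hom c * z) = c * κ z) ∧ (∀ q, ∀ z ∈ Z.gr q, κ z ∈ C.gr (q - e)) ∧
      (∀ j : Fin r, b j ∈ Z.gr (e - 2 * j)) ∧
      (∀ z, ∑ j : Fin r, g.hom (κ (z * b j)) * x ^ (j : ℕ) = z) ∧
      ∀ z, ∑ j : Fin r, g.hom (κ (z * x ^ (j : ℕ))) * b j = z := by
  rcases he with he | ⟨hr, rfl⟩
  · exact ⟨0, 0, fun c z => (mul_zero c).symm, fun _ _ _ => zero_mem _,
      fun _ => zero_mem _, fun _ => Subsingleton.elim _ _, fun _ => Subsingleton.elim _ _⟩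
  obtain ⟨r, rfl⟩ : ∃ k, r = k + 1 := ⟨r - 1, by omega⟩
  let κ : Z →ₗ[K] C := LinearMap.proj (Fin.last r) ∘ₗ h.coef.toLinearMap
  have κ_l (c z) : κ (g.hom c * z) = c * κ z := h.coef_l c z _
  have κ_pow (i : Fin (r + 1)) : κ (x ^ (i : ℕ)) = if (i : ℕ) = r then 1 else 0 := by
    change h.coef (x ^ (i : ℕ)) (Fin.last r) = _
    rw [h.coef_pow, Pi.single_apply]
    refine if_congr ?_ rfl rfl
    rw [Fin.ext_iff, Fin.val_last, eq_comm]
  let c := h.coef (x ^ (r + 1))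
  have hc : ∑ l : Fin (r + 1), g.hom (c l) * x ^ (l : ℕ) = x ^ (r + 1) := h.sum_coef _
  -- Horner's scheme
  let y : ℕ → Z := fun k =>
    Nat.rec 1 (fun k y => x * y - g.hom (if hk : r - k < r + 1 then c ⟨r - k, hk⟩ else 0)) k
  have y_succ (k) : y (k + 1) = x * y k - g.hom (c ⟨r - k, by omega⟩) := by
    change x * y k - g.hom (if hk : r - k < r + 1 then c ⟨r - k, hk⟩ else 0) = _
    rw [dif_pos]
  have y_mem (k) (hk : k ≤ r) : y k ∈ Z.gr (2 * k) := by
    induction k with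
    | zero => exact SetLike.one_mem_graded Z.gr
    | succ k ih =>
      rw [y_succ]
      have h₁ := SetLike.mul_mem_graded h.mem (ih (by omega))
      have h₂ := g.hom_mem (h.coef_mem (h.pow_mem (r + 1)) ⟨r - k, by omega⟩)
      refine sub_mem ?_ ?_
      · convert h₁ using 2; push_cast; ring
      · convert h₂ using 2; push_cast [show k ≤ r by omega]; ring
  have key (k) (hk : k ≤ r) : ∀ i : Fin (r + 1), κ (y k * x ^ (i : ℕ)) =
      if (i : ℕ) + k = r then 1 else 0 := by
    induction k with
    | zero => intro i; change κ (1 * _) = _; rw [one_mul, κ_pow, add_zero]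
    | succ k ih =>
      intro i
      have h₁ : y (k + 1) * x ^ (i : ℕ) = y k * x ^ ((i : ℕ) + 1) -
          g.hom (c ⟨r - k, by omega⟩) * x ^ (i : ℕ) := by rw [y_succ]; ring
      rw [h₁, map_sub, κ_l, κ_pow]
      by_cases hi : (i : ℕ) = r
      · rw [if_pos hi, if_neg (by omega), hi, ← hc, mul_sum, map_sum,
          sum_eq_single ⟨r - k, by omega⟩]
        · rw [mul_left_comm, κ_l, ih (by omega), if_pos (by simp; omega), sub_self]
        · intro l _ hl
          rw [mul_left_comm, κ_l, ih (by omega), if_neg, mul_zero]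
          intro hl'
          exact hl (Fin.ext (by simp; omega))
        · simp
      · have := ih (by omega) ⟨i + 1, by omega⟩
        rw [if_neg hi, mul_zero, sub_zero, this]
        exact if_congr (by simp; omega) rfl rfl
  let b : Fin (r + 1) → Z := fun j => y (r - j)
  have hb (i j : Fin (r + 1)) : κ (b j * x ^ (i : ℕ)) = if i = j then 1 else 0 := by
    rw [key _ (by omega)]
    refine if_congr ?_ rfl rfl
    rw [Fin.ext_iff]; omega
  have κ_b (z) (j) : κ (z * b j) = h.coef z j := by
    conv_lhs => rw [← h.sum_coef z, Finset.sum_mul, map_sum]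
    rw [sum_eq_single j]
    · rw [mul_assoc, κ_l, mul_comm (x ^ _), hb, if_pos rfl, mul_one]
    · intro i _ hi; rw [mul_assoc, κ_l, mul_comm (x ^ _), hb, if_neg hi, mul_zero]
    · simp
  have h₄ (z) : ∑ j : Fin (r + 1), g.hom (κ (z * b j)) * x ^ (j : ℕ) = z := by
    simp only [κ_b, h.sum_coef]
  refine ⟨κ, b, κ_l, fun q z hz => ?_, fun j => ?_, h₄, fun z => ?_⟩
  · have : κ z ∈ C.gr _ := h.coef_mem hz (Fin.last r)
    rw [Fin.val_last] at this
    convert this using 2; push_cast; ring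
  · convert y_mem (r - j) (by omega) using 2
    push_cast [show (j : ℕ) ≤ r by omega]; ring
  · rw [← sub_eq_zero, ← neg_eq_zero, neg_sub]
    set w := z - ∑ j : Fin (r + 1), g.hom (κ (z * x ^ (j : ℕ))) * b j with hw
    have h₁ (i : Fin (r + 1)) : κ (w * x ^ (i : ℕ)) = 0 := by
      rw [hw, sub_mul, map_sub, Finset.sum_mul, map_sum, sum_eq_single i, mul_assoc, κ_l, hb,
        if_pos rfl, mul_one, sub_self]
      · intro j _ hj; rw [mul_assoc, κ_l, hb, if_neg hj.symm, mul_zero]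
      · simp
    rw [← h₄ w]
    refine sum_eq_zero fun j _ => ?_
    rw [← h.sum_coef (b j), mul_sum, map_sum, sum_eq_zero, map_zero, zero_mul]
    intro i _
    rw [mul_left_comm, κ_l, h₁, mul_zero]

end Frobenius

namespace Cplx

/-- The map `A → X` that sends `1` to a central cocycle of degree `0`. -/
def unitLift (X : Cplx A A) (θ : X) (hθ : θ ∈ X.gr (0, 0))
    (hc : ∀ a, X.l a θ = X.r a θ) (hd : X.d θ = 0) : (unit A).homs X :=
  ⟨(X.l.toLinearMap.flip θ : A →ₗ[K] X), fun t (a : A) ha => by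
      rcases mem_unit_gr ha with rfl | ⟨h, ha⟩
      · change X.l 0 θ ∈ X.gr t
        rw [map_zero]; exact zero_mem _
      · obtain ⟨t₁, t₂⟩ := t
        obtain rfl : t₁ = 0 := h
        have := X.l_mem ha hθ
        rwa [add_zero] at this,
    fun a (b : A) => by
      change X.l (a * b) θ = X.l a (X.l b θ)
      rw [map_mul]; rfl,
    fun a (b : A) => by
      change X.l (a * b) θ = X.r a (X.l b θ)
      rw [mul_comm, map_mul, mul_apply, hc, X.l_r],
    fun (a : A) => by
      change X.l 0 θ = X.d (X.l a θ)
      rw [X.d_l, hd, map_zero, map_zero, LinearMap.zero_apply]⟩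

lemma unitLift_one (X : Cplx A A) (θ : X) (hθ : θ ∈ X.gr (0, 0))
    (hc : ∀ a, X.l a θ = X.r a θ) (hd : X.d θ = 0) :
    (unitLift X θ hθ hc hd).1 (unitOne A) = θ := by
  change X.l 1 θ = θ
  rw [map_one]; rfl

variable {Z : GrAlg K}

/-- A trace form of degree `-s`, as a map to the structure sheaf of the diagonal. -/
def traceHom (g : C.GrHom Z) {s : ℤ} (κ : Z →ₗ[K] C)
    (hl : ∀ c z, κ (g.hom c * z) = c * κ z) (hm : ∀ q, ∀ z ∈ Z.gr q, κ z ∈ C.gr (q - s)) :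
    (sc g g s).homs (unit C) :=
  ⟨(κ : sc g g s →ₗ[K] unit C), fun t x hx => by
      rcases exists_of_mem_sc g g s hx with rfl | ⟨h, z, hz, rfl⟩
      · exact (congrArg (· ∈ (unit C).gr t) (map_zero κ)).mpr (zero_mem _)
      · obtain ⟨t₁, t₂⟩ := t
        obtain rfl : t₁ = 0 := h
        have := hm _ z hz
        rw [add_sub_cancel_right] at this
        exact toCorr_mem (GrAlg.GrHom.id C) (GrAlg.GrHom.id C) this, hl, hl, fun z => map_zero κ⟩

end Cplx

/-- If `Z` is free over `C` with a basis of powers, then `𝒪_Z` has `𝒪_Z`, with a shift, as its right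
adjoint: the unit is the Casimir element of the trace form and the counit is the trace form. -/
lemma IsPow.nonempty_adjunction {ι : Type} {F : ι → GrAlg K} {a c : ι} {Z : GrAlg K}
    {f : (F a).GrHom Z} {g : (F c).GrHom Z} {x : Z} {r : ℕ} (h : IsPow g x r) {s t : ℤ}
    (hst : Subsingleton Z ∨ 0 < r ∧ s + t = 2 * r - 2) (M : Ker (F a) (F c))
    (N : Ker (F c) (F a)) (hM : M.cplx = sc f g s) (hN : N.cplx = sc g f t) :
    Nonempty (Bicategory.Adjunction (show (⟨a⟩ : DerBicat F) ⟶ ⟨c⟩ from DKer.of M)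
      (show (⟨c⟩ : DerBicat F) ⟶ ⟨a⟩ from DKer.of N)) := by
  obtain ⟨M, hM₁, hM₂⟩ := M
  obtain ⟨N, hN₁, hN₂⟩ := N
  dsimp only at hM hN
  subst hM hN
  obtain ⟨κ, b, κ_l, κ_m, b_m, h₄, h₅⟩ := h.exists_dual hst
  have comm (z : Z) : ∑ j : Fin r, tm (toSc f g s (z * x ^ (j : ℕ))) (toSc g f t (b j)) =
        ∑ j : Fin r, tm (toSc f g s (x ^ (j : ℕ))) (toSc g f t (z * b j)) := by
    have e₁ (j : Fin r) : tm (toSc f g s (z * x ^ (j : ℕ))) (toSc g f t (b j)) =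
        ∑ i : Fin r, tm (toSc f g s (x ^ (i : ℕ)))
          (toSc g f t (g.hom (κ (z * x ^ (j : ℕ) * b i)) * b j)) := by
      conv_lhs => rw [← h₄ (z * x ^ (j : ℕ)), map_sum, map_sum, LinearMap.sum_apply]
      refine sum_congr rfl fun i _ => ?_
      rw [← sc_r, tm_balance, sc_l]
    have e₂ (i : Fin r) : tm (toSc f g s (x ^ (i : ℕ))) (toSc g f t (z * b i)) =
        ∑ j : Fin r, tm (toSc f g s (x ^ (i : ℕ)))
          (toSc g f t (g.hom (κ (z * x ^ (j : ℕ) * b i)) * b j)) := by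
      conv_lhs => rw [← h₅ (z * b i), map_sum, map_sum]
      simp only [mul_right_comm z]
    rw [sum_congr rfl fun j _ => e₁ j, Finset.sum_comm]
    exact (sum_congr rfl fun j _ => e₂ j).symm
  let θ : tensor (sc f g s) (sc g f t) :=
    ∑ j : Fin r, tm (toSc f g s (x ^ (j : ℕ))) (toSc g f t (b j))
  let η : (unit (F a)).homs (tensor (sc f g s) (sc g f t)) := unitLift _ θ
    (sum_mem fun j _ => tm_mem (i := (0, 2 * (j : ℤ) - s)) (j := (0, s - 2 * j))
      (toSc_mem f g s (by rw [sub_add_cancel]; exact h.pow_mem j))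
      (toSc_mem g f t (by rw [sub_add_eq_add_sub]; exact b_m j)) (by simp))
    (fun a => by
      change (tensor _ _).l a (∑ j : Fin r, _) = (tensor _ _).r a (∑ j : Fin r, _)
      rw [map_sum, map_sum]
      simp only [tensor_l, tensor_r]
      exact comm _)
    (by
      change (tensor _ _).d (∑ j : Fin r, _) = 0
      rw [map_sum]
      refine sum_eq_zero fun j _ => ?_
      rw [tensor_d, sc_d, sc_d, map_zero, map_zero, LinearMap.zero_apply, add_zero])
  let μ : (tensor (sc g f t) (sc f g s)).homs (sc g g (s + t)) :=
    mulHom (GrAlg.GrHom.id Z) (GrAlg.GrHom.id Z) (fun _ => rfl) (fun _ => rfl) (fun _ => rfl)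
      (add_comm s t)
  have hμ (z z' : Z) : (compHom μ (traceHom g κ κ_l κ_m)).1
      (tm (toSc g f t z) (toSc f g s z')) = κ (z * z') := by
    rw [compHom_apply]
    exact congrArg (traceHom g κ κ_l κ_m).1 (mulHom_tm _ _ _ _ _ _ z z')
  refine DKer.nonempty_adjunction ⟨sc f g s, hM₁, hM₂⟩ ⟨sc g f t, hN₁, hN₂⟩ η
    (compHom μ (traceHom g κ κ_l κ_m)) (fun j => toSc f g s (x ^ (j : ℕ)))
    (fun j => toSc g f t (b j)) (unitLift_one _ _ _ _ _) (fun m => ?_) fun n => ?_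
  · obtain ⟨m, rfl⟩ := exists_toSc f g s m
    refine Eq.trans (sum_congr rfl fun j _ => ?_) ((map_sum (toSc f g s) _ _).symm.trans
      (congrArg (toSc f g s) (h₄ m)))
    rw [mul_comm m, ← sc_r]
    exact congrArg (fun c => (sc f g s).r c (toSc f g s (x ^ (j : ℕ)))) (hμ (b j) m)
  · obtain ⟨n, rfl⟩ := exists_toSc g f t n
    refine Eq.trans (sum_congr rfl fun j _ => ?_) ((map_sum (toSc g f t) _ _).symm.trans
      (congrArg (toSc g f t) (h₅ n)))
    rw [← sc_l]
    exact congrArg (fun c => (sc g f t).l c (toSc g f t (b j))) (hμ n (x ^ (j : ℕ)))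

/-! ### Direct sums of kernels -/

lemma Ker.isDirectSum {J : Type} [Fintype J] (X : J → Ker A C) (P : Ker A C)
    (i : ∀ j, (X j).cplx.homs P.cplx)
    (h : Bijective fun x : ∀ j, (X j).cplx => ∑ j, (i j).1 (x j)) :
    IsDirectSum X P := by
  classical
  let E : (∀ j, (X j).cplx) ≃ₗ[K] P.cplx := LinearEquiv.ofBijective
    { toFun := fun x => ∑ j, (i j).1 (x j)
      map_add' := fun x y => by simp [sum_add_distrib]
      map_smul' := fun a x => by simp [smul_sum] } h
  have hE (x) : E x = ∑ j, (i j).1 (x j) := rfl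
  -- the inverse of `E` commutes with everything the maps `i j` commute with
  have comm (T : P.cplx →ₗ[K] P.cplx) (S : ∀ j, (X j).cplx →ₗ[K] (X j).cplx)
      (hT : ∀ j x, (i j).1 (S j x) = T ((i j).1 x)) (p j) : E.symm (T p) j = S j (E.symm p j) := by
    have : E (fun j => S j (E.symm p j)) = T p := by
      conv_rhs => rw [← E.apply_symm_apply p, hE, map_sum]
      rw [hE]
      exact sum_congr rfl fun j _ => hT j _
    rw [← this, E.symm_apply_apply]
  let π (j : J) : P.cplx.homs (X j).cplx := ⟨LinearMap.proj j ∘ₗ E.symm.toLinearMap,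
    fun t p hp => by
      have := comm (P.cplx.proj t) (fun j => (X j).cplx.proj t) (fun j => hom_proj (i j) t) p j
      rw [P.cplx.proj_of_mem hp] at this
      change E.symm p j ∈ _
      rw [this]
      exact proj_mem _ _ _,
    fun a p => comm (P.cplx.l a) (fun j => (X j).cplx.l a) (fun j => hom_l (i j) a) p j,
    fun a p => comm (P.cplx.r a) (fun j => (X j).cplx.r a) (fun j => hom_r (i j) a) p j,
    fun p => comm P.cplx.d (fun j => (X j).cplx.d) (fun j => hom_d (i j)) p j⟩
  have hπ (j p) : (π j).1 p = E.symm p j := rfl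
  have hi (j x) : (i j).1 x = E (Pi.single j x) := by
    rw [hE, sum_eq_single j]
    · rw [Pi.single_eq_same]
    · intro k _ hk; rw [Pi.single_eq_of_ne hk, map_zero]
    · simp
  let b : Limits.Bicone X := {
      pt := P, ι := i, π := π
      ι_π := fun j k => by
        split_ifs with hjk
        · subst hjk
          refine homs_ext fun x => ?_
          change (π j).1 ((i j).1 x) = x
          rw [hπ, hi, E.symm_apply_apply, Pi.single_eq_same]
        · refine homs_ext fun x => ?_
          change (π k).1 ((i j).1 x) = 0
          rw [hπ, hi, E.symm_apply_apply, Pi.single_eq_of_ne (Ne.symm hjk)] }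
  refine ⟨b, ⟨Limits.isBilimitOfTotal b (homs_ext fun p => ?_)⟩, ⟨Iso.refl _⟩⟩
  have e : (∑ j, b.π j ≫ b.ι j : P ⟶ P).1 p = ∑ j, (i j).1 ((π j).1 p) := by
    refine (congrArg (fun f : P.cplx →ₗ[K] P.cplx => f p)
      (map_sum (P.cplx.homs P.cplx).subtype (fun j => b.π j ≫ b.ι j) Finset.univ)).trans ?_
    rw [LinearMap.sum_apply]
    rfl
  exact e.trans (E.apply_symm_apply p)

lemma DKer.isDirectSum {J : Type} [Finite J] {X : J → Ker A C} {P : Ker A C}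
    (h : IsDirectSum X P) : IsDirectSum (fun j => DKer.of (X j)) (DKer.of P) := by
  obtain ⟨b, ⟨hb⟩, ⟨e⟩⟩ := h
  exact ⟨(Ker.qis A C).Q.mapBicone b, ⟨isBilimitMap b hb⟩, ⟨ofIso e⟩⟩

lemma IsDirectSum.of_isZero {V : Type*} [Category V] [Preadditive V] {J : Type} [Finite J]
    {f : J → V} {X : V} (hX : Limits.IsZero X) (hf : ∀ j, Limits.IsZero (f j)) :
    IsDirectSum f X := by
  classical
  have := Fintype.ofFinite J
  let b : Limits.Bicone f := {
      pt := X, ι := fun _ => 0, π := fun _ => 0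
      ι_π := fun j k => (hf j).eq_of_src _ _ }
  exact ⟨b, ⟨Limits.isBilimitOfTotal b (hX.eq_of_src _ _)⟩, ⟨Iso.refl _⟩⟩

namespace Cplx

/-- A map that lands in the image of an injective map lifts. -/
lemma exists_lift_of_injective {M N P : Cplx A C} (f : M.homs P) (hf : Injective f.1)
    (g : N.homs P) (hg : ∀ n, g.1 n ∈ range f.1) :
    ∃ g' : N.homs M, ∀ n, f.1 (g'.1 n) = g.1 n := by
  let E := LinearEquiv.ofInjective f.1 hf
  let φ : N →ₗ[K] M := E.symm.toLinearMap ∘ₗ g.1.codRestrict (range f.1) hg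
  have hφ (n) : f.1 (φ n) = g.1 n :=
    congrArg Subtype.val (E.apply_symm_apply (g.1.codRestrict (range f.1) hg n))
  refine ⟨⟨φ, fun t n hn => ?_, fun a n => hf ?_, fun c n => hf ?_, fun n => hf ?_⟩, hφ⟩
  · have : φ n = M.proj t (φ n) := hf (by
      rw [hom_proj, hφ, ← hom_proj, N.proj_of_mem hn])
    rw [this]
    exact proj_mem _ _ _
  · rw [hom_l, hφ, hφ, hom_l]
  · rw [hom_r, hφ, hφ, hom_r]
  · rw [hom_d, hφ, hφ, hom_d]

end Cplx

namespace IsPow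

open Polynomial

variable {Z : GrAlg K} {f : A.GrHom Z} {x : Z} {r : ℕ} (h : IsPow f x r)
include h

lemma eq_zero_of_eval₂ {p : A[X]} (hp : p.degree < r)
    (hp' : p.eval₂ (f.hom : A →+* Z) x = 0) : p = 0 := by
  by_contra hne
  have hr : p.natDegree < r := (natDegree_lt_iff_degree_lt hne).2 hp
  rw [eval₂_eq_sum_range' _ hr, ← Fin.sum_univ_eq_sum_range
    (fun j => (f.hom : A →+* Z) (p.coeff j) * x ^ j)] at hp'
  have := h.bijective.1 (a₁ := fun j : Fin r => p.coeff j) (a₂ := 0) (hp'.trans (by simp))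
  refine hne (Polynomial.ext fun j => ?_)
  by_cases hj : j < r
  · exact congrFun this ⟨j, hj⟩
  · exact coeff_eq_zero_of_degree_lt (hp.trans_le (by exact_mod_cast not_lt.1 hj))

lemma exists_eval₂ (z : Z) : ∃ p : A[X], p.degree < r ∧ p.eval₂ (f.hom : A →+* Z) x = z := by
  obtain ⟨c, rfl⟩ := h.bijective.2 z
  refine ⟨∑ j : Fin r, C (c j) * X ^ (j : ℕ), degree_sum_fin_lt c, ?_⟩
  simp [eval₂_finset_sum]

end IsPow

/-! ### The fibre square of two correspondences -/

namespace Cplx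

open Polynomial

section Pair

variable {Z W : GrAlg K} {ι : A.GrHom Z} {κ : C.GrHom Z} (u v : Z.GrHom W) {p q : A.GrHom W}
  {x : Z} {r : ℕ} {s t e : ℤ}

/-- The map `𝒪_Z ⊗ 𝒪_Z → 𝒪_W ⊕ 𝒪_Z` that sends `z ⊗ z'` to `(u(z) v(z'), z z')`. Here `Z ×_C Z` is
the union of the diagonal `Z` and of `W`. -/
def pairMul (hκ : ∀ c, u.hom (κ.hom c) = v.hom (κ.hom c)) (hp : ∀ a, p.hom a = u.hom (ι.hom a))
    (hq : ∀ a, q.hom a = v.hom (ι.hom a)) (he : e = s + t) :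
    (tensor (sc ι κ s) (sc κ ι t)).homs (prod (sc p q e) (sc ι ι e)) :=
  pairHom (mulHom u v hκ hp hq he) (mulHom (GrAlg.GrHom.id Z) (GrAlg.GrHom.id Z) (fun _ => rfl)
    (fun _ => rfl) (fun _ => rfl) he)

variable (hκ : ∀ c, u.hom (κ.hom c) = v.hom (κ.hom c)) (hp : ∀ a, p.hom a = u.hom (ι.hom a))
  (hq : ∀ a, q.hom a = v.hom (ι.hom a)) (he : e = s + t)

lemma pairMul_tm (z z' : Z) : (pairMul u v hκ hp hq he).1
    (tm (toSc ι κ s z) (toSc κ ι t z')) = (toSc p q e (u.hom z * v.hom z'), toSc ι ι e (z * z')) :=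
  Prod.ext (mulHom_tm u v hκ hp hq he z z') (mulHom_tm _ _ _ _ _ _ z z')

lemma pairMul_sum {f : Z[X]} {n : ℕ} (hf : f.degree < n) : (pairMul u v hκ hp hq he).1
    (∑ j : Fin n, tm (toSc ι κ s (f.coeff j)) (toSc κ ι t (x ^ (j : ℕ)))) =
      (toSc p q e (f.eval₂ (u.hom : Z →+* W) (v.hom x)), toSc ι ι e (f.eval x)) := by
  by_cases h : f = 0
  · subst h
    simp only [coeff_zero, map_zero, LinearMap.zero_apply, Finset.sum_const_zero, eval₂_zero,
      eval_zero]
    rfl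
  have hn : f.natDegree < n := (natDegree_lt_iff_degree_lt h).2 hf
  rw [eval₂_eq_sum_range' _ hn, eval_eq_sum_range' hn, map_sum,
    ← Fin.sum_univ_eq_sum_range (fun j => (u.hom : Z →+* W) (f.coeff j) * v.hom x ^ j),
    ← Fin.sum_univ_eq_sum_range (fun j => f.coeff j * x ^ j), map_sum, map_sum]
  refine (sum_congr rfl fun j _ => pairMul_tm u v hκ hp hq he _ _).trans ?_
  refine Prod.ext ?_ ?_
  · refine (map_sum (LinearMap.fst K (sc p q e) (sc ι ι e)) _ _).trans ?_
    exact sum_congr rfl fun j _ => congrArg (fun y => toSc p q e (u.hom (f.coeff j) * y))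
      (map_pow v.hom x _)
  · exact map_sum (LinearMap.snd K (sc p q e) (sc ι ι e)) _ _

lemma exists_polynomial (h : IsPow κ x r) (y : tensor (sc ι κ s) (sc κ ι t)) :
    ∃ f : Z[X], f.degree < r ∧
      y = ∑ j : Fin r, tm (toSc ι κ s (f.coeff j)) (toSc κ ι t (x ^ (j : ℕ))) := by
  obtain ⟨z, rfl⟩ := exists_eq_sum_tm κ ι s t h y
  refine ⟨∑ j : Fin r, Polynomial.C (z j) * X ^ (j : ℕ), degree_sum_fin_lt z, ?_⟩
  refine sum_congr rfl fun j _ => ?_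
  congr 3
  rw [finset_sum_coeff, sum_eq_single j]
  · simp
  · intro i _ hi
    rw [coeff_C_mul, coeff_X_pow, if_neg fun h => hi (Fin.ext h.symm), mul_zero]
  · simp

variable (h : IsPow κ x (r + 1)) (h' : IsPow u (v.hom x) r)
  (hδ : ∀ w, (u.hom x - v.hom x) * w = 0 → w = 0)
include h h' hδ

/-- A function on the fibre product is determined by its restrictions to the two components. -/
lemma pairMul_injective : Injective (pairMul u v hκ hp hq he).1 := by
  rw [injective_iff_map_eq_zero]
  intro y hy
  obtain ⟨f, hf, rfl⟩ := exists_polynomial h y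
  rw [pairMul_sum u v hκ hp hq he hf] at hy
  have h₁ : f.eval₂ (u.hom : Z →+* W) (v.hom x) = 0 := congrArg Prod.fst hy
  have h₂ : f.eval x = 0 := congrArg Prod.snd hy
  -- `f = (X - x) g`, and the first component is `(v(x) - u(x)) g(v(x))`
  obtain ⟨g, rfl⟩ := dvd_iff_isRoot.2 h₂
  have hg : g.degree < r := by
    by_cases h0 : g = 0
    · rw [h0, degree_zero]; exact WithBot.bot_lt_coe _
    have : Nontrivial Z := ⟨⟨_, _, leadingCoeff_ne_zero.2 h0⟩⟩
    rw [mul_comm, (monic_X_sub_C x).degree_mul, degree_X_sub_C, degree_eq_natDegree h0] at hf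
    rw [degree_eq_natDegree h0]
    have hf' : g.natDegree + 1 < r + 1 := by exact_mod_cast hf
    exact_mod_cast Nat.lt_of_succ_lt_succ hf'
  have hg₀ : g = 0 := by
    refine h'.eq_zero_of_eval₂ hg (hδ _ ?_)
    rw [eval₂_mul, eval₂_sub, eval₂_X, eval₂_C] at h₁
    rw [← neg_eq_zero, ← neg_mul, neg_sub]
    exact h₁
  rw [hg₀, mul_zero]
  simp

omit hδ in
/-- The image consists of the pairs of functions on `W` and `Z` that agree on the intersection, which
is the zero set of `u(x) - v(x)`. -/
lemma mem_range_pairMul (w : W) (z : Z) :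
    ((toSc p q e w, toSc ι ι e z) : (sc p q e) × (sc ι ι e)) ∈
      range (pairMul u v hκ hp hq he).1 ↔ u.hom x - v.hom x ∣ u.hom z - w := by
  constructor
  · rintro ⟨y, hy⟩
    obtain ⟨f, hf, rfl⟩ := exists_polynomial h y
    rw [pairMul_sum u v hκ hp hq he hf] at hy
    have h₁ : f.eval₂ (u.hom : Z →+* W) (v.hom x) = w := congrArg Prod.fst hy
    have h₂ : f.eval x = z := congrArg Prod.snd hy
    rw [← h₁, ← h₂, show u.hom (f.eval x) = _ from hom_eval₂ f (RingHom.id _) (u.hom : Z →+* W) x,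
      eval₂_eq_eval_map, eval₂_eq_eval_map]
    exact sub_dvd_eval_sub _ _ _
  · rintro ⟨g₀, hg₀⟩
    obtain ⟨g, hg, rfl⟩ := h'.exists_eval₂ g₀
    have hf : (Polynomial.C z + (X - Polynomial.C x) * g).degree < ((r + 1 : ℕ) : WithBot ℕ) := by
      refine (degree_add_le _ _).trans_lt (max_lt ?_ ?_)
      · exact degree_C_le.trans_lt (WithBot.coe_lt_coe.2 (Nat.succ_pos r))
      · by_cases h0 : g = 0
        · rw [h0, mul_zero, degree_zero]; exact WithBot.bot_lt_coe _
        have : Nontrivial Z := ⟨⟨_, _, leadingCoeff_ne_zero.2 h0⟩⟩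
        rw [mul_comm, (monic_X_sub_C x).degree_mul, degree_X_sub_C, degree_eq_natDegree h0]
        rw [degree_eq_natDegree h0] at hg
        have hg' : g.natDegree < r := by exact_mod_cast hg
        exact_mod_cast Nat.succ_lt_succ hg'
    refine ⟨_, (pairMul_sum (x := x) u v hκ hp hq he hf).trans (Prod.ext ?_ ?_)⟩
    · refine congrArg (toSc p q e) ?_
      rw [eval₂_add, eval₂_C, eval₂_mul, eval₂_sub, eval₂_X, eval₂_C]
      have : (u.hom : Z →+* W) z - w = _ := hg₀
      have hx : (u.hom : Z →+* W) x = u.hom x := rfl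
      rw [hx, ← sub_eq_zero]
      linear_combination this
    · refine congrArg (toSc ι ι e) ?_
      simp

end Pair

end Cplx

namespace IsPow

open Polynomial

variable {Z Y : GrAlg K} {f : A.GrHom Z} {x : Z} {r : ℕ} (h : IsPow f x r)

/-- The `A`-linear map from `Z = A[x]` that sends `x ^ j` to `y ^ j` for `j < r`. -/
def subst (g : A.GrHom Y) (y : Y) : Z →ₗ[K] Y where
  toFun z := ∑ j, g.hom (h.coef z j) * y ^ (j : ℕ)
  map_add' z z' := by
    rw [← sum_add_distrib]
    exact sum_congr rfl fun j _ => by rw [map_add, Pi.add_apply, map_add, add_mul]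
  map_smul' c z := by
    rw [RingHom.id_apply, smul_sum]
    exact sum_congr rfl fun j _ => by rw [map_smul, Pi.smul_apply, map_smul, smul_mul_assoc]

variable (g : A.GrHom Y) (y : Y)

lemma subst_apply (z : Z) : h.subst g y z = ∑ j, g.hom (h.coef z j) * y ^ (j : ℕ) := rfl

lemma subst_l (a : A) (z : Z) : h.subst g y (f.hom a * z) = g.hom a * h.subst g y z := by
  rw [subst_apply, subst_apply, mul_sum]
  refine sum_congr rfl fun j _ => ?_
  rw [h.coef_l, map_mul, mul_assoc]

lemma subst_mem (hy : y ∈ Y.gr 2) {q : ℤ} {z : Z} (hz : z ∈ Z.gr q) : h.subst g y z ∈ Y.gr q := by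
  rw [subst_apply]
  refine Submodule.sum_mem _ fun j _ => ?_
  have := SetLike.mul_mem_graded (g.hom_mem (h.coef_mem hz j)) (SetLike.pow_mem_graded (j : ℕ) hy)
  rwa [nsmul_eq_mul, mul_comm _ (2 : ℤ), sub_add_cancel] at this

lemma subst_eval₂ {p : A[X]} (hp : p.degree < r) : h.subst g y (p.eval₂ (f.hom : A →+* Z) x) =
      p.eval₂ (g.hom : A →+* Y) y := by
  by_cases h0 : p = 0
  · rw [h0, eval₂_zero, eval₂_zero, map_zero]
  have hn : p.natDegree < r := (natDegree_lt_iff_degree_lt h0).2 hp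
  rw [eval₂_eq_sum_range' _ hn, eval₂_eq_sum_range' _ hn, ← Fin.sum_univ_eq_sum_range
    (fun j => (f.hom : A →+* Z) (p.coeff j) * x ^ j), ← Fin.sum_univ_eq_sum_range
    (fun j => (g.hom : A →+* Y) (p.coeff j) * y ^ j), subst_apply]
  have := h.coef_sum fun j => p.coeff j
  refine sum_congr rfl fun j _ => ?_
  exact congrArg (fun c : Fin r → A => g.hom (c j) * y ^ (j : ℕ)) this

/-- The monic polynomial of degree `r` that vanishes at `x`. -/
def minPoly : A[X] := X ^ r - ∑ j : Fin r, Polynomial.C (h.coef (x ^ r) j) * X ^ (j : ℕ)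

lemma monic_minPoly : h.minPoly.Monic := monic_X_pow_sub (degree_sum_fin_lt _)

lemma degree_minPoly [Nontrivial A] : h.minPoly.degree = r := by
  rw [minPoly, degree_sub_eq_left_of_degree_lt, degree_X_pow]
  rw [degree_X_pow]
  exact degree_sum_fin_lt _

lemma eval₂_minPoly : h.minPoly.eval₂ (f.hom : A →+* Z) x = 0 := by
  have := h.sum_coef (x ^ r)
  rw [minPoly, eval₂_sub, eval₂_X_pow, eval₂_finset_sum, sub_eq_zero]
  refine this.symm.trans (sum_congr rfl fun j _ => ?_)
  rw [eval₂_mul, eval₂_C, eval₂_X_pow]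
  rfl

lemma minPoly_mem (hy : y ∈ Y.gr 2) : h.minPoly.eval₂ (g.hom : A →+* Y) y ∈ Y.gr (2 * r) := by
  have h₁ := SetLike.pow_mem_graded r hy
  rw [nsmul_eq_mul, mul_comm _ (2 : ℤ)] at h₁
  have := (Y.gr (2 * r)).sub_mem h₁ (h.subst_mem g y hy (h.pow_mem r))
  convert this using 1
  rw [minPoly, eval₂_sub, eval₂_X_pow, eval₂_finset_sum]
  congr 1
  refine sum_congr rfl fun j _ => ?_
  rw [eval₂_mul, eval₂_C, eval₂_X_pow]
  rfl

end IsPow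

namespace Cplx

open Polynomial

section Square

variable {C₁ C₂ Z₁ Z₂ W : GrAlg K} {ι₁ : A.GrHom Z₁} {κ₁ : C₁.GrHom Z₁} {ι₂ : A.GrHom Z₂}
  {κ₂ : C₂.GrHom Z₂} {u₁ v₁ : Z₁.GrHom W} {u₂ v₂ : Z₂.GrHom W} {p q : A.GrHom W}
  {x₁ : Z₁} {x₂ : Z₂} {r₁ r₂ : ℕ} {s₁ t₁ s₂ t₂ e : ℤ}

lemma eval₂_comp_eq {f : A.GrHom Z₁} {u : Z₁.GrHom W} {p : A.GrHom W}
    (hp : ∀ a, p.hom a = u.hom (f.hom a)) (x : Z₁) (P : A[X]) :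
    u.hom (P.eval₂ (f.hom : A →+* Z₁) x) = P.eval₂ (p.hom : A →+* W) (u.hom x) := by
  have := hom_eval₂ P (f.hom : A →+* Z₁) (u.hom : Z₁ →+* W) x
  refine this.trans ?_
  congr 1
  exact RingHom.ext fun a => (hp a).symm

lemma sub_dvd_eval₂_sub (p : A.GrHom W) (y y' : W) (P : A[X]) :
    y - y' ∣ P.eval₂ (p.hom : A →+* W) y - P.eval₂ (p.hom : A →+* W) y' := by
  rw [eval₂_eq_eval_map, eval₂_eq_eval_map]
  exact sub_dvd_eval_sub _ _ _

variable (hκ₁ : ∀ c, u₁.hom (κ₁.hom c) = v₁.hom (κ₁.hom c))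
  (hκ₂ : ∀ c, u₂.hom (κ₂.hom c) = v₂.hom (κ₂.hom c))
  (hp₁ : ∀ a, p.hom a = u₁.hom (ι₁.hom a)) (hq₁ : ∀ a, q.hom a = v₁.hom (ι₁.hom a))
  (hp₂ : ∀ a, p.hom a = u₂.hom (ι₂.hom a)) (hq₂ : ∀ a, q.hom a = v₂.hom (ι₂.hom a))
  (he₁ : e = s₁ + t₁) (he₂ : e = s₂ + t₂)
  (hx : v₁.hom x₁ = u₂.hom x₂) (hx' : v₂.hom x₂ = u₁.hom x₁)
  (h₁ : IsPow ι₁ x₁ r₁) (h₂ : IsPow ι₂ x₂ r₂) (k₁ : IsPow κ₁ x₁ (r₂ + 1))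
  (k₂ : IsPow κ₂ x₂ (r₁ + 1)) (l₁ : IsPow u₁ (v₁.hom x₁) r₂) (l₂ : IsPow u₂ (v₂.hom x₂) r₁)
  (hδ : ∀ w, (u₁.hom x₁ - v₁.hom x₁) * w = 0 → w = 0)

include hp₁ hp₂ hx in
lemma dvd_subst_sub (z : Z₂) : u₁.hom x₁ - v₁.hom x₁ ∣ u₁.hom (h₂.subst ι₁ x₁ z) - u₂.hom z := by
  obtain ⟨g, hg, rfl⟩ := h₂.exists_eval₂ z
  rw [h₂.subst_eval₂ ι₁ x₁ hg, eval₂_comp_eq hp₁, eval₂_comp_eq hp₂, hx]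
  exact sub_dvd_eval₂_sub _ _ _ _

include hx hx' in
lemma dvd_swap {w : W} : u₂.hom x₂ - v₂.hom x₂ ∣ w ↔ u₁.hom x₁ - v₁.hom x₁ ∣ w := by
  rw [← hx, hx', ← neg_dvd, neg_sub]

include hx hx' h₁ h₂ k₁ k₂ l₁ l₂ hp₁ hp₂ hδ in
/-- The inclusion of the smaller product: `g(x₂)` goes to `g(x₁)`, where `g` has degree `< r₂`. -/
lemma exists_tensor_hom : ∃ E : (tensor (sc ι₂ κ₂ s₂) (sc κ₂ ι₂ t₂)).homs
    (tensor (sc ι₁ κ₁ s₁) (sc κ₁ ι₁ t₁)), ∀ y w z,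
      (pairMul u₂ v₂ hκ₂ hp₂ hq₂ he₂).1 y = (toSc p q e w, toSc ι₂ ι₂ e z) →
      (pairMul u₁ v₁ hκ₁ hp₁ hq₁ he₁).1 (E.1 y) =
        (toSc p q e w, toSc ι₁ ι₁ e (h₂.subst ι₁ x₁ z)) := by
  let ρ : (sc ι₂ ι₂ e).homs (sc ι₁ ι₁ e) := scHom (h₂.subst ι₁ x₁) (h₂.subst_l ι₁ x₁)
    (h₂.subst_l ι₁ x₁) fun q z hz => h₂.subst_mem ι₁ x₁ h₁.mem hz
  let Φ := pairMul (s := s₂) (t := t₂) u₂ v₂ hκ₂ hp₂ hq₂ he₂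
  obtain ⟨E, hE⟩ := exists_lift_of_injective (pairMul (s := s₁) (t := t₁) u₁ v₁ hκ₁ hp₁ hq₁ he₁)
    (pairMul_injective u₁ v₁ hκ₁ hp₁ hq₁ he₁ k₁ l₁ hδ)
    (pairHom (compHom Φ (fst _ _)) (compHom (compHom Φ (snd _ _)) ρ)) fun y => by
      obtain ⟨w, hw⟩ := exists_toSc p q e (Φ.1 y).1
      obtain ⟨z, hz⟩ := exists_toSc ι₂ ι₂ e (Φ.1 y).2
      have hy : Φ.1 y = (toSc p q e w, toSc ι₂ ι₂ e z) := Prod.ext hw.symm hz.symm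
      have hd := (dvd_swap hx hx').1 ((mem_range_pairMul u₂ v₂ hκ₂ hp₂ hq₂ he₂ k₂ l₂ w z).1 ⟨y, hy⟩)
      have : (pairHom (compHom Φ (fst _ _)) (compHom (compHom Φ (snd _ _)) ρ)).1 y =
          (toSc p q e w, toSc ι₁ ι₁ e (h₂.subst ι₁ x₁ z)) :=
        Prod.ext hw.symm (congrArg ρ.1 hz.symm)
      rw [this]
      refine (mem_range_pairMul u₁ v₁ hκ₁ hp₁ hq₁ he₁ k₁ l₁ _ _).2 ?_
      rw [← sub_add_sub_cancel _ (u₂.hom z) w]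
      exact dvd_add (dvd_subst_sub hp₁ hp₂ hx h₂ z) hd
  refine ⟨E, fun y w z hy => (hE y).trans ?_⟩
  have hy₁ : (Φ.1 y).1 = toSc p q e w := congrArg Prod.fst hy
  have hy₂ : (Φ.1 y).2 = toSc ι₂ ι₂ e z := congrArg Prod.snd hy
  exact Prod.ext hy₁ (congrArg ρ.1 hy₂)

include hp₁ hp₂ hx h₁ h₂ k₁ l₁ hδ in
/-- The summands on the diagonal: multiples of `minPoly`, extended by zero to `W`. -/
lemma exists_unit_hom (j : ℕ) : ∃ E : (sc (GrAlg.GrHom.id A) (GrAlg.GrHom.id A)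
    (e - 2 * (r₂ + j))).homs (tensor (sc ι₁ κ₁ s₁) (sc κ₁ ι₁ t₁)), ∀ a,
      (pairMul u₁ v₁ hκ₁ hp₁ hq₁ he₁).1 (E.1 (toSc _ _ _ a)) = (toSc p q e 0, toSc ι₁ ι₁ e
        (ι₁.hom a * (h₂.minPoly.eval₂ (ι₁.hom : A →+* Z₁) x₁ * x₁ ^ j))) := by
  set π := h₂.minPoly.eval₂ (ι₁.hom : A →+* Z₁) x₁ with hπ
  have hl (a z : A) : ι₁.hom ((GrAlg.GrHom.id A).hom a * z) * (π * x₁ ^ j) =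
      ι₁.hom a * (ι₁.hom z * (π * x₁ ^ j)) := by
    rw [map_mul ι₁.hom, mul_assoc]; rfl
  let ν : (sc (GrAlg.GrHom.id A) (GrAlg.GrHom.id A) (e - 2 * (r₂ + j))).homs (sc ι₁ ι₁ e) :=
    scHom (LinearMap.mulRight K (π * x₁ ^ j) ∘ₗ ι₁.hom.toLinearMap) hl hl fun q z hz => by
      have := SetLike.mul_mem_graded (ι₁.hom_mem hz) (SetLike.mul_mem_graded
        (h₂.minPoly_mem ι₁ x₁ h₁.mem) (h₁.pow_mem j))
      rw [show q + (e - 2 * (r₂ + j)) + (2 * r₂ + 2 * j) = q + e by ring] at this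
      exact this
  have hd : u₁.hom x₁ - v₁.hom x₁ ∣ u₁.hom π := by
    have := sub_dvd_eval₂_sub p (u₁.hom x₁) (v₁.hom x₁) h₂.minPoly
    rwa [hx, ← eval₂_comp_eq hp₂, h₂.eval₂_minPoly, map_zero, sub_zero, ← hx, ← eval₂_comp_eq hp₁] at this
  obtain ⟨E, hE⟩ := exists_lift_of_injective (pairMul (s := s₁) (t := t₁) u₁ v₁ hκ₁ hp₁ hq₁ he₁)
    (pairMul_injective u₁ v₁ hκ₁ hp₁ hq₁ he₁ k₁ l₁ hδ) (pairHom (0 : _) ν) fun y => by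
      obtain ⟨a, rfl⟩ := exists_toSc _ _ _ y
      refine (mem_range_pairMul u₁ v₁ hκ₁ hp₁ hq₁ he₁ k₁ l₁ 0 (ι₁.hom a * (π * x₁ ^ j))).2 ?_
      rw [sub_zero, map_mul, map_mul]
      exact dvd_mul_of_dvd_right (dvd_mul_of_dvd_left hd _) _
  exact ⟨E, fun a => (hE _).trans rfl⟩

include hκ₁ hκ₂ hp₁ hq₁ hp₂ hq₂ he₁ he₂ hx hx' h₁ h₂ k₁ k₂ l₁ l₂ hδ in
/-- Both tensor products consist of pairs of functions that agree on an intersection, on `W` and `Z₁`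
and on `W` and `Z₂`. The functions on `Z₂` are the polynomials of degree `< r₂` in `x₁`, and division
with remainder by `minPoly` gives the complement in the functions on `Z₁`. -/
lemma isDirectSum_of_square {M₁ M₂ : Ker A A} (hM₁ : M₁.cplx = tensor (sc ι₁ κ₁ s₁) (sc κ₁ ι₁ t₁))
    (hM₂ : M₂.cplx = tensor (sc ι₂ κ₂ s₂) (sc κ₂ ι₂ t₂)) {n : ℕ} (hn : r₁ = r₂ + n)
    (N : Fin n → Ker A A) (hN : ∀ j, (N j).cplx =
      sc (GrAlg.GrHom.id A) (GrAlg.GrHom.id A) (e - 2 * (r₂ + (j : ℕ)))) [Nontrivial A] :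
    IsDirectSum (fun j : Option (Fin n) => j.elim M₂ N) M₁ := by
  obtain ⟨c₁, hl₁, hr₁⟩ := M₁
  obtain ⟨c₂, hl₂, hr₂⟩ := M₂
  obtain rfl : c₁ = _ := hM₁
  obtain rfl : c₂ = _ := hM₂
  let Φ₁ := pairMul (s := s₁) (t := t₁) u₁ v₁ hκ₁ hp₁ hq₁ he₁
  have inj₁ : Injective Φ₁.1 := pairMul_injective u₁ v₁ hκ₁ hp₁ hq₁ he₁ k₁ l₁ hδ
  have inj₂ := pairMul_injective (s := s₂) (t := t₂) u₂ v₂ hκ₂ hp₂ hq₂ he₂ k₂ l₂ fun w hw => hδ w (by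
    rw [← hx, hx'] at hw
    rw [← neg_sub, neg_mul, hw, neg_zero])
  obtain ⟨E, hE⟩ := exists_tensor_hom (s₁ := s₁) (t₁ := t₁) (s₂ := s₂) (t₂ := t₂) hκ₁ hκ₂ hp₁ hq₁
    hp₂ hq₂ he₁ he₂ hx hx' h₁ h₂ k₁ k₂ l₁ l₂ hδ
  have key (j : Fin n) : ∃ (F : (N j).cplx.homs (tensor (sc ι₁ κ₁ s₁) (sc κ₁ ι₁ t₁)))
      (τ : A ≃ₗ[K] (N j).cplx), ∀ a, Φ₁.1 (F.1 (τ a)) = (toSc p q e 0,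
        toSc ι₁ ι₁ e (ι₁.hom a * (h₂.minPoly.eval₂ (ι₁.hom : A →+* Z₁) x₁ * x₁ ^ (j : ℕ)))) := by
    rw [hN j]
    obtain ⟨F, hF⟩ := exists_unit_hom (s₁ := s₁) (t₁ := t₁) hκ₁ hp₁ hq₁ hp₂ he₁ hx h₁ h₂ k₁ l₁ hδ j
    exact ⟨F, toSc _ _ _, hF⟩
  choose F τ hF using key
  let i : ∀ j : Option (Fin n), (j.elim (⟨_, hl₂, hr₂⟩ : Ker A A) N).cplx.homs
      (tensor (sc ι₁ κ₁ s₁) (sc κ₁ ι₁ t₁)) := fun j => j.rec E F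
  refine Ker.isDirectSum _ _ i ?_
  -- the value on `(g(x₂), a)` is `(g + h P)(x₁)`, where `h` has the coefficients `a`
  have val (y : ∀ j : Option (Fin n), (j.elim (⟨_, hl₂, hr₂⟩ : Ker A A) N).cplx)
      (w : W) (g : A[X]) (hg : g.degree < r₂) (a : Fin n → A)
      (hy : (pairMul u₂ v₂ hκ₂ hp₂ hq₂ he₂).1 (y none) = (toSc p q e w,
        toSc ι₂ ι₂ e (g.eval₂ (ι₂.hom : A →+* Z₂) x₂)))
      (ha : ∀ j, y (some j) = τ j (a j)) : Φ₁.1 (∑ j, (i j).1 (y j)) = (toSc p q e w,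
        toSc ι₁ ι₁ e ((g + h₂.minPoly * ∑ j, Polynomial.C (a j) * X ^ (j : ℕ)).eval₂
          (ι₁.hom : A →+* Z₁) x₁)) := by
    rw [Fintype.sum_option, map_add, map_sum]
    have e₁ : Φ₁.1 ((i none).1 (y none)) = _ := hE _ _ _ hy
    have e₂ (j : Fin n) : Φ₁.1 ((i (some j)).1 (y (some j))) = _ :=
      (congrArg (fun y => Φ₁.1 ((F j).1 y)) (ha j)).trans (hF j (a j))
    rw [e₁, sum_congr rfl fun j _ => e₂ j, h₂.subst_eval₂ ι₁ x₁ hg]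
    refine Prod.ext ?_ ?_
    · refine (map_add (LinearMap.fst K (sc p q e) (sc ι₁ ι₁ e)) _ _).trans
        ((congrArg₂ (· + ·) rfl ((map_sum (LinearMap.fst K (sc p q e) (sc ι₁ ι₁ e))
          _ _).trans (sum_eq_zero fun j _ => ?_))).trans (add_zero _))
      exact (toSc p q e).map_zero
    · rw [eval₂_add, eval₂_mul, eval₂_finset_sum, mul_sum, map_add, map_sum]
      refine (map_add (LinearMap.snd K (sc p q e) (sc ι₁ ι₁ e)) _ _).trans
        (congrArg₂ (· + ·) rfl ((map_sum (LinearMap.snd K (sc p q e) (sc ι₁ ι₁ e))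
          _ _).trans (sum_congr rfl fun j _ => congrArg (toSc ι₁ ι₁ e) ?_)))
      rw [eval₂_mul, eval₂_C, eval₂_X_pow]
      exact mul_left_comm _ _ _
  have dec (y : ∀ j : Option (Fin n), (j.elim (⟨_, hl₂, hr₂⟩ : Ker A A) N).cplx) :
      ∃ (w : W) (g : A[X]) (a : Fin n → A), g.degree < r₂ ∧
        (pairMul u₂ v₂ hκ₂ hp₂ hq₂ he₂).1 (y none) = (toSc p q e w,
          toSc ι₂ ι₂ e (g.eval₂ (ι₂.hom : A →+* Z₂) x₂)) ∧
        ∀ j, y (some j) = τ j (a j) := by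
    obtain ⟨w, hw⟩ := exists_toSc p q e ((pairMul u₂ v₂ hκ₂ hp₂ hq₂ he₂).1 (y none)).1
    obtain ⟨z, hz⟩ := exists_toSc ι₂ ι₂ e ((pairMul u₂ v₂ hκ₂ hp₂ hq₂ he₂).1 (y none)).2
    obtain ⟨g, hg, rfl⟩ := h₂.exists_eval₂ z
    exact ⟨w, g, fun j => (τ j).symm (y (some j)), hg, Prod.ext hw.symm hz.symm,
      fun j => ((τ j).apply_symm_apply _).symm⟩
  have deg (h : A[X]) (hh : h.degree < n) : (h₂.minPoly * h).degree < r₁ := by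
    by_cases h0 : h = 0
    · rw [h0, mul_zero, degree_zero]; exact WithBot.bot_lt_coe _
    rw [mul_comm, h₂.monic_minPoly.degree_mul, h₂.degree_minPoly, degree_eq_natDegree h0, hn, add_comm]
    rw [degree_eq_natDegree h0] at hh
    have hh' : h.natDegree < n := by exact_mod_cast hh
    exact_mod_cast Nat.add_lt_add_left hh' r₂
  have hr : (r₂ : WithBot ℕ) ≤ r₁ := by exact_mod_cast hn ▸ Nat.le_add_right r₂ n
  constructor
  · let L : (∀ j : Option (Fin n), (j.elim (⟨_, hl₂, hr₂⟩ : Ker A A) N).cplx) →ₗ[K]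
        (tensor (sc ι₁ κ₁ s₁) (sc κ₁ ι₁ t₁)) :=
      { toFun := fun x => ∑ j, (i j).1 (x j)
        map_add' := fun x y => by simp only [Pi.add_apply, map_add, sum_add_distrib]
        map_smul' := fun a x => by simp only [Pi.smul_apply, map_smul, smul_sum]; rfl }
    refine (injective_iff_map_eq_zero L).2 fun y hy => ?_
    obtain ⟨w, g, a, hg, hy₂, ha⟩ := dec y
    have e₀ := (val y w g hg a hy₂ ha).symm.trans ((congrArg Φ₁.1 hy).trans Φ₁.1.map_zero)
    have hw : w = 0 := (toSc p q e).injective ((congrArg Prod.fst e₀).trans (map_zero _).symm)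
    have hz := (toSc ι₁ ι₁ e).injective ((congrArg Prod.snd e₀).trans (map_zero _).symm)
    have hpoly := h₁.eq_zero_of_eval₂ ((degree_add_le _ _).trans_lt
      (max_lt (hg.trans_le hr) (deg _ (degree_sum_fin_lt a)))) hz
    obtain ⟨ha₀, hg₀⟩ := div_modByMonic_unique _ _ h₂.monic_minPoly
      ⟨hpoly, by rw [h₂.degree_minPoly]; exact hg⟩
    rw [zero_divByMonic] at ha₀
    rw [zero_modByMonic] at hg₀
    have ha' (j : Fin n) : a j = 0 := by
      have := congrArg (coeff · (j : ℕ)) ha₀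
      simp only [coeff_zero, finset_sum_coeff] at this
      rw [sum_eq_single j] at this
      · simpa using this.symm
      · intro k _ hk
        rw [coeff_C_mul, coeff_X_pow, if_neg fun h => hk (Fin.ext h.symm), mul_zero]
      · simp
    funext j
    cases j with
    | none =>
      refine inj₂ (hy₂.trans ?_)
      rw [hw, ← hg₀, eval₂_zero, map_zero, map_zero]
      exact (LinearMap.map_zero (pairMul u₂ v₂ hκ₂ hp₂ hq₂ he₂).1).symm
    | some j => rw [ha j, ha' j, map_zero]; rfl
  · intro m
    obtain ⟨w, hw⟩ := exists_toSc p q e (Φ₁.1 m).1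
    obtain ⟨z, hz⟩ := exists_toSc ι₁ ι₁ e (Φ₁.1 m).2
    obtain ⟨f, hf, rfl⟩ := h₁.exists_eval₂ z
    have hm : Φ₁.1 m = (toSc p q e w, toSc ι₁ ι₁ e _) := Prod.ext hw.symm hz.symm
    have hd := (mem_range_pairMul u₁ v₁ hκ₁ hp₁ hq₁ he₁ k₁ l₁ _ _).1 ⟨m, hm⟩
    set g := f %ₘ h₂.minPoly with hg_def
    set h := f /ₘ h₂.minPoly with hh_def
    have hfg : g + h₂.minPoly * h = f := modByMonic_add_div f h₂.minPoly
    have hg : g.degree < r₂ := by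
      rw [← h₂.degree_minPoly]; exact degree_modByMonic_lt _ h₂.monic_minPoly
    have hh : h.degree < n := by
      by_cases h0 : h = 0
      · rw [h0, degree_zero]; exact WithBot.bot_lt_coe _
      have hd : (h₂.minPoly * h).degree < r₁ := by
        rw [← sub_eq_iff_eq_add'.2 hfg.symm]
        exact (degree_sub_le _ _).trans_lt (max_lt hf (hg.trans_le hr))
      rw [mul_comm, h₂.monic_minPoly.degree_mul, h₂.degree_minPoly, degree_eq_natDegree h0, hn] at hd
      have hd' : h.natDegree + r₂ < r₂ + n := by exact_mod_cast hd
      rw [degree_eq_natDegree h0]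
      exact_mod_cast (by omega : h.natDegree < n)
    have hh' : ∑ j : Fin n, Polynomial.C (h.coeff j) * X ^ (j : ℕ) = h := by
      rw [Fin.sum_univ_eq_sum_range (fun j => Polynomial.C (h.coeff j) * X ^ j)]
      by_cases h0 : h = 0
      · simp [h0]
      · exact (as_sum_range_C_mul_X_pow' _ ((natDegree_lt_iff_degree_lt h0).2 hh)).symm
    -- the pair `(w, g(x₂))` lies in the image since `f` and `g` agree at `x₂`
    have hd₂ : u₁.hom x₁ - v₁.hom x₁ ∣ u₂.hom (g.eval₂ (ι₂.hom : A →+* Z₂) x₂) - w := by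
      have e₁ : g.eval₂ (ι₂.hom : A →+* Z₂) x₂ = f.eval₂ (ι₂.hom : A →+* Z₂) x₂ := by
        rw [← hfg, eval₂_add, eval₂_mul, h₂.eval₂_minPoly, zero_mul, add_zero]
      rw [e₁, eval₂_comp_eq hp₂, ← hx]
      rw [eval₂_comp_eq hp₁] at hd
      have := dvd_sub hd (sub_dvd_eval₂_sub p (u₁.hom x₁) (v₁.hom x₁) f)
      rwa [sub_sub_sub_cancel_left] at this
    obtain ⟨m₂, hm₂⟩ := (mem_range_pairMul (s := s₂) (t := t₂) u₂ v₂ hκ₂ hp₂ hq₂ he₂ k₂ l₂ w _).2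
      ((dvd_swap hx hx').2 hd₂)
    let y : ∀ j : Option (Fin n), (j.elim (⟨_, hl₂, hr₂⟩ : Ker A A) N).cplx :=
      fun j => j.rec m₂ fun j => τ j (h.coeff j)
    refine ⟨y, inj₁ ((val y w g hg (fun j => h.coeff j) hm₂ fun j => rfl).trans ?_)⟩
    rw [hh', hfg, hm]

end Square
end Cplx

/-! ### Invariants of permutation groups -/

namespace PermInv

open MvPolynomial Equiv

/-- The polynomials that are invariant under a group of permutations of the variables. -/
def inv (K : Type u) [Field K] (G : Subgroup (Perm ℕ)) : Subalgebra K (MvPolynomial ℕ K) where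
  carrier := {p | ∀ σ ∈ G, rename σ p = p}
  mul_mem' := fun hp hq σ hσ => by rw [map_mul, hp σ hσ, hq σ hσ]
  add_mem' := fun hp hq σ hσ => by rw [map_add, hp σ hσ, hq σ hσ]
  algebraMap_mem' x := fun σ _ => AlgHom.commutes _ x

/-- The stabilizer of a variable. -/
def stab (G : Subgroup (Perm ℕ)) (ξ : ℕ) : Subgroup (Perm ℕ) where
  carrier := {σ | σ ∈ G ∧ σ ξ = ξ}
  mul_mem' := fun ha hb => ⟨mul_mem ha.1 hb.1, by rw [Perm.mul_apply, hb.2, ha.2]⟩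
  one_mem' := ⟨one_mem _, rfl⟩
  inv_mem' := fun ha => ⟨inv_mem ha.1, Perm.inv_eq_iff_eq.2 ha.2.symm⟩

lemma rename_mul (σ τ : Perm ℕ) (p : MvPolynomial ℕ K) :
    rename (σ * τ : Perm ℕ) p = rename σ (rename τ p) := by
  rw [rename_rename, Perm.coe_mul]

/-- Divided differences exist. -/
lemma sub_dvd_sub_swap (x y : ℕ) (f : MvPolynomial ℕ K) :
    (X x - X y : MvPolynomial ℕ K) ∣ f - rename (swap x y) f := by
  induction f using MvPolynomial.induction_on with
  | C a => rw [rename_C, sub_self]; exact dvd_zero _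
  | add p q hp hq => rw [map_add, add_sub_add_comm]; exact dvd_add hp hq
  | mul_X p i hp =>
    have h : (X x - X y : MvPolynomial ℕ K) ∣ X i - X (swap x y i) := by
      rcases eq_or_ne i x with rfl | hx
      · rw [swap_apply_left]
      rcases eq_or_ne i y with rfl | hy
      · rw [swap_apply_right]; exact ⟨-1, by ring⟩
      · rw [swap_apply_of_ne_of_ne hx hy, sub_self]; exact dvd_zero _
    have e : p * X i - rename (swap x y) (p * X i) = (p - rename (swap x y) p) * X i +
        rename (swap x y) p * (X i - X (swap x y i)) := by
      rw [map_mul, rename_X]; ring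
    rw [e]
    exact dvd_add (hp.mul_right _) (h.mul_left _)

/-- A group of permutations that acts on a finite set and contains all transpositions in it. -/
structure Full (G : Subgroup (Perm ℕ)) (S : Finset ℕ) : Prop where
  stable : ∀ σ ∈ G, ∀ x ∈ S, σ x ∈ S
  swap_mem : ∀ x ∈ S, ∀ y ∈ S, swap x y ∈ G

lemma Full.stab {G : Subgroup (Perm ℕ)} {S : Finset ℕ} (h : Full G S) (ξ : ℕ) :
    Full (stab G ξ) (S.erase ξ) where
  stable σ hσ x hx := mem_erase.2 ⟨fun e => (mem_erase.1 hx).1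
    (σ.injective (e.trans hσ.2.symm)), h.stable σ hσ.1 x (Finset.mem_of_mem_erase hx)⟩
  swap_mem x hx y hy := ⟨h.swap_mem x (Finset.mem_of_mem_erase hx) y (Finset.mem_of_mem_erase hy),
    swap_apply_of_ne_of_ne (mem_erase.1 hx).1.symm (mem_erase.1 hy).1.symm⟩

/-- A polynomial of degree less than `#S` is determined by its values at the `X_z`, `z ∈ S`. -/
lemma eq_of_eval_X {S : Finset ℕ} {f g : Polynomial (MvPolynomial ℕ K)}
    (hf : f.degree < S.card) (hg : g.degree < S.card) (h : ∀ z ∈ S, f.eval (X z) = g.eval (X z)) :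
    f = g :=
  Polynomial.eq_of_degrees_lt_of_eval_index_eq S (X_injective.injOn) hf hg h

lemma degree_map_lt {n : ℕ} {f : Polynomial (MvPolynomial ℕ K)} (hf : f.degree < n)
    (σ : Perm ℕ) : (f.map (rename σ : MvPolynomial ℕ K →ₐ[K] _).toRingHom).degree < n :=
  (Polynomial.degree_map_le).trans_lt hf

lemma eval_map_rename (f : Polynomial (MvPolynomial ℕ K)) (σ : Perm ℕ) (z : ℕ) :
    (f.map (rename σ : MvPolynomial ℕ K →ₐ[K] _).toRingHom).eval (X (σ z)) =
      rename σ (f.eval (X z)) := by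
  have := Polynomial.eval_map_apply (rename σ : MvPolynomial ℕ K →ₐ[K] MvPolynomial ℕ K).toRingHom
    (p := f) (X z)
  rw [show (rename σ : MvPolynomial ℕ K →ₐ[K] _).toRingHom (X z) = X (σ z) from rename_X _ _] at this
  exact this

/-- An invariant of the stabilizer of `ξ` is a polynomial in `X_ξ` whose coefficients are invariant
under the whole group. The polynomial is the Lagrange interpolation of the conjugates of `f`; that its
coefficients are polynomials is seen by induction, from the divided difference. -/
lemma exists_polynomial {S : Finset ℕ} {G : Subgroup (Perm ℕ)} (h : Full G S) {ξ : ℕ} (hξ : ξ ∈ S)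
    {f : MvPolynomial ℕ K} (hf : f ∈ inv K (stab G ξ)) :
    ∃ Λ : Polynomial (MvPolynomial ℕ K), Λ.degree < S.card ∧ (∀ j, Λ.coeff j ∈ inv K G) ∧
      Λ.eval (X ξ) = f := by
  obtain ⟨n, hn⟩ : ∃ n, S.card = n := ⟨_, rfl⟩
  induction n generalizing S G ξ f with
  | zero => rw [Finset.card_eq_zero.1 hn] at hξ; exact absurd hξ (Finset.notMem_empty _)
  | succ n ih =>
    have hS' : (S.erase ξ).card = n := by rw [Finset.card_erase_of_mem hξ, hn, Nat.add_sub_cancel]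
    -- it suffices to find a polynomial with the right values
    suffices H : ∃ Λ : Polynomial (MvPolynomial ℕ K), Λ.degree < S.card ∧
        ∀ z ∈ S, Λ.eval (X z) = rename (swap ξ z) f by
      obtain ⟨Λ, hd, hv⟩ := H
      refine ⟨Λ, hd, fun j σ hσ => ?_, ?_⟩
      · have e : Λ.map (rename σ : MvPolynomial ℕ K →ₐ[K] _).toRingHom = Λ := by
          refine eq_of_eval_X (degree_map_lt hd σ) hd fun z hz => ?_
          obtain ⟨z, rfl⟩ := σ.surjective z
          have hz' : z ∈ S := by
            have := h.stable σ⁻¹ (inv_mem hσ) _ hz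
            rwa [← Perm.mul_apply, inv_mul_cancel, Perm.one_apply] at this
          rw [eval_map_rename, hv z hz', hv _ hz, ← rename_mul]
          have := hf ((swap ξ (σ z))⁻¹ * (σ * swap ξ z)) ⟨mul_mem (inv_mem (h.swap_mem _ hξ _ hz))
            (mul_mem hσ (h.swap_mem _ hξ _ hz')), by
              rw [Perm.mul_apply, Perm.mul_apply, swap_apply_left, swap_inv, swap_apply_right]⟩
          conv_rhs => rw [← this, ← rename_mul, mul_inv_cancel_left]
        have := congrArg (Polynomial.coeff · j) e
        rw [Polynomial.coeff_map] at this
        exact this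
      · rw [hv ξ hξ, swap_self]
        exact rename_id_apply f
    rcases (S.erase ξ).eq_empty_or_nonempty with hS | ⟨y, hy⟩
    · refine ⟨Polynomial.C f, ?_, fun z hz => ?_⟩
      · rw [hn]
        exact Polynomial.degree_C_le.trans_lt (WithBot.coe_lt_coe.2 (Nat.succ_pos n))
      · obtain rfl : z = ξ := by
          by_contra hne
          exact Finset.notMem_empty z (hS ▸ mem_erase.2 ⟨hne, hz⟩)
        rw [Polynomial.eval_C, swap_self]
        exact (rename_id_apply f).symm
    have hyS := Finset.mem_of_mem_erase hy
    have hyξ : y ≠ ξ := (mem_erase.1 hy).1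
    obtain ⟨g, hg⟩ := sub_dvd_sub_swap ξ y f
    have hg' : g ∈ inv K (stab (stab G ξ) y) := by
      rintro σ ⟨⟨hσ, hσξ⟩, hσy⟩
      have hne : (X ξ - X y : MvPolynomial ℕ K) ≠ 0 :=
        sub_ne_zero.2 fun e => hyξ (X_injective e).symm
      refine mul_left_cancel₀ hne ?_
      have e₁ : rename σ (X ξ - X y : MvPolynomial ℕ K) = X ξ - X y := by
        rw [map_sub, rename_X, rename_X, hσξ, hσy]
      have e₂ : σ * swap ξ y = swap ξ y * σ := by
        have := Equiv.mul_swap_eq_swap_mul σ ξ y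
        rwa [hσξ, hσy] at this
      rw [← hg]
      conv_lhs => rw [← e₁, ← map_mul, ← hg, map_sub, ← rename_mul, e₂, rename_mul, hf σ ⟨hσ, hσξ⟩]
    obtain ⟨Γ, hΓ, hc, hΓg⟩ := ih (h.stab ξ) hy hg' hS'
    have hfix {σ : Perm ℕ} (hσ : σ ∈ stab G ξ) :
        Γ.map (rename σ : MvPolynomial ℕ K →ₐ[K] _).toRingHom = Γ :=
      Polynomial.ext fun j => by rw [Polynomial.coeff_map]; exact hc j σ hσ
    refine ⟨Polynomial.C f + (Polynomial.X - Polynomial.C (X ξ)) * Γ, ?_, fun z hz => ?_⟩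
    · refine (Polynomial.degree_add_le _ _).trans_lt (max_lt ?_ ?_)
      · rw [hn]
        exact Polynomial.degree_C_le.trans_lt (WithBot.coe_lt_coe.2 (Nat.succ_pos n))
      · by_cases h0 : Γ = 0
        · rw [h0, mul_zero, Polynomial.degree_zero]; exact WithBot.bot_lt_coe _
        rw [Polynomial.degree_mul, Polynomial.degree_X_sub_C, Polynomial.degree_eq_natDegree h0, hn]
        rw [hS', Polynomial.degree_eq_natDegree h0] at hΓ
        have hΓ' : Γ.natDegree < n := by exact_mod_cast hΓ
        exact_mod_cast (by omega : 1 + Γ.natDegree < n + 1)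
    rw [Polynomial.eval_add, Polynomial.eval_mul, Polynomial.eval_sub, Polynomial.eval_C,
      Polynomial.eval_X, Polynomial.eval_C]
    rcases eq_or_ne z ξ with rfl | hzξ
    · rw [sub_self, zero_mul, add_zero, swap_self]
      exact (rename_id_apply f).symm
    -- the value at `X_y` is the definition of `g`; the other values are conjugate to it
    have hy₀ : f + (X y - X ξ) * Γ.eval (X y) = rename (swap ξ y) f := by
      rw [hΓg, ← neg_sub, neg_mul, ← hg]; ring
    have hs : swap y z ∈ stab G ξ :=
      ⟨h.swap_mem _ hyS _ hz, swap_apply_of_ne_of_ne hyξ.symm hzξ.symm⟩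
    have := congrArg (rename (swap y z)) hy₀
    have hz' : rename (swap y z) (Γ.eval (X y)) = Γ.eval (X z) := by
      have := eval_map_rename Γ (swap y z) y
      rw [hfix hs, swap_apply_left] at this
      exact this.symm
    rw [map_add, map_mul, map_sub, hf _ hs, rename_X, rename_X, swap_apply_left, hs.2, hz',
      ← rename_mul] at this
    rw [this]
    have e : swap y z * swap ξ y = swap ξ z * swap y z := by
      have := Equiv.mul_swap_eq_swap_mul (swap y z) ξ y
      rwa [swap_apply_left, hs.2] at this
    rw [e, rename_mul, hf _ hs]

lemma eq_zero_of_eval {S : Finset ℕ} {G : Subgroup (Perm ℕ)} (h : Full G S) {ξ : ℕ} (hξ : ξ ∈ S)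
    {Λ : Polynomial (MvPolynomial ℕ K)} (hd : Λ.degree < S.card) (hc : ∀ j, Λ.coeff j ∈ inv K G)
    (h0 : Λ.eval (X ξ) = 0) : Λ = 0 := by
  refine eq_of_eval_X hd (by rw [Polynomial.degree_zero]; exact WithBot.bot_lt_coe _) fun z hz => ?_
  have hfix : Λ.map (rename (swap ξ z) : MvPolynomial ℕ K →ₐ[K] _).toRingHom = Λ :=
    Polynomial.ext fun j => by rw [Polynomial.coeff_map]; exact hc j _ (h.swap_mem _ hξ _ hz)
  have := eval_map_rename Λ (swap ξ z) ξ
  rw [hfix, swap_apply_left, h0, map_zero] at this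
  rw [this, Polynomial.eval_zero]

end PermInv

/-! ### Rings of symmetric functions -/

section Sym

open MvPolynomial Equiv

variable {m m' : ℕ} {c : Fin m → ℤ} {c' : Fin m' → ℤ}

/-- The bounds between the blocks of variables. -/
def cutSet (c : Fin m → ℤ) : Set ℤ := {d | ∃ j ≤ m, cut c j = d}

lemma cut_mem_cutSet {j : ℕ} (hj : j ≤ m) : cut c j ∈ cutSet c := ⟨j, hj, rfl⟩

lemma cut_zero : cut c 0 = 0 := by simp [cut]

lemma cut_succ (c : Fin m → ℤ) (l : Fin m) : cut c (l.val + 1) = cut c l.val + c l := by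
  simp only [cut, ← sub_eq_iff_eq_add', ← Finset.sum_sub_distrib]
  rw [sum_eq_single l]
  · simp
  · intro j _ hj
    have : j.val ≠ l.val := fun e => hj (Fin.ext e)
    split_ifs <;> omega
  · simp

lemma preservesBlocks_iff {σ : Perm ℕ} : PreservesBlocks c σ ↔
    ∀ d ∈ cutSet c, ∀ x : ℕ, d ≤ (σ x : ℤ) ↔ d ≤ (x : ℤ) :=
  ⟨fun h d ⟨j, hj, e⟩ x => e ▸ h j hj x, fun h j hj x => h _ (cut_mem_cutSet hj) x⟩

/-- The group of permutations that preserve the blocks. -/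
def blockGroup (c : Fin m → ℤ) : Subgroup (Perm ℕ) where
  carrier := {σ | PreservesBlocks c σ}
  mul_mem' := fun ha hb j hj x => (ha j hj _).trans (hb j hj x)
  one_mem' := fun j hj x => Iff.rfl
  inv_mem' := fun {σ} ha j hj x => by
    have := ha j hj (σ⁻¹ x)
    rw [← Perm.mul_apply, mul_inv_cancel, Perm.one_apply] at this
    exact this.symm

lemma bounds_of_mem_cutSet (h : ∀ i, 0 ≤ c i) {d : ℤ} (hd : d ∈ cutSet c) :
    0 ≤ d ∧ d ≤ cut c m := by
  obtain ⟨j, hj, rfl⟩ := hd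
  exact ⟨cut_zero (c := c) ▸ cut_mono h (Nat.zero_le j), cut_mono h hj⟩

lemma X_mem_symPoly (h : ∀ i, 0 ≤ c i) {ξ : ℤ} (h₀ : ξ ∈ cutSet c) (h₁ : ξ + 1 ∈ cutSet c) :
    (X ξ.toNat : MvPolynomial ℕ K) ∈ symPoly K c := by
  have b₀ := bounds_of_mem_cutSet h h₀
  have b₁ := bounds_of_mem_cutSet h h₁
  refine ⟨Algebra.subset_adjoin (Set.mem_image_of_mem _ ?_), fun σ hσ => ?_⟩
  · change ((ξ.toNat : ℕ) : ℤ) < _; omega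
  · have e₀ := preservesBlocks_iff.1 hσ _ h₀ ξ.toNat
    have e₁ := preservesBlocks_iff.1 hσ _ h₁ ξ.toNat
    rw [rename_X, show σ ξ.toNat = ξ.toNat by omega]

/-- The variable with index `ξ`, if it forms a block of its own. -/
def symVar (K : Type u) [Field K] (c : Fin m → ℤ) (ξ : ℤ) : symAlg K c := by
  classical
  exact (fun _ => if h : X ξ.toNat ∈ symPoly K c then ⟨X ξ.toNat, h⟩ else 0 : symRing K c)

/-- A function on `𝔸_c` as a polynomial. -/
def symEv (h : ∀ i, 0 ≤ c i) : symAlg K c →ₐ[K] MvPolynomial ℕ K where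
  toFun f := ((f : symRing K c) ⟨h⟩).1
  map_one' := rfl
  map_mul' _ _ := rfl
  map_zero' := rfl
  map_add' _ _ := rfl
  commutes' _ := rfl

lemma symEv_apply (h : ∀ i, 0 ≤ c i) (f : symRing K c) : symEv h f = (f ⟨h⟩).1 := rfl

lemma symEv_injective (h : ∀ i, 0 ≤ c i) : Injective (symEv (K := K) h) := by
  intro f g e
  exact funext fun _ => Subtype.ext e

lemma symEv_mem (h : ∀ i, 0 ≤ c i) (f : symAlg K c) : symEv h f ∈ symPoly K c :=
  ((f : symRing K c) ⟨h⟩).2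

lemma exists_symEv (h : ∀ i, 0 ≤ c i) {p : MvPolynomial ℕ K} (hp : p ∈ symPoly K c) :
    ∃ f : symAlg K c, symEv h f = p :=
  ⟨(fun _ => ⟨p, hp⟩ : symRing K c), rfl⟩

lemma mem_symGr_iff (h : ∀ i, 0 ≤ c i) {q : ℤ} {f : symAlg K c} :
    f ∈ (symAlg K c).gr q ↔ (symEv h f).IsWeightedHomogeneous varDeg q :=
  ⟨fun hf => (mem_symGr.1 hf) ⟨h⟩, fun hf => mem_symGr.2 fun _ => hf⟩

lemma symAlg_subsingleton (h : ¬ ∀ i, 0 ≤ c i) : Subsingleton (symAlg K c) :=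
  ⟨fun _ _ => funext fun h' => (h h'.down).elim⟩

lemma symEv_incl (h₁ : (∀ i, 0 ≤ c' i) → ∀ i, 0 ≤ c i) (h₂ : cut c m = cut c' m')
    (h₃ : ∀ j ≤ m, ∃ j' ≤ m', cut c j = cut c' j') (h : ∀ i, 0 ≤ c' i) (f : symAlg K c) :
    symEv h ((symIncl h₁ h₂ h₃).hom f) = symEv (h₁ h) f := by
  have e₁ := symEv_apply h (symInclHom h₁ h₂ h₃ f)
  have e₂ := symEv_apply (h₁ h) f
  have e₃ := symInclHom_apply h₁ h₂ h₃ (f : symRing K c) ⟨h⟩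
  exact (e₁.trans e₃).trans e₂.symm

/-- A homomorphism of rings of symmetric functions that is the inclusion in the polynomial ring. -/
def IsIncl (f : (symAlg K c).GrHom (symAlg K c')) : Prop :=
  ∃ h₁ : (∀ i, 0 ≤ c' i) → ∀ i, 0 ≤ c i, ∀ h a, symEv h (f.hom a) = symEv (h₁ h) a

lemma isIncl_symIncl (h₁ : (∀ i, 0 ≤ c' i) → ∀ i, 0 ≤ c i) (h₂ : cut c m = cut c' m')
    (h₃ : ∀ j ≤ m, ∃ j' ≤ m', cut c j = cut c' j') : IsIncl (symIncl (𝕜 := K) h₁ h₂ h₃) :=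
  ⟨h₁, symEv_incl h₁ h₂ h₃⟩

lemma exists_isIncl (K : Type u) [Field K] (h₁ : (∀ i, 0 ≤ c' i) → ∀ i, 0 ≤ c i)
    (h₂ : cut c m = cut c' m') (h₃ : cutSet c ⊆ cutSet c') :
    ∃ f : (symAlg K c).GrHom (symAlg K c'), IsIncl f :=
  ⟨_, isIncl_symIncl h₁ h₂ fun j hj => (h₃ (cut_mem_cutSet hj)).imp fun _ h => ⟨h.1, h.2.symm⟩⟩

lemma ext_symEv {a b : symAlg K c} (h : ∀ h, symEv h a = symEv h b) : a = b := by
  by_cases hc : ∀ i, 0 ≤ c i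
  · exact symEv_injective hc (h hc)
  · exact (symAlg_subsingleton hc).elim _ _

lemma symEv_var (h : ∀ i, 0 ≤ c i) {ξ : ℤ} (h₀ : ξ ∈ cutSet c) (h₁ : ξ + 1 ∈ cutSet c) :
    symEv h (symVar K c ξ) = X ξ.toNat := by
  have : symEv h (symVar K c ξ) = ((symVar K c ξ : symRing K c) ⟨h⟩).1 := rfl
  rw [this, symVar, dif_pos (X_mem_symPoly h h₀ h₁)]

lemma symVar_mem (c : Fin m → ℤ) (ξ : ℤ) : symVar K c ξ ∈ (symAlg K c).gr 2 := by
  refine mem_symGr.2 ?_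
  intro h
  rw [symVar]
  split_ifs
  · exact isWeightedHomogeneous_X K varDeg _
  · exact zero_mem _

/-- The map that sets the variables with index `≥ N` to zero. -/
def truncVars (K : Type u) [Field K] (N : ℤ) : MvPolynomial ℕ K →ₐ[K] MvPolynomial ℕ K :=
  aeval fun x => if (x : ℤ) < N then X x else 0

lemma truncVars_of_mem {N : ℤ} {p : MvPolynomial ℕ K}
    (hp : p ∈ supported K {x : ℕ | (x : ℤ) < N}) : truncVars K N p = p := by
  conv_rhs => rw [← aeval_X_left_apply p]
  refine eval₂Hom_congr' rfl (fun x hx _ => ?_) rfl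
  have : (x : ℤ) < N := mem_supported.1 hp hx
  rw [if_pos this]

lemma truncVars_mem (N : ℤ) (p : MvPolynomial ℕ K) :
    truncVars K N p ∈ supported K {x : ℕ | (x : ℤ) < N} := by
  induction p using MvPolynomial.induction_on with
  | C a => rw [truncVars, algHom_C]; exact Subalgebra.algebraMap_mem _ a
  | add p q hp hq => rw [map_add]; exact add_mem hp hq
  | mul_X p i hp =>
    rw [map_mul]
    refine mul_mem hp ?_
    rw [truncVars, aeval_X]
    split_ifs with h
    · exact Algebra.subset_adjoin (Set.mem_image_of_mem _ h)
    · exact zero_mem _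

lemma rename_truncVars {N : ℤ} {σ : Perm ℕ} (hσ : ∀ x : ℕ, N ≤ (σ x : ℤ) ↔ N ≤ (x : ℤ))
    (p : MvPolynomial ℕ K) : rename σ (truncVars K N p) = truncVars K N (rename σ p) := by
  rw [truncVars, aeval_rename, ← AlgHom.comp_apply, comp_aeval]
  congr 2
  funext x
  have := hσ x
  by_cases h : (x : ℤ) < N
  · rw [if_pos h, Function.comp_apply, if_pos (by omega), rename_X]
  · rw [if_neg h, Function.comp_apply, if_neg (by omega), map_zero]

lemma truncVars_mem_symPoly {p : MvPolynomial ℕ K} (hp : p ∈ PermInv.inv K (blockGroup c)) :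
    truncVars K (cut c m) p ∈ symPoly K c :=
  ⟨truncVars_mem _ p, fun σ hσ => by rw [rename_truncVars (hσ m le_rfl), hp σ hσ]⟩

/-- The variables in a block. -/
def block (c : Fin m → ℤ) (l : Fin m) : Finset ℕ :=
  Finset.Ico (cut c l.val).toNat (cut c (l.val + 1)).toNat

lemma card_block (h : ∀ i, 0 ≤ c i) (l : Fin m) : (block c l).card = (c l).toNat := by
  have h₁ := cut_succ c l
  have h₂ := h l
  have h₃ := (bounds_of_mem_cutSet h (cut_mem_cutSet l.isLt.le)).1
  rw [block, Nat.card_Ico]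
  omega

lemma full_blockGroup (h : ∀ i, 0 ≤ c i) (l : Fin m) :
    PermInv.Full (blockGroup c) (block c l) where
  stable σ hσ x hx := by
    have e₀ := hσ l.val l.isLt.le x
    have e₁ := hσ (l.val + 1) l.isLt x
    rw [block, mem_Ico] at hx ⊢
    omega
  swap_mem x hx y hy j hj z := by
    rw [block, mem_Ico] at hx hy
    have e : cut c j ≤ cut c l.val ∨ cut c (l.val + 1) ≤ cut c j := by
      rcases Nat.lt_or_ge l.val j with hj' | hj'
      · exact Or.inr (cut_mono h hj')
      · exact Or.inl (cut_mono h hj')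
    rcases eq_or_ne z x with rfl | hzx
    · rw [swap_apply_left]; omega
    rcases eq_or_ne z y with rfl | hzy
    · rw [swap_apply_right]; omega
    rw [swap_apply_of_ne_of_ne hzx hzy]

lemma mem_stab_blockGroup (h : ∀ i, 0 ≤ c' i) {ξ d : ℤ} (hc : cutSet c' = insert d (cutSet c))
    (hd : d = ξ ∨ d = ξ + 1) (h₀ : ξ ∈ cutSet c') (h₁ : ξ + 1 ∈ cutSet c') {σ : Perm ℕ} :
    σ ∈ PermInv.stab (blockGroup c) ξ.toNat ↔ PreservesBlocks c' σ := by
  have b₀ := bounds_of_mem_cutSet h h₀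
  constructor
  · rintro ⟨hσ, hξ⟩
    have hσ := preservesBlocks_iff.1 hσ
    rw [preservesBlocks_iff, hc]
    rintro _ (rfl | hd') x
    · have hne : σ x = ξ.toNat ↔ x = ξ.toNat := by
        conv_lhs => rw [← hξ, σ.injective.eq_iff]
      rw [hc] at h₀ h₁
      rcases hd with rfl | rfl
      · rcases h₁ with h₁ | h₁
        · omega
        have := hσ _ h₁ x
        omega
      · rcases h₀ with h₀ | h₀
        · omega
        have := hσ _ h₀ x
        omega
    · exact hσ _ hd' x
  · intro hσ
    have hσ := preservesBlocks_iff.1 hσ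
    refine ⟨preservesBlocks_iff.2 fun d hd => hσ d (hc ▸ Set.mem_insert_of_mem _ hd), ?_⟩
    have e₀ := hσ _ h₀ ξ.toNat
    have e₁ := hσ _ h₁ ξ.toNat
    omega

/-- If the blocks of `c'` arise from those of `c` by making the first or last variable `ξ` of a block
into a block of its own, then the ring of `c'` is free over the ring of `c` on the powers of `ξ`. -/
lemma IsIncl.isPow {f : (symAlg K c).GrHom (symAlg K c')} (hf : IsIncl f)
    (h₂ : cut c m = cut c' m') (l : Fin m) {ξ d : ℤ}
    (hv : (∀ i, 0 ≤ c i) → 0 < c l → ∀ i, 0 ≤ c' i)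
    (hl : (∀ i, 0 ≤ c' i) → cut c l.val ≤ ξ ∧ ξ < cut c (l.val + 1))
    (hc : cutSet c' = insert d (cutSet c)) (hd : d = ξ ∨ d = ξ + 1)
    (hξ₀ : ξ ∈ cutSet c') (hξ₁ : ξ + 1 ∈ cutSet c') :
    IsPow f (symVar K c' ξ) (c l).toNat := by
  obtain ⟨h₁, hf⟩ := hf
  refine ⟨symVar_mem c' ξ, ?_⟩
  by_cases h' : ∀ i, 0 ≤ c' i
  swap
  · have : Subsingleton (symAlg K c') := symAlg_subsingleton h'
    have : Subsingleton (Fin (c l).toNat → symAlg K c) := by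
      by_cases h : ∀ i, 0 ≤ c i
      · have : (c l).toNat = 0 := by
          by_contra h0
          exact h' (hv h (by omega))
        rw [this]
        infer_instance
      · have : Subsingleton (symAlg K c) := symAlg_subsingleton h
        infer_instance
    exact ⟨fun _ _ _ => Subsingleton.elim _ _, fun z => ⟨0, Subsingleton.elim _ _⟩⟩
  have h := h₁ h'
  have full := full_blockGroup h l
  have hmem : ξ.toNat ∈ block c l := by
    have := hl h'
    have := (bounds_of_mem_cutSet h (cut_mem_cutSet l.isLt.le)).1
    rw [block, mem_Ico]
    omega
  -- functions of `c'` are polynomials in `ξ` whose coefficients are functions of `c`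
  have hval (a : Fin (c l).toNat → symAlg K c) :
      symEv h' (∑ j, f.hom (a j) * symVar K c' ξ ^ (j : ℕ)) =
        (∑ j : Fin (c l).toNat, Polynomial.C (symEv h (a j)) * Polynomial.X ^ (j : ℕ)).eval
          (X ξ.toNat) := by
    rw [map_sum, Polynomial.eval_finset_sum]
    refine sum_congr rfl fun j _ => ?_
    rw [map_mul, map_pow, symEv_var h' hξ₀ hξ₁, hf, Polynomial.eval_mul, Polynomial.eval_C,
      Polynomial.eval_pow, Polynomial.eval_X]
  have hcoeff (a : Fin (c l).toNat → symAlg K c) (k : ℕ) :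
      (∑ j : Fin (c l).toNat, Polynomial.C (symEv h (a j)) * Polynomial.X ^ (j : ℕ)).coeff k =
        if hk : k < (c l).toNat then symEv h (a ⟨k, hk⟩) else 0 := by
    rw [Polynomial.finset_sum_coeff]
    simp only [Polynomial.coeff_C_mul, Polynomial.coeff_X_pow, mul_ite, mul_one, mul_zero]
    split_ifs with hk
    · rw [sum_eq_single ⟨k, hk⟩]
      · rw [if_pos rfl]
      · intro j _ hj
        exact if_neg fun e => hj (Fin.ext e.symm)
      · simp
    · refine sum_eq_zero fun j _ => if_neg fun e => hk ?_
      rw [e]; exact j.isLt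
  constructor
  · intro a b hab
    have hdiff := hval (a - b)
    have e : (∑ j, f.hom ((a - b) j) * symVar K c' ξ ^ (j : ℕ)) = 0 := by
      refine Eq.trans ?_ (sub_eq_zero.2 hab)
      rw [← Finset.sum_sub_distrib]
      exact sum_congr rfl fun j _ => by rw [Pi.sub_apply, map_sub, sub_mul]
    rw [e, map_zero] at hdiff
    have hz := PermInv.eq_zero_of_eval full hmem (by
      rw [card_block h]; exact Polynomial.degree_sum_fin_lt _) (fun k => by
        rw [hcoeff]
        split_ifs
        · exact (symEv_mem h _).2
        · exact zero_mem _) hdiff.symm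
    funext j
    have hj := congrArg (Polynomial.coeff · (j : ℕ)) hz
    simp only [hcoeff, j.isLt, dif_pos, Polynomial.coeff_zero] at hj
    refine sub_eq_zero.1 (symEv_injective h ?_)
    rw [map_zero]
    exact hj
  · intro z
    have hz : symEv h' z ∈ PermInv.inv K (PermInv.stab (blockGroup c) ξ.toNat) := fun σ hσ =>
      (symEv_mem h' z).2 σ ((mem_stab_blockGroup h' hc hd hξ₀ hξ₁).1 hσ)
    obtain ⟨Λ, hΛ, hΛc, hΛf⟩ := PermInv.exists_polynomial full hmem hz
    choose a ha using fun j => exists_symEv h (truncVars_mem_symPoly (hΛc j))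
    refine ⟨fun j => a j, symEv_injective h' ?_⟩
    refine (hval _).trans ?_
    have hb : (X ξ.toNat : MvPolynomial ℕ K) = truncVars K (cut c m) (X ξ.toNat) := by
      rw [truncVars_of_mem]
      have := X_mem_symPoly (K := K) h' hξ₀ hξ₁
      rw [h₂]
      exact this.1
    have hz' : truncVars K (cut c m) (symEv h' z) = symEv h' z := by
      rw [h₂]; exact truncVars_of_mem (symEv_mem h' z).1
    rw [← hz', ← hΛf, Polynomial.eval_finset_sum]
    by_cases h0 : Λ = 0
    · refine (sum_eq_zero fun j _ => ?_).trans (by rw [h0, Polynomial.eval_zero, map_zero])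
      rw [ha, h0, Polynomial.coeff_zero, map_zero, Polynomial.C_0, zero_mul, Polynomial.eval_zero]
    have hn : Λ.natDegree < (c l).toNat := by
      rw [← card_block h]
      exact (Polynomial.natDegree_lt_iff_degree_lt h0).2 hΛ
    rw [Polynomial.eval_eq_sum_range' hn, map_sum, ← Fin.sum_univ_eq_sum_range
      (fun j => truncVars K (cut c m) (Λ.coeff j * X ξ.toNat ^ j))]
    refine sum_congr rfl fun j _ => ?_
    rw [ha, Polynomial.eval_mul, Polynomial.eval_C, Polynomial.eval_pow, Polynomial.eval_X, map_mul,
      map_pow, ← hb]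

lemma IsIncl.hom_hom_eq {m₁ m₂ : ℕ} {b : Fin m₁ → ℤ} {b' : Fin m₂ → ℤ}
    {f : (symAlg K c).GrHom (symAlg K b)} {g : (symAlg K b).GrHom (symAlg K c')}
    {f' : (symAlg K c).GrHom (symAlg K b')} {g' : (symAlg K b').GrHom (symAlg K c')}
    (hf : IsIncl f) (hg : IsIncl g) (hf' : IsIncl f') (hg' : IsIncl g') (a : symAlg K c) :
    g.hom (f.hom a) = g'.hom (f'.hom a) :=
  ext_symEv fun h => by rw [hg.2, hg'.2, hf.2, hf'.2]

lemma IsIncl.hom_var {f : (symAlg K c).GrHom (symAlg K c')} (hf : IsIncl f)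
    (hc : cutSet c ⊆ cutSet c') {ξ : ℤ} (h₀ : ξ ∈ cutSet c) (h₁ : ξ + 1 ∈ cutSet c) :
    f.hom (symVar K c ξ) = symVar K c' ξ :=
  ext_symEv fun h => by
    rw [hf.2, symEv_var _ h₀ h₁, symEv_var h (hc h₀) (hc h₁)]

/-- The automorphism that is given by a permutation of the variables. -/
def symRename (K : Type u) [Field K] (c : Fin m → ℤ) (π : Perm ℕ)
    (hπ : (∀ i, 0 ≤ c i) → ∀ p ∈ symPoly K c, rename π p ∈ symPoly K c) :
    (symAlg K c).GrHom (symAlg K c) where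
  hom := (AlgHom.ofLinearMap
    { toFun := fun f h => ⟨rename π (f h).1, hπ h.down _ (f h).2⟩
      map_add' := fun f g => funext fun h => Subtype.ext (map_add (rename π) (f h).1 (g h).1)
      map_smul' := fun a f => funext fun h => Subtype.ext (map_smul (rename π) a (f h).1) }
    (funext fun h => Subtype.ext (map_one (rename π)))
    fun f g => funext fun h => Subtype.ext (map_mul (rename π) (f h).1 (g h).1) :
      symRing K c →ₐ[K] symRing K c)
  hom_mem {q f} hf := mem_symGr.2 fun h d hd => by
    obtain ⟨d, rfl, hd'⟩ := coeff_rename_ne_zero _ _ _ hd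
    rw [← mem_symGr.1 hf h hd', Finsupp.weight_apply, Finsupp.weight_apply,
      Finsupp.sum_mapDomain_index] <;> simp [add_mul]

lemma symEv_rename {π : Perm ℕ}
    (hπ : (∀ i, 0 ≤ c i) → ∀ p ∈ symPoly K c, rename π p ∈ symPoly K c) (h : ∀ i, 0 ≤ c i)
    (a : symAlg K c) : symEv h ((symRename K c π hπ).hom a) = rename π (symEv h a) := rfl

end Sym

/-! ### The correspondences -/

section Corr

variable {n : ℕ}

lemma root_apply (i : Fin (n - 1)) (x : Fin n) :
    root i x = (if x = hi i then 1 else 0) - if x = lo i then 1 else 0 := by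
  rw [root, Pi.sub_apply, Pi.single_apply, Pi.single_apply]

lemma lo_ne_hi (i : Fin (n - 1)) : lo i ≠ hi i := fun h => by
  have := congrArg Fin.val h
  simp only [lo, hi] at this
  omega

lemma add_root_hi (k : Fin n → ℤ) (i : Fin (n - 1)) : (k + root i) (hi i) = k (hi i) + 1 := by
  rw [Pi.add_apply, root_apply, if_pos rfl, if_neg (lo_ne_hi i).symm, sub_zero]

lemma add_root_lo (k : Fin n → ℤ) (i : Fin (n - 1)) : (k + root i) (lo i) = k (lo i) - 1 := by
  rw [Pi.add_apply, root_apply, if_neg (lo_ne_hi i), if_pos rfl, zero_sub, sub_eq_add_neg]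

lemma dot_root (k : Fin n → ℤ) (i : Fin (n - 1)) : k ⬝ᵥ root i = k (hi i) - k (lo i) := by
  rw [root, dotProduct_sub, dotProduct_single, dotProduct_single, mul_one, mul_one]

lemma splitSeq_nonneg_iff {k : Fin n → ℤ} {i : Fin (n - 1)} :
    (∀ j, 0 ≤ splitSeq i k j) ↔ (∀ j, 0 ≤ k j) ∧ 0 < k (lo i) := by
  have e (j : Fin n) : (k - Pi.single (lo i) 1 : Fin n → ℤ) j = k j - if j = lo i then 1 else 0 := by
    rw [Pi.sub_apply, Pi.single_apply]
  rw [Fin.forall_iff_succAbove (hi i).castSucc]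
  simp only [splitSeq, Fin.insertNth_apply_same, Fin.insertNth_apply_succAbove, e]
  refine ⟨fun h => ⟨fun j => ?_, ?_⟩, fun h => ⟨zero_le_one, fun j => ?_⟩⟩
  · have := h.2 j; split_ifs at this <;> omega
  · have := h.2 (lo i); rw [if_pos rfl] at this; omega
  · have := h.1 j
    split_ifs with hj
    · subst hj; have := h.2; omega
    · omega

/-- The correspondence is nonempty if and only if the target has a point to move. -/
lemma add_root_nonneg_iff {k : Fin n → ℤ} {i : Fin (n - 1)} :
    (∀ j, 0 ≤ splitSeq i k j) ↔ (∀ j, 0 ≤ (k + root i) j) ∧ 0 < (k + root i) (hi i) := by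
  rw [splitSeq_nonneg_iff]
  have e (j : Fin n) := root_apply i j
  have hne := lo_ne_hi i
  refine ⟨fun h => ⟨fun j => ?_, ?_⟩, fun h => ⟨fun j => ?_, ?_⟩⟩
  · have := h.1 j; rw [Pi.add_apply, e]
    by_cases hj : j = lo i
    · subst hj; rw [if_neg hne, if_pos rfl]; have := h.2; omega
    · rw [if_neg hj]; split_ifs <;> omega
  · have := h.1 (hi i); rw [add_root_hi]; omega
  · have := h.1 j; rw [Pi.add_apply, e] at this
    by_cases hj : j = hi i
    · subst hj; have := h.2; rw [add_root_hi] at this; omega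
    · rw [if_neg hj] at this; split_ifs at this <;> omega
  · have := h.1 (lo i); rw [add_root_lo] at this; omega

lemma cutSet_splitSeq (i : Fin (n - 1)) (k : Fin n → ℤ) :
    cutSet (splitSeq i k) = insert (cut k (i.val + 1) - 1) (cutSet k) := by
  have hi := i.isLt
  ext d
  constructor
  · rintro ⟨j, hj, rfl⟩
    rw [cut_splitSeq]
    by_cases h : j = i.val + 1
    · subst h
      rw [if_pos le_rfl, if_pos rfl]
      exact Set.mem_insert _ _
    · rw [if_neg h, sub_zero]
      refine Set.mem_insert_of_mem _ (cut_mem_cutSet ?_)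
      split_ifs <;> omega
  · rintro (rfl | ⟨j, hj, rfl⟩)
    · refine ⟨i.val + 1, by omega, ?_⟩
      rw [cut_splitSeq, if_pos le_rfl, if_pos rfl]
    · obtain ⟨j', hj', e⟩ := exists_cut_left k i j hj
      exact ⟨j', hj', e.symm⟩

lemma cutSet_splitSeq' (i : Fin (n - 1)) (k : Fin n → ℤ) :
    cutSet (splitSeq i k) = insert (cut k (i.val + 1)) (cutSet (k + root i)) := by
  have hi := i.isLt
  rw [cutSet_splitSeq]
  ext d
  constructor
  · rintro (rfl | ⟨j, hj, rfl⟩)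
    · refine Set.mem_insert_of_mem _ ⟨i.val + 1, by omega, ?_⟩
      rw [cut_add_root, if_pos rfl]
    · by_cases h : j = i.val + 1
      · subst h; exact Set.mem_insert _ _
      · refine Set.mem_insert_of_mem _ ⟨j, hj, ?_⟩
        rw [cut_add_root, if_neg h, sub_zero]
  · rintro (rfl | ⟨j, hj, rfl⟩)
    · exact Set.mem_insert_of_mem _ (cut_mem_cutSet (by omega))
    · rw [cut_add_root]
      by_cases h : j = i.val + 1
      · subst h; rw [if_pos rfl]; exact Set.mem_insert _ _
      · rw [if_neg h, sub_zero]; exact Set.mem_insert_of_mem _ (cut_mem_cutSet hj)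

lemma cut_add_root_last (k : Fin n → ℤ) (i : Fin (n - 1)) : cut (k + root i) n = cut k n := by
  have := i.isLt
  rw [cut_add_root, if_neg (by omega), sub_zero]

lemma node_mem (i : Fin (n - 1)) (k : Fin n → ℤ) : cut k (i.val + 1) - 1 ∈ cutSet (splitSeq i k) ∧
      cut k (i.val + 1) - 1 + 1 ∈ cutSet (splitSeq i k) := by
  have := i.isLt
  rw [cutSet_splitSeq, sub_add_cancel]
  exact ⟨Set.mem_insert _ _, Set.mem_insert_of_mem _ (cut_mem_cutSet (by omega))⟩

variable (K) in
/-- The coordinate of the point that the correspondence moves from one divisor to the next. -/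
abbrev nodeVar (i : Fin (n - 1)) (k : Fin n → ℤ) : symAlg K (splitSeq i k) :=
  symVar K (splitSeq i k) (cut k (i.val + 1) - 1)

lemma isIncl_projLeft (i : Fin (n - 1)) (k : Fin n → ℤ) : IsIncl (projLeft (𝕜 := K) i k) :=
  isIncl_symIncl _ _ _

lemma isIncl_projRight (i : Fin (n - 1)) {k k' : Fin n → ℤ} (h : k' = k + root i) :
    IsIncl (projRight (𝕜 := K) i h) := isIncl_symIncl _ _ _

lemma isPow_projLeft (i : Fin (n - 1)) (k : Fin n → ℤ) :
    IsPow (projLeft i k) (nodeVar K i k) (k (lo i)).toNat := by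
  have hs := cut_succ k (lo i)
  refine (isIncl_projLeft i k).isPow (cut_splitSeq_last k i).symm (lo i)
    (fun h h' => splitSeq_nonneg_iff.2 ⟨h, h'⟩) (fun h => ?_) (cutSet_splitSeq i k) (Or.inl rfl)
    (node_mem i k).1 (node_mem i k).2
  have h := (splitSeq_nonneg_iff.1 h).2
  simp only [lo] at hs h ⊢
  omega

lemma isPow_projRight (i : Fin (n - 1)) {k k' : Fin n → ℤ} (h : k' = k + root i) :
    IsPow (projRight i h) (nodeVar K i k) (k' (hi i)).toNat := by
  subst h
  have hs := cut_succ (k + root i) (hi i)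
  refine (isIncl_projRight i rfl).isPow ((cut_add_root_last k i).trans (cut_splitSeq_last k i).symm)
    (hi i) (fun h h' => add_root_nonneg_iff.2 ⟨h, h'⟩) (fun h => ?_) (cutSet_splitSeq' i k)
    (Or.inr (sub_add_cancel _ _).symm) (node_mem i k).1 (node_mem i k).2
  have h := (add_root_nonneg_iff.1 h).2
  have e := cut_add_root k i (i.val + 1)
  rw [if_pos rfl] at e
  simp only [hi] at hs h ⊢
  omega

/-! ### Finiteness of rings of symmetric functions -/

open MvPolynomial

section Finite

variable {m : ℕ} (c : Fin m → ℤ)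

lemma weight_varDeg (d : ℕ →₀ ℕ) : Finsupp.weight varDeg d = 2 * (d.degree : ℤ) := by
  rw [Finsupp.weight_apply, Finsupp.degree_apply, Finsupp.sum, Nat.cast_sum, mul_sum]
  exact sum_congr rfl fun x _ => by rw [nsmul_eq_mul, mul_comm]

lemma symGr_neg {q : ℤ} (hq : q < 0) : (symAlg K c).gr q = ⊥ := by
  refine (Submodule.eq_bot_iff _).2 fun f hf => ext_symEv fun h => ?_
  rw [map_zero]
  refine MvPolynomial.ext _ _ fun d => ?_
  by_contra hd
  have := (mem_symGr_iff h).1 hf hd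
  rw [weight_varDeg] at this
  omega

/-- The functions of degree `0` are the constants. -/
lemma symGr_zero {f : symAlg K c} (hf : f ∈ (symAlg K c).gr 0) :
    ∃ a : K, f = algebraMap K _ a := by
  by_cases h : ∀ i, 0 ≤ c i
  · refine ⟨(symEv h f).coeff 0, ext_symEv fun _ => ?_⟩
    rw [AlgHom.commutes]
    refine MvPolynomial.ext _ _ fun d => ?_
    rw [algebraMap_eq, coeff_C]
    split_ifs with hd
    · rw [hd]
    · by_contra hne
      have := (mem_symGr_iff h).1 hf hne
      rw [weight_varDeg] at this
      exact hd ((Finsupp.degree_eq_zero_iff d).1 (by omega)).symm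
  · exact ⟨0, (symAlg_subsingleton h).elim _ _⟩

/-- An element of degree `q` is determined by its coefficients at finitely many monomials. -/
lemma symAlg_locallyFinite : (symAlg K c).LocallyFinite := by
  refine ⟨fun q hq => symGr_neg c hq, fun q => ?_⟩
  by_cases h : ∀ i, 0 ≤ c i
  swap
  · have := symAlg_subsingleton (K := K) h
    exact Module.Finite.of_injective (0 : (symAlg K c).gr q →ₗ[K] K) fun _ _ _ =>
      Subtype.ext (Subsingleton.elim _ _)
  let T : Finset (ℕ →₀ ℕ) :=
    (Finset.range (cut c m).toNat).finsupp fun _ => Finset.range (q.toNat + 1)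
  let Φ : (symAlg K c).gr q →ₗ[K] (T → K) := LinearMap.pi fun d =>
    lcoeff K d.1 ∘ₗ (symEv h).toLinearMap ∘ₗ ((symAlg K c).gr q).subtype
  refine Module.Finite.of_injective Φ ((injective_iff_map_eq_zero Φ).2 fun f hf => ?_)
  refine Subtype.ext (symEv_injective h ?_)
  rw [Submodule.coe_zero, map_zero]
  refine MvPolynomial.ext _ _ fun d => ?_
  by_contra hd
  have hw := (mem_symGr_iff h).1 f.2 hd
  rw [weight_varDeg] at hw
  refine hd (congrFun hf ⟨d, Finset.mem_finsupp_iff.2 ⟨fun x hx => ?_, fun x _ => ?_⟩⟩)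
  · have : (x : ℤ) < cut c m := mem_supported.1 (symEv_mem h f.1).1
      (mem_vars x |>.2 ⟨d, mem_support_iff.2 hd, hx⟩)
    rw [mem_range]
    omega
  · have := Finsupp.le_degree x d
    rw [mem_range]
    omega

end Finite

end Corr

section Noetherian

open MvPolynomial

variable {m : ℕ} (c : Fin m → ℤ)

/-- Every variable is integral over the symmetric functions. -/
lemma exists_monic_symEv (h : ∀ i, 0 ≤ c i) (x : ℕ) (hx : (x : ℤ) < cut c m) :
    ∃ P : Polynomial (symAlg K c), P.Monic ∧ P.eval₂ (symEv (K := K) h).toRingHom (X x) = 0 := by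
  set N := (cut c m).toNat with hN
  let Q : Polynomial (MvPolynomial ℕ K) := ∏ y ∈ Finset.range N, (Polynomial.X - Polynomial.C (X y))
  have hQ : Q.Monic := Polynomial.monic_prod_of_monic _ _ fun y _ => Polynomial.monic_X_sub_C _
  have hsupp : Q ∈ Polynomial.lifts (supported K {y : ℕ | (y : ℤ) < cut c m}).val.toRingHom := by
    refine Subsemiring.prod_mem _ fun y hy => ?_
    have hy' : (y : ℤ) < cut c m := by rw [mem_range] at hy; omega
    refine (Polynomial.lifts_iff_coeff_lifts _).2 fun k => ?_
    have hv : (X y : MvPolynomial ℕ K) ∈ supported K {y : ℕ | (y : ℤ) < cut c m} :=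
      Algebra.subset_adjoin (Set.mem_image_of_mem _ hy')
    refine ⟨((Polynomial.X - Polynomial.C ⟨X y, hv⟩ :
      Polynomial (supported K {y : ℕ | (y : ℤ) < cut c m})).coeff k), ?_⟩
    rw [← Polynomial.coeff_map]
    simp
  have hinv (σ) (hσ : PreservesBlocks c σ) :
      Q.map (rename σ : MvPolynomial ℕ K →ₐ[K] _).toRingHom = Q := by
    rw [Polynomial.map_prod]
    refine Finset.prod_equiv σ (fun y => ?_) fun y _ => ?_
    · have := hσ m le_rfl y
      rw [mem_range, mem_range]
      omega
    · rw [Polynomial.map_sub, Polynomial.map_X, Polynomial.map_C]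
      congr 2
      exact rename_X _ _
  have hl : Q ∈ Polynomial.lifts (symEv (K := K) h).toRingHom := by
    refine (Polynomial.lifts_iff_coeff_lifts _).2 fun k => ?_
    obtain ⟨⟨p, hp⟩, hpQ⟩ := (Polynomial.lifts_iff_coeff_lifts _).1 hsupp k
    have hpQ : p = Q.coeff k := hpQ
    refine (exists_symEv h (p := Q.coeff k) ⟨hpQ ▸ hp, fun σ hσ => ?_⟩).imp fun _ h => h
    have := congrArg (Polynomial.coeff · k) (hinv σ hσ)
    rw [Polynomial.coeff_map] at this
    exact this
  obtain ⟨P, hP, -, hPm⟩ := Polynomial.lifts_and_degree_eq_and_monic hl hQ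
  refine ⟨P, hPm, ?_⟩
  rw [Polynomial.eval₂_eq_eval_map, hP, Polynomial.eval_prod]
  refine Finset.prod_eq_zero (i := x) (by rw [mem_range]; omega) ?_
  rw [Polynomial.eval_sub, Polynomial.eval_X, Polynomial.eval_C, sub_self]

/-- The ring of symmetric functions is finitely generated, by the theorem of Artin and Tate. -/
lemma symAlg_finiteType : Algebra.FiniteType K (symAlg K c) := by
  by_cases h : ∀ i, 0 ≤ c i
  swap
  · have := symAlg_subsingleton (K := K) h
    exact ⟨⟨∅, Subsingleton.elim _ _⟩⟩
  let N := (cut c m).toNat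
  let θ : MvPolynomial ℕ K →ₐ[K] MvPolynomial (Fin N) K :=
    aeval fun x => if hx : x < N then X ⟨x, hx⟩ else 0
  let ψ : symAlg K c →ₐ[K] MvPolynomial (Fin N) K := θ.comp (symEv h)
  have hψ : Injective ψ := by
    refine Injective.of_comp (f := rename Fin.val) fun a b hab => symEv_injective h ?_
    have e (p : MvPolynomial ℕ K) : rename Fin.val (θ p) = truncVars K (cut c m) p := by
      rw [truncVars, ← AlgHom.comp_apply, comp_aeval]
      congr 2
      funext x
      by_cases hx : x < N
      · rw [dif_pos hx, if_pos (by omega), rename_X]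
      · rw [dif_neg hx, if_neg (by omega), map_zero]
    have := (e (symEv h a)).symm.trans (hab.trans (e (symEv h b)))
    rwa [truncVars_of_mem (symEv_mem h a).1, truncVars_of_mem (symEv_mem h b).1] at this
  let : Algebra (symAlg K c) (MvPolynomial (Fin N) K) := ψ.toRingHom.toAlgebra
  have : IsScalarTower K (symAlg K c) (MvPolynomial (Fin N) K) :=
    IsScalarTower.of_algebraMap_eq fun a => (ψ.commutes a).symm
  have hint : Algebra.IsIntegral (symAlg K c) (MvPolynomial (Fin N) K) := by
    refine ⟨fun p => ?_⟩
    induction p using MvPolynomial.induction_on with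
    | C a =>
      have := isIntegral_algebraMap (R := (symAlg K c)) (A := MvPolynomial (Fin N) K)
        (x := algebraMap K _ a)
      rwa [← IsScalarTower.algebraMap_apply] at this
    | add p q hp hq => exact hp.add hq
    | mul_X p x hp =>
      refine hp.mul ?_
      obtain ⟨P, hP, hPx⟩ := exists_monic_symEv (K := K) c h x.val (by have := x.isLt; omega)
      refine ⟨P, hP, ?_⟩
      have := congrArg θ.toRingHom hPx
      rw [map_zero, Polynomial.hom_eval₂] at this
      have e : θ.toRingHom (X x.val) = X x := by
        refine (aeval_X _ _).trans ?_
        rw [dif_pos x.isLt]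
      rw [e] at this
      exact this
  have : Algebra.FiniteType (symAlg K c) (MvPolynomial (Fin N) K) :=
    Algebra.FiniteType.of_restrictScalars_finiteType K _ _
  have hfin : Module.Finite (symAlg K c) (MvPolynomial (Fin N) K) := Algebra.IsIntegral.finite
  exact ⟨fg_of_fg_of_fg K (symAlg K c) (MvPolynomial (Fin N) K)
    Algebra.FiniteType.out hfin.fg_top hψ⟩

instance {m' : ℕ} (c' : Fin m' → ℤ) : IsNoetherianRing ((symAlg K c) ⊗[K] (symAlg K c')) := by
  have := symAlg_finiteType (K := K) c
  have := symAlg_finiteType (K := K) c'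
  have : Algebra.FiniteType K ((symAlg K c) ⊗[K] (symAlg K c')) :=
    Algebra.FiniteType.trans (S := (symAlg K c)) inferInstance inferInstance
  exact Algebra.FiniteType.isNoetherianRing K _

end Noetherian

/-! ### Flatness, adjunctions and coherence -/

section Fields

variable {n : ℕ}

open Bicategory Limits

lemma kernelsFlat (K : Type u) [Field K] (n : ℕ) : KernelsFlat K n where
  E_left i _ _ h := ((isPow_projLeft i _).isKFlatLeft _).shift _
  E_right i _ _ h := ((isPow_projRight i h).isKFlatRight _).shift _
  F_left i _ _ h := ((isPow_projRight i h).isKFlatLeft _).shift _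
  F_right i _ _ h := ((isPow_projLeft i _).isKFlatRight _).shift _

variable (hf : KernelsFlat K n)

/-- The kernel of `E_i`. -/
abbrev KernelsFlat.E (i : Fin (n - 1)) {k k' : Fin n → ℤ} (h : k' = k + root i) :
    Ker (symAlg K k) (symAlg K k') := ⟨kerE i h, hf.E_left i h, hf.E_right i h⟩

/-- The kernel of `F_i`. -/
abbrev KernelsFlat.F (i : Fin (n - 1)) {k k' : Fin n → ℤ} (h : k' = k + root i) :
    Ker (symAlg K k') (symAlg K k) := ⟨kerF i h, hf.F_left i h, hf.F_right i h⟩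

lemma Cplx.eq_sc_of_shift {Z : GrAlg K} (f : A.GrHom Z) (g : C.GrHom Z) {s t e : ℤ} (he : t + s = e) :
    (sc f g s).shift t = sc f g e := by rw [shift_shift, he]

lemma right_adjoint (i : Fin (n - 1)) {k k' : Fin n → ℤ} (h : k' = k + root i) :
    Nonempty (Adjunction ((knData hf).E i h) (sh K (k ⬝ᵥ root i + 1) ((knData hf).F i h))) := by
  refine (isPow_projRight (K := K) i h).nonempty_adjunction (F := symAlg K) (s := k (lo i) - 1)
    (t := k ⬝ᵥ root i + 1 + k (hi i)) ?_ (hf.E i h) ((Ker.shift (k ⬝ᵥ root i + 1)).obj (hf.F i h)) rfl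
    (eq_sc_of_shift _ _ rfl)
  by_cases hv : ∀ j, 0 ≤ splitSeq i k j
  · have h₁ := (add_root_nonneg_iff.1 hv).2
    have h₂ := add_root_hi k i
    rw [dot_root]
    subst h
    omega
  · exact Or.inl (symAlg_subsingleton hv)

lemma left_adjoint (i : Fin (n - 1)) {k k' : Fin n → ℤ} (h : k' = k + root i) :
    Nonempty (Adjunction (sh K (-(k ⬝ᵥ root i) - 1) ((knData hf).F i h)) ((knData hf).E i h)) := by
  refine (isPow_projLeft (K := K) i k).nonempty_adjunction (F := symAlg K)
    (s := -(k ⬝ᵥ root i) - 1 + k (hi i)) (t := k (lo i) - 1) ?_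
    ((Ker.shift (-(k ⬝ᵥ root i) - 1)).obj (hf.F i h)) (hf.E i h) (eq_sc_of_shift _ _ rfl) rfl
  by_cases hv : ∀ j, 0 ≤ splitSeq i k j
  · have h₁ := (splitSeq_nonneg_iff.1 hv).2
    rw [dot_root]
    omega
  · exact Or.inl (symAlg_subsingleton hv)

lemma end_neg (k : Fin n → ℤ) (l : ℤ) (hl : l < 0)
    (f : 𝟙 ((knData hf).obj k) ⟶ sh K l (𝟙 ((knData hf).obj k))) : f = 0 := by
  obtain ⟨⟨a, ha⟩, rfl⟩ := DKer.exists_unitMul (symAlg K k) l f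
  have ha' := ha
  rw [symGr_neg k hl] at ha'
  obtain rfl : a = 0 := (Submodule.mem_bot K).1 ha'
  have : unitMul (symAlg K k) l ⟨0, ha⟩ = 0 := map_zero (unitMul (symAlg K k) l)
  rw [this]
  exact DKer.ofHom_zero (M := Ker.unit (symAlg K k)) (N := (Ker.shift l).obj (Ker.unit (symAlg K k)))

lemma DKer.exists_smul_id {A : GrAlg K} (hA : ∀ a ∈ A.gr 0, ∃ b : K, a = algebraMap K _ b)
    (w : DKer.of (Ker.unit A) ⟶ DKer.of (Ker.unit A)) : ∃ b : K, b • 𝟙 _ = w := by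
  let e : DKer.of ((Ker.shift 0).obj (Ker.unit A)) ≅ DKer.of (Ker.unit A) :=
    DKer.ofIso (Ker.shiftZero.app (Ker.unit A))
  obtain ⟨⟨a, ha⟩, hw⟩ := DKer.exists_unitMul A 0 (w ≫ e.inv)
  obtain ⟨b, rfl⟩ := hA a ha
  refine ⟨b, ?_⟩
  rw [← cancel_mono e.inv, hw, Linear.smul_comp, Category.id_comp]
  refine ((Ker.qis A A).Q.map_smul b _).symm.trans
    (congrArg DKer.ofHom (Subtype.ext (LinearMap.ext fun x => ?_)))
  exact Algebra.smul_def b (show A from x)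

lemma end_zero (k : Fin n → ℤ) (hk : ¬ IsZero (𝟙 ((knData hf).obj k))) :
    Module.finrank K (𝟙 ((knData hf).obj k) ⟶ 𝟙 ((knData hf).obj k)) = 1 :=
  finrank_eq_one (𝟙 (DKer.of (Ker.unit (symAlg K k)))) (fun h => hk ((IsZero.iff_id_eq_zero _).2 h))
    fun w => DKer.exists_smul_id (fun _ => symGr_zero k) w

lemma Cplx.IsCoherent.shift {M : Cplx A C} (hM : IsCoherent M) (s : ℤ) : IsCoherent (M.shift s) := hM

lemma Cplx.IsCoherent.sc_tensor {Z : GrAlg K} {f : A.GrHom Z} {g : C.GrHom Z} {x x' : Z}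
    {r r' : ℕ} (h : IsPow f x r) (h' : IsPow g x' r') (s : ℤ) {N : Cplx C D} (hN : IsCoherent N) :
    IsCoherent (tensor (sc f g s) N) :=
  ((IsCoherent.corr_tensor h h' hN).shift s).of_qis' (isQis_of_bijective (exL s (corr f g) N)
    (exL_bijective s (corr f g) N))

lemma Cplx.IsCoherent.tensor_sc {Z : GrAlg K} {f : A.GrHom Z} {g : C.GrHom Z} {x x' : Z}
    {r r' : ℕ} (h : IsPow f x r) (h' : IsPow g x' r') (s : ℤ) {N : Cplx D A} (hN : IsCoherent N) :
    IsCoherent (tensor N (sc f g s)) :=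
  ((IsCoherent.tensor_corr h h' hN).shift s).of_qis' (isQis_of_bijective (exR s N (corr f g))
    (exR_bijective s N (corr f g)))

lemma Cplx.isCoherent_unit (A : GrAlg K) : IsCoherent (unit A) := by
  classical
  refine ⟨{(1 : A)}, fun z _ => rfl, fun z _ => mem_sup_left
    (subset_span ⟨z, 1, _, Finset.mem_singleton_self _, ?_⟩)⟩
  exact (show (show A from z) = (show A from z) * (1 * 1) by rw [mul_one, mul_one])

lemma isActionStable : IsActionStable (knData hf) (knCoherent hf) where
  id k := isCoherent_unit _
  iso {k k' f g} e h := DKer.isCoherent_of_iso (M := locObj f) (N := locObj g) e h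
  shift s _ _ _ h := h
  comp_E i _ k _ h _ hM := IsCoherent.tensor_sc (isPow_projLeft i k) (isPow_projRight i h) _ hM
  comp_F i _ k _ h _ hM := IsCoherent.tensor_sc (isPow_projRight i h) (isPow_projLeft i k) _ hM
  E_comp i _ k _ h _ hM := IsCoherent.sc_tensor (isPow_projLeft i k) (isPow_projRight i h) _ hM
  F_comp i _ k _ h _ hM := IsCoherent.sc_tensor (isPow_projRight i h) (isPow_projLeft i k) _ hM

lemma DKer.acyclic_of_isZero {M : Ker A C} (h : IsZero (DKer.of M)) : Acyclic M.cplx := fun m hm => by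
  have : IsIso (DKer.ofHom (0 : M ⟶ M)) := ⟨0, h.eq_of_src _ _, h.eq_of_src _ _⟩
  exact (DKer.isQis_of_isIso (0 : M ⟶ M)).1 m hm ⟨0, (map_zero _).symm⟩

lemma isZero_unit_iff {k : Fin n → ℤ} : IsZero (𝟙 ((knData hf).obj k)) ↔ ¬ ∀ i, 0 ≤ k i := by
  constructor
  · intro h hk
    obtain ⟨x, hx⟩ := DKer.acyclic_of_isZero (M := Ker.unit (symAlg K k)) h (1 : symAlg K k) rfl
    have h₁ : (1 : symAlg K k) = 0 := hx
    have := congrArg (symEv hk) h₁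
    rw [map_one, map_zero] at this
    exact one_ne_zero this
  · intro h
    have := symAlg_subsingleton (K := K) h
    exact DKer.isZero_of (M := Ker.unit (symAlg K k)) fun m _ => ⟨m, Subsingleton.elim (α := (symAlg K k)) _ _⟩

lemma vanish (k α : Fin n → ℤ) (hα : (∃ i, α = root i) ∨
    ∃ i j : Fin (n - 1), |(i.val : ℤ) - j.val| = 1 ∧ α = root i + root j) :
    ∃ r₀ : ℤ, ∀ r : ℤ, r₀ ≤ |r| → IsZero (𝟙 ((knData hf).obj (k + r • α))) := by
  -- `α` has an entry `-1` and an entry `1`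
  obtain ⟨x, y, hx, hy⟩ : ∃ x y, α x = -1 ∧ α y = 1 := by
    rcases hα with ⟨i, rfl⟩ | ⟨i, j, hij, rfl⟩
    · exact ⟨lo i, hi i, by simp [root_apply, lo_ne_hi i], by simp [root_apply, (lo_ne_hi i).symm]⟩
    · have hi' := i.isLt
      have hj' := j.isLt
      rcases abs_eq (by norm_num) |>.1 hij with h | h
      · refine ⟨lo j, hi i, ?_, ?_⟩ <;> rw [Pi.add_apply, root_apply, root_apply] <;>
          simp only [lo, hi, Fin.mk.injEq] <;> split_ifs <;> omega
      · refine ⟨lo i, hi j, ?_, ?_⟩ <;> rw [Pi.add_apply, root_apply, root_apply] <;>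
          simp only [lo, hi, Fin.mk.injEq] <;> split_ifs <;> omega
  refine ⟨|k x| + |k y| + 1, fun r hr => (isZero_unit_iff hf).2 fun h => ?_⟩
  have h₁ := h x
  have h₂ := h y
  simp only [Pi.add_apply, Pi.smul_apply, hx, hy, smul_eq_mul] at h₁ h₂
  have := le_abs_self (k x)
  have := le_abs_self (k y)
  have := abs_nonneg (k x)
  have := abs_nonneg (k y)
  rcases abs_cases r with h | h <;> omega

lemma nonzero {i j : Fin (n - 1)} (hij : i ≠ j) (k : Fin n → ℤ)
    (h₁ : ¬ IsZero (𝟙 ((knData hf).obj (k + root i))))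
    (h₂ : ¬ IsZero (𝟙 ((knData hf).obj (k + root j)))) :
    ¬ IsZero (𝟙 ((knData hf).obj k)) ∧ ¬ IsZero (𝟙 ((knData hf).obj (k + root i + root j))) := by
  simp only [isZero_unit_iff, not_not] at *
  have hv : i.val ≠ j.val := fun h => hij (Fin.ext h)
  refine ⟨fun x => ?_, fun x => ?_⟩ <;> have e₁ := h₁ x <;> have e₂ := h₂ x <;>
    simp only [Pi.add_apply, root_apply, lo, hi, Fin.ext_iff] at e₁ e₂ ⊢ <;>
    split_ifs at e₁ e₂ ⊢ <;> omega

end Fields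

/-! ### The relation between `E_i` and `F_i` -/

section Square

open MvPolynomial Equiv

/-- The composition of homomorphisms of graded algebras. -/
def GrAlg.GrHom.comp (g : B.GrHom C) (f : A.GrHom B) : A.GrHom C :=
  ⟨g.hom.comp f.hom, fun h => g.hom_mem (f.hom_mem h)⟩

lemma swap_mem_symPoly {m : ℕ} {c : Fin m → ℤ} (h : ∀ i, 0 ≤ c i) {ξ : ℤ} (h₀ : ξ ∈ cutSet c)
    (h₁ : ξ + 1 ∈ cutSet c) (h₂ : ξ + 2 ∈ cutSet c) {p : MvPolynomial ℕ K} (hp : p ∈ symPoly K c) :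
    rename (swap ξ.toNat (ξ + 1).toNat) p ∈ symPoly K c := by
  classical
  have b₀ := bounds_of_mem_cutSet h h₀
  have b₂ := bounds_of_mem_cutSet h h₂
  refine ⟨mem_supported.2 fun x hx => ?_, fun σ hσ => ?_⟩
  · obtain ⟨y, hy, rfl⟩ := mem_image.1 (vars_rename _ p hx)
    have hy' : (y : ℤ) < cut c m := mem_supported.1 hp.1 hy
    change ((swap _ _ y : ℕ) : ℤ) < cut c m
    rw [swap_apply_def]
    split_ifs <;> omega
  · have hσ' := preservesBlocks_iff.1 hσ
    have f₁ := hσ' _ h₀ ξ.toNat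
    have f₂ := hσ' _ h₁ ξ.toNat
    have f₃ := hσ' _ h₁ (ξ + 1).toNat
    have f₄ := hσ' _ h₂ (ξ + 1).toNat
    have e := Equiv.mul_swap_eq_swap_mul σ ξ.toNat (ξ + 1).toNat
    rw [show σ ξ.toNat = ξ.toNat by omega, show σ (ξ + 1).toNat = (ξ + 1).toNat by omega] at e
    rw [← PermInv.rename_mul, e, PermInv.rename_mul, hp.2 σ hσ]

/-- A symmetric function is invariant under the transposition of two variables of the same block. -/
lemma rename_swap_symEv {m : ℕ} {c : Fin m → ℤ} (h : ∀ i, 0 ≤ c i) (l : Fin m) {ξ : ℤ}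
    (h₁ : cut c l.val ≤ ξ) (h₂ : ξ + 1 < cut c (l.val + 1)) (a : symAlg K c) :
    rename (swap ξ.toNat (ξ + 1).toNat) (symEv h a) = symEv h a := by
  have b₀ := (bounds_of_mem_cutSet h (cut_mem_cutSet l.isLt.le)).1
  refine (symEv_mem h a).2 _ ((full_blockGroup h l).swap_mem _ ?_ _ ?_) <;>
    rw [block, mem_Ico] <;> omega

/-- The intersection of the correspondences `E_i F_i` and `F_i E_i`, where both points are given. -/
lemma exists_square {n : ℕ} (i : Fin (n - 1)) {k₁ k k₂ : Fin n → ℤ} (h₁ : k = k₁ + root i)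
    (h₂ : k₂ = k + root i) : ∃ (W : GrAlg K) (u₁ v₁ : (symAlg K (splitSeq i k₁)).GrHom W)
      (u₂ v₂ : (symAlg K (splitSeq i k)).GrHom W) (p q : (symAlg K k).GrHom W),
      ((∀ c, u₁.hom ((projLeft i k₁).hom c) = v₁.hom ((projLeft i k₁).hom c)) ∧
        (∀ c, u₂.hom ((projRight i h₂).hom c) = v₂.hom ((projRight i h₂).hom c)) ∧
        (∀ a, p.hom a = u₁.hom ((projRight i h₁).hom a)) ∧
        (∀ a, q.hom a = v₁.hom ((projRight i h₁).hom a)) ∧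
        (∀ a, p.hom a = u₂.hom ((projLeft i k).hom a)) ∧
        (∀ a, q.hom a = v₂.hom ((projLeft i k).hom a))) ∧
      v₁.hom (nodeVar K i k₁) = u₂.hom (nodeVar K i k) ∧
      v₂.hom (nodeVar K i k) = u₁.hom (nodeVar K i k₁) ∧
      IsPow u₁ (v₁.hom (nodeVar K i k₁)) (k (lo i)).toNat ∧
      IsPow u₂ (v₂.hom (nodeVar K i k)) (k (hi i)).toNat ∧
      ∀ w, (u₁.hom (nodeVar K i k₁) - v₁.hom (nodeVar K i k₁)) * w = 0 → w = 0 := by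
  have hi' := i.isLt
  let s := splitSeq i k₁
  let i' : Fin (n + 1 - 1) := ⟨i.val, by omega⟩
  let l : Fin (n + 1) := ⟨i.val + 2, by omega⟩
  let w := splitSeq i' s
  -- in `w`, the two points are the variables `ξ` and `ξ + 1`
  set ξ := cut k (i.val + 1) - 1 with hξ
  have ek₁ : cut k₁ (i.val + 1) = ξ + 2 := by
    have := cut_add_root k₁ i (i.val + 1)
    rw [← h₁, if_pos rfl] at this
    omega
  have es : cut s (i'.val + 1) = ξ + 1 := by
    change cut (splitSeq i k₁) (i.val + 1) = _
    rw [cut_splitSeq, if_pos le_rfl, if_pos rfl, ek₁]; ring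
  have cs : cutSet s = insert (ξ + 2) (cutSet k) := by
    rw [cutSet_splitSeq', ek₁, ← h₁]
  have cw : cutSet w = insert ξ (cutSet s) := by
    rw [cutSet_splitSeq, es, add_sub_cancel_right]
  have cz : cutSet (splitSeq i k) = insert ξ (cutSet k) := cutSet_splitSeq i k
  have cw' : cutSet w = insert (ξ + 2) (cutSet (splitSeq i k)) := by
    rw [cw, cs, cz, Set.insert_comm]
  have hsl : s (lo i') = k (lo i) := by
    have h : cut s (i.val + 1) = cut s i.val + s (lo i') := cut_succ s (lo i')
    have h' : cut k₁ (i.val + 1) = cut k₁ i.val + k₁ (lo i) := cut_succ k₁ (lo i)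
    have h'' := add_root_lo k₁ i
    have e : cut s i.val = cut k₁ i.val := by
      rw [cut_splitSeq, if_pos (by omega), if_neg (by omega), sub_zero]
    rw [← h₁] at h''
    have e'' : cut s (i.val + 1) = ξ + 1 := es
    generalize s (lo i') = z at *
    omega
  have hzl : splitSeq i k l = k (hi i) := by
    have h := cut_succ (splitSeq i k) l
    have h' : cut k (i.val + 1 + 1) = cut k (i.val + 1) + k (hi i) := cut_succ k (hi i)
    have e₁ : cut (splitSeq i k) l.val = cut k (i.val + 1) := by
      rw [cut_splitSeq, if_neg (by simp [l]), if_neg (by simp [l]), sub_zero]; rfl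
    have e₂ : cut (splitSeq i k) (l.val + 1) = cut k (i.val + 1 + 1) := by
      rw [cut_splitSeq, if_neg (by simp [l]), if_neg (by simp [l]), sub_zero]; rfl
    omega
  have vs : (∀ j, 0 ≤ s j) ↔ (∀ j, 0 ≤ k j) ∧ 0 < k (hi i) := by rw [add_root_nonneg_iff, ← h₁]
  have vw : (∀ j, 0 ≤ w j) ↔ ((∀ j, 0 ≤ k j) ∧ 0 < k (hi i)) ∧ 0 < k (lo i) := by
    rw [splitSeq_nonneg_iff, vs, hsl]
  have vz : (∀ j, 0 ≤ splitSeq i k j) ↔ (∀ j, 0 ≤ k j) ∧ 0 < k (lo i) := splitSeq_nonneg_iff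
  have last : cut (splitSeq i k) (n + 1) = cut w (n + 1 + 1) := by
    rw [cut_splitSeq_last, cut_splitSeq_last, cut_splitSeq_last, h₁, cut_add_root_last]
  have m₀ : ξ ∈ cutSet w := by rw [cw]; exact Set.mem_insert _ _
  have m₂ : ξ + 2 ∈ cutSet w := by rw [cw']; exact Set.mem_insert _ _
  have m₁' : ξ + 1 ∈ cutSet k := ⟨i.val + 1, by omega, by omega⟩
  have m₁ : ξ + 1 ∈ cutSet w := by
    rw [cw, cs]; exact Set.mem_insert_of_mem _ (Set.mem_insert_of_mem _ m₁')
  obtain ⟨u₂, hu₂⟩ := exists_isIncl K (c := splitSeq i k) (c' := w)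
    (fun h => vz.2 ⟨(vw.1 h).1.1, (vw.1 h).2⟩) last (cw' ▸ Set.subset_insert _ _)
  let u₁ : (symAlg K s).GrHom (symAlg K w) := projLeft i' s
  have hu₁ : IsIncl u₁ := isIncl_projLeft i' s
  have hπ (h : ∀ j, 0 ≤ w j) (p : MvPolynomial ℕ K) (hp : p ∈ symPoly K w) :
      rename (swap ξ.toNat (ξ + 1).toNat) p ∈ symPoly K w := swap_mem_symPoly h m₀ m₁ m₂ hp
  -- `v₁` and `v₂` are `u₁` and `u₂`, followed by the exchange of the two points
  let τ := symRename K w (swap ξ.toNat (ξ + 1).toNat) hπ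
  let p : (symAlg K k).GrHom (symAlg K w) := u₁.comp (projRight i h₁)
  have hp (a) : p.hom a = u₂.hom ((projLeft i k).hom a) :=
    (isIncl_projRight i h₁).hom_hom_eq hu₁ (isIncl_projLeft i k) hu₂ a
  have hx₁ : u₁.hom (nodeVar K i k₁) = symVar K w (ξ + 1) := by
    have e : cut k₁ (i.val + 1) - 1 = ξ + 1 := by omega
    have hn := node_mem i k₁
    rw [nodeVar, hu₁.hom_var (cw ▸ Set.subset_insert _ _) hn.1 hn.2, e]
  have hx₂ : u₂.hom (nodeVar K i k) = symVar K w ξ :=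
    hu₂.hom_var (cw' ▸ Set.subset_insert _ _) (node_mem i k).1 (node_mem i k).2
  have m₂' : ξ + 1 + 1 ∈ cutSet w := (show ξ + 2 = ξ + 1 + 1 by ring) ▸ m₂
  have hτ₁ : τ.hom (symVar K w (ξ + 1)) = symVar K w ξ := ext_symEv fun h => by
    rw [symEv_rename, symEv_var h m₁ m₂', symEv_var h m₀ m₁, rename_X, swap_apply_right]
  have hτ₀ : τ.hom (symVar K w ξ) = symVar K w (ξ + 1) := ext_symEv fun h => by
    rw [symEv_rename, symEv_var h m₁ m₂', symEv_var h m₀ m₁, rename_X, swap_apply_left]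
  have hvx₁ : (τ.comp u₁).hom (nodeVar K i k₁) = symVar K w ξ := (congrArg τ.hom hx₁).trans hτ₁
  have hvx₂ : (τ.comp u₂).hom (nodeVar K i k) = symVar K w (ξ + 1) := (congrArg τ.hom hx₂).trans hτ₀
  refine ⟨symAlg K w, u₁, τ.comp u₁, u₂, τ.comp u₂, p, τ.comp p, ⟨fun c => ext_symEv fun h => ?_,
    fun c => ext_symEv fun h => ?_, fun a => rfl, fun a => rfl, hp, fun a => congrArg τ.hom (hp a)⟩,
    hvx₁.trans hx₂.symm, hvx₂.trans hx₁.symm, ?_, ?_, fun y hy => ?_⟩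
  · refine Eq.trans ?_ (symEv_rename hπ h (u₁.hom ((projLeft i k₁).hom c))).symm
    have hk := vw.1 h
    have h' := cut_succ k₁ (lo i)
    have h'' := add_root_lo k₁ i
    rw [← h₁] at h''
    rw [hu₁.2, (isIncl_projLeft i k₁).2, rename_swap_symEv _ (lo i)]
    · simp only [lo] at hk h' h'' ⊢; omega
    · simp only [lo]; omega
  · refine Eq.trans ?_ (symEv_rename hπ h (u₂.hom ((projRight i h₂).hom c))).symm
    have hk := vw.1 h
    have h' := cut_succ k (hi i)
    have e₁ := cut_add_root k i (i.val + 1)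
    have e₂ := cut_add_root k i (i.val + 1 + 1)
    rw [if_pos rfl, ← h₂] at e₁
    rw [if_neg (by omega), ← h₂] at e₂
    rw [hu₂.2, (isIncl_projRight i h₂).2, rename_swap_symEv _ (hi i)]
    · simp only [hi]; omega
    · simp only [hi] at hk h' ⊢; omega
  · rw [hvx₁]
    have := isPow_projLeft (K := K) i' s
    rw [hsl, nodeVar, es, add_sub_cancel_right] at this
    exact this
  · rw [hvx₂, ← hzl]
    refine hu₂.isPow last l (fun h h' => vw.2 ?_) (fun h => ?_) cw' (Or.inr (by ring)) m₁ m₂'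
    · rw [hzl] at h'
      exact ⟨⟨(vz.1 h).1, h'⟩, (vz.1 h).2⟩
    · have h' := cut_succ (splitSeq i k) l
      have hk := (vw.1 h).1.2
      have e₁ : cut (splitSeq i k) l.val = cut k (i.val + 1) := by
        rw [cut_splitSeq, if_neg (by simp [l]), if_neg (by simp [l]), sub_zero]; rfl
      rw [hzl] at h'
      omega
  · have hy' : (symVar K w (ξ + 1) - symVar K w ξ) * y = 0 := by rw [← hy, hx₁, hvx₁]
    refine ext_symEv fun h => ?_
    have := congrArg (symEv h) hy'
    rw [map_mul, map_sub, symEv_var h m₁ m₂', symEv_var h m₀ m₁, map_zero] at this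
    rw [map_zero]
    refine (mul_eq_zero.1 this).resolve_left (sub_ne_zero.2 fun e => ?_)
    have := X_injective e
    have := (bounds_of_mem_cutSet h m₀).1
    omega

end Square

section EF

open Bicategory Limits

variable {n : ℕ}

lemma DKer.isZero_of_subsingleton [Subsingleton A] (M : Ker A C) : IsZero (DKer.of M) :=
  DKer.isZero_of fun m _ => by
    have h : M.cplx.l 1 m = M.cplx.l 0 m := by rw [Subsingleton.elim (1 : A) 0]
    rw [map_zero, map_one] at h
    exact ⟨0, (show m = 0 from h).trans (map_zero _).symm⟩

variable (hf : KernelsFlat K n) (i : Fin (n - 1)) {k₁ k k₂ : Fin n → ℤ} (h₁ : k = k₁ + root i)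
  (h₂ : k₂ = k + root i)

lemma isDirectSum_of_subsingleton [Subsingleton A] {J : Type} [Finite J] (f : J → DKer A C)
    (X : DKer A C) : IsDirectSum f X :=
  IsDirectSum.of_isZero (DKer.isZero_of_subsingleton (locObj X))
    fun j => DKer.isZero_of_subsingleton (locObj (f j))

instance (m : ℤ) : Finite (Option (Fin m.toNat)) := inferInstance

/-- The kernels `E F` and `F E` are the two sides of the square of `exists_square`. -/
lemma EF_FE : (0 ≤ k ⬝ᵥ root i →
    IsDirectSum (addQuantum K ((knData hf).E i h₂ ≫ (knData hf).F i h₂) (𝟙 ((knData hf).obj k))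
      (k ⬝ᵥ root i)) ((knData hf).F i h₁ ≫ (knData hf).E i h₁)) ∧
    (k ⬝ᵥ root i ≤ 0 →
    IsDirectSum (addQuantum K ((knData hf).F i h₁ ≫ (knData hf).E i h₁) (𝟙 ((knData hf).obj k))
      (-(k ⬝ᵥ root i))) ((knData hf).E i h₂ ≫ (knData hf).F i h₂)) := by
  by_cases hv : ∀ j, 0 ≤ k j
  swap
  · have := symAlg_subsingleton (K := K) hv
    exact ⟨fun _ => isDirectSum_of_subsingleton (A := symAlg K k) (C := symAlg K k) _ _,
      fun _ => isDirectSum_of_subsingleton (A := symAlg K k) (C := symAlg K k) _ _⟩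
  have hnt : Nontrivial (symAlg K k) := (symEv (K := K) hv).domain_nontrivial
  obtain ⟨W, u₁, v₁, u₂, v₂, p, q, ⟨hκ₁, hκ₂, hp₁, hq₁, hp₂, hq₂⟩, hx, hx', l₁, l₂, hδ⟩ :=
    exists_square (K := K) i h₁ h₂
  have d := dot_root k i
  have a₁ := add_root_lo k₁ i
  have a₂ := add_root_hi k₁ i
  have a₃ := add_root_hi k i
  rw [← h₁] at a₁ a₂
  rw [← h₂] at a₃
  have v₁' := hv (lo i)
  have v₂' := hv (hi i)
  refine ⟨fun hk => ?_, fun hk => ?_⟩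
  · have key := isDirectSum_of_square (e := k (lo i) + k (hi i) - 1) (s₁ := k₁ (hi i))
      (t₁ := k₁ (lo i) - 1) (s₂ := k (lo i) - 1) (t₂ := k (hi i)) hκ₁ hκ₂ hp₁ hq₁ hp₂ hq₂
      (by omega) (by omega) hx hx' (isPow_projRight i h₁) (isPow_projLeft i k)
      (by rw [show (k (lo i)).toNat + 1 = (k₁ (lo i)).toNat by omega]; exact isPow_projLeft i k₁)
      (by rw [show (k (hi i)).toNat + 1 = (k₂ (hi i)).toNat by omega]; exact isPow_projRight i h₂)
      l₁ l₂ hδ (M₁ := (hf.F i h₁).tensor (hf.E i h₁)) (M₂ := (hf.E i h₂).tensor (hf.F i h₂)) rfl rfl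
      (n := (k ⬝ᵥ root i).toNat) (by omega)
      (fun j => (Ker.shift (k ⬝ᵥ root i - 1 - 2 * (j : ℕ))).obj (Ker.unit (symAlg K k)))
      fun j => congrArg (sc _ _) (by omega)
    exact (congrArg (IsDirectSum · _) (funext fun j => by cases j <;> rfl)).mpr
      (DKer.isDirectSum key)
  · have key := isDirectSum_of_square (e := k (lo i) + k (hi i) - 1) (s₂ := k₁ (hi i))
      (t₂ := k₁ (lo i) - 1) (s₁ := k (lo i) - 1) (t₁ := k (hi i)) hκ₂ hκ₁ hp₂ hq₂ hp₁ hq₁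
      (by omega) (by omega) hx' hx (isPow_projLeft i k) (isPow_projRight i h₁)
      (by rw [show (k (hi i)).toNat + 1 = (k₂ (hi i)).toNat by omega]; exact isPow_projRight i h₂)
      (by rw [show (k (lo i)).toNat + 1 = (k₁ (lo i)).toNat by omega]; exact isPow_projLeft i k₁)
      l₂ l₁ (fun w hw => hδ w (by rw [← neg_sub, neg_mul, hx, ← hx', hw, neg_zero]))
      (M₁ := (hf.E i h₂).tensor (hf.F i h₂)) (M₂ := (hf.F i h₁).tensor (hf.E i h₁)) rfl rfl
      (n := (-(k ⬝ᵥ root i)).toNat) (by omega)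
      (fun j => (Ker.shift (-(k ⬝ᵥ root i) - 1 - 2 * (j : ℕ))).obj (Ker.unit (symAlg K k)))
      fun j => congrArg (sc _ _) (by omega)
    exact (congrArg (IsDirectSum · _) (funext fun j => by cases j <;> rfl)).mpr
      (DKer.isDirectSum key)

end EF

/-! ### The relation between `E_i` and `F_j` for `i ≠ j` -/

lemma DKer.nonempty_iso_of_bijective {M N : Ker A C} {X : Cplx A C} (F : M.cplx.homs X)
    (G : N.cplx.homs X) (hF : Bijective F.1) (hG : Bijective G.1) :
    Nonempty (DKer.of M ≅ DKer.of N) := by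
  obtain ⟨g, hg⟩ := exists_lift_of_injective G hG.1 F fun m => hG.2 _
  have hb : Bijective g.1 := by
    refine ⟨fun x y h => hF.1 ?_, fun y => ?_⟩
    · rw [← hg, ← hg, h]
    · obtain ⟨x, hx⟩ := hF.2 (G.1 y)
      exact ⟨x, hG.1 ((hg x).trans hx)⟩
  have := DKer.isIso_ofHom (f := (show M ⟶ N from g)) (isQis_of_bijective g hb)
  exact ⟨asIso (DKer.ofHom (show M ⟶ N from g))⟩

section Comm

variable {n : ℕ} (hf : KernelsFlat K n)

/-- Both composites are the structure sheaf of the correspondence in which one point moves from the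
factor `i` to `i + 1` and one from `j + 1` to `j`. -/
lemma EF_comm {i j : Fin (n - 1)} (hij : i ≠ j) {k k₁ k₂ k₃ : Fin n → ℤ} (h₁ : k₁ = k + root i)
    (h₂ : k₁ = k₃ + root j) (h₃ : k = k₂ + root j) (h₄ : k₃ = k₂ + root i) :
    Nonempty ((knData hf).E i h₁ ≫ (knData hf).F j h₂ ≅ (knData hf).F j h₃ ≫ (knData hf).E i h₄) := by
  have hi' := i.isLt
  have hj' := j.isLt
  have hv : i.val ≠ j.val := fun h => hij (Fin.ext h)
  let s := splitSeq j k₂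
  -- the positions of the factors `k_i` and `k_{j+1}` after the insertion of a factor
  let i' : Fin (n + 1 - 1) := ⟨if i.val < j.val then i.val else i.val + 1, by split_ifs <;> omega⟩
  let l : Fin (n + 1) := ⟨if j.val < i.val then j.val + 1 else j.val + 2, by split_ifs <;> omega⟩
  let w := splitSeq i' s
  set a := cut k₂ (i.val + 1) with ha
  set b := cut k₂ (j.val + 1) with hb
  have ek (x : ℕ) : cut k x = cut k₂ x - if x = j.val + 1 then 1 else 0 := by
    rw [h₃, cut_add_root]
  have ej : cut k (j.val + 1) = b - 1 := (ek _).trans (by rw [if_pos rfl])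
  have ek₁ (x : ℕ) : cut k₁ x = cut k x - if x = i.val + 1 then 1 else 0 := by
    rw [h₁, cut_add_root]
  have ek₃ (x : ℕ) : cut k₃ x = cut k₂ x - if x = i.val + 1 then 1 else 0 := by
    rw [h₄, cut_add_root]
  have es : cut s (i'.val + 1) = a := by
    rw [cut_splitSeq]
    simp only [i', ha]
    split_ifs <;> first | omega | (rw [sub_zero]; try rfl)
  have ez : cut k (i.val + 1) = a := by rw [ek, if_neg (by omega), sub_zero]
  have ez₃ : cut k₃ (j.val + 1) = b := by rw [ek₃, if_neg (by omega), sub_zero]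
  have cs : cutSet s = insert (b - 1) (cutSet k₂) := cutSet_splitSeq j k₂
  have cs' : cutSet s = insert b (cutSet k) := by rw [cutSet_splitSeq', ← h₃]
  have cw : cutSet w = insert (a - 1) (cutSet s) := by rw [cutSet_splitSeq, es]
  have c₁ : cutSet (splitSeq i k) = insert (a - 1) (cutSet k) := by rw [cutSet_splitSeq, ez]
  have cw' : cutSet w = insert b (cutSet (splitSeq i k)) := by rw [cw, cs', c₁, Set.insert_comm]
  have c₃ : cutSet (splitSeq j k₃) = insert (b - 1) (cutSet k₃) := by rw [cutSet_splitSeq, ez₃]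
  have c₄ : cutSet (splitSeq i k₂) = insert (a - 1) (cutSet k₂) := cutSet_splitSeq i k₂
  have c₄' : cutSet (splitSeq i k₂) = insert a (cutSet k₃) := by rw [cutSet_splitSeq', ← h₄]
  have i₄ : cutSet (splitSeq i k₂) ⊆ cutSet w := by
    rw [c₄, cw, cs]; exact Set.insert_subset_insert (Set.subset_insert _ _)
  have i₁ : cutSet (splitSeq i k) ⊆ cutSet w := by rw [cw']; exact Set.subset_insert _ _
  have is : cutSet s ⊆ cutSet w := by rw [cw]; exact Set.subset_insert _ _
  have mb : b - 1 ∈ cutSet w ∧ b - 1 + 1 ∈ cutSet w := ⟨is (node_mem j k₂).1, is (node_mem j k₂).2⟩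
  have i₃ : cutSet (splitSeq j k₃) ⊆ cutSet w := by
    rw [c₃]
    refine Set.insert_subset mb.1 (Set.Subset.trans ?_ i₄)
    rw [c₄']; exact Set.subset_insert _ _
  have hsl : s (lo i') = k₂ (lo i) := by
    have h : cut s (i'.val + 1) = cut s i'.val + s (lo i') := cut_succ s (lo i')
    have h' : cut k₂ (i.val + 1) = cut k₂ i.val + k₂ (lo i) := cut_succ k₂ (lo i)
    have e : cut s i'.val = cut k₂ i.val := by
      rw [cut_splitSeq]
      simp only [i']
      split_ifs <;> first | omega | (rw [sub_zero]; try rfl)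
    omega
  have el : cut (splitSeq i k) l.val = b - 1 ∧ cut (splitSeq i k) (l.val + 1) =
      cut k (j.val + 1 + 1) - if j.val + 1 + 1 = i.val + 1 then 1 else 0 := by
    rw [cut_splitSeq, cut_splitSeq, ← ej]
    by_cases hc : j.val < i.val
    · rw [show l.val = j.val + 1 from if_pos hc, if_pos (show j.val + 1 ≤ i.val + 1 by omega),
        if_neg (show ¬ j.val + 1 = i.val + 1 by omega), if_pos (show j.val + 1 + 1 ≤ i.val + 1 by omega)]
      exact ⟨sub_zero _, rfl⟩
    · rw [show l.val = j.val + 1 + 1 from if_neg hc,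
        if_neg (show ¬ j.val + 1 + 1 ≤ i.val + 1 by omega),
        if_neg (show ¬ j.val + 1 + 1 = i.val + 1 by omega),
        if_neg (show ¬ j.val + 1 + 1 + 1 ≤ i.val + 1 by omega),
        if_neg (show ¬ j.val + 1 + 1 + 1 = i.val + 1 by omega)]
      exact ⟨sub_zero _, rfl⟩
  have hzl : splitSeq i k l = k₁ (hi j) := by
    have h := cut_succ (splitSeq i k) l
    have h' : cut k₁ (j.val + 1 + 1) = cut k₁ (j.val + 1) + k₁ (hi j) := cut_succ k₁ (hi j)
    rw [ek₁, ek₁, if_neg (show ¬ j.val + 1 = i.val + 1 by omega)] at h'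
    omega
  have ne₁ : hi j ≠ hi i := fun h => hv (by have := congrArg Fin.val h; simp only [hi] at this; omega)
  have ne₂ : lo i ≠ lo j := fun h => hv (by have := congrArg Fin.val h; exact this)
  have r₁ : k (lo i) = k₂ (lo i) + if lo i = hi j then 1 else 0 := by
    rw [h₃, Pi.add_apply, root_apply, if_neg ne₂, sub_zero]
  have r₃ : k₃ (hi j) = k₂ (hi j) - if lo i = hi j then 1 else 0 := by
    rw [h₄, Pi.add_apply, root_apply, if_neg ne₁, zero_sub, sub_eq_add_neg]; simp only [eq_comm]
  have r₄ : k₃ (lo j) = k₂ (lo j) + if lo j = hi i then 1 else 0 := by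
    rw [h₄, Pi.add_apply, root_apply, if_neg ne₂.symm, sub_zero]
  have r₅ : k₁ (hi j) = k (hi j) - if lo i = hi j then 1 else 0 := by
    rw [h₁, Pi.add_apply, root_apply, if_neg ne₁, zero_sub, sub_eq_add_neg]; simp only [eq_comm]
  have vs : (∀ x, 0 ≤ s x) ↔ (∀ x, 0 ≤ k₂ x) ∧ 0 < k₂ (lo j) := splitSeq_nonneg_iff
  have vs' : (∀ x, 0 ≤ s x) ↔ (∀ x, 0 ≤ k x) ∧ 0 < k (hi j) := by rw [add_root_nonneg_iff, ← h₃]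
  have vw : (∀ x, 0 ≤ w x) ↔ (∀ x, 0 ≤ s x) ∧ 0 < k₂ (lo i) := by rw [splitSeq_nonneg_iff, hsl]
  have v₁ : (∀ x, 0 ≤ splitSeq i k x) ↔ (∀ x, 0 ≤ k x) ∧ 0 < k (lo i) := splitSeq_nonneg_iff
  have v₃ : (∀ x, 0 ≤ splitSeq j k₃ x) ↔ (∀ x, 0 ≤ k₃ x) ∧ 0 < k₃ (lo j) := splitSeq_nonneg_iff
  have v₄ : (∀ x, 0 ≤ splitSeq i k₂ x) ↔ (∀ x, 0 ≤ k₂ x) ∧ 0 < k₂ (lo i) := splitSeq_nonneg_iff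
  have v₄' : (∀ x, 0 ≤ splitSeq i k₂ x) → ∀ x, 0 ≤ k₃ x := fun h => h₄ ▸ (splitSeq_nonneg h).2
  have last : cut w (n + 1 + 1) = cut k₂ n := by rw [cut_splitSeq_last, cut_splitSeq_last]
  have last₁ : cut (splitSeq i k) (n + 1) = cut w (n + 1 + 1) := by
    rw [last, cut_splitSeq_last, h₃, cut_add_root_last]
  obtain ⟨j₁, hj₁⟩ := exists_isIncl K (c := splitSeq i k) (c' := w)
    (fun h => v₁.2 ⟨(vs'.1 (vw.1 h).1).1, by have := (vw.1 h).2; split_ifs at r₁ <;> omega⟩) last₁ i₁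
  obtain ⟨j₂, hj₂⟩ := exists_isIncl K (c := splitSeq j k₃) (c' := w) (fun h => by
      have h' := vs.1 (vw.1 h).1
      exact v₃.2 ⟨v₄' (v₄.2 ⟨h'.1, (vw.1 h).2⟩), by split_ifs at r₄ <;> omega⟩)
    (by rw [last, cut_splitSeq_last, h₄, cut_add_root_last]) i₃
  obtain ⟨j₄, hj₄⟩ := exists_isIncl K (c := splitSeq i k₂) (c' := w)
    (fun h => v₄.2 ⟨(vs.1 (vw.1 h).1).1, (vw.1 h).2⟩) (by rw [last, cut_splitSeq_last]) i₄
  let j₃ : (symAlg K s).GrHom (symAlg K w) := projLeft i' s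
  have hj₃ : IsIncl j₃ := isIncl_projLeft i' s
  -- `w` is free over both factors of either composite, so it is their fibre product
  have p₁ : IsPow j₁ (j₂.hom (nodeVar K j k₃)) (k₁ (hi j)).toNat := by
    have hn := node_mem j k₃
    rw [nodeVar, hj₂.hom_var i₃ hn.1 hn.2, ez₃, ← hzl]
    refine hj₁.isPow last₁ l (fun h hl => ?_) (fun h => ?_) cw' (Or.inr (by ring)) mb.1 mb.2
    · rw [hzl] at hl
      have h' := v₁.1 h
      refine vw.2 ⟨vs'.2 ⟨h'.1, by split_ifs at r₅ <;> omega⟩, ?_⟩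
      by_cases hc : lo i = hi j
      · rw [if_pos hc] at r₁ r₅
        rw [← hc] at r₅ hl
        omega
      · rw [if_neg hc] at r₁; have := h'.2; omega
    · have := cut_succ (splitSeq i k) l
      have h' := vw.1 h
      have h'' := (vs'.1 h'.1).2
      rw [hzl] at this
      refine ⟨el.1.le, ?_⟩
      by_cases hc : lo i = hi j
      · rw [if_pos hc] at r₁ r₅
        rw [← hc] at r₅ this
        omega
      · rw [if_neg hc] at r₅; omega
  have p₃ : IsPow j₃ (j₄.hom (nodeVar K i k₂)) (k₂ (lo i)).toNat := by
    have hn := node_mem i k₂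
    have := isPow_projLeft (K := K) i' s
    rw [hsl, nodeVar, es] at this
    rw [nodeVar, hj₄.hom_var i₄ hn.1 hn.2]
    exact this
  let p : (symAlg K k).GrHom (symAlg K w) := j₃.comp (projRight j h₃)
  let q : (symAlg K k₃).GrHom (symAlg K w) := j₄.comp (projRight i h₄)
  exact DKer.nonempty_iso_of_bijective (M := (hf.E i h₁).tensor (hf.F j h₂))
    (N := (hf.F j h₃).tensor (hf.E i h₄)) (X := sc p q (k (lo i) - 1 + k₃ (hi j)))
    (mulHom j₁ j₂ (fun c => (isIncl_projRight i h₁).hom_hom_eq hj₁ (isIncl_projRight j h₂) hj₂ c)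
      (fun c => (isIncl_projRight j h₃).hom_hom_eq hj₃ (isIncl_projLeft i k) hj₁ c)
      (fun c => (isIncl_projRight i h₄).hom_hom_eq hj₄ (isIncl_projLeft j k₃) hj₂ c) rfl)
    (mulHom j₃ j₄ (fun c => (isIncl_projLeft j k₂).hom_hom_eq hj₃ (isIncl_projLeft i k₂) hj₄ c)
      (fun _ => rfl) (fun _ => rfl) (by rw [r₁, r₃]; ring))
    (mulHom_bijective _ _ (isPow_projRight j h₂) p₁ _ _ _ _)
    (mulHom_bijective _ _ (isPow_projLeft i k₂) p₃ _ _ _ _)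

end Comm

/-! ### The divided power of `E_i` -/

section Retract

lemma Cplx.IsQis.of_retract {M N M' N' : Cplx A C} {f : M.homs N} (hf : IsQis f) (g : M'.homs N')
    {i : M'.homs M} {j : N'.homs N} {r : M.homs M'} {t : N.homs N'} (hi : ∀ x, f.1 (i.1 x) = j.1 (g.1 x))
    (hr : ∀ x, g.1 (r.1 x) = t.1 (f.1 x)) (h₁ : ∀ x, r.1 (i.1 x) = x) (h₂ : ∀ x, t.1 (j.1 x) = x) :
    IsQis g := by
  constructor
  · rintro m hm ⟨y, hy⟩
    obtain ⟨x, hx⟩ := hf.1 (i.1 m) (by rw [← i.2.2.2.2, hm, map_zero])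
      ⟨j.1 y, by rw [hi, hy, j.2.2.2.2]⟩
    exact ⟨r.1 x, by rw [← r.2.2.2.2, ← hx, h₁]⟩
  · intro y hy
    obtain ⟨m, x, hm, hx⟩ := hf.2 (j.1 y) (by rw [← j.2.2.2.2, hy, map_zero])
    exact ⟨r.1 m, t.1 x, by rw [← r.2.2.2.2, hm, map_zero],
      by rw [hr, ← t.2.2.2.2, ← map_add, ← hx, h₂]⟩

lemma Cplx.IsKFlatRight.of_retract {M N : Cplx A B} (hM : IsKFlatRight M) (i : N.homs M)
    (r : M.homs N) (h : ∀ x, r.1 (i.1 x) = x) : IsKFlatRight N := fun C P P' f hf => by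
  refine (hM C P P' f hf).of_retract _ (i := tmap i (idHom P)) (j := tmap i (idHom P'))
    (r := tmap r (idHom P)) (t := tmap r (idHom P')) ?_ ?_ ?_ ?_
  all_goals
    intro x
    induction x using tensor_induction with
    | h m n => simp only [tmap_tm, idHom_apply, h]
    | hadd x y hx hy => simp only [map_add, hx, hy]

lemma Cplx.IsKFlatLeft.of_retract {M N : Cplx A B} (hM : IsKFlatLeft M) (i : N.homs M)
    (r : M.homs N) (h : ∀ x, r.1 (i.1 x) = x) : IsKFlatLeft N :=
  .of_flip (IsKFlatRight.of_retract (M := M.flip) (.of_flip hM)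
    ⟨i.1, i.2.1, i.2.2.2.1, i.2.2.1, i.2.2.2.2⟩ ⟨r.1, r.2.1, r.2.2.2.1, r.2.2.1, r.2.2.2.2⟩ h)

end Retract

section Double

variable {T Y : GrAlg K} {π : T.GrHom Y} {x : Y} (h : IsPow π x 2) {p : A.GrHom T}
  {q : C.GrHom T} {p' : A.GrHom Y} {q' : C.GrHom Y} (hp : ∀ a, p'.hom a = π.hom (p.hom a))
  (hq : ∀ c, q'.hom c = π.hom (q.hom c)) {s t : ℤ} (hs : s + 2 = t) {M : Cplx A C}
  (μ : M.homs (sc p' q' t)) (hμ : Bijective μ.1)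

include h in
lemma IsPow.coef_two (a b : T) :
    h.coef (π.hom a + π.hom b * x) 0 = a ∧ h.coef (π.hom a + π.hom b * x) 1 = b := by
  have := h.coef_sum ![a, b]
  rw [Fin.sum_univ_two] at this
  simp only [Matrix.cons_val_zero, Matrix.cons_val_one, Fin.val_zero, Fin.val_one, pow_zero, pow_one,
    mul_one] at this
  rw [this]
  exact ⟨rfl, rfl⟩

include h in
lemma IsPow.eq_two (y : Y) : y = π.hom (h.coef y 0) + π.hom (h.coef y 1) * x := by
  conv_lhs => rw [← h.sum_coef y, Fin.sum_univ_two]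
  rw [Fin.val_zero, Fin.val_one, pow_zero, pow_one, mul_one]

include hp hq hs hμ in
/-- If `Y` is free over `T` with basis `1, x`, then its structure sheaf is the direct sum of two
shifts of the structure sheaf of `T`. -/
lemma Cplx.exists_sc_split : ∃ (f₁ : M.homs (sc p q s)) (f₀ : M.homs (sc p q t))
      (i₁ : (sc p q s).homs M) (i₀ : (sc p q t).homs M),
      (∀ m y, μ.1 m = toSc p' q' t y → f₁.1 m = toSc p q s (h.coef y 1)) ∧
      (∀ m y, μ.1 m = toSc p' q' t y → f₀.1 m = toSc p q t (h.coef y 0)) ∧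
      (∀ z, μ.1 (i₁.1 (toSc p q s z)) = toSc p' q' t (π.hom z * x)) ∧
      ∀ z, μ.1 (i₀.1 (toSc p q t z)) = toSc p' q' t (π.hom z) := by
  let k (j : Fin 2) : Y →ₗ[K] T := LinearMap.proj j ∘ₗ h.coef.toLinearMap
  have kl (j) (a z) : k j (p'.hom a * z) = p.hom a * k j z := by
    rw [hp]; exact h.coef_l (p.hom a) z j
  have kr (j) (a z) : k j (q'.hom a * z) = q.hom a * k j z := by
    rw [hq]; exact h.coef_l (q.hom a) z j
  let g₁ : (sc p' q' t).homs (sc p q s) := scHom (k 1) (kl 1) (kr 1) fun e z hz => by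
    have := h.coef_mem hz 1
    rwa [show e + t - 2 * ((1 : Fin 2) : ℕ) = e + s by rw [← hs]; simp; ring] at this
  let g₀ : (sc p' q' t).homs (sc p q t) := scHom (k 0) (kl 0) (kr 0) fun e z hz => by
    have := h.coef_mem hz 0
    rwa [show e + t - 2 * ((0 : Fin 2) : ℕ) = e + t by simp] at this
  let e₁ : (sc p q s).homs (sc p' q' t) := scHom (LinearMap.mulRight K x ∘ₗ π.hom.toLinearMap)
      (fun a z => by
        change π.hom (p.hom a * z) * x = p'.hom a * (π.hom z * x)
        rw [map_mul, hp, mul_assoc])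
      (fun a z => by
        change π.hom (q.hom a * z) * x = q'.hom a * (π.hom z * x)
        rw [map_mul, hq, mul_assoc]) fun e z hz => by
        have := SetLike.mul_mem_graded (π.hom_mem hz) h.mem
        rwa [add_assoc, hs] at this
  let e₀ : (sc p q t).homs (sc p' q' t) := scHom π.hom.toLinearMap (fun a z => by
      change π.hom (p.hom a * z) = p'.hom a * π.hom z
      rw [map_mul, hp])
    (fun a z => by
      change π.hom (q.hom a * z) = q'.hom a * π.hom z
      rw [map_mul, hq]) fun e z hz => π.hom_mem hz
  obtain ⟨i₁, hi₁⟩ := exists_lift_of_injective μ hμ.1 e₁ fun _ => hμ.2 _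
  obtain ⟨i₀, hi₀⟩ := exists_lift_of_injective μ hμ.1 e₀ fun _ => hμ.2 _
  exact ⟨compHom μ g₁, compHom μ g₀, i₁, i₀, fun m y e => congrArg g₁.1 e,
    fun m y e => congrArg g₀.1 e, fun z => hi₁ _, fun z => hi₀ _⟩

include h hp hq hμ in
/-- The structure sheaf of `T` is K-flat if that of `Y` is. -/
lemma Cplx.isKFlat_of_split (hl : IsKFlatLeft M) (hr : IsKFlatRight M) (e : ℤ) :
    IsKFlatLeft (sc p q e) ∧ IsKFlatRight (sc p q e) := by
  obtain ⟨f₁, f₀, i₁, i₀, hf₁, hf₀, hi₁, hi₀⟩ := exists_sc_split h hp hq (sub_add_cancel t 2) μ hμ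
  have k (z : sc p q t) : f₀.1 (i₀.1 z) = z := by
    obtain ⟨z, rfl⟩ := exists_toSc p q t z
    rw [hf₀ _ _ (hi₀ z)]
    have := (h.coef_two z 0).1
    rw [map_zero, zero_mul, add_zero] at this
    rw [this]
  have e' := eq_sc_of_shift p q (s := t) (t := e - t) (e := e) (by ring)
  rw [← e']
  exact ⟨(hl.of_retract i₀ f₀ k).shift _, (hr.of_retract i₀ f₀ k).shift _⟩

open Limits in
include h hp hq hs in
/-- The direct sum decomposition of the structure sheaf of `Y`. An endomorphism that is the
multiplication by `π(θ₀) + a x` induces `a` times the canonical map between the summands. -/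
lemma DKer.exists_bicone {M L R : Ker A C} (μ : M.cplx.homs (sc p' q' t))
    (hμ : Bijective μ.1) (hL : L.cplx = sc p q s) (hR : R.cplx = sc p q t) :
    ∃ (b : BinaryBicone (DKer.of L) (DKer.of R)) (e : DKer.of M ≅ b.pt) (ι : R ⟶ (Ker.shift 2).obj L),
      Nonempty b.IsBilimit ∧ Bijective ι.1 ∧
      ∀ (θ : M ⟶ (Ker.shift 2).obj M) (θ₀ : T) (a : K), (∀ m y, μ.1 m = toSc p' q' t y →
          μ.1 (θ.1 m) = toSc p' q' t ((π.hom θ₀ + algebraMap K _ a * x) * y)) →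
        b.inr ≫ e.inv ≫ ofHom θ ≫ (DKer.shift 2).map (e.hom ≫ b.fst) = a • ofHom ι := by
  obtain ⟨L, Ll, Lr⟩ := L
  obtain ⟨R, Rl, Rr⟩ := R
  obtain rfl : L = _ := hL
  obtain rfl : R = _ := hR
  obtain ⟨f₁, f₀, i₁, i₀, hf₁, hf₀, hi₁, hi₀⟩ := exists_sc_split h hp hq hs μ hμ
  let L : Ker A C := ⟨sc p q s, Ll, Lr⟩
  let R : Ker A C := ⟨sc p q t, Rl, Rr⟩
  let F₁ : M ⟶ L := f₁
  let F₀ : M ⟶ R := f₀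
  let I₁ : L ⟶ M := i₁
  let I₀ : R ⟶ M := i₀
  have k₁ (z : T) := h.coef_two 0 z
  have k₀ (z : T) := h.coef_two z 0
  simp only [map_zero, zero_mul, add_zero, zero_add] at k₀ k₁
  have e₁₁ : I₁ ≫ F₁ = 𝟙 L := homs_ext fun z => by
    obtain ⟨z, rfl⟩ := exists_toSc p q s z
    exact (hf₁ _ _ (hi₁ z)).trans (congrArg _ (k₁ z).2)
  have e₁₀ : I₁ ≫ F₀ = 0 := homs_ext fun z => by
    obtain ⟨z, rfl⟩ := exists_toSc p q s z
    exact (hf₀ _ _ (hi₁ z)).trans ((congrArg _ (k₁ z).1).trans (map_zero _))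
  have e₀₁ : I₀ ≫ F₁ = 0 := homs_ext fun z => by
    obtain ⟨z, rfl⟩ := exists_toSc p q t z
    exact (hf₁ _ _ (hi₀ z)).trans ((congrArg _ (k₀ z).2).trans (map_zero _))
  have e₀₀ : I₀ ≫ F₀ = 𝟙 R := homs_ext fun z => by
    obtain ⟨z, rfl⟩ := exists_toSc p q t z
    exact (hf₀ _ _ (hi₀ z)).trans (congrArg _ (k₀ z).1)
  have total : F₁ ≫ I₁ + F₀ ≫ I₀ = 𝟙 M := homs_ext fun m => hμ.1 (by
    obtain ⟨y, hy⟩ := exists_toSc p' q' t (μ.1 m)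
    change μ.1 (i₁.1 (f₁.1 m) + i₀.1 (f₀.1 m)) = μ.1 m
    rw [map_add, hf₁ m y hy.symm, hf₀ m y hy.symm, hi₁, hi₀, ← map_add, add_comm, ← h.eq_two, hy])
  let b : BinaryBicone (DKer.of L) (DKer.of R) :=
    { pt := DKer.of M, fst := ofHom F₁, snd := ofHom F₀, inl := ofHom I₁, inr := ofHom I₀
      inl_fst := by rw [← ofHom_comp, e₁₁, ofHom_id]
      inl_snd := by rw [← ofHom_comp, e₁₀, ofHom_zero]
      inr_fst := by rw [← ofHom_comp, e₀₁, ofHom_zero]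
      inr_snd := by rw [← ofHom_comp, e₀₀, ofHom_id] }
  let ι : R ⟶ (Ker.shift 2).obj L := (⟨LinearMap.id, fun u m hm => by
    have hm' : m ∈ (corr p q).gr (u.1, u.2 + t) := hm
    change m ∈ (corr p q).gr (u.1, u.2 + 2 + s)
    rwa [add_assoc, add_comm 2 s, hs], fun _ _ => rfl, fun _ _ => rfl, fun _ => rfl⟩ :
      (sc p q t).homs ((sc p q s).shift 2))
  refine ⟨b, Iso.refl _, ι, ⟨isBinaryBilimitOfTotal b ?_⟩, Function.bijective_id, fun θ θ₀ a hθ => ?_⟩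
  · change ofHom F₁ ≫ ofHom I₁ + ofHom F₀ ≫ ofHom I₀ = 𝟙 (DKer.of M)
    rw [← ofHom_comp, ← ofHom_comp, ← ofHom_add, total, ofHom_id]
  · have key : I₀ ≫ θ ≫ (Ker.shift 2).map F₁ = a • ι := homs_ext fun z => by
      obtain ⟨z, rfl⟩ := exists_toSc p q t z
      refine (hf₁ (θ.1 (i₀.1 (toSc p q t z))) _ (hθ _ _ (hi₀ z))).trans ?_
      have e : (π.hom θ₀ + algebraMap K Y a * x) * π.hom z =
          π.hom (θ₀ * z) + π.hom (a • z) * x := by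
        rw [add_mul, map_mul, map_smul, Algebra.smul_def, mul_right_comm]
      exact congrArg (toSc p q s) ((congrArg (fun y => h.coef y 1) e).trans (h.coef_two _ _).2)
    rw [Iso.refl_inv, Iso.refl_hom, Category.id_comp, Category.id_comp]
    refine (congrArg (fun f => ofHom I₀ ≫ ofHom θ ≫ f) (shift_map 2 F₁)).trans ?_
    change ofHom I₀ ≫ ofHom θ ≫ ofHom ((Ker.shift 2).map F₁) = _
    rw [← ofHom_comp, ← ofHom_comp, key]
    exact (Ker.qis A C).Q.map_smul a ι

end Double

section Theta

open Bicategory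

/-- The multiplication by an element of degree `2`. -/
def Ker.unitMul (b : B.gr 2) : Ker.unit B ⟶ (Ker.shift 2).obj (Ker.unit B) := _root_.unitMul B 2 b

/-- The multiplication by an element of degree `2` of the algebra in the middle. -/
def Ker.midMul (M : Ker A B) (N : Ker B C) (b : B.gr 2) :
    M.tensor N ⟶ (Ker.shift 2).obj (M.tensor N) :=
  M.tensorLeft.map (N.leftUnitIso.inv ≫ N.tensorRight.map (Ker.unitMul b) ≫
    (Ker.shiftTensor 2 (Ker.unit B) N).hom ≫ (Ker.shift 2).map N.leftUnitIso.hom) ≫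
    (Ker.tensorShift 2 M N).hom

lemma Ker.midMul_tm (M : Ker A B) (N : Ker B C) (b : B.gr 2) (m : M.cplx) (n : N.cplx) :
    (M.midMul N b).1 (tm m n) = (show (Cplx.tensor M.cplx N.cplx) from tm m (N.cplx.l b n)) := by
  have e : (leftUnitHom N.cplx).1 (exLLin 2 (Cplx.unit B) N.cplx ((tmap (_root_.unitMul B 2 b)
      (idHom N.cplx)).1 (tm (unitOne B) n))) = N.cplx.l b n := by
    rw [tmap_tm, idHom_apply]
    refine (congrArg (leftUnitHom N.cplx).1 (exLLin_tm 2 (Cplx.unit B) N.cplx _ n)).trans ?_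
    refine (leftUnitHom_tm N.cplx _ n).trans ?_
    exact congrArg (fun x => N.cplx.l x n) (mul_one (b : B))
  refine (congrArg (exRLin 2 M.cplx N.cplx) (tmap_tm _ _ m n)).trans ?_
  refine (exRLin_tm 2 M.cplx N.cplx _ _).trans ?_
  rw [idHom_apply]
  exact congrArg (tm m) e

/-- Inserting a 2-endomorphism of the identity is multiplication by it in the middle. -/
lemma insertTheta_eq {ι : Type} {F : ι → GrAlg K} {a b c : ι} (M : Ker (F a) (F b))
    (N : Ker (F b) (F c)) (t : (F b).gr 2) :
    insertTheta (𝕜 := K) (show (⟨a⟩ : DerBicat F) ⟶ ⟨b⟩ from DKer.of M) (DKer.ofHom (Ker.unitMul t))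
      (show (⟨b⟩ : DerBicat F) ⟶ ⟨c⟩ from DKer.of N) = DKer.ofHom (M.midMul N t) := by
  let f₁ := N.leftUnitIso.inv
  let f₂ : (Ker.unit (F b)).tensor N ⟶ ((Ker.shift 2).obj (Ker.unit (F b))).tensor N :=
    N.tensorRight.map (Ker.unitMul t)
  let f₃ := (Ker.shiftTensor 2 (Ker.unit (F b)) N).hom
  let f₄ := (Ker.shift 2).map N.leftUnitIso.hom
  have e : DKer.ofHom f₁ ≫ DKer.ofHom f₂ ≫ DKer.ofHom f₃ ≫ DKer.ofHom f₄ =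
      DKer.ofHom (f₁ ≫ f₂ ≫ f₃ ≫ f₄) := by rw [DKer.ofHom_comp, DKer.ofHom_comp, DKer.ofHom_comp]
  exact (congrArg (fun g => DKer.lmap M g ≫ DKer.ofHom (Ker.tensorShift 2 M N).hom)
    ((congrArg₂ (fun g g' => DKer.ofHom f₁ ≫ g ≫ DKer.ofHom f₃ ≫ g')
      (DKer.tensorRight_map N (Ker.unitMul t)) (DKer.shift_map 2 N.leftUnitIso.hom)).trans e)).trans
    ((congrArg (· ≫ DKer.ofHom (Ker.tensorShift 2 M N).hom) (DKer.tensorLeft_map M _)).trans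
      (DKer.ofHom_comp _ _).symm)

end Theta

section Theta

open MvPolynomial

lemma sum_Ico_mem_symPoly {m : ℕ} {c : Fin m → ℤ} (h : ∀ i, 0 ≤ c i) {d d' : ℤ} (hd : d ∈ cutSet c)
    (hd' : d' ∈ cutSet c) : ∑ x ∈ Finset.Ico d.toNat d'.toNat, X x ∈ symPoly K c := by
  refine ⟨sum_mem fun x hx => Algebra.subset_adjoin (Set.mem_image_of_mem _ ?_), fun σ hσ => ?_⟩
  · have := (bounds_of_mem_cutSet h hd').2
    have := Int.lt_toNat.1 (mem_Ico.1 hx).2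
    change (x : ℤ) < _
    omega
  · rw [map_sum]
    simp only [rename_X]
    refine Finset.sum_equiv σ (fun x => ?_) fun _ _ => rfl
    rw [mem_Ico, mem_Ico, Int.toNat_le, Int.toNat_le, Int.lt_toNat, Int.lt_toNat,
      ← not_le, ← not_le, preservesBlocks_iff.1 hσ _ hd, preservesBlocks_iff.1 hσ _ hd']

lemma symEv_e₁ {m : ℕ} {c : Fin m → ℤ} (h : ∀ i, 0 ≤ c i) (l : Fin m) :
    symEv h (e₁ c l : symAlg K c) =
      ∑ x ∈ Finset.Ico (cut c l.val).toNat (cut c (l.val + 1)).toNat, X x := rfl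

variable {n m₁ m₂ : ℕ} {w : Fin m₁ → ℤ} {v : Fin m₂ → ℤ} {k : Fin n → ℤ} (i : Fin (n - 1))
  {u : (symAlg K k).GrHom (symAlg K w)} (hu : IsIncl u) {π : (symAlg K v).GrHom (symAlg K w)}
  (hπ : IsIncl π) (hw : cutSet w = insert (cut k (i.val + 1)) (cutSet v)) (hk : cutSet k ⊆ cutSet w)
  (hv : cut k (i.val + 1) - 1 ∈ cutSet v)
  (hpos : (∀ j, 0 ≤ w j) → 0 < k (lo i) ∧ 0 < k (hi i))

include hu hπ hw hk hv hpos

/-- If the blocks of `v` arise from those of `k` by moving the variable `x` from the block of `k_i` to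
the block of `k_{i+1}`, then the first elementary symmetric functions of the two blocks change by
`x` and `-x`. -/
lemma exists_e₁_eq (l : Fin n) : ∃ a : symAlg K v, u.hom (e₁ k l) =
    π.hom a - ((root i l : ℤ) : K) • symVar K w (cut k (i.val + 1) - 1) := by
  have hi' := i.isLt
  by_cases h : ∀ j, 0 ≤ w j
  swap
  · exact ⟨0, (symAlg_subsingleton h).elim _ _⟩
  have hkv := hu.1 h
  have hvv := hπ.1 h
  obtain ⟨p₀, p₁⟩ := hpos h
  have c₀ : cut k (i.val + 1) = cut k i.val + k (lo i) := cut_succ k (lo i)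
  have c₁ : cut k (i.val + 1 + 1) = cut k (i.val + 1) + k (hi i) := cut_succ k (hi i)
  have hmem (j : ℕ) (hj : j ≤ n) (hne : j ≠ i.val + 1) : cut k j ∈ cutSet v := by
    have := hk (cut_mem_cutSet hj)
    rw [hw] at this
    refine this.resolve_left fun e => ?_
    rcases lt_or_gt_of_ne hne with h' | h'
    · have := cut_mono hkv (show j ≤ i.val by omega)
      omega
    · have := cut_mono hkv (show i.val + 1 + 1 ≤ j by omega)
      omega
  have hb := bounds_of_mem_cutSet hvv hv
  have hx : symEv h (symVar K w (cut k (i.val + 1) - 1)) = X (cut k (i.val + 1) - 1).toNat :=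
    symEv_var h (by rw [hw]; exact Set.mem_insert_of_mem _ hv)
      (by rw [hw, sub_add_cancel]; exact Set.mem_insert _ _)
  have hnat : (cut k (i.val + 1)).toNat = (cut k (i.val + 1) - 1).toNat + 1 := by omega
  have fin {p : MvPolynomial ℕ K} (hp : p ∈ symPoly K v) (e : symEv (hu.1 h) (e₁ k l) =
      p - ((root i l : ℤ) : K) • X (cut k (i.val + 1) - 1).toNat) :
      ∃ a : symAlg K v, u.hom (e₁ k l) =
        π.hom a - ((root i l : ℤ) : K) • symVar K w (cut k (i.val + 1) - 1) := by
    obtain ⟨a, rfl⟩ := exists_symEv hvv hp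
    refine ⟨a, ext_symEv fun h => ?_⟩
    rw [map_sub, map_smul, hπ.2 h, hx]
    exact (hu.2 h _).trans e
  rw [symEv_e₁] at fin
  by_cases h₀ : l = lo i
  · subst h₀
    rw [root_apply, if_neg (lo_ne_hi i), if_pos rfl] at fin ⊢
    refine fin (sum_Ico_mem_symPoly hvv (hmem i.val (by omega) (by omega)) hv) ?_
    change ∑ x ∈ Finset.Ico (cut k i.val).toNat (cut k (i.val + 1)).toNat, X x = _
    rw [hnat, Finset.sum_Ico_succ_top (by omega)]
    simp
  by_cases h₁ : l = hi i
  · subst h₁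
    rw [root_apply, if_neg (lo_ne_hi i).symm, if_pos rfl] at fin ⊢
    refine fin (sum_Ico_mem_symPoly hvv hv (hmem (i.val + 1 + 1) (by omega) (by omega))) ?_
    change ∑ x ∈ Finset.Ico (cut k (i.val + 1)).toNat (cut k (i.val + 1 + 1)).toNat, X x = _
    rw [Finset.sum_eq_sum_Ico_succ_bot (a := (cut k (i.val + 1) - 1).toNat) (by omega), hnat]
    simp
  · have n₀ : l.val ≠ i.val := fun e => h₀ (Fin.ext e)
    have n₁ : l.val ≠ i.val + 1 := fun e => h₁ (Fin.ext e)
    rw [root_apply, if_neg h₀, if_neg h₁] at fin ⊢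
    exact fin (sum_Ico_mem_symPoly hvv (hmem _ l.isLt.le n₁) (hmem _ l.isLt (by omega))) (by simp)

/-- On `E_i E_i`, the middle action of `θ` is `⟨θ, α_i⟩ x` up to an element `a` of the subring
`v` over which `1, x` is a basis. -/
lemma exists_thetaElt_eq (c : Fin (n - 1) → K) : ∃ a : symAlg K v,
    u.hom (thetaElt k c).1 = π.hom a + algebraMap K _ (thetaPairing c i) *
      symVar K w (cut k (i.val + 1) - 1) := by
  let E (l : Fin n) : symAlg K k := e₁ k l
  have hE (l : Fin n) : ∃ a : symAlg K v, u.hom (E l) =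
      π.hom a - ((root i l : ℤ) : K) • symVar K w (cut k (i.val + 1) - 1) :=
    exists_e₁_eq i hu hπ hw hk hv hpos l
  choose a ha using hE
  refine ⟨∑ j, c j • (a (lo j) - a (hi j)), ?_⟩
  have e (j : Fin (n - 1)) : u.hom (E (lo j) - E (hi j)) =
      π.hom (a (lo j) - a (hi j)) + ((root j ⬝ᵥ root i : ℤ) : K) •
        symVar K w (cut k (i.val + 1) - 1) := by
    have : root j ⬝ᵥ root i = root i (hi j) - root i (lo j) := by rw [dotProduct_comm, dot_root]
    rw [map_sub, map_sub, ha, ha, this, Int.cast_sub, sub_smul]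
    abel
  have e₀ : thetaElt k c = ∑ j, c j • ((⟨E (lo j), e₁_mem k _⟩ : (symAlg K k).gr 2) -
      ⟨E (hi j), e₁_mem k _⟩) := Fintype.linearCombination_apply K _ c
  have e' : (thetaElt k c).1 = ∑ j, c j • (E (lo j) - E (hi j)) := by
    rw [e₀, Submodule.coe_sum]
    rfl
  rw [e', map_sum, map_sum, ← Algebra.smul_def, thetaPairing, Finset.sum_smul,
    ← sum_add_distrib]
  exact sum_congr rfl fun j _ => by rw [map_smul, e, smul_add, map_smul, mul_smul]

end Theta

section MidMul

variable {Z₁ Z₂ Y : GrAlg K} {f₁ : A.GrHom Z₁} {g₁ : B.GrHom Z₁} {f₂ : B.GrHom Z₂}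
  {g₂ : C.GrHom Z₂} {p : A.GrHom Y} {q : C.GrHom Y} (j₁ : Z₁.GrHom Y) (j₂ : Z₂.GrHom Y) {s₁ s₂ s : ℤ}

lemma Cplx.mulHom_midMul (Ml : IsKFlatLeft (sc f₁ g₁ s₁)) (Mr : IsKFlatRight (sc f₁ g₁ s₁))
    (Nl : IsKFlatLeft (sc f₂ g₂ s₂)) (Nr : IsKFlatRight (sc f₂ g₂ s₂))
    (hj : ∀ b, j₁.hom (g₁.hom b) = j₂.hom (f₂.hom b)) (hp : ∀ a, p.hom a = j₁.hom (f₁.hom a))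
    (hq : ∀ c, q.hom c = j₂.hom (g₂.hom c)) (hs : s = s₁ + s₂) (b : B.gr 2)
    (m : Cplx.tensor (sc f₁ g₁ s₁) (sc f₂ g₂ s₂)) (y : Y)
    (hm : (mulHom j₁ j₂ hj hp hq hs :
      (Cplx.tensor (sc f₁ g₁ s₁) (sc f₂ g₂ s₂)).homs (sc p q s)).1 m = toSc p q s y) :
    (mulHom j₁ j₂ hj hp hq hs : (Cplx.tensor (sc f₁ g₁ s₁) (sc f₂ g₂ s₂)).homs (sc p q s)).1
      ((Ker.midMul ⟨_, Ml, Mr⟩ ⟨_, Nl, Nr⟩ b).1 m) =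
      toSc p q s (j₂.hom (f₂.hom b.1) * y) := by
  let G : (Cplx.tensor (sc f₁ g₁ s₁) (sc f₂ g₂ s₂)).homs (sc p q s) := mulHom j₁ j₂ hj hp hq hs
  let F : Cplx.tensor (sc f₁ g₁ s₁) (sc f₂ g₂ s₂) →ₗ[K]
      (Cplx.tensor (sc f₁ g₁ s₁) (sc f₂ g₂ s₂)) := (Ker.midMul ⟨_, Ml, Mr⟩ ⟨_, Nl, Nr⟩ b).1
  let Ψ : sc p q s →ₗ[K] sc p q s := (toSc p q s).toLinearMap ∘ₗ
    LinearMap.mulLeft K (j₂.hom (f₂.hom b.1)) ∘ₗ (toSc p q s).symm.toLinearMap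
  have h : G.1 ∘ₗ F = Ψ ∘ₗ G.1 := by
    refine tensor_ext fun m n => ?_
    obtain ⟨z₁, rfl⟩ := exists_toSc f₁ g₁ s₁ m
    obtain ⟨z₂, rfl⟩ := exists_toSc f₂ g₂ s₂ n
    have e₁ : F (tm (toSc f₁ g₁ s₁ z₁) (toSc f₂ g₂ s₂ z₂)) =
        tm (toSc f₁ g₁ s₁ z₁) (toSc f₂ g₂ s₂ (f₂.hom b.1 * z₂)) := Ker.midMul_tm _ _ b _ _
    have e₂ (z : Z₂) : G.1 (tm (toSc f₁ g₁ s₁ z₁) (toSc f₂ g₂ s₂ z)) =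
        toSc p q s (j₁.hom z₁ * j₂.hom z) := mulHom_tm j₁ j₂ hj hp hq hs z₁ z
    have e₃ (z : Y) : Ψ (toSc p q s z) = toSc p q s (j₂.hom (f₂.hom b.1) * z) := rfl
    rw [LinearMap.comp_apply, LinearMap.comp_apply, e₁, e₂, e₂, e₃, map_mul j₂.hom, mul_left_comm]
  exact (LinearMap.congr_fun h m).trans (congrArg Ψ hm)

end MidMul

section EE

open Limits

variable {n : ℕ} (hf : KernelsFlat K n)

lemma splitSeq_lo (i : Fin (n - 1)) (k : Fin n → ℤ) (h : i.val < n + 1) :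
    splitSeq i k ⟨i.val, h⟩ = k (lo i) - 1 := by
  have h₁ : cut (splitSeq i k) (i.val + 1) = cut (splitSeq i k) i.val + splitSeq i k ⟨i.val, h⟩ :=
    cut_succ (splitSeq i k) ⟨i.val, h⟩
  have h₂ : cut k (i.val + 1) = cut k i.val + k (lo i) := cut_succ k (lo i)
  rw [cut_splitSeq, cut_splitSeq, if_pos le_rfl, if_pos rfl, if_pos (by omega), if_neg (by omega)] at h₁
  omega

/-- `E_i E_i` is the structure sheaf of the correspondence in which two ordered points move; the
divided power is that of the correspondence in which an unordered pair moves. -/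
lemma EE (i : Fin (n - 1)) {k₁ k k₂ : Fin n → ℤ} (h₁ : k = k₁ + root i) (h₂ : k₂ = k + root i) :
    ∃ (E₂ : (knData hf).obj k₁ ⟶ (knData hf).obj k₂) (b : BinaryBicone (sh K (-1) E₂) (sh K 1 E₂))
      (e : (knData hf).E i h₁ ≫ (knData hf).E i h₂ ≅ b.pt), Nonempty b.IsBilimit ∧
      ∀ c : Fin (n - 1) → K, let φ : sh K 1 E₂ ⟶ sh K 2 (sh K (-1) E₂) :=
          b.inr ≫ e.inv ≫ insertTheta ((knData hf).E i h₁) ((knData hf).θ k c) ((knData hf).E i h₂) ≫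
            (GradedLinearBicategory.shift K 2 _ _).map (e.hom ≫ b.fst)
        (thetaPairing c i ≠ 0 → ¬ IsZero E₂ → φ ≠ 0) ∧ (thetaPairing c i = 0 → φ = 0) := by
  have hi' := i.isLt
  let s := splitSeq i k₁
  let i' : Fin (n + 1 - 1) := ⟨i.val, by omega⟩
  let w := splitSeq i' s
  let v := s + root i'
  set d := cut k (i.val + 1) with hd
  have e₁ (x : ℕ) : cut k x = cut k₁ x - if x = i.val + 1 then 1 else 0 := by rw [h₁, cut_add_root]
  have e₂ (x : ℕ) : cut k₂ x = cut k x - if x = i.val + 1 then 1 else 0 := by rw [h₂, cut_add_root]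
  have ev (x : ℕ) : cut v x = cut k₁ (if x ≤ i.val + 1 then x else x - 1) -
      if x = i.val + 1 then 2 else 0 := by
    rw [cut_add_root, cut_splitSeq]
    simp only [i']
    split_ifs <;> omega
  have d₁ : cut k₁ (i.val + 1) = d + 1 := by
    have := e₁ (i.val + 1); rw [if_pos rfl] at this; omega
  have es : cut s (i'.val + 1) = d := by
    change cut (splitSeq i k₁) (i.val + 1) = d
    rw [cut_splitSeq, if_pos le_rfl, if_pos rfl, d₁, add_sub_cancel_right]
  have cs : cutSet s = insert (d + 1) (cutSet k) := by rw [cutSet_splitSeq', d₁, ← h₁]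
  have cw : cutSet w = insert (d - 1) (cutSet s) := by rw [cutSet_splitSeq, es]
  have cw' : cutSet w = insert d (cutSet v) := by rw [cutSet_splitSeq', es]
  have cz : cutSet (splitSeq i k) = insert (d - 1) (cutSet k) := cutSet_splitSeq i k
  have iz : cutSet (splitSeq i k) ⊆ cutSet w := by
    rw [cz, cw, cs]; exact Set.insert_subset_insert (Set.subset_insert _ _)
  have ik : cutSet k ⊆ cutSet w := (cz ▸ Set.subset_insert _ _ : cutSet k ⊆ _).trans iz
  have dv : d - 1 ∈ cutSet v := ⟨i.val + 1, by omega, by rw [ev, if_pos le_rfl, if_pos rfl]; omega⟩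
  have i₁ : cutSet k₁ ⊆ cutSet v := by
    rintro _ ⟨j, hj, rfl⟩
    by_cases hc : j ≤ i.val
    · exact ⟨j, by omega, by rw [ev, if_pos (by omega), if_neg (by omega), sub_zero]⟩
    · exact ⟨j + 1, by omega, by
        rw [ev, if_neg (by omega), if_neg (by omega), sub_zero, Nat.add_sub_cancel]⟩
  have i₂ : cutSet k₂ ⊆ cutSet v := by
    rintro _ ⟨j, hj, rfl⟩
    by_cases hc : j = i.val + 1
    · rw [hc, e₂, if_pos rfl]; exact dv
    · rw [e₂, e₁, if_neg hc, sub_zero, sub_zero]; exact i₁ (cut_mem_cutSet hj)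
  have hsl : s (lo i') = k (lo i) := by
    have := add_root_lo k₁ i
    rw [← h₁] at this
    rw [this]
    exact splitSeq_lo i k₁ _
  have hvh : v (hi i') = 2 := by
    have := add_root_hi s i'
    rw [show s (hi i') = 1 from Fin.insertNth_apply_same _ _ _] at this
    exact this
  have vs : (∀ x, 0 ≤ s x) ↔ (∀ x, 0 ≤ k x) ∧ 0 < k (hi i) := by rw [add_root_nonneg_iff, ← h₁]
  have vw : (∀ x, 0 ≤ w x) ↔ (∀ x, 0 ≤ s x) ∧ 0 < k (lo i) := by rw [splitSeq_nonneg_iff, hsl]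
  have vv (h : ∀ x, 0 ≤ v x) : ∀ x, 0 ≤ w x := add_root_nonneg_iff.2 ⟨h, by
    change 0 < v (hi i'); omega⟩
  have vz (h : ∀ x, 0 ≤ w x) : ∀ x, 0 ≤ splitSeq i k x :=
    splitSeq_nonneg_iff.2 ⟨(vs.1 (vw.1 h).1).1, (vw.1 h).2⟩
  have last : cut w (n + 1 + 1) = cut k₁ n := by rw [cut_splitSeq_last, cut_splitSeq_last]
  have lastv : cut v (n + 1) = cut k₁ n := by
    rw [ev, if_neg (by omega), if_neg (by omega), sub_zero, Nat.add_sub_cancel]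
  have last₁ : cut k n = cut k₁ n := by rw [h₁, cut_add_root_last]
  obtain ⟨j₂, hj₂⟩ := exists_isIncl K (c := splitSeq i k) (c' := w) vz
    (by rw [last, cut_splitSeq_last, last₁]) iz
  obtain ⟨p, hp⟩ := exists_isIncl K (c := k₁) (c' := v)
    (fun h => (splitSeq_nonneg (vw.1 (vv h)).1).1) lastv.symm i₁
  obtain ⟨q, hq⟩ := exists_isIncl K (c := k₂) (c' := v)
    (fun h => h₂ ▸ (splitSeq_nonneg (vz (vv h))).2) (by rw [lastv, h₂, cut_add_root_last, last₁]) i₂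
  let j₁ : (symAlg K s).GrHom (symAlg K w) := projLeft i' s
  have hj₁ : IsIncl j₁ := isIncl_projLeft i' s
  let π : (symAlg K v).GrHom (symAlg K w) := projRight i' rfl
  have hπ : IsIncl π := isIncl_projRight i' rfl
  have P : IsPow π (symVar K w (d - 1)) 2 := by
    have := isPow_projRight (K := K) i' (k := s) rfl
    rw [nodeVar, es] at this
    rwa [show (s + root i') (hi i') = 2 from hvh] at this
  have P₁ : IsPow j₁ (j₂.hom (nodeVar K i k)) (k (lo i)).toNat := by
    have := isPow_projLeft (K := K) i' s
    rw [hsl, nodeVar, es] at this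
    rw [nodeVar, hj₂.hom_var iz (node_mem i k).1 (node_mem i k).2]
    exact this
  let t := k₁ (lo i) - 1 + (k (lo i) - 1)
  -- `w` is the fibre product of the two correspondences, and `v` its quotient by the exchange
  let p' : (symAlg K k₁).GrHom (symAlg K w) := j₁.comp (projLeft i k₁)
  let q' : (symAlg K k₂).GrHom (symAlg K w) := j₂.comp (projRight i h₂)
  have hp' (a) : p'.hom a = π.hom (p.hom a) := (isIncl_projLeft i k₁).hom_hom_eq hj₁ hp hπ a
  have hq' (a) : q'.hom a = π.hom (q.hom a) := (isIncl_projRight i h₂).hom_hom_eq hj₂ hq hπ a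
  have hj (a) : j₁.hom ((projRight i h₁).hom a) = j₂.hom ((projLeft i k).hom a) :=
    (isIncl_projRight i h₁).hom_hom_eq hj₁ (isIncl_projLeft i k) hj₂ a
  let M := (hf.E i h₁).tensor (hf.E i h₂)
  let μ : M.cplx.homs (sc p' q' t) := mulHom j₁ j₂ hj (fun _ => rfl) (fun _ => rfl) rfl
  have hμ : Bijective μ.1 := mulHom_bijective _ _ (isPow_projLeft i k) P₁ _ _ _ _
  obtain ⟨fl, fr⟩ := isKFlat_of_split P hp' hq' μ hμ M.flatLeft M.flatRight (t - 1)
  let E₂ : Ker (symAlg K k₁) (symAlg K k₂) := ⟨sc p q (t - 1), fl, fr⟩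
  obtain ⟨b, e, ι, hb, hι, H⟩ := DKer.exists_bicone P hp' hq' (sub_add_cancel t 2)
    (L := (Ker.shift (-1)).obj E₂) (R := (Ker.shift 1).obj E₂) μ hμ (eq_sc_of_shift _ _ (by ring))
    (eq_sc_of_shift _ _ (by ring))
  refine ⟨DKer.of E₂, b, e, hb, fun c => ?_⟩
  obtain ⟨θ₀, hθ⟩ := exists_thetaElt_eq (u := j₂.comp (projLeft i k)) i ⟨fun h => (splitSeq_nonneg (vz h)).1,
    fun h a => (hj₂.2 h _).trans ((isIncl_projLeft i k).2 _ a)⟩ hπ cw' ik dv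
    (fun h => ⟨(vw.1 h).2, (vs.1 (vw.1 h).1).2⟩) c
  have key := H ((hf.E i h₁).midMul (hf.E i h₂) (thetaElt k c)) θ₀ (thetaPairing c i) fun m y hm => by
    have := mulHom_midMul j₁ j₂ (p := p') (q := q') (hf.E_left i h₁) (hf.E_right i h₁)
      (hf.E_left i h₂) (hf.E_right i h₂) hj (fun _ => rfl) (fun _ => rfl) rfl (thetaElt k c) m y hm
    exact this.trans (congrArg (fun z => toSc p' q' t (z * y)) hθ)
  have hφ := (congrArg (fun g => b.inr ≫ e.inv ≫ g ≫ (DKer.shift 2).map (e.hom ≫ b.fst))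
    (insertTheta_eq (F := symAlg K) (hf.E i h₁) (hf.E i h₂) (thetaElt k c))).trans key
  refine ⟨fun h₀ hz h => hz ?_, fun h₀ => hφ.trans ?_⟩
  · have hι₀ : DKer.ofHom ι = 0 := by
      have := hφ.symm.trans h
      exact (smul_eq_zero.1 this).resolve_left h₀
    have : IsIso (DKer.ofHom ι) := DKer.isIso_ofHom (isQis_of_bijective _ hι)
    have hR : IsZero (DKer.of ((Ker.shift 1).obj E₂)) := (IsZero.iff_id_eq_zero _).2 ((IsIso.hom_inv_id
      (DKer.ofHom ι)).symm.trans ((congrArg (· ≫ inv (DKer.ofHom ι)) hι₀).trans zero_comp))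
    exact DKer.isZero_of (M := E₂) (DKer.acyclic_of_isZero (M := (Ker.shift 1).obj E₂) hR)
  · rw [h₀, zero_smul]
    rfl

end EE

end

theorem theorem3p1 (𝕜 : Type u) [Field 𝕜] (n : ℕ) :
    ∃ hf : KernelsFlat 𝕜 n, IsSlThetaAction (knData hf) (knCoherent hf) ∧
      IsActionStable (knData hf) (knCoherent hf) :=
  ⟨kernelsFlat 𝕜 n,
    { additive := fun k k' => inferInstanceAs (Limits.HasFiniteBiproducts
        (DKer (symAlg 𝕜 k) (symAlg 𝕜 k')))
      idempotentComplete := fun k k' => inferInstanceAs (IsIdempotentComplete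
        (DKer (symAlg 𝕜 k) (symAlg 𝕜 k')))
      end_neg := end_neg _
      end_zero := end_zero _
      hom_finite := fun f g hf hg => DKer.hom_finite (M := locObj f) (N := locObj g)
        (symAlg_locallyFinite _) (symAlg_locallyFinite _) hf hg
      right_adjoint := fun i _ _ h => right_adjoint _ i h
      left_adjoint := fun i _ _ h => left_adjoint _ i h
      EF_of_nonneg := fun i _ _ _ h₁ h₂ => (EF_FE _ i h₁ h₂).1
      FE_of_nonpos := fun i _ _ _ h₁ h₂ => (EF_FE _ i h₁ h₂).2
      EF_comm := fun hij _ _ _ _ h₁ h₂ h₃ h₄ => EF_comm _ hij h₁ h₂ h₃ h₄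
      EE := fun i _ _ _ h₁ h₂ => EE _ i h₁ h₂
      vanish := vanish _
      nonzero := nonzero _ }, isActionStable _⟩
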